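/- **Setting.** Let $N\ge 1$ and let $d\mu(\Phi)=\pi^{-N^2}e^{-\mathrm{Tr}\,\Phi^\star\Phi}\prod_{i,j}d\Re\Phi_{ij}\,d\Im\Phi_{ij}$ be the normalized Gaussian measure on complex $N\times N$ matrices with $\langle\bar\Phi_{ij}\Phi_{kl}\rangle=\delta_{ik}\delta_{jl}$, $\langle\Phi_{ij}\Phi_{kl}\rangle=0$. For $\lambda>0$ put $$Z(\lambda,N)=\int e^{-\frac{\lambda}{N}\mathrm{Tr}\,\Phi^\star\Phi\Phi^\star\Phi}\,d\mu(\Phi).$$ For an $N\times N$ matrix $\sigma$ let $H(\sigma)=\sqrt{2\lambda/N}\;1\otimes\sigma$ on $\mathbb C^N\otimes\mathbb C^N$, and let the loop vertex be $V(\sigma)=-\mathrm{Tr}\log(1\otimes1+iH(\sigma))$, where $\mathrm{Tr}\log A$ is the sum of the principal logarithms of the eigenvalues of $A$ with algebraic multiplicity. $V$ is holomorphic in the matrix entries near Hermitian $\sigma$, and $\delta/\delta\sigma_{ij}$ denotes the complex partial derivative. For a tree $T$ on the vertices $\{1,\dots,n\}$ and $w=(w_\ell)_{\ell\in T}\in[0,1]^{T}$,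 let $w^T(v,v',\{w\})$ be $1$ if $v=v'$ and otherwise the infimum of the $w_\ell$ over the lines $\ell$ of the unique path from $v$ to $v'$ in $T$. **Theorem (tree formula).** 1. For every $N$, every tree $T$ on $n$ vertices and every $w\in[0,1]^T$ the matrix $w^T$ is positive semidefinite, so that there is a centred Gaussian probability measure $d\nu_T(\{\sigma^v\},\{w\})$ on $n$-tuples of Hermitian $N\times N$ matrices with covariance $$\langle\sigma^v_{ij}\sigma^{v'}_{kl}\rangle=\delta_{il}\delta_{jk}\,w^T(v,v',\{w\}).$$ 2. There is $\lambda_0>0$, independent of $N$, such that for all $N\ge1$ and $0<\lambda<\lambda_0$: with $d\mu_{GUE}$ the Gaussian measure on Hermitian matrices of covariance $\langle\sigma_{ij}\sigma_{kl}\rangle=\delta_{il}\delta_{jk}$, $$Z(\lambda,N)=\int d\mu_{GUE}(\sigma)\,e^{V(\sigma)},$$ and $$\log Z(\lambda,N)=\sum_{n=1}^\infty\frac1{n!}\sum_T\bigg\{\prod_{\ell\in T}\Big[\int_0^1dw_\ell\sum_{i_\ell,j_\ell,k_\ell,l_\ell}\Big]\bigg\}\int d\nu_T(\{\sigma^v\},\{w\})\bigg\{\prod_{\ell\in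 T}\Big[\delta_{i_\ell l_\ell}\delta_{j_\ell k_\ell}\frac{\delta}{\delta\sigma^{v(\ell)}_{i_\ell j_\ell}}\frac{\delta}{\delta\sigma^{v'(\ell)}_{k_\ell l_\ell}}\Big]\bigg\}\prod_{v=1}^nV(\sigma^v),$$ where $T$ runs over the trees on the vertices $\{1,\dots,n\}$ (which have $n-1$ lines) and $v(\ell)\ne v'(\ell)$ are the two ends of $\ell$. All the integrals over $\sigma$ and over $w$ converge absolutely, and the series over $n$ converges (absolutely) to $\log Z(\lambda,N)$. -/

import Mathlib

open MeasureTheory ProbabilityTheory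
open scoped Kronecker

noncomputable section

namespace LoopVertex

/-- Complex `N × N` matrices, seen as arrays (this carries the product σ-algebra, the product
Lebesgue measure and the sup norm). `Matrix.of` turns an array into a matrix. -/
abbrev MatField (N : ℕ) : Type := Fin N → Fin N → ℂ

/-! ### The quartic matrix model -/

/-- The Gaussian measure `π^{-N²} exp(-Tr Φ⋆Φ) ∏ dRe Φ_ij dIm Φ_ij` on complex matrices, that is
the normalized one with `⟨Φ̄_ij Φ_kl⟩ = δ_ik δ_jl` and `⟨Φ_ij Φ_kl⟩ = 0`. -/
def complexGaussian (N : ℕ) : Measure (MatField N) :=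
  (volume : Measure (MatField N)).withDensity fun Φ =>
    ENNReal.ofReal ((Real.pi ^ (N ^ 2))⁻¹ *
      Real.exp (-((Matrix.of Φ).conjTranspose * Matrix.of Φ).trace.re))

/-- The normalization `Z(lam, N) = ∫ exp(-(lam/N) Tr Φ⋆ΦΦ⋆Φ) dμ(Φ)`. The trace is real. -/
def partitionFunction (lam : ℝ) (N : ℕ) : ℝ :=
  ∫ Φ, Real.exp (-(lam / N) *
    ((Matrix.of Φ).conjTranspose * Matrix.of Φ *
      (Matrix.of Φ).conjTranspose * Matrix.of Φ).trace.re) ∂(complexGaussian N)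

/-! ### The loop vertex -/

/-- `Tr log A` with the principal branch of the logarithm: the sum of the logarithms of the
eigenvalues of `A`, counted with algebraic multiplicity. -/
def trLog {m : Type*} [Fintype m] [DecidableEq m] (A : Matrix m m ℂ) : ℂ :=
  (A.charpoly.roots.map Complex.log).sum

/-- The operator `H = √(2 lam / N) (1 ⊗ σ)` on `ℂ^N ⊗ ℂ^N`. -/
def fieldOp (lam : ℝ) {N : ℕ} (σ : MatField N) : Matrix (Fin N × Fin N) (Fin N × Fin N) ℂ :=
  ((Real.sqrt (2 * lam / N) : ℝ) : ℂ) • ((1 : Matrix (Fin N) (Fin N) ℂ) ⊗ₖ Matrix.of σ)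

/-- The loop vertex `V = -Tr log (1 ⊗ 1 + i H)`, as a function of an arbitrary complex matrix
`σ`; it is holomorphic in the entries of `σ` near every Hermitian `σ`. -/
def loopVertex (lam : ℝ) {N : ℕ} (σ : MatField N) : ℂ :=
  -trLog (1 + Complex.I • fieldOp lam σ)

/-! ### Gaussian Hermitian matrix fields -/

/-- The Hermitian matrices with entries `σ^v_ij = ((1 + i) x^v_ij + (1 - i) x^v_ji) / 2`; this is a
linear isometry from real arrays onto Hermitian matrices (Hilbert–Schmidt norm). -/
def hermitianFields {n N : ℕ} (x : EuclideanSpace ℝ (Fin n × Fin N × Fin N)) :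
    Fin n → MatField N :=
  fun v i j => ((1 + Complex.I) * (x (v, i, j) : ℂ) + (1 - Complex.I) * (x (v, j, i) : ℂ)) / 2

/-- The Gaussian measure on `n`-tuples of Hermitian matrices with covariance
`⟨σ^v_ij σ^v'_kl⟩ = δ_il δ_jk W v v'`, for `W` positive semidefinite (possibly degenerate). The
independent real coordinates `x_ij` of `hermitianFields` all have the covariance `W` in `v, v'`. -/
def gaussianFields {n : ℕ} (N : ℕ) (W : Matrix (Fin n) (Fin n) ℝ) :
    Measure (Fin n → MatField N) :=
  (multivariateGaussian (0 : EuclideanSpace ℝ (Fin n × Fin N × Fin N))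
    (W ⊗ₖ (1 : Matrix (Fin N × Fin N) (Fin N × Fin N) ℝ))).map hermitianFields

/-- `ν` is a centred Gaussian probability measure, carried by tuples of Hermitian matrices, with
covariance `⟨σ^v_ij σ^v'_kl⟩ = δ_il δ_jk W v v'`. -/
structure HasMatrixCovariance {n N : ℕ} (ν : Measure (Fin n → MatField N))
    (W : Matrix (Fin n) (Fin n) ℝ) : Prop where
  isGaussian : IsGaussian ν
  hermitian : ∀ᵐ σ ∂ν, ∀ v, (Matrix.of (σ v)).IsHermitian
  centred : ∀ v i j, ∫ σ, σ v i j ∂ν = 0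
  covariance : ∀ v v' i j k l,
    Integrable (fun σ => σ v i j * σ v' k l) ν ∧
    ∫ σ, σ v i j * σ v' k l ∂ν = if i = l ∧ j = k then (W v v' : ℂ) else 0

/-- The standard Gaussian measure on Hermitian matrices, `⟨σ_ij σ_kl⟩ = δ_il δ_jk`. -/
def gue (N : ℕ) : Measure (MatField N) :=
  (gaussianFields N (1 : Matrix (Fin 1) (Fin 1) ℝ)).map fun σ => σ 0

/-! ### The tree expansion -/

instance fintypeEdges {n : ℕ} (T : SimpleGraph (Fin n)) : Fintype T.edgeSet :=
  Fintype.ofFinite _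

/-- `w^T(v, v')`: `1` if `v = v'`, and otherwise the infimum of `w_ℓ` over the lines `ℓ` of the
path in `T` from `v` to `v'` (which is unique when `T` is a tree). -/
def treeWeight {n : ℕ} (T : SimpleGraph (Fin n)) (w : T.edgeSet → ℝ) :
    Matrix (Fin n) (Fin n) ℝ :=
  fun v v' => open Classical in
    if v = v' then 1
    else sInf {x : ℝ | ∃ (p : T.Walk v v') (ℓ : T.edgeSet),
      p.IsPath ∧ (ℓ : Sym2 (Fin n)) ∈ p.edges ∧ x = w ℓ}

/-- The partial derivative `∂/∂σ^v_ij` of a function of the complex matrix entries. -/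
def sigmaDeriv {n N : ℕ} (v : Fin n) (i j : Fin N) (F : (Fin n → MatField N) → ℂ) :
    (Fin n → MatField N) → ℂ :=
  fun σ => deriv (fun z : ℂ =>
    F (Function.update σ v fun a b => σ v a b + if a = i ∧ b = j then z else 0)) 0

/-- The four indices `i_ℓ, j_ℓ, k_ℓ, l_ℓ` of a line. -/
structure LineIndex (N : ℕ) where
  i : Fin N
  j : Fin N
  k : Fin N
  l : Fin N
deriving DecidableEq, Fintype

/-- The operator `δ_il δ_jk ∂/∂σ^v_ij ∂/∂σ^v'_kl` of a line `ℓ = {v, v'}`. -/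
def lineOp {n N : ℕ} (ℓ : Sym2 (Fin n)) (c : LineIndex N) (F : (Fin n → MatField N) → ℂ) :
    (Fin n → MatField N) → ℂ :=
  fun σ => (if c.i = c.l then 1 else 0) * (if c.j = c.k then 1 else 0) *
    sigmaDeriv ℓ.inf c.i c.j (sigmaDeriv ℓ.sup c.k c.l F) σ

/-- The integrand `∏_ℓ [δ_il δ_jk ∂/∂σ^v(ℓ)_ij ∂/∂σ^v'(ℓ)_kl] ∏_v V_v`, for given values `c` of the
line indices. The line operators are composed in some order; they commute on functions that are
holomorphic near Hermitian fields, so the order plays no role. -/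
def treeIntegrand (lam : ℝ) {n N : ℕ} (T : SimpleGraph (Fin n)) (c : T.edgeSet → LineIndex N) :
    (Fin n → MatField N) → ℂ :=
  (Finset.univ : Finset T.edgeSet).toList.foldr (fun (ℓ : T.edgeSet) F => lineOp ℓ.1 (c ℓ) F)
    (fun σ => ∏ v, loopVertex lam (σ v))

/-- The integral against `ν_T(·, w)` of the integrand, for given `w` and line indices. -/
def treeExpectation (lam : ℝ) {n N : ℕ} (T : SimpleGraph (Fin n)) (c : T.edgeSet → LineIndex N)
    (w : T.edgeSet → ℝ) : ℂ :=
  ∫ σ, treeIntegrand lam T c σ ∂(gaussianFields N (treeWeight T w))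

/-- The contribution of one tree, `∏_ℓ [∫_0^1 dw_ℓ ∑_{i_ℓ,j_ℓ,k_ℓ,l_ℓ}] ∫ dν_T {...}`. -/
def treeAmplitude (lam : ℝ) {n : ℕ} (N : ℕ) (T : SimpleGraph (Fin n)) : ℂ :=
  ∫ w in Set.Icc (0 : T.edgeSet → ℝ) 1, ∑ c : T.edgeSet → LineIndex N, treeExpectation lam T c w

/-- The term of order `n`: the sum over labelled trees on the vertices, with the factor `1/n!`. -/
def treeTerm (lam : ℝ) (N n : ℕ) : ℂ :=
  open Classical in
  (n.factorial : ℂ)⁻¹ * ∑ T : {T : SimpleGraph (Fin n) // T.IsTree}, treeAmplitude lam N T.1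

end LoopVertex

end

/-!
Write `V` for the loop vertex and let `φ` with `φ 1 = V` solve the backward equation
`∂ᵤ φ = - Δ φ / 2 - ⟨∇ φ, ∇ φ⟩ / 2` on `[0, 1]`, where `Δ` and `⟨∇ ·, ∇ ·⟩` are built with the
trace pairing of matrices. Averaging over a Gaussian Hermitian matrix of variance `u` is the heat
semigroup `heat u`, and the equation implies that `heat u (exp (φ u))` does not depend on `u`.
At `u = 1` it is the average of `exp V`, at `u = 0` it is `exp (φ 0)`, so `log Z = φ 0 0`.

The solution is expanded in the number of vertices: `flow V n` is the part of degree `n + 1` in `V`,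
obtained from the lower ones by Duhamel's formula. The loop vertex is holomorphic on a strip of
half-width `ρ` around the Hermitian matrices, and averaging over Hermitian matrices preserves the
strip. Cauchy's estimate costs a part of the strip in each step; with the `n`-th Catalan number
counting the ways to build the `n`-th term, it gives the geometric bound
`norm_grad_flow_le_geometric`. Hence the expansion converges, but its sum need not be shown to solve
the equation: the exponential of a partial sum satisfies the heat equation up to a truncation error
(`hasDerivAt_heat_exp`), which tends to zero (`heat_exp_eq_exp_tsum`). The symmetry `σ ↦ - σᴴ`
makes all terms real at the origin, so that the sum is the real logarithm of `Z` and not another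
branch (`hasSum_flow`).

It remains to see that `n ! * flow V (n - 1)` is the sum over the trees on `n` vertices. For this
purpose the expansion is polarized: `polyFlow F S` is multilinear in a family `F` of vertices indexed
by `S`, and its source term is a sum over the ways to cut `S` into two parts. On the side of the
trees, the integral over the line weights is decomposed according to the line `ℓ` of smallest weight
`r` (`integral_lines_min`). Every path through `ℓ` has weight `r`, while the other weights, rescaled
to `[r, 1]`, are again independent and uniform. The weight matrix is therefore `r` times the matrix
of ones plus `1 - r` times the block sum of the weight matrices of the two sides of `ℓ`
(`Split.maskedWeight_eq`). By induction this makes it positive semidefinite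
(`posSemidef_maskedWeight`). It also splits the Gaussian tuple into a component that is common to
all vertices and independent tuples on the two sides, and the integral over `r` becomes Duhamel's
integral (`Split.minLineContribution_eq`). As trees with a distinguished oriented line correspond to
pairs of trees on complementary parts with a vertex in each (`sum_tree_dart`), the sum over the trees
obeys the recursion of `polyFlow` (`sum_treeContribution`).

The analytic input on the loop vertex is the following. It is `- N` times the trace of the logarithm
of `1 + i √(2 lam / N) σ`, a matrix that on the strip of half-width `ρ = 1 / (2 √(2 lam / N))` has
Hermitian part at least `1 / 2`. Such a matrix has its eigenvalues in the right half-plane and an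
inverse of norm at most `2`, so by Jacobi's formula the loop vertex is holomorphic with gradient
bounded by `K = 2 √(2 lam N)`. The quotient `K / ρ = 8 lam` is independent of `N`, which is why the
radius of convergence is. Finally `exp V` is the power `- N` of the determinant; it arises from the
matrix integral when the quartic weight is written as the Fourier transform of a Gaussian measure
and the integral over `Φ` is done first (`partitionFunction_eq`).
-/

noncomputable section

namespace LoopVertex

open Filter Topology Metric
open scoped Matrix.Norms.L2Operator

/-! ### Families of holomorphic functions -/

section HoloFamily

variable {T E F : Type*} [TopologicalSpace T] [NormedAddCommGroup E] [NormedSpace ℂ E]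
  [NormedAddCommGroup F] [NormedSpace ℂ F]

/-- Cauchy's estimate for the Fréchet derivative on a ball. -/
theorem norm_fderiv_le_of_ball {f : E → F} {c : E} {R C : ℝ} (hR : 0 < R)
    (hf : DifferentiableOn ℂ f (ball c R)) (hC : ∀ z ∈ ball c R, ‖f z‖ ≤ C) :
    ‖fderiv ℂ f c‖ ≤ C / R := by
  have hC0 : 0 ≤ C := (norm_nonneg _).trans (hC c (mem_ball_self hR))
  refine ContinuousLinearMap.opNorm_le_bound _ (by positivity) fun X => ?_
  rcases eq_or_ne X 0 with rfl | hX
  · simp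
  have hX' : 0 < ‖X‖ := norm_pos_iff.2 hX
  have hd : DifferentiableAt ℂ f c := hf.differentiableAt (isOpen_ball.mem_nhds (mem_ball_self hR))
  -- the estimate on a slightly smaller disc of the line through `c` in the direction `X`
  have key : ∀ r : ℝ, 0 < r → r < R → ‖fderiv ℂ f c X‖ * r ≤ C * ‖X‖ := by
    intro r hr hrR
    have hline : ∀ z ∈ closedBall (0 : ℂ) (r / ‖X‖), c + z • X ∈ ball c R := by
      intro z hz
      rw [mem_closedBall_zero_iff, le_div_iff₀ hX'] at hz
      simp only [mem_ball, dist_self_add_left, norm_smul]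
      linarith
    have hder : HasDerivAt (fun z : ℂ => f (c + z • X)) (fderiv ℂ f c X) 0 := by
      have h1 : HasDerivAt (fun z : ℂ => c + z • X) X 0 := by
        simpa using ((hasDerivAt_id (0 : ℂ)).smul_const X).const_add c
      have h2 : HasFDerivAt f (fderiv ℂ f c) (c + (0 : ℂ) • X) := by simpa using hd.hasFDerivAt
      exact h2.comp_hasDerivAt (0 : ℂ) h1
    have hdiff : DifferentiableOn ℂ (fun z : ℂ => f (c + z • X)) (closedBall 0 (r / ‖X‖)) := by
      intro z hz
      have h1 : DifferentiableAt ℂ (fun z : ℂ => c + z • X) z := by fun_prop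
      exact (DifferentiableAt.comp z (hf.differentiableAt (isOpen_ball.mem_nhds (hline z hz)))
        h1).differentiableWithinAt
    have := Complex.norm_deriv_le_of_forall_mem_sphere_norm_le (f := fun z : ℂ => f (c + z • X))
      (c := 0) (R := r / ‖X‖) (C := C) (by positivity)
      ((hdiff.mono closure_ball_subset_closedBall).diffContOnCl)
      fun z hz => hC _ (hline z (sphere_subset_closedBall hz))
    rw [hder.deriv, le_div_iff₀ (by positivity)] at this
    field_simp at this
    linarith
  have hlim : ‖fderiv ℂ f c X‖ * R ≤ C * ‖X‖ := by
    have h1 : Tendsto (fun r : ℝ => ‖fderiv ℂ f c X‖ * r) (𝓝[<] R)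
        (𝓝 (‖fderiv ℂ f c X‖ * R)) :=
      ((continuous_const.mul continuous_id).tendsto R).mono_left nhdsWithin_le_nhds
    refine le_of_tendsto h1 ?_
    filter_upwards [Ioo_mem_nhdsLT hR] with r hr using key r hr.1 hr.2
  rw [div_mul_eq_mul_div, le_div_iff₀ hR]
  exact hlim

/-- A family of functions, holomorphic on `U`, that is jointly continuous in the parameter and the
point. -/
structure HoloFamily (U : Set E) (φ : T → E → F) : Prop where
  cont : ∀ t, ∀ σ ∈ U, ContinuousAt (fun p : T × E => φ p.1 p.2) (t, σ)
  holo : ∀ t, DifferentiableOn ℂ (φ t) U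

namespace HoloFamily

variable {U : Set E} {φ ψ : T → E → F}

theorem differentiableAt (hφ : HoloFamily U φ) (hU : IsOpen U) (t : T) {σ : E} (hσ : σ ∈ U) :
    DifferentiableAt ℂ (φ t) σ :=
  (hφ.holo t).differentiableAt (hU.mem_nhds hσ)

theorem congr (hφ : HoloFamily U φ) (hU : IsOpen U) (h : ∀ t, ∀ σ ∈ U, ψ t σ = φ t σ) :
    HoloFamily U ψ where
  cont t σ hσ := by
    refine (hφ.cont t σ hσ).congr ?_
    have : ∀ᶠ p : T × E in 𝓝 (t, σ), p.2 ∈ U :=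
      continuous_snd.continuousAt.eventually (hU.mem_nhds hσ)
    filter_upwards [this] with p hp using (h _ _ hp).symm
  holo t := (hφ.holo t).congr fun σ hσ => h t σ hσ

theorem of_differentiableOn {f : E → F} (hU : IsOpen U) (hf : DifferentiableOn ℂ f U) :
    HoloFamily U (fun _ : T => f) where
  cont _ _ hσ := ContinuousAt.comp (f := Prod.snd)
    (hf.differentiableAt (hU.mem_nhds hσ)).continuousAt continuousAt_snd
  holo _ := hf

theorem const (c : F) : HoloFamily U (fun (_ : T) (_ : E) => c) where
  cont _ _ _ := continuousAt_const
  holo _ := differentiableOn_const c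

theorem add (hφ : HoloFamily U φ) (hψ : HoloFamily U ψ) :
    HoloFamily U (fun t σ => φ t σ + ψ t σ) where
  cont t σ hσ := (hφ.cont t σ hσ).add (hψ.cont t σ hσ)
  holo t := (hφ.holo t).add (hψ.holo t)

theorem sum {ι : Type*} {s : Finset ι} {φ : ι → T → E → F} (hφ : ∀ i ∈ s, HoloFamily U (φ i)) :
    HoloFamily U (fun t σ => ∑ i ∈ s, φ i t σ) where
  cont t σ hσ := tendsto_finsetSum _ fun i hi => (hφ i hi).cont t σ hσ
  holo t := DifferentiableOn.fun_sum fun i hi => (hφ i hi).holo t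

theorem mul {φ ψ : T → E → ℂ} (hφ : HoloFamily U φ) (hψ : HoloFamily U ψ) :
    HoloFamily U (fun t σ => φ t σ * ψ t σ) where
  cont t σ hσ := (hφ.cont t σ hσ).mul (hψ.cont t σ hσ)
  holo t := (hφ.holo t).mul (hψ.holo t)

theorem param_mul {φ : T → E → ℂ} (hφ : HoloFamily U φ) {a : T → ℂ} (ha : Continuous a) :
    HoloFamily U (fun t σ => a t * φ t σ) where
  cont t σ hσ := (ha.continuousAt.comp (x := (t, σ)) continuousAt_fst).mul (hφ.cont t σ hσ)
  holo t := (hφ.holo t).const_mul _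

theorem clm_comp {G : Type*} [NormedAddCommGroup G] [NormedSpace ℂ G] (L : F →L[ℂ] G)
    (hφ : HoloFamily U φ) : HoloFamily U (fun t σ => L (φ t σ)) where
  cont t σ hσ := L.continuous.continuousAt.comp (hφ.cont t σ hσ)
  holo t := L.differentiable.comp_differentiableOn (hφ.holo t)

theorem exp {φ : T → E → ℂ} (hφ : HoloFamily U φ) :
    HoloFamily U (fun t σ => Complex.exp (φ t σ)) where
  cont t σ hσ := (Complex.continuous_exp.continuousAt).comp (hφ.cont t σ hσ)
  holo t := (hφ.holo t).cexp

/-- A continuous change of parameters together with a parameter dependent translation. -/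
theorem translate {T' : Type*} [TopologicalSpace T'] (hφ : HoloFamily U φ) {a : T' → T}
    (ha : Continuous a) {y : T' → E} (hy : Continuous y) (hU : ∀ t, ∀ σ ∈ U, σ + y t ∈ U) :
    HoloFamily U (fun t σ => φ (a t) (σ + y t)) where
  cont t σ hσ := by
    have h1 : ContinuousAt (fun p : T' × E => (a p.1, p.2 + y p.1)) (t, σ) :=
      Continuous.continuousAt (by fun_prop)
    exact ContinuousAt.comp (f := fun p : T' × E => (a p.1, p.2 + y p.1)) (x := (t, σ))
      (hφ.cont (a t) (σ + y t) (hU t σ hσ)) h1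
  holo t := by
    refine (hφ.holo (a t)).comp (f := fun σ => σ + y t) ?_ fun σ hσ => hU t σ hσ
    exact differentiableOn_id.add_const _

theorem comp_param {T' : Type*} [TopologicalSpace T'] (hφ : HoloFamily U φ) {a : T' → T}
    (ha : Continuous a) : HoloFamily U (fun t σ => φ (a t) σ) := by
  simpa using hφ.translate ha (continuous_const (y := (0 : E))) (by simp)

end HoloFamily

/-- The derivative of a holomorphic function that depends measurably on a parameter is measurable
in the parameter: it is a limit of difference quotients. -/
theorem aestronglyMeasurable_fderiv [FiniteDimensional ℂ E] {Y : Type*} [MeasurableSpace Y]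
    {ν : Measure Y} {U : Set E} (hU : IsOpen U) {φ : Y → E → ℂ}
    (hm : ∀ σ ∈ U, AEStronglyMeasurable (fun y => φ y σ) ν)
    (hh : ∀ y, DifferentiableOn ℂ (φ y) U) {σ : E} (hσ : σ ∈ U) :
    AEStronglyMeasurable (fun y => fderiv ℂ (φ y) σ) ν := by
  classical
  let b := Module.finBasis ℂ E
  let co : Fin (Module.finrank ℂ E) → (E →L[ℂ] ℂ) := fun i =>
    LinearMap.toContinuousLinearMap (b.coord i)
  have hexp : ∀ L : E →L[ℂ] ℂ, L = ∑ i, L (b i) • co i := by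
    intro L
    ext x
    conv_lhs => rw [← b.sum_repr x]
    simp [co, -Module.Basis.sum_repr, mul_comm]
  -- Along the complex steps `1 / (n + 1)`, from some `n₀` on the difference quotient in the
  -- direction `X` stays in `U`.
  have hdir : ∀ X : E, AEStronglyMeasurable (fun y => fderiv ℂ (φ y) σ X) ν := by
    intro X
    have hz : Tendsto (fun n : ℕ => ((n : ℂ) + 1)⁻¹) atTop (𝓝[≠] 0) := by
      refine tendsto_nhdsWithin_iff.2 ⟨?_, .of_forall fun n => ?_⟩
      · simpa [one_div] using tendsto_one_div_add_atTop_nhds_zero_nat (𝕜 := ℂ)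
      · exact inv_ne_zero (by exact_mod_cast n.succ_ne_zero)
    have hin : ∀ᶠ n : ℕ in atTop, σ + ((n : ℂ) + 1)⁻¹ • X ∈ U := by
      have hc : Tendsto (fun n : ℕ => σ + ((n : ℂ) + 1)⁻¹ • X) atTop (𝓝 σ) := by
        have := (hz.mono_right nhdsWithin_le_nhds).smul_const X |>.const_add σ
        simpa using this
      exact hc.eventually (hU.mem_nhds hσ)
    obtain ⟨n₀, hn₀⟩ := eventually_atTop.1 hin
    refine aestronglyMeasurable_of_tendsto_ae atTop
      (f := fun n y => ((n + n₀ : ℕ) + 1 : ℂ) * (φ y (σ + (((n + n₀ : ℕ) : ℂ) + 1)⁻¹ • X) - φ y σ))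
      (fun n => ?_) (.of_forall fun y => ?_)
    · exact ((hm _ (hn₀ _ (Nat.le_add_left _ _))).sub (hm _ hσ)).const_mul _
    · have hd : HasDerivAt (fun z : ℂ => φ y (σ + z • X)) (fderiv ℂ (φ y) σ X) 0 := by
        have h1 : HasDerivAt (fun z : ℂ => σ + z • X) X 0 := by
          simpa using ((hasDerivAt_id (0 : ℂ)).smul_const X).const_add σ
        have h2 : HasFDerivAt (φ y) (fderiv ℂ (φ y) σ) (σ + (0 : ℂ) • X) := by
          simpa using ((hh y).differentiableAt (hU.mem_nhds hσ)).hasFDerivAt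
        exact h2.comp_hasDerivAt (0 : ℂ) h1
      have h3 := (hasDerivAt_iff_tendsto_slope_zero.1 hd).comp (hz.comp (tendsto_add_atTop_nat n₀))
      refine h3.congr fun n => ?_
      simp [Function.comp_def]
  have : (fun y => fderiv ℂ (φ y) σ) = fun y => ∑ i, fderiv ℂ (φ y) σ (b i) • co i := by
    funext y; exact hexp _
  rw [this]
  have := Finset.aestronglyMeasurable_sum (μ := ν) Finset.univ
    (f := fun i y => fderiv ℂ (φ y) σ (b i) • co i) fun i _ => (hdir (b i)).smul_const _
  convert! this using 1
  ext1 y; simp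

/-- Integration of a holomorphic family over an additional variable, under a locally uniform
integrable bound. The derivative can be taken under the integral sign. -/
theorem HoloFamily.integral [FirstCountableTopology T] [FiniteDimensional ℂ E] {Y : Type*}
    [MeasurableSpace Y] {ν : Measure Y} {U : Set E} (hU : IsOpen U) {φ : Y → T → E → ℂ}
    (hm : ∀ t, ∀ σ ∈ U, AEStronglyMeasurable (fun y => φ y t σ) ν)
    (hφ : ∀ y, HoloFamily U (φ y))
    (hb : ∀ t, ∀ σ ∈ U, ∃ g : Y → ℝ, Integrable g ν ∧
      ∀ᶠ p : T × E in 𝓝 (t, σ), ∀ y, ‖φ y p.1 p.2‖ ≤ g y) :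
    HoloFamily U (fun t σ => ∫ y, φ y t σ ∂ν) ∧
      ∀ t, ∀ σ ∈ U, ∀ X : E, Integrable (fun y => fderiv ℂ (φ y t) σ X) ν ∧
        fderiv ℂ (fun σ => ∫ y, φ y t σ ∂ν) σ X = ∫ y, fderiv ℂ (φ y t) σ X ∂ν := by
  have hmem : ∀ (t : T), ∀ σ ∈ U, ∀ᶠ p : T × E in 𝓝 (t, σ), p.2 ∈ U := fun t σ hσ =>
    continuous_snd.continuousAt.eventually (hU.mem_nhds hσ)
  have hcont : ∀ t, ∀ σ ∈ U, ContinuousAt (fun p : T × E => ∫ y, φ y p.1 p.2 ∂ν) (t, σ) := by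
    intro t σ hσ
    obtain ⟨g, hg, hgb⟩ := hb t σ hσ
    have : FirstCountableTopology (T × E) := inferInstance
    refine continuousAt_of_dominated (bound := g) ?_ ?_ hg ?_
    · filter_upwards [hmem t σ hσ] with p hp using hm _ _ hp
    · filter_upwards [hgb] with p hp using .of_forall hp
    · exact .of_forall fun y => (hφ y).cont t σ hσ
  have hder : ∀ t, ∀ σ ∈ U, Integrable (fun y => fderiv ℂ (φ y t) σ) ν ∧
      HasFDerivAt (fun σ => ∫ y, φ y t σ ∂ν) (∫ y, fderiv ℂ (φ y t) σ ∂ν) σ := by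
    intro t σ hσ
    obtain ⟨g, hg, hgb⟩ := hb t σ hσ
    have hgb' : ∀ᶠ τ in 𝓝 σ, τ ∈ U ∧ ∀ y, ‖φ y t τ‖ ≤ g y := by
      have hc : Tendsto (fun τ : E => (t, τ)) (𝓝 σ) (𝓝 (t, σ)) :=
        (Continuous.prodMk_right t).tendsto σ
      filter_upwards [hU.mem_nhds hσ, hc.eventually hgb] with τ h1 h2 using ⟨h1, h2⟩
    obtain ⟨R, hR, hball⟩ := Metric.nhds_basis_ball.mem_iff.1 hgb'
    -- Cauchy's estimate on balls of half the radius turns the bound `g` on the values into a bound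
    -- on the derivatives.
    have hest : ∀ y, ∀ τ ∈ ball σ (R / 2), ‖fderiv ℂ (φ y t) τ‖ ≤ g y / (R / 2) := by
      intro y τ hτ
      have hsub : ball τ (R / 2) ⊆ ball σ R := by
        intro x hx
        have := dist_triangle x τ σ
        simp only [mem_ball] at hx hτ ⊢
        linarith
      exact norm_fderiv_le_of_ball (by positivity)
        (((hφ y).holo t).mono fun x hx => (hball (hsub hx)).1) fun x hx => (hball (hsub hx)).2 y
    have hσR : σ ∈ ball σ (R / 2) := mem_ball_self (by positivity)
    have hmeas' : AEStronglyMeasurable (fun y => fderiv ℂ (φ y t) σ) ν :=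
      aestronglyMeasurable_fderiv hU (fun τ hτ => hm t τ hτ) (fun y => (hφ y).holo t) hσ
    refine ⟨(hg.div_const (R / 2)).mono' hmeas' (.of_forall fun y => hest y σ hσR), ?_⟩
    refine hasFDerivAt_integral_of_dominated_of_fderiv_le (𝕜 := ℂ)
      (ball_mem_nhds σ (by positivity : 0 < R / 2)) (bound := fun y => g y / (R / 2)) ?_ ?_ hmeas'
      (.of_forall hest) (hg.div_const _) ?_
    · filter_upwards [hU.mem_nhds hσ] with τ hτ using hm t τ hτ
    · exact hg.mono' (hm t σ hσ) (.of_forall fun y =>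
        (hball (mem_ball_self hR)).2 y)
    · refine .of_forall fun y τ hτ => ?_
      have : τ ∈ ball σ R := ball_subset_ball (by linarith) hτ
      exact ((hφ y).differentiableAt hU t (hball this).1).hasFDerivAt
  refine ⟨⟨hcont, fun t σ hσ => (hder t σ hσ).2.differentiableAt.differentiableWithinAt⟩,
    fun t σ hσ X => ⟨(hder t σ hσ).1.apply_continuousLinearMap X, ?_⟩⟩
  rw [(hder t σ hσ).2.fderiv, ContinuousLinearMap.integral_apply (hder t σ hσ).1]

/-- The derivative of a holomorphic function is holomorphic: by Cauchy's formula on small discs,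
each directional derivative is an integral of holomorphic functions. -/
theorem differentiableOn_fderiv [FiniteDimensional ℂ E] {U : Set E} (hU : IsOpen U) {f : E → ℂ}
    (hf : DifferentiableOn ℂ f U) : DifferentiableOn ℂ (fun σ => fderiv ℂ f σ) U := by
  have : ProperSpace E := FiniteDimensional.proper ℂ E
  have hdir : ∀ X : E, DifferentiableOn ℂ (fun σ => fderiv ℂ f σ X) U := by
    intro X σ₀ hσ₀
    obtain ⟨R, hR, hball⟩ := Metric.nhds_basis_closedBall.mem_iff.1 (hU.mem_nhds hσ₀)
    set r : ℝ := R / 2 / (‖X‖ + 1) with hr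
    have hr0 : 0 < r := by positivity
    have hrX : r * ‖X‖ ≤ R / 2 := by
      rw [hr, div_mul_eq_mul_div, div_le_iff₀ (by positivity)]
      nlinarith [norm_nonneg X]
    have hin : ∀ σ ∈ ball σ₀ (R / 2), ∀ z ∈ closedBall (0 : ℂ) r, σ + z • X ∈ closedBall σ₀ R := by
      intro σ hσ z hz
      rw [mem_closedBall_zero_iff] at hz
      rw [mem_ball, dist_eq_norm] at hσ
      rw [mem_closedBall, dist_eq_norm]
      calc ‖σ + z • X - σ₀‖ = ‖(σ - σ₀) + z • X‖ := by congr 1; abel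
        _ ≤ ‖σ - σ₀‖ + ‖z‖ * ‖X‖ := (norm_add_le _ _).trans (by rw [norm_smul])
        _ ≤ R / 2 + r * ‖X‖ := by gcongr
        _ ≤ R := by linarith
    have hcirc : ∀ θ : ℝ, circleMap 0 r θ ∈ closedBall (0 : ℂ) r := fun θ =>
      sphere_subset_closedBall (circleMap_mem_sphere 0 hr0.le θ)
    obtain ⟨C, hC⟩ := (isCompact_closedBall σ₀ R).exists_bound_of_continuousOn
      ((hf.mono hball).continuousOn)
    let ν : Measure ℝ := volume.restrict (Set.Ioc 0 (2 * Real.pi))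
    -- The integrand of Cauchy's formula for `d/dz f (σ + z • X)` at `z = 0` over the circle of
    -- radius `r`.
    let φ : ℝ → Unit → E → ℂ := fun θ _ σ =>
      deriv (circleMap 0 r) θ * (((circleMap 0 r θ - 0) ^ 2)⁻¹ * f (σ + circleMap 0 r θ • X))
    have hφh : ∀ θ, DifferentiableOn ℂ (φ θ ()) (ball σ₀ (R / 2)) := by
      intro θ
      refine ((hf.comp (f := fun σ => σ + circleMap 0 r θ • X)
        (differentiableOn_id.add_const _) fun σ hσ => hball (hin σ hσ _ (hcirc θ))).const_mul
        _).const_mul _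
    have hkey := HoloFamily.integral (T := Unit) (ν := ν) (φ := φ) (U := ball σ₀ (R / 2))
      isOpen_ball ?_ ?_ ?_
    · have hd := hkey.1.holo ()
      have heq : ∀ σ ∈ ball σ₀ (R / 2), fderiv ℂ f σ X =
          (2 * Real.pi * Complex.I : ℂ)⁻¹ * ∫ θ, φ θ () σ ∂ν := by
        intro σ hσ
        have hder : HasDerivAt (fun z : ℂ => f (σ + z • X)) (fderiv ℂ f σ X) 0 := by
          have h1 : HasDerivAt (fun z : ℂ => σ + z • X) X 0 := by
            simpa using ((hasDerivAt_id (0 : ℂ)).smul_const X).const_add σ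
          have h0 : σ ∈ U := by
            have := hball (hin σ hσ 0 (mem_closedBall_self hr0.le))
            simpa using this
          have h2 : HasFDerivAt f (fderiv ℂ f σ) (σ + (0 : ℂ) • X) := by
            simpa using (hf.differentiableAt (hU.mem_nhds h0)).hasFDerivAt
          exact h2.comp_hasDerivAt (0 : ℂ) h1
        have hopen : IsOpen ((fun z : ℂ => σ + z • X) ⁻¹' U) :=
          hU.preimage (by fun_prop)
        have hdO : DifferentiableOn ℂ (fun z : ℂ => f (σ + z • X))
            ((fun z : ℂ => σ + z • X) ⁻¹' U) :=
          hf.comp (f := fun z : ℂ => σ + z • X) (by fun_prop) fun z hz => hz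
        have := Complex.two_pi_I_inv_smul_circleIntegral_sub_sq_inv_smul_of_differentiable
          (c := 0) (w₀ := 0) (R := r) hopen (fun z hz => hball (hin σ hσ z hz)) hdO
          (mem_ball_self hr0)
        rw [hder.deriv] at this
        rw [← this, circleIntegral, intervalIntegral.integral_of_le (by positivity)]
        simp [φ, ν, smul_eq_mul]
      have hσ₀' : σ₀ ∈ ball σ₀ (R / 2) := mem_ball_self (by positivity)
      have := (hd.const_mul (2 * Real.pi * Complex.I : ℂ)⁻¹).congr heq
      exact (this.differentiableAt (isOpen_ball.mem_nhds hσ₀')).differentiableWithinAt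
    · intro _ σ hσ
      refine Continuous.aestronglyMeasurable ?_
      have h1 : Continuous fun θ : ℝ => f (σ + circleMap 0 r θ • X) := by
        refine hf.continuousOn.comp_continuous ?_ fun θ => hball (hin σ hσ _ (hcirc θ))
        exact continuous_const.add ((continuous_circleMap 0 r).smul continuous_const)
      have h2 : Continuous fun θ : ℝ => ((circleMap 0 r θ - 0) ^ 2)⁻¹ := by
        refine Continuous.inv₀ (((continuous_circleMap 0 r).sub continuous_const).pow 2) fun θ => ?_
        simp [hr0.ne']
      have h3 : Continuous fun θ : ℝ => deriv (circleMap 0 r) θ := by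
        simp only [deriv_circleMap]
        exact (continuous_circleMap 0 r).mul continuous_const
      exact h3.mul (h2.mul h1)
    · exact fun θ => HoloFamily.of_differentiableOn isOpen_ball (hφh θ)
    · intro _ σ hσ
      refine ⟨fun _ => r * ((r ^ 2)⁻¹ * C), integrable_const _, ?_⟩
      have : ∀ᶠ p : Unit × E in 𝓝 ((), σ), p.2 ∈ ball σ₀ (R / 2) :=
        continuous_snd.continuousAt.eventually (isOpen_ball.mem_nhds hσ)
      filter_upwards [this] with p hp θ
      simp only [φ, norm_mul, deriv_circleMap, norm_circleMap_zero, Complex.norm_I, norm_inv,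
        norm_pow, sub_zero, abs_of_pos hr0, mul_one]
      gcongr
      exact hC _ (hin _ hp _ (hcirc θ))
  let b := Module.finBasis ℂ E
  have hexp : (fun σ => fderiv ℂ f σ) = fun σ => ∑ i, fderiv ℂ f σ (b i) •
      (LinearMap.toContinuousLinearMap (b.coord i) : E →L[ℂ] ℂ) := by
    funext σ
    ext x
    conv_lhs => rw [← b.sum_repr x]
    simp [-Module.Basis.sum_repr, mul_comm]
  rw [hexp]
  exact DifferentiableOn.fun_sum fun i _ => (hdir (b i)).smul_const _

namespace HoloFamily

variable {U : Set E} {φ : T → E → ℂ}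

/-- The derivative of a holomorphic family is a holomorphic family: by Cauchy's estimate, locally
uniform convergence of holomorphic functions passes to the derivatives. -/
theorem fderiv [FiniteDimensional ℂ E] (hφ : HoloFamily U φ) (hU : IsOpen U) :
    HoloFamily U (fun t σ => _root_.fderiv ℂ (φ t) σ) := by
  have : ProperSpace E := FiniteDimensional.proper ℂ E
  have hholo : ∀ t, DifferentiableOn ℂ (fun σ => _root_.fderiv ℂ (φ t) σ) U := by
    exact fun t => differentiableOn_fderiv hU (hφ.holo t)
  refine ⟨fun t σ hσ => ?_, hholo⟩
  obtain ⟨R, hR, hball⟩ := Metric.nhds_basis_closedBall.mem_iff.1 (hU.mem_nhds hσ)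
  rw [Metric.continuousAt_iff']
  intro ε hε
  have hc : ContinuousAt (fun τ => _root_.fderiv ℂ (φ t) τ) σ :=
    ((hholo t).differentiableAt (hU.mem_nhds hσ)).continuousAt
  -- uniform closeness of `φ s` and `φ t` on the compact ball, for `s` near `t`
  have hunif : ∀ᶠ s in 𝓝 t, ∀ τ ∈ closedBall σ R, ‖φ s τ - φ t τ‖ ≤ ε / 4 * (R / 2) := by
    have hK : IsCompact (closedBall σ R) := isCompact_closedBall _ _
    have := hK.eventually_forall_of_forall_eventually (x₀ := t)
      (P := fun s τ => ‖φ s τ - φ t τ‖ ≤ ε / 4 * (R / 2)) ?_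
    · exact this
    intro τ hτ
    have h1 : ContinuousAt (fun p : T × E => φ p.1 p.2 - φ t p.2) (t, τ) := by
      refine (hφ.cont t τ (hball hτ)).sub ?_
      exact ContinuousAt.comp (f := Prod.snd) (x := (t, τ))
        (hφ.differentiableAt hU t (hball hτ)).continuousAt continuousAt_snd
    have h2 := h1.norm.tendsto
    simp only [sub_self, norm_zero] at h2
    exact h2.eventually (eventually_le_nhds (by positivity))
  have hnear : ∀ᶠ p : T × E in 𝓝 (t, σ), p.2 ∈ ball σ (R / 2) :=
    continuous_snd.continuousAt.eventually (ball_mem_nhds σ (by positivity))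
  have hcl : ∀ᶠ p : T × E in 𝓝 (t, σ),
      dist (_root_.fderiv ℂ (φ t) p.2) (_root_.fderiv ℂ (φ t) σ) < ε / 2 :=
    (ContinuousAt.comp (f := Prod.snd) (x := (t, σ)) hc continuousAt_snd).eventually
      (ball_mem_nhds _ (by positivity))
  filter_upwards [hnear, hcl, continuous_fst.continuousAt.eventually hunif] with p hp1 hp2 hp3
  have hsub : ball p.2 (R / 2) ⊆ closedBall σ R := by
    intro τ hτ
    have := dist_triangle τ p.2 σ
    simp only [mem_ball, mem_closedBall] at hτ hp1 ⊢
    linarith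
  have hp2U : p.2 ∈ U := hball (hsub (mem_ball_self (by positivity)))
  have hest : ‖_root_.fderiv ℂ (fun τ => φ p.1 τ - φ t τ) p.2‖ ≤ ε / 4 * (R / 2) / (R / 2) :=
    norm_fderiv_le_of_ball (by positivity)
      (((hφ.holo p.1).sub (hφ.holo t)).mono (hsub.trans hball)) fun τ hτ => hp3 τ (hsub hτ)
  rw [fderiv_fun_sub (hφ.differentiableAt hU _ hp2U) (hφ.differentiableAt hU _ hp2U),
    mul_div_cancel_right₀ _ (by positivity), ← dist_eq_norm] at hest
  calc _ ≤ dist (_root_.fderiv ℂ (φ p.1) p.2) (_root_.fderiv ℂ (φ t) p.2)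
        + dist (_root_.fderiv ℂ (φ t) p.2) (_root_.fderiv ℂ (φ t) σ) := dist_triangle _ _ _
    _ < ε := by linarith

theorem fderiv_apply [FiniteDimensional ℂ E] (hφ : HoloFamily U φ)
    (hU : IsOpen U) (X : E) : HoloFamily U (fun t σ => _root_.fderiv ℂ (φ t) σ X) :=
  (hφ.fderiv hU).clm_comp (ContinuousLinearMap.apply ℂ ℂ X)

end HoloFamily

end HoloFamily

/-! ### The strip around the Hermitian matrices -/

/-- Complex `N × N` matrices with the operator norm. -/
abbrev Mat (N : ℕ) : Type := Matrix (Fin N) (Fin N) ℂ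

section Strip

variable {N : ℕ} {T : Type*} [TopologicalSpace T]

/-- A lower bound for the distance, in operator norm, from `σ` to the boundary of the strip of
half-width `ρ`; it only depends on the skew-Hermitian part of `σ`. -/
def stripDist (ρ : ℝ) (σ : Mat N) : ℝ := ρ - ‖σ - σ.conjTranspose‖ / 2

/-- The matrices whose skew-Hermitian part has norm less than `ρ`. -/
def strip (ρ : ℝ) : Set (Mat N) := {σ | 0 < stripDist ρ σ}

theorem continuous_stripDist (ρ : ℝ) : Continuous (stripDist (N := N) ρ) := by
  unfold stripDist
  have : Continuous fun σ : Mat N => σ.conjTranspose := continuous_star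
  fun_prop

theorem isOpen_strip (ρ : ℝ) : IsOpen (strip (N := N) ρ) :=
  isOpen_lt continuous_const (continuous_stripDist ρ)

theorem stripDist_add_ge (ρ : ℝ) (σ X : Mat N) : stripDist ρ σ - ‖X‖ ≤ stripDist ρ (σ + X) := by
  have h1 : (σ + X) - (σ + X).conjTranspose
      = (σ - σ.conjTranspose) + (X - X.conjTranspose) := by
    rw [Matrix.conjTranspose_add]; abel
  have h2 : ‖X - X.conjTranspose‖ ≤ ‖X‖ + ‖X‖ :=
    (norm_sub_le _ _).trans (by rw [Matrix.l2_opNorm_conjTranspose])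
  have h3 := norm_add_le (σ - σ.conjTranspose) (X - X.conjTranspose)
  unfold stripDist
  rw [h1]
  linarith

theorem stripDist_add_hermitian (ρ : ℝ) (σ : Mat N) {X : Mat N} (hX : X.IsHermitian) :
    stripDist ρ (σ + X) = stripDist ρ σ := by
  unfold stripDist
  rw [Matrix.conjTranspose_add, hX.eq, add_sub_add_right_eq_sub]

theorem stripDist_hermitian (ρ : ℝ) {X : Mat N} (hX : X.IsHermitian) : stripDist ρ X = ρ := by
  simp [stripDist, hX.eq]

theorem hermitian_mem_strip {ρ : ℝ} (hρ : 0 < ρ) {X : Mat N} (hX : X.IsHermitian) :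
    X ∈ strip ρ := by
  simpa [strip, stripDist_hermitian ρ hX]

theorem add_hermitian_mem_strip {ρ : ℝ} {σ X : Mat N} (hσ : σ ∈ strip ρ) (hX : X.IsHermitian) :
    σ + X ∈ strip ρ := by
  simpa [strip, stripDist_add_hermitian ρ σ hX] using hσ

theorem stripDist_ball {ρ r : ℝ} {σ τ : Mat N} (hτ : τ ∈ ball σ r) :
    stripDist ρ σ - r < stripDist ρ τ := by
  have h := stripDist_add_ge ρ σ (τ - σ)
  rw [mem_ball, dist_eq_norm] at hτ
  rw [add_sub_cancel] at h
  linarith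

theorem ball_subset_strip {ρ r : ℝ} {σ : Mat N} (hr : r ≤ stripDist ρ σ) :
    ball σ r ⊆ strip ρ := fun τ hτ => by
  have := stripDist_ball (ρ := ρ) hτ
  simp only [strip, Set.mem_ofPred_eq]
  linarith

/-- Cauchy's estimate on the strip. -/
theorem norm_fderiv_le_of_strip {F : Type*} [NormedAddCommGroup F] [NormedSpace ℂ F] {ρ r C : ℝ}
    {f : Mat N → F} {σ : Mat N} (hf : DifferentiableOn ℂ f (strip ρ)) (hr : 0 < r)
    (hrσ : r ≤ stripDist ρ σ) (hC : ∀ τ, stripDist ρ σ - r < stripDist ρ τ → ‖f τ‖ ≤ C) :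
    ‖fderiv ℂ f σ‖ ≤ C / r :=
  norm_fderiv_le_of_ball hr (hf.mono (ball_subset_strip hrσ)) fun τ hτ => hC τ (stripDist_ball hτ)

/-- Boundedness away from the boundary of the strip, uniformly in the parameter. -/
def StripBdd {F : Type*} [Norm F] (ρ : ℝ) (φ : T → Mat N → F) : Prop :=
  ∀ ε > 0, ∃ C, ∀ t σ, ε ≤ stripDist ρ σ → ‖φ t σ‖ ≤ C

/-- Holomorphic families on the strip that are bounded away from its boundary. -/
structure BddHolo (ρ : ℝ) (φ : T → Mat N → ℂ) : Prop where
  holo : HoloFamily (strip ρ) φ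
  bdd : StripBdd ρ φ

/-- Holomorphic families on the strip whose derivative is bounded away from its boundary. -/
structure LipHolo (ρ : ℝ) (φ : T → Mat N → ℂ) : Prop where
  holo : HoloFamily (strip ρ) φ
  bdd : StripBdd ρ fun t σ => fderiv ℂ (φ t) σ

variable {ρ : ℝ} {φ ψ : T → Mat N → ℂ}

/-- Cauchy's estimate on a ball of half the distance to the boundary of the strip. -/
theorem BddHolo.lipHolo (hφ : BddHolo ρ φ) : LipHolo ρ φ where
  holo := hφ.holo
  bdd ε hε := by
    obtain ⟨C, hC⟩ := hφ.bdd (ε / 2) (by positivity)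
    refine ⟨C / (ε / 2), fun t σ hσ => ?_⟩
    exact norm_fderiv_le_of_strip (hφ.holo.holo t) (by positivity) (by linarith)
      fun τ hτ => hC t τ (by linarith)

theorem LipHolo.fderiv_apply (hφ : LipHolo ρ φ) (X : Mat N) :
    BddHolo ρ (fun t σ => fderiv ℂ (φ t) σ X) where
  holo := hφ.holo.fderiv_apply (isOpen_strip ρ) X
  bdd ε hε := by
    obtain ⟨C, hC⟩ := hφ.bdd ε hε
    refine ⟨C * ‖X‖, fun t σ hσ => (ContinuousLinearMap.le_opNorm _ _).trans ?_⟩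
    gcongr
    exact hC t σ hσ

namespace BddHolo

theorem congr (hφ : BddHolo ρ φ) (h : ∀ t, ∀ σ ∈ strip ρ, ψ t σ = φ t σ) : BddHolo ρ ψ where
  holo := hφ.holo.congr (isOpen_strip ρ) h
  bdd ε hε := by
    obtain ⟨C, hC⟩ := hφ.bdd ε hε
    exact ⟨C, fun t σ hσ => by rw [h t σ (lt_of_lt_of_le hε hσ)]; exact hC t σ hσ⟩

theorem const (c : ℂ) : BddHolo ρ (fun (_ : T) (_ : Mat N) => c) where
  holo := HoloFamily.const c
  bdd _ _ := ⟨‖c‖, fun _ _ _ => le_rfl⟩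

theorem add (hφ : BddHolo ρ φ) (hψ : BddHolo ρ ψ) : BddHolo ρ (fun t σ => φ t σ + ψ t σ) where
  holo := hφ.holo.add hψ.holo
  bdd ε hε := by
    obtain ⟨C, hC⟩ := hφ.bdd ε hε
    obtain ⟨D, hD⟩ := hψ.bdd ε hε
    exact ⟨C + D, fun t σ hσ => (norm_add_le _ _).trans (add_le_add (hC t σ hσ) (hD t σ hσ))⟩

theorem mul (hφ : BddHolo ρ φ) (hψ : BddHolo ρ ψ) : BddHolo ρ (fun t σ => φ t σ * ψ t σ) where
  holo := hφ.holo.mul hψ.holo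
  bdd ε hε := by
    obtain ⟨C, hC⟩ := hφ.bdd ε hε
    obtain ⟨D, hD⟩ := hψ.bdd ε hε
    refine ⟨C * D, fun t σ hσ => ?_⟩
    rw [norm_mul]
    exact mul_le_mul (hC t σ hσ) (hD t σ hσ) (norm_nonneg _) ((norm_nonneg _).trans (hC t σ hσ))

theorem sum {ι : Type*} {s : Finset ι} {φ : ι → T → Mat N → ℂ} (hφ : ∀ i ∈ s, BddHolo ρ (φ i)) :
    BddHolo ρ (fun t σ => ∑ i ∈ s, φ i t σ) := by
  classical
  induction s using Finset.induction_on with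
  | empty => simpa using const (0 : ℂ)
  | insert a s ha ih =>
    simp only [Finset.sum_insert ha]
    exact (hφ a (Finset.mem_insert_self _ _)).add
      (ih fun i hi => hφ i (Finset.mem_insert_of_mem hi))

theorem prod {ι : Type*} {s : Finset ι} {φ : ι → T → Mat N → ℂ} (hφ : ∀ i ∈ s, BddHolo ρ (φ i)) :
    BddHolo ρ (fun t σ => ∏ i ∈ s, φ i t σ) := by
  classical
  induction s using Finset.induction_on with
  | empty => simpa using const (1 : ℂ)
  | insert a s ha ih =>
    simp only [Finset.prod_insert ha]
    exact (hφ a (Finset.mem_insert_self _ _)).mul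
      (ih fun i hi => hφ i (Finset.mem_insert_of_mem hi))

theorem comp_param {T' : Type*} [TopologicalSpace T'] (hφ : BddHolo ρ φ) {a : T' → T}
    (ha : Continuous a) : BddHolo ρ (fun t σ => φ (a t) σ) where
  holo := hφ.holo.comp_param ha
  bdd ε hε := by
    obtain ⟨C, hC⟩ := hφ.bdd ε hε
    exact ⟨C, fun t σ hσ => hC _ σ hσ⟩

theorem translate {T' : Type*} [TopologicalSpace T'] (hφ : BddHolo ρ φ) {a : T' → T}
    (ha : Continuous a) {y : T' → Mat N} (hy : Continuous y) (hH : ∀ t, (y t).IsHermitian) :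
    BddHolo ρ (fun t σ => φ (a t) (σ + y t)) where
  holo := hφ.holo.translate ha hy fun t σ hσ => add_hermitian_mem_strip hσ (hH t)
  bdd ε hε := by
    obtain ⟨C, hC⟩ := hφ.bdd ε hε
    exact ⟨C, fun t σ hσ => hC _ _ (by rwa [stripDist_add_hermitian ρ σ (hH t)])⟩

theorem fderiv_apply (hφ : BddHolo ρ φ) (X : Mat N) :
    BddHolo ρ (fun t σ => fderiv ℂ (φ t) σ X) := hφ.lipHolo.fderiv_apply X

/-- Integration over an additional variable against a finite measure. -/
theorem integral [FirstCountableTopology T] {Y : Type*} [MeasurableSpace Y] {ν : Measure Y}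
    [IsFiniteMeasure ν] {φ : Y → T → Mat N → ℂ}
    (hm : ∀ t, ∀ σ ∈ strip ρ, AEStronglyMeasurable (fun y => φ y t σ) ν)
    (hφ : ∀ y, HoloFamily (strip ρ) (φ y))
    (hb : ∀ ε > 0, ∃ C, ∀ y t σ, ε ≤ stripDist ρ σ → ‖φ y t σ‖ ≤ C) :
    BddHolo ρ (fun t σ => ∫ y, φ y t σ ∂ν) ∧
      ∀ t, ∀ σ ∈ strip ρ, ∀ X : Mat N, Integrable (fun y => fderiv ℂ (φ y t) σ X) ν ∧
        fderiv ℂ (fun σ => ∫ y, φ y t σ ∂ν) σ X = ∫ y, fderiv ℂ (φ y t) σ X ∂ν := by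
  have h := HoloFamily.integral (ν := ν) (isOpen_strip ρ) hm hφ ?_
  · refine ⟨⟨h.1, fun ε hε => ?_⟩, h.2⟩
    obtain ⟨C, hC⟩ := hb ε hε
    refine ⟨C * ν.real Set.univ, fun t σ hσ => ?_⟩
    exact norm_integral_le_of_norm_le_const (.of_forall fun y => hC y t σ hσ)
  · intro t σ hσ
    have hpos : 0 < stripDist ρ σ := hσ
    obtain ⟨C, hC⟩ := hb (stripDist ρ σ / 2) (by positivity)
    refine ⟨fun _ => C, integrable_const _, ?_⟩
    have : ∀ᶠ p : T × Mat N in 𝓝 (t, σ), stripDist ρ σ / 2 < stripDist ρ p.2 :=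
      ((continuous_stripDist ρ).comp continuous_snd).continuousAt.eventually
        (lt_mem_nhds (by simp only [Function.comp]; linarith))
    filter_upwards [this] with p hp y using hC y _ _ hp.le

end BddHolo

end Strip

/-! ### Gaussian averages over Hermitian matrices -/

section Heat

variable {N : ℕ}

/-- The real coordinates of Hermitian matrices. -/
abbrev Coord (N : ℕ) : Type := EuclideanSpace ℝ (Fin N × Fin N)

/-- The Hermitian matrix with given real coordinates, as in `hermitianFields`. -/
def herm : Coord N →L[ℝ] Mat N :=
  LinearMap.toContinuousLinearMap
    { toFun := fun x => Matrix.of fun i j =>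
        ((1 + Complex.I) * (x (i, j) : ℂ) + (1 - Complex.I) * (x (j, i) : ℂ)) / 2
      map_add' := fun x y => by ext i j; simp; ring
      map_smul' := fun c x => by ext i j; simp; ring }

theorem herm_apply (x : Coord N) (i j : Fin N) :
    herm x i j = ((1 + Complex.I) * (x (i, j) : ℂ) + (1 - Complex.I) * (x (j, i) : ℂ)) / 2 := rfl

theorem herm_isHermitian (x : Coord N) : (herm x).IsHermitian := by
  ext i j
  simp only [Matrix.conjTranspose_apply, herm_apply, RCLike.star_def, map_div₀, map_add, map_mul,
    map_sub, map_one, Complex.conj_I, Complex.conj_ofReal, map_ofNat]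
  ring

/-- The heat semigroup: the average of `f` over a Gaussian Hermitian matrix of covariance `t`
(and `f` itself for `t ≤ 0`). -/
def heat (t : ℝ) (f : Mat N → ℂ) (σ : Mat N) : ℂ :=
  ∫ x, f (σ + herm (√t • x)) ∂(stdGaussian (Coord N))

theorem integrable_norm_herm : Integrable (fun x : Coord N => ‖herm x‖) (stdGaussian (Coord N)) := by
  have h : Integrable (fun x : Coord N => x) (stdGaussian (Coord N)) := IsGaussian.integrable_id
  exact ((herm (N := N)).integrable_comp h).norm

theorem norm_herm_sqrt_smul (t : ℝ) (x : Coord N) : ‖herm (√t • x)‖ = √t * ‖herm x‖ := by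
  rw [map_smul, norm_smul, Real.norm_of_nonneg (Real.sqrt_nonneg t)]

theorem heat_of_nonpos {t : ℝ} (ht : t ≤ 0) (f : Mat N → ℂ) (σ : Mat N) : heat t f σ = f σ := by
  simp [heat, Real.sqrt_eq_zero_of_nonpos ht]

variable {T : Type*} [TopologicalSpace T] {ρ : ℝ} {φ : T → Mat N → ℂ}

/-- A Lipschitz bound along Hermitian directions. -/
theorem norm_sub_le_of_hermitian {f : Mat N → ℂ} (hf : DifferentiableOn ℂ f (strip ρ)) {σ X : Mat N}
    (hσ : σ ∈ strip ρ) (hX : X.IsHermitian) {C : ℝ}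
    (hC : ∀ τ, stripDist ρ τ = stripDist ρ σ → ‖fderiv ℂ f τ‖ ≤ C) :
    ‖f (σ + X) - f σ‖ ≤ C * ‖X‖ := by
  let s : Set (Mat N) := {τ | (τ - σ).IsHermitian}
  have hs : Convex ℝ s := by
    intro a ha b hb p q hp hq hpq
    have : p • a + q • b - σ = p • (a - σ) + q • (b - σ) := by
      have hσ' : σ = p • σ + q • σ := by rw [← add_smul, hpq, one_smul]
      conv_lhs => rw [hσ']
      rw [smul_sub, smul_sub]; abel
    simp only [s, Set.mem_ofPred_eq, this]
    ext i j
    have h1 := congrFun (congrFun ha i) j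
    have h2 := congrFun (congrFun hb i) j
    simp only [Matrix.conjTranspose_apply, Matrix.sub_apply, RCLike.star_def, map_sub] at h1 h2
    simp only [Matrix.conjTranspose_apply, Matrix.add_apply, Matrix.smul_apply, Matrix.sub_apply,
      Complex.real_smul, RCLike.star_def, map_add, map_mul, map_sub, Complex.conj_ofReal, h1, h2]
  have hd : ∀ τ ∈ s, stripDist ρ τ = stripDist ρ σ := fun τ hτ => by
    rw [← stripDist_add_hermitian ρ σ hτ, add_sub_cancel]
  have := hs.norm_image_sub_le_of_norm_hasFDerivWithin_le (𝕜 := ℂ) (f := f)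
    (f' := fun τ => fderiv ℂ f τ) (x := σ) (y := σ + X) (C := C) ?_ (fun τ hτ => hC τ (hd τ hτ))
    (by simp [s]) (by simpa [s] using hX)
  · simpa using this
  · intro τ hτ
    have hτ' : τ ∈ strip ρ := by
      have h0 : 0 < stripDist ρ σ := hσ
      change 0 < stripDist ρ τ
      rwa [hd τ hτ]
    exact (hf.differentiableAt ((isOpen_strip ρ).mem_nhds hτ')).hasFDerivAt.hasFDerivWithinAt

theorem norm_heat_le {t C : ℝ} {f : Mat N → ℂ} {σ : Mat N} (h : ∀ x, ‖f (σ + herm x)‖ ≤ C) :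
    ‖heat t f σ‖ ≤ C := by
  have := norm_integral_le_of_norm_le_const (μ := stdGaussian (Coord N))
    (f := fun x => f (σ + herm (√t • x))) (.of_forall fun x => h _)
  simpa [heat] using this

theorem LipHolo.continuous_comp (hφ : LipHolo ρ φ) {σ : Mat N} (hσ : σ ∈ strip ρ) (t : T) (s : ℝ) :
    Continuous fun x : Coord N => φ t (σ + herm (√s • x)) :=
  (hφ.holo.holo t).continuousOn.comp_continuous (by fun_prop)
    fun x => add_hermitian_mem_strip hσ (herm_isHermitian _)

theorem BddHolo.integrable_comp (hφ : BddHolo ρ φ) {σ : Mat N} (hσ : σ ∈ strip ρ) (t : T) (s : ℝ) :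
    Integrable (fun x : Coord N => φ t (σ + herm (√s • x))) (stdGaussian (Coord N)) := by
  obtain ⟨C, hC⟩ := hφ.bdd (stripDist ρ σ) hσ
  refine Integrable.of_bound (hφ.lipHolo.continuous_comp hσ t s).aestronglyMeasurable C
    (.of_forall fun x => hC _ _ ?_)
  rw [stripDist_add_hermitian ρ σ (herm_isHermitian _)]

/-- The heat semigroup preserves holomorphic families with a bounded derivative, and commutes with
derivatives. -/
theorem LipHolo.heat [FirstCountableTopology T] (hφ : LipHolo ρ φ) {τ : T → ℝ}
    (hτ : Continuous τ) :
    LipHolo ρ (fun t σ => heat (τ t) (φ t) σ) ∧ ∀ t, ∀ σ ∈ strip ρ, ∀ X : Mat N,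
      fderiv ℂ (LoopVertex.heat (τ t) (φ t)) σ X
        = LoopVertex.heat (τ t) (fun σ => fderiv ℂ (φ t) σ X) σ := by
  have h := HoloFamily.integral (T := T) (ν := stdGaussian (Coord N)) (isOpen_strip (N := N) ρ)
    (φ := fun x t σ => φ t (σ + herm (√(τ t) • x))) ?_ ?_ ?_
  · have hform : ∀ t, ∀ σ ∈ strip ρ, ∀ X : Mat N,
        fderiv ℂ (LoopVertex.heat (τ t) (φ t)) σ X
          = LoopVertex.heat (τ t) (fun σ => fderiv ℂ (φ t) σ X) σ := by
      intro t σ hσ X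
      refine ((h.2 t σ hσ X).2).trans ?_
      simp only [LoopVertex.heat, fderiv_comp_add_right]
    refine ⟨⟨h.1, fun ε hε => ?_⟩, hform⟩
    obtain ⟨C, hC⟩ := hφ.bdd ε hε
    refine ⟨max C 0, fun t σ hσ => ContinuousLinearMap.opNorm_le_bound _ (le_max_right _ _)
      fun X => ?_⟩
    change ‖fderiv ℂ (LoopVertex.heat (τ t) (φ t)) σ X‖ ≤ _
    rw [hform t σ (lt_of_lt_of_le hε hσ) X]
    refine norm_heat_le fun x => (ContinuousLinearMap.le_opNorm _ _).trans ?_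
    gcongr
    refine (hC t _ ?_).trans (le_max_left _ _)
    rwa [stripDist_add_hermitian ρ σ (herm_isHermitian _)]
  · exact fun t σ hσ => (hφ.continuous_comp hσ t (τ t)).aestronglyMeasurable
  · exact fun x => hφ.holo.translate continuous_id
      (herm.continuous.comp ((Real.continuous_sqrt.comp hτ).smul continuous_const))
      fun t σ hσ => add_hermitian_mem_strip hσ (herm_isHermitian _)
  · intro t σ hσ
    have hpos : 0 < stripDist ρ σ := hσ
    obtain ⟨C, hC⟩ := hφ.bdd (stripDist ρ σ / 2) (by positivity)
    -- `φ` itself may be unbounded: along Hermitian directions it grows at most linearly, and the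
    -- norm of a Gaussian matrix is integrable.
    refine ⟨fun x => (‖φ t σ‖ + 1) + max C 0 * ((√(τ t) + 1) * ‖herm x‖), ?_, ?_⟩
    · exact (integrable_const _).add ((integrable_norm_herm.const_mul _).const_mul _)
    have h1 : ∀ᶠ p : T × Mat N in 𝓝 (t, σ), stripDist ρ σ / 2 < stripDist ρ p.2 :=
      ((continuous_stripDist ρ).comp continuous_snd).continuousAt.eventually
        (lt_mem_nhds (by simp only [Function.comp]; linarith))
    have h2 : ∀ᶠ p : T × Mat N in 𝓝 (t, σ), ‖φ p.1 p.2‖ < ‖φ t σ‖ + 1 :=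
      (hφ.holo.cont t σ hσ).norm.eventually (gt_mem_nhds (by simp))
    have h3 : ∀ᶠ p : T × Mat N in 𝓝 (t, σ), √(τ p.1) < √(τ t) + 1 :=
      ((Real.continuous_sqrt.comp hτ).comp continuous_fst).continuousAt.eventually
        (gt_mem_nhds (by simp))
    filter_upwards [h1, h2, h3] with p hp1 hp2 hp3 x
    have hpU : p.2 ∈ strip ρ := by
      change 0 < stripDist ρ p.2; linarith
    have hlip := norm_sub_le_of_hermitian (hφ.holo.holo p.1) hpU
      (herm_isHermitian (√(τ p.1) • x)) (C := max C 0) fun σ' hσ' =>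
        (hC _ _ (by rw [hσ']; exact hp1.le)).trans (le_max_left _ _)
    calc ‖φ p.1 (p.2 + herm (√(τ p.1) • x))‖
        ≤ ‖φ p.1 p.2‖ + ‖φ p.1 (p.2 + herm (√(τ p.1) • x)) - φ p.1 p.2‖ := by
          have := norm_add_le (φ p.1 p.2) (φ p.1 (p.2 + herm (√(τ p.1) • x)) - φ p.1 p.2)
          rwa [add_sub_cancel] at this
      _ ≤ _ := by
          refine add_le_add hp2.le (hlip.trans ?_)
          rw [norm_herm_sqrt_smul]
          gcongr

theorem BddHolo.heat [FirstCountableTopology T] (hφ : BddHolo ρ φ) {τ : T → ℝ}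
    (hτ : Continuous τ) : BddHolo ρ (fun t σ => LoopVertex.heat (τ t) (φ t) σ) where
  holo := (hφ.lipHolo.heat hτ).1.holo
  bdd ε hε := by
    obtain ⟨C, hC⟩ := hφ.bdd ε hε
    refine ⟨C, fun t σ hσ => norm_heat_le fun x => hC t _ ?_⟩
    rwa [stripDist_add_hermitian ρ σ (herm_isHermitian _)]

end Heat

/-! ### Gaussian integration by parts -/

/-- Resampling one coordinate preserves a product probability measure. -/
theorem measurePreserving_update {ι : Type*} [Fintype ι] [DecidableEq ι] {α : Type*}
    [MeasurableSpace α] (μ : Measure α) [IsProbabilityMeasure μ] (a : ι) :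
    MeasurePreserving (fun p : (ι → α) × α => Function.update p.1 a p.2)
      ((Measure.pi fun _ => μ).prod μ) (Measure.pi fun _ => μ) where
  measurable := by
    refine measurable_pi_iff.2 fun i => ?_
    rcases eq_or_ne i a with rfl | h
    · simpa using measurable_snd
    · simp only [Function.update_of_ne h]
      fun_prop
  map_eq := by
    symm
    refine Measure.pi_eq fun s hs => ?_
    have hmeas : Measurable (fun p : (ι → α) × α => Function.update p.1 a p.2) := by
      refine measurable_pi_iff.2 fun i => ?_
      rcases eq_or_ne i a with rfl | h
      · simpa using measurable_snd
      · simp only [Function.update_of_ne h]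
        fun_prop
    rw [Measure.map_apply hmeas (MeasurableSet.univ_pi hs)]
    have : (fun p : (ι → α) × α => Function.update p.1 a p.2) ⁻¹' Set.univ.pi s
        = (Set.univ.pi (Function.update s a Set.univ)) ×ˢ s a := by
      ext p
      simp only [Set.mem_preimage, Set.mem_pi, Set.mem_univ, true_implies, Set.mem_prod]
      constructor
      · intro h
        refine ⟨fun i => ?_, by simpa using h a⟩
        rcases eq_or_ne i a with rfl | hi
        · simp
        · simpa [Function.update_of_ne hi] using h i
      · rintro ⟨h1, h2⟩ i
        rcases eq_or_ne i a with rfl | hi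
        · simpa using h2
        · simpa [Function.update_of_ne hi] using h1 i
    rw [this, Measure.prod_prod, Measure.pi_pi, ← Finset.mul_prod_erase _ _ (Finset.mem_univ a),
      ← Finset.mul_prod_erase (a := a) _ (fun i => μ (s i)) (Finset.mem_univ a)]
    simp only [Function.update_self, measure_univ, one_mul]
    rw [mul_comm]
    congr 1
    exact Finset.prod_congr rfl fun i hi => by
      rw [Function.update_of_ne (Finset.ne_of_mem_erase hi)]

/-- Gaussian integration by parts on the line. -/
theorem integral_id_mul_gaussianReal {g g' : ℝ → ℂ} {C : ℝ} (hg : ∀ y, HasDerivAt g (g' y) y)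
    (hgC : ∀ y, ‖g y‖ ≤ C) (hgC' : ∀ y, ‖g' y‖ ≤ C) (hg' : Continuous g') :
    ∫ y, (y : ℂ) * g y ∂(gaussianReal 0 1) = ∫ y, g' y ∂(gaussianReal 0 1) := by
  have hgc : Continuous g := continuous_iff_continuousAt.2 fun y => (hg y).continuousAt
  rw [integral_gaussianReal_eq_integral_smul one_ne_zero,
    integral_gaussianReal_eq_integral_smul one_ne_zero]
  let p : ℝ → ℂ := fun y => (gaussianPDFReal 0 1 y : ℂ)
  -- The Gaussian density `p` satisfies `p' = -y p`.
  have hp : ∀ y : ℝ, HasDerivAt p (-(y : ℂ) * p y) y := by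
    intro y
    have h1 : HasDerivAt (fun y : ℝ => gaussianPDFReal 0 1 y) (-y * gaussianPDFReal 0 1 y) y := by
      unfold gaussianPDFReal
      have h2 : HasDerivAt (fun y : ℝ => -(y - 0) ^ 2 / (2 * ((1 : NNReal) : ℝ))) (-y) y := by
        have := (((hasDerivAt_id y).sub_const 0).pow 2).neg.div_const (2 * ((1 : NNReal) : ℝ))
        convert! this using 1
        simp; ring
      have := h2.exp.const_mul (√(2 * Real.pi * ((1 : NNReal) : ℝ)))⁻¹
      convert! this using 1
      ring
    have := h1.ofReal_comp
    convert! this using 1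
    simp [p]
  have hint : Integrable (fun y : ℝ => p y) := (integrable_gaussianPDFReal 0 1).ofReal
  have hpc : Continuous p := continuous_iff_continuousAt.2 fun y => (hp y).continuousAt
  have hint1 : Integrable (fun y : ℝ => (y : ℂ) * p y) := by
    have h1 : Integrable (fun y : ℝ => (y : ℝ)) (gaussianReal 0 1) := IsGaussian.integrable_id
    rw [gaussianReal_of_var_ne_zero _ one_ne_zero] at h1
    rw [gaussianPDF_def, integrable_withDensity_iff_integrable_smul₀' (by fun_prop) (by simp)] at h1
    have h2 := h1.ofReal (𝕜 := ℂ)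
    refine h2.congr (.of_forall fun y => ?_)
    simp only [smul_eq_mul, p, ENNReal.toReal_ofReal (gaussianPDFReal_nonneg 0 1 y)]
    push_cast; exact mul_comm _ _
  have key := integral_mul_deriv_eq_deriv_mul_of_integrable (u := p) (v := g)
    (u' := fun y => -(y : ℂ) * p y) (v' := g') (fun y _ => hp y) (fun y _ => hg y) ?_ ?_ ?_
  · simp only [Complex.real_smul]
    rw [show (fun y : ℝ => ((gaussianPDFReal 0 1 y : ℝ) : ℂ) * g' y) = fun y => p y * g' y from rfl,
      key, ← integral_neg]
    congr 1; ext y; simp only [p]; ring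
  · exact (hint.mul_bdd (c := C) hg'.aestronglyMeasurable (.of_forall hgC'))
  · have := (hint1.neg.mul_bdd (c := C) hgc.aestronglyMeasurable (.of_forall hgC))
    refine this.congr (.of_forall fun y => ?_)
    simp
  · exact (hint.mul_bdd (c := C) hgc.aestronglyMeasurable (.of_forall hgC))

/-- Gaussian integration by parts in one coordinate. -/
theorem integral_coord_mul_stdGaussian {ι : Type*} [Fintype ι] [DecidableEq ι] (a : ι)
    {G G' : EuclideanSpace ℝ ι → ℂ} {C : ℝ} (hG : Continuous G) (hG' : Continuous G')
    (hd : ∀ x, HasDerivAt (fun s : ℝ => G (x + s • EuclideanSpace.single a 1)) (G' x) 0)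
    (hC : ∀ x, ‖G x‖ ≤ C) (hC' : ∀ x, ‖G' x‖ ≤ C) :
    ∫ x, (x a : ℂ) * G x ∂(stdGaussian (EuclideanSpace ℝ ι))
      = ∫ x, G' x ∂(stdGaussian (EuclideanSpace ℝ ι)) := by
  have hup : ∀ (x : ι → ℝ) (y s : ℝ), WithLp.toLp 2 (Function.update x a (y + s))
      = WithLp.toLp 2 (Function.update x a y) + s • EuclideanSpace.single a (1 : ℝ) := by
    intro x y s
    ext i
    rcases eq_or_ne i a with rfl | h
    · simp
    · simp [h]
  have hmeas : Measurable (WithLp.toLp 2 : (ι → ℝ) → EuclideanSpace ℝ ι) := by fun_prop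
  have hI1 : Integrable (fun x : EuclideanSpace ℝ ι => (x a : ℂ) * G x)
      (stdGaussian (EuclideanSpace ℝ ι)) := by
    have h1 : Integrable (fun x : EuclideanSpace ℝ ι => x a) (stdGaussian (EuclideanSpace ℝ ι)) := by
      have h : Integrable (fun x : EuclideanSpace ℝ ι => x) (stdGaussian (EuclideanSpace ℝ ι)) :=
        IsGaussian.integrable_id
      exact (EuclideanSpace.proj (𝕜 := ℝ) a).integrable_comp h
    exact h1.ofReal.mul_bdd (c := C) hG.aestronglyMeasurable (.of_forall hC)
  have hI2 : Integrable G' (stdGaussian (EuclideanSpace ℝ ι)) :=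
    Integrable.of_bound hG'.aestronglyMeasurable C (.of_forall hC')
  rw [← map_pi_eq_stdGaussian] at hI1 hI2 ⊢
  rw [integral_map hmeas.aemeasurable hI1.1, integral_map hmeas.aemeasurable hI2.1]
  have hI1' := hI1.comp_measurable hmeas
  have hI2' := hI2.comp_measurable hmeas
  -- Resampling the coordinate `a` preserves the measure and isolates an integral over the line.
  have hmp := measurePreserving_update (ι := ι) (gaussianReal 0 1) a
  have h1 := integral_map (μ := (Measure.pi fun _ : ι => gaussianReal 0 1).prod (gaussianReal 0 1))
    hmp.measurable.aemeasurable (f := fun x : ι → ℝ => ((WithLp.toLp 2 x : EuclideanSpace ℝ ι) a : ℂ)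
      * G (WithLp.toLp 2 x)) (by rw [hmp.map_eq]; exact hI1'.1)
  have h2 := integral_map (μ := (Measure.pi fun _ : ι => gaussianReal 0 1).prod (gaussianReal 0 1))
    hmp.measurable.aemeasurable (f := fun x : ι → ℝ => G' (WithLp.toLp 2 x))
      (by rw [hmp.map_eq]; exact hI2'.1)
  rw [hmp.map_eq] at h1 h2
  rw [h1, h2]
  refine (integral_prod _ (hmp.integrable_comp_of_integrable hI1')).trans (Eq.trans ?_
    (integral_prod _ (hmp.integrable_comp_of_integrable hI2')).symm)
  congr 1
  ext x
  simp only [Function.comp_def, Function.update_self]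
  have hcu : Continuous fun y : ℝ => WithLp.toLp 2 (Function.update x a y) := by
    have : Continuous fun y : ℝ => Function.update x a y := continuous_const.update a continuous_id
    fun_prop
  refine integral_id_mul_gaussianReal (C := C) (fun y => ?_) (fun y => hC _) (fun y => hC' _)
    (hG'.comp hcu)
  have h1 := hd (WithLp.toLp 2 (Function.update x a y))
  simp only [← hup] at h1
  have h2 := HasDerivAt.comp_sub_const (f := fun s : ℝ => G (WithLp.toLp 2 (Function.update x a (y + s)))) y y (by simpa using h1)
  simpa using h2

/-! ### The heat equation -/

section HeatEquation

variable {N : ℕ} {ρ : ℝ}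

/-- The holomorphic partial derivative with respect to the matrix entry `a`. -/
def pderiv (a : Fin N × Fin N) (f : Mat N → ℂ) : Mat N → ℂ :=
  fun σ => fderiv ℂ f σ (Matrix.single a.1 a.2 1)

/-- The holomorphic extension of the Laplacian on Hermitian matrices. -/
def lap (f : Mat N → ℂ) : Mat N → ℂ := fun σ => ∑ a, pderiv a.swap (pderiv a f) σ

theorem herm_single (i j : Fin N) : herm (EuclideanSpace.single (i, j) (1 : ℝ))
    = ((1 + Complex.I) / 2) • Matrix.single i j (1 : ℂ)
      + ((1 - Complex.I) / 2) • Matrix.single j i (1 : ℂ) := by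
  ext k l
  have h1 : ((i, j) : Fin N × Fin N) = (k, l) ↔ i = k ∧ j = l := Prod.mk.injEq .. ▸ Iff.rfl
  have h2 : ((i, j) : Fin N × Fin N) = (l, k) ↔ j = k ∧ i = l := by
    rw [Prod.mk.injEq, and_comm]
  simp only [herm_apply, Matrix.add_apply, Matrix.smul_apply, Matrix.single_apply, smul_eq_mul,
    PiLp.single_apply, @eq_comm _ (_, _) (i, j), h1, h2]
  by_cases hA : i = k ∧ j = l
  · rw [if_pos hA, if_pos hA]
    by_cases hB : j = k ∧ i = l
    · rw [if_pos hB, if_pos hB]; push_cast; ring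
    · rw [if_neg hB, if_neg hB]; push_cast; ring
  · rw [if_neg hA, if_neg hA]
    by_cases hB : j = k ∧ i = l
    · rw [if_pos hB, if_pos hB]; push_cast; ring
    · rw [if_neg hB, if_neg hB]; push_cast; ring

theorem fderiv_fderiv_apply {f : Mat N → ℂ} (hf : DifferentiableOn ℂ f (strip ρ)) {σ : Mat N}
    (hσ : σ ∈ strip ρ) (X Y : Mat N) :
    fderiv ℂ (fun τ => fderiv ℂ f τ X) σ Y = fderiv ℂ (fun τ => fderiv ℂ f τ) σ Y X := by
  have hd := (differentiableOn_fderiv (isOpen_strip ρ) hf).differentiableAt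
    ((isOpen_strip ρ).mem_nhds hσ)
  have := hd.hasFDerivAt.clm_apply (hasFDerivAt_const X σ)
  rw [this.fderiv]
  simp

/-- Second derivatives of holomorphic functions commute. -/
theorem fderiv_fderiv_comm {f : Mat N → ℂ} (hf : DifferentiableOn ℂ f (strip ρ)) {σ : Mat N}
    (hσ : σ ∈ strip ρ) (X Y : Mat N) :
    fderiv ℂ (fun τ => fderiv ℂ f τ X) σ Y = fderiv ℂ (fun τ => fderiv ℂ f τ Y) σ X := by
  have hd := (differentiableOn_fderiv (isOpen_strip ρ) hf).differentiableAt
    ((isOpen_strip ρ).mem_nhds hσ)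
  rw [fderiv_fderiv_apply hf hσ, fderiv_fderiv_apply hf hσ]
  refine second_derivative_symmetric_of_eventually (𝕜 := ℂ) (f := f) (x := σ) ?_ hd.hasFDerivAt Y X
  filter_upwards [(isOpen_strip ρ).mem_nhds hσ] with τ hτ
  exact (hf.differentiableAt ((isOpen_strip ρ).mem_nhds hτ)).hasFDerivAt

/-- The second derivatives along an orthonormal basis of the Hermitian matrices add up to `lap f`:
the change of coordinates `herm` turns `∑ ∂_a²` into `∑ ∂_ij ∂_ji`. -/
theorem sum_fderiv_herm_single {f : Mat N → ℂ} (hf : DifferentiableOn ℂ f (strip ρ)) {σ : Mat N}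
    (hσ : σ ∈ strip ρ) :
    ∑ a : Fin N × Fin N, fderiv ℂ (fun τ => fderiv ℂ f τ (herm (EuclideanSpace.single a 1))) σ
      (herm (EuclideanSpace.single a 1)) = lap f σ := by
  unfold lap pderiv
  simp only [fderiv_fderiv_apply hf hσ]
  set L := fderiv ℂ (fun τ => fderiv ℂ f τ) σ
  simp only [Fintype.sum_prod_type, herm_single, map_add, map_smul, add_apply,
    smul_apply, Prod.swap, smul_eq_mul]
  set e := fun i j : Fin N => Matrix.single i j (1 : ℂ)
  have h1 : ∑ i, ∑ j, L (e j i) (e j i) = ∑ i, ∑ j, L (e i j) (e i j) := Finset.sum_comm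
  have h2 : ∑ i, ∑ j, L (e i j) (e j i) = ∑ i, ∑ j, L (e j i) (e i j) := Finset.sum_comm
  have hI : Complex.I ^ 2 = -1 := Complex.I_sq
  have : ∀ i j, (1 + Complex.I) / 2 * ((1 + Complex.I) / 2 * L (e i j) (e i j)
      + (1 - Complex.I) / 2 * L (e j i) (e i j))
      + (1 - Complex.I) / 2 * ((1 + Complex.I) / 2 * L (e i j) (e j i)
      + (1 - Complex.I) / 2 * L (e j i) (e j i))
      = Complex.I / 2 * L (e i j) (e i j) + 1 / 2 * L (e j i) (e i j)
        + 1 / 2 * L (e i j) (e j i) - Complex.I / 2 * L (e j i) (e j i) := by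
    intro i j
    linear_combination (L (e i j) (e i j) - L (e j i) (e i j) - L (e i j) (e j i)
      + L (e j i) (e j i)) / 4 * hI
  calc _ = ∑ i, ∑ j, (Complex.I / 2 * L (e i j) (e i j) + 1 / 2 * L (e j i) (e i j)
        + 1 / 2 * L (e i j) (e j i) - Complex.I / 2 * L (e j i) (e j i)) := by
        refine Finset.sum_congr rfl fun i _ => Finset.sum_congr rfl fun j _ => ?_
        rw [← this i j]
        try ring
    _ = _ := by
        simp only [Finset.sum_add_distrib, Finset.sum_sub_distrib, ← Finset.mul_sum]
        rw [h1, h2]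
        ring

/-- Gaussian integration by parts: the derivative in a Gaussian direction averages to the
Laplacian. -/
theorem integral_fderiv_herm {f : Mat N → ℂ} (hf : LipHolo ρ (fun _ : Unit => f)) {σ : Mat N}
    (hσ : σ ∈ strip ρ) (t : ℝ) :
    ∫ x, fderiv ℂ f (σ + herm (√t • x)) (herm x) ∂(stdGaussian (Coord N))
      = √t * heat t (lap f) σ := by
  let e : Fin N × Fin N → Coord N := fun a => EuclideanSpace.single a 1
  let G : Fin N × Fin N → Coord N → ℂ := fun a x => fderiv ℂ f (σ + herm (√t • x)) (herm (e a))
  have hG : ∀ a, BddHolo ρ (fun _ : Unit => fun τ => fderiv ℂ f τ (herm (e a))) := fun a =>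
    hf.fderiv_apply _
  have hG2 : ∀ a, BddHolo ρ (fun _ : Unit => fun τ =>
      fderiv ℂ (fun τ => fderiv ℂ f τ (herm (e a))) τ (herm (e a))) := fun a =>
    (hG a).fderiv_apply _
  have hint : ∀ a, Integrable (fun x : Coord N => (x a : ℂ) * G a x) (stdGaussian (Coord N)) := by
    intro a
    have h1 : Integrable (fun x : Coord N => x a) (stdGaussian (Coord N)) := by
      have h : Integrable (fun x : Coord N => x) (stdGaussian (Coord N)) :=
        IsGaussian.integrable_id
      exact (EuclideanSpace.proj (𝕜 := ℝ) a).integrable_comp h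
    obtain ⟨C, hC⟩ := (hG a).bdd (stripDist ρ σ) hσ
    refine h1.ofReal.mul_bdd (c := C)
      ((hG a).lipHolo.continuous_comp hσ () t).aestronglyMeasurable (.of_forall fun x => hC () _ ?_)
    rw [stripDist_add_hermitian ρ σ (herm_isHermitian _)]
  -- Expanding the direction `herm x` in coordinates produces the factors `x a` that integration by
  -- parts removes.
  have hexp : ∀ x : Coord N, fderiv ℂ f (σ + herm (√t • x)) (herm x)
      = ∑ a, (x a : ℂ) * G a x := by
    intro x
    have hx : herm x = ∑ a, (x a : ℂ) • herm (e a) := by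
      conv_lhs => rw [← (EuclideanSpace.basisFun (Fin N × Fin N) ℝ).sum_repr x]
      rw [map_sum]
      refine Finset.sum_congr rfl fun a _ => ?_
      rw [map_smul]
      ext k l
      simp [e]
    conv_lhs => rw [hx]
    simp [map_sum, G]
  simp only [hexp]
  rw [integral_finsetSum _ fun a _ => hint a]
  have hibp : ∀ a, ∫ x, (x a : ℂ) * G a x ∂(stdGaussian (Coord N))
      = ∫ x, (√t : ℂ) * fderiv ℂ (fun τ => fderiv ℂ f τ (herm (e a))) (σ + herm (√t • x))
          (herm (e a)) ∂(stdGaussian (Coord N)) := by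
    intro a
    obtain ⟨C, hC⟩ := (hG a).bdd (stripDist ρ σ) hσ
    obtain ⟨D, hD⟩ := (hG2 a).bdd (stripDist ρ σ) hσ
    have hs : ∀ x : Coord N, stripDist ρ σ ≤ stripDist ρ (σ + herm (√t • x)) := fun x => by
      rw [stripDist_add_hermitian ρ σ (herm_isHermitian _)]
    refine integral_coord_mul_stdGaussian a (C := max C (√t * D))
      ((hG a).lipHolo.continuous_comp hσ () t)
      (continuous_const.mul ((hG2 a).lipHolo.continuous_comp hσ () t)) (fun x => ?_)
      (fun x => (hC () _ (hs x)).trans (le_max_left _ _)) (fun x => ?_)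
    · have h0 : σ + herm (√t • x) ∈ strip ρ := add_hermitian_mem_strip hσ (herm_isHermitian _)
      have h1 : HasFDerivAt (fun τ => fderiv ℂ f τ (herm (e a)))
          ((fderiv ℂ (fun τ => fderiv ℂ f τ (herm (e a))) (σ + herm (√t • x))).restrictScalars ℝ)
          (σ + herm (√t • x)) :=
        ((hG a).holo.differentiableAt (isOpen_strip ρ) () h0).hasFDerivAt.restrictScalars ℝ
      have h2 : HasDerivAt (fun s : ℝ => σ + herm (√t • (x + s • e a))) (√t • herm (e a)) 0 := by
        have h3 : HasDerivAt (fun s : ℝ => √t • (x + s • e a)) (√t • e a) 0 := by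
          have := (((hasDerivAt_id (0 : ℝ)).smul_const (e a)).const_add x).const_smul √t
          rw [one_smul] at this
          exact this
        have := ((herm (N := N)).hasFDerivAt.comp_hasDerivAt (0 : ℝ) h3).const_add σ
        rw [map_smul] at this
        exact this
      have h4 : HasFDerivAt (fun τ => fderiv ℂ f τ (herm (e a)))
          ((fderiv ℂ (fun τ => fderiv ℂ f τ (herm (e a))) (σ + herm (√t • x))).restrictScalars ℝ)
          (σ + herm (√t • (x + (0 : ℝ) • e a))) := by simpa using h1
      have h5 := h4.comp_hasDerivAt (0 : ℝ) h2
      convert! h5 using 1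
      simp
    · rw [norm_mul, Complex.norm_real, Real.norm_of_nonneg (Real.sqrt_nonneg t)]
      refine le_trans ?_ (le_max_right _ _)
      gcongr
      exact hD () _ (hs x)
  simp only [hibp, integral_const_mul]
  rw [← Finset.mul_sum, ← integral_finsetSum _ fun a _ => (hG2 a).integrable_comp hσ () t]
  unfold heat
  congr 2
  ext x
  exact sum_fderiv_herm_single (hf.holo.holo ()) (add_hermitian_mem_strip hσ (herm_isHermitian _))

/-- The heat equation for a family of functions that also depends on the time directly. -/
theorem hasDerivAt_heat {G G' : ℝ → Mat N → ℂ} (hG : LipHolo ρ G) (hG' : BddHolo ρ G')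
    (hd : ∀ u ∈ Set.Ioo (0 : ℝ) 1, ∀ τ ∈ strip ρ, HasDerivAt (fun u => G u τ) (G' u τ) u)
    {σ : Mat N} (hσ : σ ∈ strip ρ) {u₀ : ℝ} (hu₀ : u₀ ∈ Set.Ioo (0 : ℝ) 1) :
    HasDerivAt (fun u => heat u (G u) σ)
      (heat u₀ (G' u₀) σ + 1 / 2 * heat u₀ (lap (G u₀)) σ) u₀ := by
  obtain ⟨C, hC⟩ := hG.bdd (stripDist ρ σ) hσ
  obtain ⟨D, hD⟩ := hG'.bdd (stripDist ρ σ) hσ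
  have hmem : ∀ x : Coord N, ∀ u : ℝ, σ + herm (√u • x) ∈ strip ρ := fun x u =>
    add_hermitian_mem_strip hσ (herm_isHermitian _)
  have hs : ∀ x : Coord N, ∀ u : ℝ, stripDist ρ σ ≤ stripDist ρ (σ + herm (√u • x)) := fun x u => by
    rw [stripDist_add_hermitian ρ σ (herm_isHermitian _)]
  -- The derivative in `u` of the integrand; its singular factor `1 / (2 √u)` meets the `√u` that
  -- integration by parts produces.
  let F' : ℝ → Coord N → ℂ := fun u x => G' u (σ + herm (√u • x))
    + ((1 / (2 * √u) : ℝ) : ℂ) * fderiv ℂ (G u) (σ + herm (√u • x)) (herm x)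
  have hdiff : ∀ x : Coord N, ∀ u ∈ Set.Ioo (0 : ℝ) 1,
      HasDerivAt (fun u => G u (σ + herm (√u • x))) (F' u x) u := by
    intro x u hu
    have hmem' := hmem x u
    have hev : ∀ᶠ v : ℝ × Mat N in 𝓝 (u, σ + herm (√u • x)),
        v.1 ∈ Set.Ioo (0 : ℝ) 1 ∧ v.2 ∈ strip ρ :=
      (isOpen_Ioo.prod (isOpen_strip ρ)).mem_nhds ⟨hu, hmem'⟩
    have hstrict := hasStrictFDerivAt_uncurry_coprod (𝕜 := ℝ) (u := (u, σ + herm (√u • x)))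
      (f := G)
      (f₁ := fun v τ => ContinuousLinearMap.toSpanSingleton ℝ (G' v τ))
      (f₂ := fun v τ => (fderiv ℂ (G v) τ).restrictScalars ℝ) ?_ ?_ ?_ ?_
    · have h3 : HasDerivAt (fun u : ℝ => √u • x) ((1 / (2 * √u)) • x) u :=
        (Real.hasDerivAt_sqrt hu.1.ne').smul_const x
      have h4 : HasDerivAt (fun u : ℝ => σ + herm (√u • x)) ((1 / (2 * √u)) • herm x) u := by
        have := ((herm (N := N)).hasFDerivAt.comp_hasDerivAt u h3).const_add σ
        rw [map_smul] at this
        exact this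
      have h5 : HasDerivAt (fun u : ℝ => (u, σ + herm (√u • x))) (1, (1 / (2 * √u)) • herm x) u :=
        (hasDerivAt_id u).prodMk h4
      have h6 := hstrict.hasFDerivAt.comp_hasDerivAt u h5
      convert! h6 using 1
      simp [F', Function.HasUncurry.uncurry]
    · filter_upwards [hev] with v hv
      exact (hd v.1 hv.1 v.2 hv.2).hasFDerivAt
    · filter_upwards [hev] with v hv
      exact (hG.holo.differentiableAt (isOpen_strip ρ) v.1 hv.2).hasFDerivAt.restrictScalars ℝ
    · have := hG'.holo.cont u _ hmem'
      exact (ContinuousLinearMap.toSpanSingletonCLE (𝕜 := ℝ) (E := ℂ)).continuous.continuousAt.comp this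
    · have := (hG.holo.fderiv (isOpen_strip ρ)).cont u _ hmem'
      exact (ContinuousLinearMap.restrictScalarsL ℂ (Mat N) ℂ ℝ ℝ).continuous.continuousAt.comp this
  have hF'c : ∀ u, Continuous (F' u) := by
    intro u
    have h1 : Continuous fun x : Coord N => fderiv ℂ (G u) (σ + herm (√u • x)) :=
      ((hG.holo.fderiv (isOpen_strip ρ)).holo u).continuousOn.comp_continuous (by fun_prop)
        fun x => hmem x u
    exact (hG'.lipHolo.continuous_comp hσ u u).add
      (continuous_const.mul (h1.clm_apply herm.continuous))
  have hkey := hasDerivAt_integral_of_dominated_loc_of_deriv_le (𝕜 := ℝ) (x₀ := u₀)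
    (F := fun u x => G u (σ + herm (√u • x))) (F' := F') (μ := stdGaussian (Coord N))
    (s := Set.Ioo (u₀ / 2) 1)
    (bound := fun x => D + 1 / (2 * √(u₀ / 2)) * (max C 0 * ‖herm x‖))
    (Ioo_mem_nhds (by linarith [hu₀.1]) hu₀.2) ?_ ?_ (hF'c u₀).aestronglyMeasurable ?_ ?_ ?_
  · have h1 := hkey.2
    convert! h1 using 1
    have hI1 := hG'.integrable_comp hσ u₀ u₀
    have hu0 := hu₀.1
    have hlip0 : LipHolo ρ (fun _ : Unit => G u₀) :=
      ⟨HoloFamily.of_differentiableOn (isOpen_strip ρ) (hG.holo.holo u₀), fun ε hε => by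
        obtain ⟨C, hC⟩ := hG.bdd ε hε
        exact ⟨C, fun _ τ hτ => hC u₀ τ hτ⟩⟩
    have hI2 : Integrable (fun x : Coord N => ((1 / (2 * √u₀) : ℝ) : ℂ) *
        fderiv ℂ (G u₀) (σ + herm (√u₀ • x)) (herm x)) (stdGaussian (Coord N)) := by
      have := hkey.1.sub hI1
      refine this.congr (.of_forall fun x => ?_)
      simp [F']
    simp only [F']
    rw [integral_add hI1 hI2, integral_const_mul, integral_fderiv_herm hlip0 hσ]
    congr 1
    have hsq : (√u₀ : ℂ) ≠ 0 := by
      exact_mod_cast (Real.sqrt_pos.2 hu0).ne'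
    push_cast
    field_simp
  · exact .of_forall fun u => (hG.continuous_comp hσ u u).aestronglyMeasurable
  · have hg : Integrable (fun x : Coord N => ‖G u₀ σ‖ + max C 0 * (√u₀ * ‖herm x‖))
        (stdGaussian (Coord N)) :=
      (integrable_const _).add ((integrable_norm_herm.const_mul _).const_mul _)
    refine hg.mono' (hG.continuous_comp hσ u₀ u₀).aestronglyMeasurable (.of_forall fun x => ?_)
    have hlip := norm_sub_le_of_hermitian (hG.holo.holo u₀) hσ
      (herm_isHermitian (√u₀ • x)) (C := max C 0) fun σ' hσ' =>
        (hC _ _ hσ'.ge).trans (le_max_left _ _)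
    rw [norm_herm_sqrt_smul] at hlip
    have := norm_add_le (G u₀ σ) (G u₀ (σ + herm (√u₀ • x)) - G u₀ σ)
    rw [add_sub_cancel] at this
    linarith
  · refine .of_forall fun x u hu => (norm_add_le _ _).trans (add_le_add (hD _ _ (hs x u)) ?_)
    rw [norm_mul, Complex.norm_real, Real.norm_of_nonneg (by positivity)]
    have h1 : √(u₀ / 2) ≤ √u := Real.sqrt_le_sqrt hu.1.le
    have h0 : 0 < √(u₀ / 2) := Real.sqrt_pos.2 (by linarith [hu₀.1])
    gcongr
    refine (ContinuousLinearMap.le_opNorm _ _).trans ?_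
    gcongr
    exact (hC _ _ (hs x u)).trans (le_max_left _ _)
  · exact (integrable_const _).add ((integrable_norm_herm.const_mul _).const_mul _)
  · exact .of_forall fun x u hu => hdiff x u ⟨by linarith [hu.1, hu₀.1], hu.2⟩

end HeatEquation

/-! ### The expansion of the effective potential -/

section Flow

variable {N : ℕ} {ρ : ℝ}

/-- The contraction `∑ ∂f/∂σ_ij ∂g/∂σ_ji` created by a propagator. -/
def pairing (f g : Mat N → ℂ) : Mat N → ℂ := fun σ => ∑ a, pderiv a f σ * pderiv a.swap g σ

/-- Times are truncated to the unit interval. -/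
def clamp (u : ℝ) : ℝ := max 0 (min u 1)

theorem clamp_nonneg (u : ℝ) : 0 ≤ clamp u := le_max_left _ _

theorem clamp_le_one (u : ℝ) : clamp u ≤ 1 := max_le zero_le_one (min_le_right _ _)

theorem clamp_of_mem {u : ℝ} (hu : u ∈ Set.Icc (0 : ℝ) 1) : clamp u = u := by
  simp [clamp, min_eq_left hu.2, max_eq_right hu.1]

theorem continuous_clamp : Continuous clamp := by unfold clamp; fun_prop

/-- Duhamel's integral `∫_u^1 P_{s-u} Q_s ds` for the backward heat equation with source `Q`. -/
def duhamel (Q : ℝ → Mat N → ℂ) (u : ℝ) (σ : Mat N) : ℂ :=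
  ∫ s in clamp u..1, heat (s - clamp u) (Q s) σ

/-- The expansion coefficients of the effective potential at scale `u`: the solution, order by
order in `V`, of the equation `∂_u φ = - Δφ / 2 - ⟨∇φ, ∇φ⟩ / 2` with `φ = V` at `u = 1`. The
coefficient with index `n` is homogeneous of degree `n + 1` in `V`. -/
def flow (V : Mat N → ℂ) : ℕ → ℝ → Mat N → ℂ
  | 0 => fun u => heat (1 - clamp u) V
  | n + 1 => duhamel fun s σ => 1 / 2 * ∑ i : Fin (n + 1), pairing (flow V i s) (flow V (n - i) s) σ

/-- The source term of the equation for `flow V (n + 1)`. -/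
def source (V : Mat N → ℂ) (n : ℕ) : ℝ → Mat N → ℂ := fun s σ =>
  1 / 2 * ∑ i : Fin (n + 1), pairing (flow V i s) (flow V (n - i) s) σ

theorem flow_zero (V : Mat N → ℂ) : flow V 0 = fun u => heat (1 - clamp u) V := by
  rw [flow]

theorem flow_succ (V : Mat N → ℂ) (n : ℕ) : flow V (n + 1) = duhamel (source V n) := by
  rw [flow]; rfl

theorem LipHolo.pairing {T : Type*} [TopologicalSpace T] {φ ψ : T → Mat N → ℂ}
    (hφ : LipHolo ρ φ) (hψ : LipHolo ρ ψ) :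
    BddHolo ρ (fun t => LoopVertex.pairing (φ t) (ψ t)) :=
  BddHolo.sum fun _ _ => (hφ.fderiv_apply _).mul (hψ.fderiv_apply _)

theorem LipHolo.lap {T : Type*} [TopologicalSpace T] {φ : T → Mat N → ℂ} (hφ : LipHolo ρ φ) :
    BddHolo ρ (fun t => LoopVertex.lap (φ t)) :=
  BddHolo.sum fun _ _ => (hφ.fderiv_apply _).fderiv_apply _

theorem fderiv_congr_strip {f g : Mat N → ℂ} (h : ∀ τ ∈ strip ρ, f τ = g τ) {σ : Mat N}
    (hσ : σ ∈ strip ρ) : fderiv ℂ f σ = fderiv ℂ g σ :=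
  Filter.EventuallyEq.fderiv_eq (by filter_upwards [(isOpen_strip ρ).mem_nhds hσ] with τ hτ using h τ hτ)

/-- The Laplacian commutes with the heat semigroup. -/
theorem LipHolo.lap_heat {f : Mat N → ℂ} (hf : LipHolo ρ (fun _ : Unit => f)) (t : ℝ) {σ : Mat N}
    (hσ : σ ∈ strip ρ) :
    LoopVertex.lap (LoopVertex.heat t f) σ = LoopVertex.heat t (LoopVertex.lap f) σ := by
  have h1 := (hf.heat (τ := fun _ => t) continuous_const).2 ()
  unfold LoopVertex.lap pderiv
  have h2 : ∀ a : Fin N × Fin N, fderiv ℂ (fun σ => fderiv ℂ (LoopVertex.heat t f) σ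
      (Matrix.single a.1 a.2 1)) σ (Matrix.single a.swap.1 a.swap.2 1)
      = LoopVertex.heat t (fun σ => fderiv ℂ (fun σ => fderiv ℂ f σ (Matrix.single a.1 a.2 1)) σ
        (Matrix.single a.swap.1 a.swap.2 1)) σ := by
    intro a
    rw [fderiv_congr_strip (fun τ hτ => h1 τ hτ (Matrix.single a.1 a.2 1)) hσ]
    exact ((hf.fderiv_apply (Matrix.single a.1 a.2 1)).lipHolo.heat (τ := fun _ => t)
      continuous_const).2 () σ hσ _
  simp only [h2]
  unfold LoopVertex.heat
  rw [integral_finsetSum]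
  exact fun a _ => ((hf.fderiv_apply (Matrix.single a.1 a.2 1)).fderiv_apply
    (Matrix.single a.swap.1 a.swap.2 1)).integrable_comp hσ () t

theorem LipHolo.const {T T' : Type*} [TopologicalSpace T] [TopologicalSpace T']
    {φ : T → Mat N → ℂ} (hφ : LipHolo ρ φ) (t : T) : LipHolo ρ (fun _ : T' => φ t) where
  holo := hφ.holo.comp_param continuous_const
  bdd ε hε := by
    obtain ⟨C, hC⟩ := hφ.bdd ε hε
    exact ⟨C, fun _ σ hσ => hC t σ hσ⟩

/-- Duhamel's integral as an integral over the unit interval. -/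
theorem duhamel_eq (Q : ℝ → Mat N → ℂ) (u : ℝ) (σ : Mat N) :
    duhamel Q u σ = ((1 - clamp u : ℝ) : ℂ) * ∫ y in Set.Ioc (0 : ℝ) 1,
      heat ((1 - clamp u) * y) (Q (clamp u + (1 - clamp u) * y)) σ := by
  have := intervalIntegral.smul_integral_comp_add_mul (a := 0) (b := 1)
    (fun s => heat (s - clamp u) (Q s) σ) (1 - clamp u) (clamp u)
  rw [← intervalIntegral.integral_of_le zero_le_one]
  simp only [add_sub_cancel_left, mul_zero, add_zero, mul_one, add_sub_cancel] at this
  rw [duhamel, ← this, Complex.real_smul]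

/-- Duhamel's integral maps bounded families to bounded families and commutes with derivatives. -/
theorem BddHolo.duhamel {Q : ℝ → Mat N → ℂ} (hQ : BddHolo ρ Q) :
    BddHolo ρ (LoopVertex.duhamel Q) ∧ ∀ u, ∀ σ ∈ strip ρ, ∀ X : Mat N,
      fderiv ℂ (LoopVertex.duhamel Q u) σ X
        = LoopVertex.duhamel (fun s τ => fderiv ℂ (Q s) τ X) u σ := by
  let ν : Measure ℝ := volume.restrict (Set.Ioc (0 : ℝ) 1)
  have hc := continuous_clamp
  have hjoint : BddHolo ρ (fun (p : ℝ × ℝ) σ => LoopVertex.heat ((1 - clamp p.1) * p.2)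
      (Q (clamp p.1 + (1 - clamp p.1) * p.2)) σ) :=
    (hQ.comp_param (a := fun p : ℝ × ℝ => clamp p.1 + (1 - clamp p.1) * p.2)
      (by fun_prop)).heat (by fun_prop)
  have h := BddHolo.integral (ρ := ρ) (ν := ν) (φ := fun (y : ℝ) (u : ℝ) (σ : Mat N) =>
    LoopVertex.heat ((1 - clamp u) * y) (Q (clamp u + (1 - clamp u) * y)) σ) ?_ ?_ ?_
  · have hlin : BddHolo ρ (fun (u : ℝ) (_ : Mat N) => ((1 - clamp u : ℝ) : ℂ)) := by
      refine ⟨⟨fun t σ _ => ?_, fun t => differentiableOn_const _⟩, fun _ _ => ⟨1, fun u _ _ => ?_⟩⟩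
      · have : Continuous fun p : ℝ × Mat N => ((1 - clamp p.1 : ℝ) : ℂ) := by fun_prop
        exact this.continuousAt
      · rw [Complex.norm_real, Real.norm_of_nonneg (by linarith [clamp_le_one u])]
        linarith [clamp_nonneg u]
    have heq : LoopVertex.duhamel Q = fun u σ => ((1 - clamp u : ℝ) : ℂ) * ∫ y in Set.Ioc (0 : ℝ) 1,
        LoopVertex.heat ((1 - clamp u) * y) (Q (clamp u + (1 - clamp u) * y)) σ := by
      funext u σ; exact duhamel_eq Q u σ
    refine ⟨heq ▸ hlin.mul h.1, fun u σ hσ X => ?_⟩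
    rw [heq, duhamel_eq]
    have hd := h.1.holo.differentiableAt (isOpen_strip ρ) u hσ
    rw [fderiv_const_mul hd]
    rw [smul_apply, smul_eq_mul, (h.2 u σ hσ X).2]
    congr 2
    ext y
    exact ((hQ.lipHolo.const (T' := Unit) _).heat (τ := fun _ => (1 - clamp u) * y)
      continuous_const).2 () σ hσ X
  · intro u σ hσ
    have : Continuous fun y : ℝ => LoopVertex.heat ((1 - clamp u) * y)
        (Q (clamp u + (1 - clamp u) * y)) σ := by
      refine continuous_iff_continuousAt.2 fun y => ?_
      have h1 := hjoint.holo.cont (u, y) σ hσ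
      exact ContinuousAt.comp (f := fun y : ℝ => (((u, y) : ℝ × ℝ), σ)) (x := y) h1
        (Continuous.continuousAt (by fun_prop))
    exact this.aestronglyMeasurable
  · exact fun y => hjoint.holo.comp_param (a := fun u : ℝ => (u, y)) (by fun_prop)
  · intro ε hε
    obtain ⟨C, hC⟩ := hjoint.bdd ε hε
    exact ⟨C, fun y u σ hσ => hC (u, y) σ hσ⟩

variable {V : Mat N → ℂ}

theorem lipHolo_flow (hV : LipHolo ρ (fun _ : Unit => V)) (n : ℕ) : LipHolo ρ (flow V n) := by
  induction n using Nat.strong_induction_on with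
  | _ n ih =>
    rcases n with _ | n
    · rw [flow_zero]
      have hc := continuous_clamp
      exact ((hV.const (T' := ℝ) ()).heat (τ := fun u => 1 - clamp u) (by fun_prop)).1
    · rw [flow_succ]
      refine (BddHolo.duhamel ?_).1.lipHolo
      refine (BddHolo.const (T := ℝ) (1 / 2)).mul (BddHolo.sum fun i _ => ?_)
      exact (ih i (by omega)).pairing (ih (n - i) (by omega))

theorem bddHolo_source (hV : LipHolo ρ (fun _ : Unit => V)) (n : ℕ) : BddHolo ρ (source V n) :=
  (BddHolo.const (T := ℝ) (1 / 2)).mul (BddHolo.sum fun _ _ =>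
    (lipHolo_flow hV _).pairing (lipHolo_flow hV _))

theorem bddHolo_flow_succ (hV : LipHolo ρ (fun _ : Unit => V)) (n : ℕ) :
    BddHolo ρ (flow V (n + 1)) := by
  rw [flow_succ]
  exact (bddHolo_source hV n).duhamel.1

/-! ### The flow equation -/

theorem LipHolo.continuous_heat {f : Mat N → ℂ} (hf : LipHolo ρ (fun _ : Unit => f)) {σ : Mat N}
    (hσ : σ ∈ strip ρ) : Continuous fun t => LoopVertex.heat t f σ := by
  have h := ((hf.const (T' := ℝ) ()).heat (τ := id) continuous_id).1.holo
  refine continuous_iff_continuousAt.2 fun t => ?_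
  exact ContinuousAt.comp (f := fun t : ℝ => (t, σ)) (x := t) (h.cont t σ hσ)
    (Continuous.continuousAt (by fun_prop))

theorem LipHolo.hasDerivAt_heat_const {f : Mat N → ℂ} (hf : LipHolo ρ (fun _ : Unit => f))
    {σ : Mat N} (hσ : σ ∈ strip ρ) {t : ℝ} (ht : t ∈ Set.Ioo (0 : ℝ) 1) :
    HasDerivAt (fun t => LoopVertex.heat t f σ) (1 / 2 * LoopVertex.heat t (LoopVertex.lap f) σ) t := by
  have := hasDerivAt_heat (G := fun _ => f) (G' := fun _ _ => 0) (hf.const ())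
    (BddHolo.const 0) (fun u _ τ _ => hasDerivAt_const u _) hσ ht
  simpa [LoopVertex.heat] using this

theorem LipHolo.heat_eq_add_integral {f : Mat N → ℂ} (hf : LipHolo ρ (fun _ : Unit => f))
    {σ : Mat N} (hσ : σ ∈ strip ρ) {t : ℝ} (ht : t ∈ Set.Icc (0 : ℝ) 1) :
    LoopVertex.heat t f σ
      = f σ + ∫ r in (0 : ℝ)..t, 1 / 2 * LoopVertex.heat r (LoopVertex.lap f) σ := by
  have hlap : Continuous fun r => 1 / 2 * LoopVertex.heat r (LoopVertex.lap f) σ :=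
    continuous_const.mul (hf.lap.lipHolo.continuous_heat hσ)
  rw [intervalIntegral.integral_eq_sub_of_hasDerivAt_of_le ht.1
    (hf.continuous_heat hσ).continuousOn
    (fun r hr => hf.hasDerivAt_heat_const hσ ⟨hr.1, hr.2.trans_le ht.2⟩)
    (hlap.intervalIntegrable _ _), heat_of_nonpos le_rfl]
  ring

/-- Fubini's theorem on a triangle. -/
theorem integral_triangle {f : ℝ → ℝ → ℂ} (hf : Continuous fun p : ℝ × ℝ => f p.1 p.2) {u b : ℝ}
    (hub : u ≤ b) :
    ∫ s in u..b, ∫ r in u..s, f r s = ∫ r in u..b, ∫ s in r..b, f r s := by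
  let S : Set (ℝ × ℝ) := {p | p.1 < p.2}
  have hS : MeasurableSet S := measurableSet_lt measurable_fst measurable_snd
  let g : ℝ → ℝ → ℂ := fun r s => S.indicator (fun p => f p.1 p.2) (r, s)
  have hg : Integrable (Function.uncurry g)
      ((volume.restrict (Set.Ioc u b)).prod (volume.restrict (Set.Ioc u b))) := by
    have h1 : Integrable (fun p : ℝ × ℝ => f p.1 p.2)
        ((volume.restrict (Set.Ioc u b)).prod (volume.restrict (Set.Ioc u b))) := by
      rw [Measure.prod_restrict, ← IntegrableOn]
      exact (hf.continuousOn.integrableOn_compact (isCompact_Icc.prod isCompact_Icc)).mono_set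
        (Set.prod_mono Set.Ioc_subset_Icc_self Set.Ioc_subset_Icc_self)
    exact h1.indicator hS
  have hswap := integral_integral_swap hg
  rw [intervalIntegral.integral_of_le hub, intervalIntegral.integral_of_le hub]
  refine Eq.trans ?_ (hswap.symm.trans ?_)
  · refine setIntegral_congr_fun measurableSet_Ioc fun s hs => ?_
    rw [intervalIntegral.integral_of_le hs.1.le, integral_Ioc_eq_integral_Ioo]
    have : (fun r => g r s) = (Set.Iio s).indicator fun r => f r s := by
      funext r
      by_cases h : r < s <;> simp [g, S, Set.indicator, h]
    rw [this, setIntegral_indicator measurableSet_Iio]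
    congr 2
    ext r
    simp only [Set.mem_Ioo, Set.mem_inter_iff, Set.mem_Ioc, Set.mem_Iio]
    exact ⟨fun h => ⟨⟨h.1, h.2.le.trans hs.2⟩, h.2⟩, fun h => ⟨h.1.1, h.2⟩⟩
  · refine setIntegral_congr_fun measurableSet_Ioc fun r hr => ?_
    rw [intervalIntegral.integral_of_le hr.2]
    have : (fun s => g r s) = (Set.Ioi r).indicator fun s => f r s := by
      funext s
      by_cases h : r < s <;> simp [g, S, Set.indicator, h]
    rw [this, setIntegral_indicator measurableSet_Ioi]
    congr 2
    ext s
    simp only [Set.mem_inter_iff, Set.mem_Ioc, Set.mem_Ioi]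
    exact ⟨fun h => ⟨h.2, h.1.2⟩, fun h => ⟨⟨hr.1.trans h.1, h.2⟩, h.1⟩⟩

theorem continuous_integral_upper {f : ℝ → ℝ → ℂ} (hf : Continuous fun p : ℝ × ℝ => f p.1 p.2)
    (v : ℝ) : Continuous fun s => ∫ r in v..s, f r s := by
  have hf' : Continuous (Function.uncurry fun s r => f r s) := hf.comp continuous_swap
  exact intervalIntegral.continuous_parametric_intervalIntegral_of_continuous hf' continuous_id

theorem LipHolo.continuous_param {φ : ℝ → Mat N → ℂ} (hφ : LipHolo ρ φ) {σ : Mat N}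
    (hσ : σ ∈ strip ρ) : Continuous fun t => φ t σ := by
  refine continuous_iff_continuousAt.2 fun t => ?_
  exact ContinuousAt.comp (f := fun t : ℝ => (t, σ)) (x := t) (hφ.holo.cont t σ hσ)
    (Continuous.continuousAt (by fun_prop))

/-- The Laplacian can be taken under Duhamel's integral. -/
theorem BddHolo.lap_duhamel {Q : ℝ → Mat N → ℂ} (hQ : BddHolo ρ Q) (u : ℝ) {σ : Mat N}
    (hσ : σ ∈ strip ρ) :
    LoopVertex.lap (LoopVertex.duhamel Q u) σ
      = LoopVertex.duhamel (fun s => LoopVertex.lap (Q s)) u σ := by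
  have hc := continuous_clamp
  unfold LoopVertex.lap pderiv
  have h2 : ∀ a : Fin N × Fin N, fderiv ℂ (fun σ => fderiv ℂ (LoopVertex.duhamel Q u) σ
      (Matrix.single a.1 a.2 1)) σ (Matrix.single a.swap.1 a.swap.2 1)
      = LoopVertex.duhamel (fun s σ => fderiv ℂ (fun σ => fderiv ℂ (Q s) σ
        (Matrix.single a.1 a.2 1)) σ (Matrix.single a.swap.1 a.swap.2 1)) u σ := by
    intro a
    rw [fderiv_congr_strip (fun τ hτ => hQ.duhamel.2 u τ hτ (Matrix.single a.1 a.2 1)) hσ]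
    exact (hQ.fderiv_apply (Matrix.single a.1 a.2 1)).duhamel.2 u σ hσ _
  simp only [h2]
  have hB : ∀ a : Fin N × Fin N, BddHolo ρ fun (s : ℝ) σ => fderiv ℂ (fun σ => fderiv ℂ (Q s) σ
        (Matrix.single a.1 a.2 1)) σ (Matrix.single a.swap.1 a.swap.2 1) := fun a =>
    (hQ.fderiv_apply _).fderiv_apply _
  unfold LoopVertex.duhamel
  rw [← intervalIntegral.integral_finsetSum]
  · congr 1
    ext s
    unfold LoopVertex.heat
    rw [integral_finsetSum]
    exact fun a _ => (hB a).integrable_comp hσ s _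
  · intro a _
    exact (((hB a).heat (τ := fun s => s - clamp u) (by fun_prop)).lipHolo.continuous_param
      hσ).intervalIntegrable _ _

/-- Duhamel's integral solves the backward heat equation with source `Q`. -/
theorem BddHolo.hasDerivAt_duhamel {Q : ℝ → Mat N → ℂ} (hQ : BddHolo ρ Q) {σ : Mat N}
    (hσ : σ ∈ strip ρ) {u : ℝ} (hu : u ∈ Set.Ioo (0 : ℝ) 1) :
    HasDerivAt (fun u => LoopVertex.duhamel Q u σ)
      (-(1 / 2 * LoopVertex.lap (LoopVertex.duhamel Q u) σ + Q u σ)) u := by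
  have hc := continuous_clamp
  have hlapQ : BddHolo ρ (fun s => LoopVertex.lap (Q s)) := hQ.lipHolo.lap
  have hR : Continuous fun r => Q r σ + 1 / 2 * LoopVertex.duhamel (fun s => LoopVertex.lap (Q s)) r σ :=
    (hQ.lipHolo.continuous_param hσ).add
      (continuous_const.mul (hlapQ.duhamel.1.lipHolo.continuous_param hσ))
  have hint : ∀ v ∈ Set.Icc (0 : ℝ) 1, LoopVertex.duhamel Q v σ = ∫ r in v..1,
      (Q r σ + 1 / 2 * LoopVertex.duhamel (fun s => LoopVertex.lap (Q s)) r σ) := by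
    intro v hv
    let f : ℝ → ℝ → ℂ := fun r s => 1 / 2 * LoopVertex.heat (s - r) (LoopVertex.lap (Q s)) σ
    have hf : Continuous fun p : ℝ × ℝ => f p.1 p.2 := by
      have h := (hlapQ.comp_param (a := fun p : ℝ × ℝ => p.2) continuous_snd).heat
        (τ := fun p => p.2 - p.1) (by fun_prop)
      refine continuous_const.mul (continuous_iff_continuousAt.2 fun p => ?_)
      exact ContinuousAt.comp (f := fun p : ℝ × ℝ => (p, σ)) (x := p) (h.holo.cont p σ hσ)
        (Continuous.continuousAt (by fun_prop))
    -- Writing `P_{s-v} Q_s` as `Q_s` plus the integral of its derivative and exchanging the two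
    -- integrals shows that Duhamel's integral is an integral from `v` to `1` of a continuous
    -- function.
    have h1 : LoopVertex.duhamel Q v σ = ∫ s in v..1, (Q s σ + ∫ r in v..s, f r s) := by
      rw [LoopVertex.duhamel, clamp_of_mem hv]
      refine intervalIntegral.integral_congr fun s hs => ?_
      rw [Set.uIcc_of_le hv.2] at hs
      rw [(hQ.lipHolo.const (T' := Unit) s).heat_eq_add_integral hσ
        ⟨by linarith [hs.1], by linarith [hs.2, hv.1]⟩]
      congr 1
      have := intervalIntegral.integral_comp_sub_left (a := v) (b := s)
        (fun r => 1 / 2 * LoopVertex.heat r (LoopVertex.lap (Q s)) σ) s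
      rw [sub_self] at this
      exact this.symm
    have hfi := continuous_integral_upper hf v
    have hQi := (hQ.lipHolo.continuous_param hσ).intervalIntegrable (μ := volume) v 1
    have hdi : IntervalIntegrable
        (fun r => 1 / 2 * LoopVertex.duhamel (fun s => LoopVertex.lap (Q s)) r σ) volume v 1 :=
      (continuous_const.mul (hlapQ.duhamel.1.lipHolo.continuous_param hσ)).intervalIntegrable _ _
    rw [h1, intervalIntegral.integral_add hQi (hfi.intervalIntegrable _ _),
      integral_triangle hf hv.2, intervalIntegral.integral_add hQi hdi]
    congr 1
    refine intervalIntegral.integral_congr fun r hr => ?_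
    rw [Set.uIcc_of_le hv.2] at hr
    simp only [f, LoopVertex.duhamel, clamp_of_mem ⟨hv.1.trans hr.1, hr.2⟩]
    rw [intervalIntegral.integral_const_mul]
  have hd := intervalIntegral.integral_hasDerivAt_left (a := u) (b := 1)
    (hR.intervalIntegrable _ _) hR.stronglyMeasurable.stronglyMeasurableAtFilter hR.continuousAt
  rw [hQ.lap_duhamel u hσ, add_comm]
  refine hd.congr_of_eventuallyEq ?_
  filter_upwards [Icc_mem_nhds hu.1 hu.2] with v hv using hint v hv

/-- The flow equation. -/
theorem hasDerivAt_flow (hV : LipHolo ρ (fun _ : Unit => V)) (n : ℕ) {σ : Mat N}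
    (hσ : σ ∈ strip ρ) {u : ℝ} (hu : u ∈ Set.Ioo (0 : ℝ) 1) :
    HasDerivAt (fun u => flow V n u σ)
      (-(1 / 2 * lap (flow V n u) σ + if n = 0 then 0 else source V (n - 1) u σ)) u := by
  rcases n with _ | n
  · rw [flow_zero]
    have hu' : clamp u = u := clamp_of_mem ⟨hu.1.le, hu.2.le⟩
    have h1 := hV.hasDerivAt_heat_const hσ (t := 1 - u) ⟨by linarith [hu.2], by linarith [hu.1]⟩
    have h2 : HasDerivAt (fun v : ℝ => 1 - v) (-1) u := by
      simpa using (hasDerivAt_id u).const_sub 1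
    have h3 := h1.scomp u h2
    beta_reduce
    rw [hu', hV.lap_heat _ hσ]
    have h4 : HasDerivAt ((fun t => heat t V σ) ∘ fun v : ℝ => 1 - v)
        (-(1 / 2 * heat (1 - u) (lap V) σ + if 0 = 0 then 0 else source V (0 - 1) u σ)) u := by
      simpa using h3
    refine h4.congr_of_eventuallyEq ?_
    filter_upwards [Icc_mem_nhds hu.1 hu.2] with v hv
    simp [clamp_of_mem hv]
  · rw [flow_succ]
    simpa using (bddHolo_source hV n).hasDerivAt_duhamel hσ hu

end Flow

/-! ### Bounds on the expansion coefficients -/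

section Bounds

variable {N : ℕ} {ρ : ℝ} {f g : Mat N → ℂ} {σ : Mat N}

/-- The gradient of `f`, normalized by `fderiv f σ X = Tr (grad f σ * X)`. -/
def grad (f : Mat N → ℂ) (σ : Mat N) : Mat N := Matrix.of fun i j => pderiv (j, i) f σ

theorem fderiv_eq_sum (f : Mat N → ℂ) (σ X : Mat N) :
    fderiv ℂ f σ X = ∑ a : Fin N × Fin N, X a.1 a.2 * pderiv a f σ := by
  conv_lhs => rw [Matrix.matrix_eq_sum_single X]
  rw [Fintype.sum_prod_type, map_sum]
  refine Finset.sum_congr rfl fun i _ => ?_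
  rw [map_sum]
  refine Finset.sum_congr rfl fun j _ => ?_
  have : Matrix.single i j (X i j) = X i j • Matrix.single i j (1 : ℂ) := by simp
  rw [this, map_smul, smul_eq_mul]
  rfl

theorem pairing_eq_fderiv (f g : Mat N → ℂ) (σ : Mat N) :
    pairing f g σ = fderiv ℂ f σ (grad g σ) := by
  rw [fderiv_eq_sum]
  exact Finset.sum_congr rfl fun a _ => mul_comm _ _

/-- A matrix of rank one. -/
def rankOne (x y : EuclideanSpace ℂ (Fin N)) : Mat N := Matrix.vecMulVec y (star x.ofLp)

theorem fderiv_rankOne (f : Mat N → ℂ) (σ : Mat N) (x y : EuclideanSpace ℂ (Fin N)) :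
    fderiv ℂ f σ (rankOne x y) = inner ℂ x (Matrix.toEuclideanCLM (𝕜 := ℂ) (grad f σ) y) := by
  rw [fderiv_eq_sum, EuclideanSpace.inner_eq_star_dotProduct, Matrix.ofLp_toEuclideanCLM,
    Fintype.sum_prod_type, Finset.sum_comm]
  simp only [dotProduct, Matrix.mulVec, rankOne, Matrix.vecMulVec_apply, grad, Matrix.of_apply,
    Finset.sum_mul]
  refine Finset.sum_congr rfl fun i _ => Finset.sum_congr rfl fun j _ => by ring

theorem norm_fderiv_rankOne_le (f : Mat N → ℂ) (σ : Mat N) (x y : EuclideanSpace ℂ (Fin N)) :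
    ‖fderiv ℂ f σ (rankOne x y)‖ ≤ ‖grad f σ‖ * (‖x‖ * ‖y‖) := by
  rw [fderiv_rankOne]
  refine (norm_inner_le_norm _ _).trans ?_
  have := (Matrix.toEuclideanCLM (𝕜 := ℂ) (grad f σ)).le_opNorm y
  rw [Matrix.l2_opNorm_toEuclideanCLM] at this
  nlinarith [norm_nonneg x]

/-- The operator norm of the gradient is seen on matrices of rank one. -/
theorem norm_grad_le {C : ℝ} (hC : 0 ≤ C)
    (h : ∀ x y : EuclideanSpace ℂ (Fin N), ‖fderiv ℂ f σ (rankOne x y)‖ ≤ C * (‖x‖ * ‖y‖)) :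
    ‖grad f σ‖ ≤ C := by
  rw [← Matrix.l2_opNorm_toEuclideanCLM]
  refine ContinuousLinearMap.opNorm_le_bound _ hC fun y => ?_
  set z := Matrix.toEuclideanCLM (𝕜 := ℂ) (grad f σ) y with hz
  have h1 := h z y
  rw [fderiv_rankOne, ← hz, inner_self_eq_norm_sq_to_K, norm_pow, RCLike.norm_ofReal,
    abs_norm] at h1
  rcases (norm_nonneg z).eq_or_lt with h0 | h0
  · rw [← h0]; positivity
  · have : ‖z‖ * ‖z‖ ≤ ‖z‖ * (C * ‖y‖) := by nlinarith
    exact le_of_mul_le_mul_left this h0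

theorem rankOne_single (a : Fin N × Fin N) :
    rankOne (EuclideanSpace.single a.2 1) (EuclideanSpace.single a.1 1)
      = Matrix.single a.1 a.2 (1 : ℂ) := by
  ext i j
  simp only [rankOne, Matrix.vecMulVec_apply, Pi.star_apply, PiLp.single_apply, Matrix.single_apply]
  by_cases h1 : i = a.1 <;> by_cases h2 : j = a.2 <;> simp [h1, h2, eq_comm]

theorem norm_pderiv_le (f : Mat N → ℂ) (σ : Mat N) (a : Fin N × Fin N) :
    ‖pderiv a f σ‖ ≤ ‖grad f σ‖ := by
  have := norm_fderiv_rankOne_le f σ (EuclideanSpace.single a.2 1) (EuclideanSpace.single a.1 1)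
  rw [rankOne_single] at this
  simpa [pderiv] using this

theorem norm_pairing_le (f g : Mat N → ℂ) (σ : Mat N) :
    ‖pairing f g σ‖ ≤ (N : ℝ) ^ 2 * (‖grad f σ‖ * ‖grad g σ‖) := by
  refine (norm_sum_le _ _).trans ?_
  refine (Finset.sum_le_sum (g := fun _ => ‖grad f σ‖ * ‖grad g σ‖) fun a _ => ?_).trans ?_
  · rw [norm_mul]
    exact mul_le_mul (norm_pderiv_le _ _ _) (norm_pderiv_le _ _ _) (norm_nonneg _) (norm_nonneg _)
  · simp [sq]

/-- The derivative of a pairing, by the symmetry of second derivatives. -/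
theorem fderiv_pairing (hf : DifferentiableOn ℂ f (strip ρ)) (hg : DifferentiableOn ℂ g (strip ρ))
    (hσ : σ ∈ strip ρ) (Y : Mat N) :
    fderiv ℂ (pairing f g) σ Y
      = fderiv ℂ (fun τ => fderiv ℂ f τ Y) σ (grad g σ)
        + fderiv ℂ (fun τ => fderiv ℂ g τ Y) σ (grad f σ) := by
  have hd : ∀ {f : Mat N → ℂ}, DifferentiableOn ℂ f (strip ρ) → ∀ X : Mat N,
      DifferentiableAt ℂ (fun τ => fderiv ℂ f τ X) σ := fun hf X =>
    ((differentiableOn_fderiv (isOpen_strip ρ) hf).differentiableAt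
      ((isOpen_strip ρ).mem_nhds hσ)).clm_apply (differentiableAt_const X)
  have h1 : HasFDerivAt (pairing f g) (∑ a : Fin N × Fin N,
      (pderiv a f σ • fderiv ℂ (pderiv a.swap g) σ + pderiv a.swap g σ • fderiv ℂ (pderiv a f) σ))
      σ := by
    unfold pairing
    exact HasFDerivAt.fun_sum fun a _ => (hd hf _).hasFDerivAt.mul (hd hg _).hasFDerivAt
  rw [h1.fderiv, fderiv_eq_sum, fderiv_eq_sum]
  simp only [_root_.sum_apply, add_apply, smul_apply, smul_eq_mul]
  rw [Finset.sum_add_distrib, add_comm]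
  congr 1
  · refine Finset.sum_congr rfl fun a _ => ?_
    congr 1
    exact fderiv_fderiv_comm hf hσ _ _
  · rw [← (Equiv.prodComm (Fin N) (Fin N)).sum_comp]
    refine Finset.sum_congr rfl fun a _ => ?_
    congr 1
    exact fderiv_fderiv_comm hg hσ _ _

theorem one_add_inv_pow_le (i : ℕ) : (((i : ℝ) + 1) / i) ^ i ≤ 3 := by
  rcases i.eq_zero_or_pos with rfl | hi
  · norm_num
  have hi' : (0 : ℝ) < i := by exact_mod_cast hi
  have h1 : ((i : ℝ) + 1) / i ≤ Real.exp (1 / i) := by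
    have := Real.add_one_le_exp (1 / (i : ℝ))
    rw [add_div, div_self hi'.ne']
    linarith
  calc (((i : ℝ) + 1) / i) ^ i ≤ Real.exp (1 / i) ^ i := by gcongr
    _ = Real.exp 1 := by rw [← Real.exp_nat_mul]; congr 1; field_simp
    _ ≤ 3 := by linarith [Real.exp_one_lt_d9]

/-- Cauchy's estimate, with the radius optimized, for a function that blows up like the power
`-i` of the distance to the boundary of the strip. -/
theorem norm_fderiv_le_of_pow {h : Mat N → ℂ} (hh : DifferentiableOn ℂ h (strip ρ)) {B : ℝ}
    (hB : 0 ≤ B) (i : ℕ) (hb : ∀ τ ∈ strip ρ, ‖h τ‖ ≤ B / stripDist ρ τ ^ i) (hσ : σ ∈ strip ρ) :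
    ‖fderiv ℂ h σ‖ ≤ (i + 1) * 3 * B / stripDist ρ σ ^ (i + 1) := by
  have hδ : 0 < stripDist ρ σ := hσ
  set δ := stripDist ρ σ
  have hr : δ - δ / (i + 1) = δ * (i / (i + 1)) := by field_simp; ring
  -- On the ball of radius `δ / (i + 1)` the distance to the boundary is at least `δ i / (i + 1)`,
  -- and `((i + 1) / i) ^ i ≤ 3`.
  have h1 := norm_fderiv_le_of_strip (r := δ / (i + 1)) (C := B / (δ * (i / (i + 1))) ^ i) hh
    (by positivity) (div_le_self hδ.le (by simp)) ?_
  · refine h1.trans ?_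
    have h2 : B / (δ * (i / (i + 1))) ^ i / (δ / (i + 1))
        = (i + 1) * (((i : ℝ) + 1) / i) ^ i * B / δ ^ (i + 1) := by
      rcases i.eq_zero_or_pos with rfl | hi
      · simp
      · have hi' : (0 : ℝ) < i := by exact_mod_cast hi
        have h3 : (δ * (i / (i + 1))) ^ i * (((i : ℝ) + 1) / i) ^ i = δ ^ i := by
          rw [← mul_pow]; congr 1; field_simp
        have hA : 0 < (δ * ((i : ℝ) / (i + 1))) ^ i := by positivity
        have hB' : 0 < (((i : ℝ) + 1) / i) ^ i := by positivity
        rw [pow_succ δ, ← h3]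
        generalize (δ * ((i : ℝ) / (i + 1))) ^ i = A at hA ⊢
        generalize (((i : ℝ) + 1) / i) ^ i = A' at hB' ⊢
        field_simp
    rw [h2]
    gcongr
    exact one_add_inv_pow_le i
  · intro τ hτ
    rw [hr] at hτ
    have h0 : 0 ≤ δ * ((i : ℝ) / (i + 1)) := by positivity
    refine (hb τ (h0.trans_lt hτ)).trans ?_
    rcases i.eq_zero_or_pos with rfl | hi
    · simp
    · have hi' : (0 : ℝ) < i := by exact_mod_cast hi
      gcongr

variable {V : Mat N → ℂ} {K : ℝ}

/-- The Catalan recursion turns the quadratic source term into a bound of order `n + 1`; the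
factor `n + 2` produced by Cauchy's estimate is cancelled by the integral over the scale. -/
theorem norm_grad_flow_le (hV : LipHolo ρ (fun _ : Unit => V)) (hK : 0 ≤ K)
    (hgrad : ∀ σ ∈ strip ρ, ‖grad V σ‖ ≤ K) (n : ℕ) :
    ∀ u, ∀ σ ∈ strip ρ, ‖grad (flow V n u) σ‖
      ≤ 3 ^ n * catalan n * K ^ (n + 1) * (1 - clamp u) ^ n / stripDist ρ σ ^ n := by
  induction n using Nat.strong_induction_on with
  | _ n ih =>
  intro u σ hσ
  have hc1 := clamp_le_one u
  have hc0 := clamp_nonneg u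
  have hu0 : 0 ≤ 1 - clamp u := by linarith
  have hδ : 0 < stripDist ρ σ := hσ
  rcases n with _ | n
  · simp only [pow_zero, catalan_zero, Nat.cast_one, mul_one, one_mul, zero_add, pow_one, div_one]
    refine norm_grad_le hK fun x y => ?_
    rw [flow_zero, (hV.heat (τ := fun _ => 1 - clamp u) continuous_const).2 () σ hσ]
    refine norm_heat_le fun z => (norm_fderiv_rankOne_le _ _ _ _).trans ?_
    gcongr
    exact hgrad _ (add_hermitian_mem_strip hσ (herm_isHermitian z))
  · refine norm_grad_le (by positivity) fun x y => ?_
    have hpos : ∀ τ ∈ strip (N := N) ρ, 0 < stripDist ρ τ := fun _ h => h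
    -- one term of the derivative of the source
    have hT : ∀ i j : ℕ, i + j = n → ∀ s ∈ Set.Icc (0 : ℝ) 1, ∀ τ ∈ strip ρ,
        ‖fderiv ℂ (fun τ' => fderiv ℂ (flow V i s) τ' (rankOne x y)) τ (grad (flow V j s) τ)‖
          ≤ (i + 1) * (3 ^ (n + 1) * (catalan i * catalan j) * K ^ (n + 2) * (1 - s) ^ n
            / stripDist ρ τ ^ (n + 1) * (‖x‖ * ‖y‖)) := by
      intro i j hij s hs τ hτ
      have hs1 : 0 ≤ 1 - s := by linarith [hs.2]
      have hτ0 := hpos τ hτ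
      have h1 := norm_fderiv_le_of_pow (ρ := ρ) (i := i)
        (B := 3 ^ i * catalan i * K ^ (i + 1) * (1 - s) ^ i * (‖x‖ * ‖y‖))
        (((lipHolo_flow hV i).fderiv_apply (rankOne x y)).holo.holo s) (by positivity)
        (fun τ hτ => by
          have h := ih i (by omega) s τ hτ
          rw [clamp_of_mem hs] at h
          refine (norm_fderiv_rankOne_le _ _ _ _).trans ?_
          rw [mul_div_right_comm]
          gcongr) hτ
      have h2 := ih j (by omega) s τ hτ
      rw [clamp_of_mem hs] at h2
      refine (ContinuousLinearMap.le_opNorm _ _).trans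
        ((mul_le_mul h1 h2 (norm_nonneg _) (by positivity)).trans (le_of_eq ?_))
      subst hij
      field_simp
      ring
    have hsrc : ∀ s ∈ Set.Icc (0 : ℝ) 1, ∀ τ ∈ strip ρ,
        ‖fderiv ℂ (source V n s) τ (rankOne x y)‖
          ≤ ((n : ℝ) + 2) / 2 * (3 ^ (n + 1) * catalan (n + 1) * K ^ (n + 2) * (1 - s) ^ n
            / stripDist ρ τ ^ (n + 1) * (‖x‖ * ‖y‖)) := by
      intro s hs τ hτ
      have hdf : ∀ i, DifferentiableOn ℂ (flow V i s) (strip ρ) := fun i =>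
        (lipHolo_flow hV i).holo.holo s
      have hdp : ∀ i : Fin (n + 1), DifferentiableAt ℂ (pairing (flow V i s) (flow V (n - i) s)) τ :=
        fun i => ((lipHolo_flow hV _).pairing (lipHolo_flow hV _)).holo.differentiableAt
          (isOpen_strip ρ) s hτ
      have hd : HasFDerivAt (source V n s) ((1 / 2 : ℂ) • ∑ i : Fin (n + 1),
          fderiv ℂ (pairing (flow V i s) (flow V (n - i) s)) τ) τ := by
        unfold source
        exact (HasFDerivAt.fun_sum fun i _ => (hdp i).hasFDerivAt).const_mul _
      rw [hd.fderiv]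
      simp only [_root_.sum_apply, smul_apply, smul_eq_mul]
      rw [norm_mul]
      have hsum : ‖∑ i : Fin (n + 1), fderiv ℂ (pairing (flow V i s) (flow V (n - i) s)) τ
          (rankOne x y)‖ ≤ ∑ i : Fin (n + 1), ((n : ℝ) + 2) * (catalan i * catalan (n - i)) *
            (3 ^ (n + 1) * K ^ (n + 2) * (1 - s) ^ n / stripDist ρ τ ^ (n + 1) * (‖x‖ * ‖y‖)) := by
        refine norm_sum_le_of_le _ fun i _ => ?_
        have hi : (i : ℕ) + (n - i) = n := by omega
        rw [fderiv_pairing (hdf _) (hdf _) hτ]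
        refine (norm_add_le_of_le (hT i (n - i) hi s hs τ hτ)
          (hT (n - i) i (by omega) s hs τ hτ)).trans (le_of_eq ?_)
        have hcast : ((n - i : ℕ) : ℝ) = n - i := by rw [Nat.cast_sub (by omega)]
        rw [hcast]
        ring
      rw [← Finset.sum_mul, ← Finset.mul_sum] at hsum
      -- The Catalan recursion. The two halves of the derivative of a pairing have carried the
      -- factors `i + 1` and `n - i + 1`, whose sum `n + 2` does not depend on `i`.
      have hcat : ((catalan (n + 1) : ℕ) : ℝ)
          = ∑ i : Fin (n + 1), (catalan i : ℝ) * (catalan (n - i) : ℝ) := by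
        rw [catalan_succ]; push_cast; rfl
      rw [← hcat] at hsum
      have hhalf : ‖(1 / 2 : ℂ)‖ = 1 / 2 := by norm_num
      rw [hhalf]
      refine (mul_le_mul_of_nonneg_left hsum (by norm_num)).trans (le_of_eq ?_)
      ring
    rw [flow_succ, (bddHolo_source hV n).duhamel.2 u σ hσ, duhamel]
    -- The integral over the scale yields `1 / (n + 1)`, so that the factor left over is `(n + 2) /
    -- (2 (n + 1)) ≤ 1`.
    have hint : ∫ s in clamp u..1, ((n : ℝ) + 2) / 2 * (3 ^ (n + 1) * catalan (n + 1) * K ^ (n + 2) *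
        (1 - s) ^ n / stripDist ρ σ ^ (n + 1) * (‖x‖ * ‖y‖))
        = ((n : ℝ) + 2) / (2 * (n + 1)) * (3 ^ (n + 1) * catalan (n + 1) * K ^ (n + 2) *
          (1 - clamp u) ^ (n + 1) / stripDist ρ σ ^ (n + 1) * (‖x‖ * ‖y‖)) := by
      have hp : ∫ s in clamp u..1, (1 - s) ^ n = (1 - clamp u) ^ (n + 1) / (n + 1) := by
        rw [intervalIntegral.integral_comp_sub_left (fun s => s ^ n) 1, integral_pow]
        simp
      have : ∀ s : ℝ, ((n : ℝ) + 2) / 2 * (3 ^ (n + 1) * catalan (n + 1) * K ^ (n + 2) *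
        (1 - s) ^ n / stripDist ρ σ ^ (n + 1) * (‖x‖ * ‖y‖))
        = (((n : ℝ) + 2) / 2 * (3 ^ (n + 1) * catalan (n + 1) * K ^ (n + 2)
          / stripDist ρ σ ^ (n + 1) * (‖x‖ * ‖y‖))) * (1 - s) ^ n := fun s => by ring
      simp only [this]
      rw [intervalIntegral.integral_const_mul, hp]
      field_simp
    refine (intervalIntegral.norm_integral_le_of_norm_le hc1 (.of_forall fun s hs => ?_)
      (Continuous.intervalIntegrable (by fun_prop) _ _)).trans (hint.le.trans ?_)
    · refine norm_heat_le fun z => ?_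
      have := hsrc s ⟨hc0.trans hs.1.le, hs.2⟩ _ (add_hermitian_mem_strip hσ (herm_isHermitian z))
      rwa [stripDist_add_hermitian ρ σ (herm_isHermitian z)] at this
    · have hle : ((n : ℝ) + 2) / (2 * (n + 1)) ≤ 1 := by
        rw [div_le_one (by positivity)]; linarith [Nat.cast_nonneg (α := ℝ) n]
      exact mul_le_of_le_one_left (by positivity) hle

theorem catalan_le_four_pow (n : ℕ) : catalan n ≤ 4 ^ n := by
  rw [catalan_eq_centralBinom_div]
  exact (Nat.div_le_self _ _).trans (Nat.centralBinom_le_four_pow n)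

/-- The gradients of the expansion coefficients are bounded by a geometric series. -/
theorem norm_grad_flow_le_geometric (hV : LipHolo ρ (fun _ : Unit => V)) (hK : 0 ≤ K)
    (hgrad : ∀ σ ∈ strip ρ, ‖grad V σ‖ ≤ K) (n : ℕ) (u : ℝ) (hσ : σ ∈ strip ρ) :
    ‖grad (flow V n u) σ‖ ≤ K * (12 * K / stripDist ρ σ) ^ n := by
  refine (norm_grad_flow_le hV hK hgrad n u σ hσ).trans ?_
  have hδ : 0 < stripDist ρ σ := hσ
  have h1 : (1 - clamp u) ^ n ≤ 1 :=
    pow_le_one₀ (by linarith [clamp_le_one u]) (by linarith [clamp_nonneg u])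
  have h2 : (catalan n : ℝ) ≤ 4 ^ n := by exact_mod_cast catalan_le_four_pow n
  have h0 : 0 ≤ (1 - clamp u) ^ n := pow_nonneg (by linarith [clamp_le_one u]) n
  calc _ ≤ 3 ^ n * 4 ^ n * K ^ (n + 1) * 1 / stripDist ρ σ ^ n := by gcongr
    _ = _ := by
      rw [div_pow, mul_pow, show (12 : ℝ) = 3 * 4 by norm_num, mul_pow, pow_succ]
      ring

/-- From order `2` in `V` on, the expansion coefficients themselves are bounded, being integrals of
pairings of gradients. The coefficient of order `1` is not. -/
theorem norm_flow_succ_le (hV : LipHolo ρ (fun _ : Unit => V)) (hK : 0 ≤ K)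
    (hgrad : ∀ σ ∈ strip ρ, ‖grad V σ‖ ≤ K) (n : ℕ) (u : ℝ) (hσ : σ ∈ strip ρ) :
    ‖flow V (n + 1) u σ‖ ≤ (N : ℝ) ^ 2 * K ^ 2 * ((n + 1) * (12 * K / stripDist ρ σ) ^ n) := by
  have hδ : 0 < stripDist ρ σ := hσ
  have hsrc : ∀ s, ∀ τ ∈ strip ρ, ‖source V n s τ‖
      ≤ (N : ℝ) ^ 2 * K ^ 2 * ((n + 1) * (12 * K / stripDist ρ τ) ^ n) := by
    intro s τ hτ
    have hδ' : 0 < stripDist ρ τ := hτ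
    rw [source, norm_mul]
    have h1 : ‖∑ i : Fin (n + 1), pairing (flow V i s) (flow V (n - i) s) τ‖
        ≤ ∑ _i : Fin (n + 1), (N : ℝ) ^ 2 * K ^ 2 * (12 * K / stripDist ρ τ) ^ n := by
      refine norm_sum_le_of_le _ fun i _ => (norm_pairing_le _ _ _).trans ?_
      have hi : n = i + (n - i) := by omega
      calc _ ≤ (N : ℝ) ^ 2 * ((K * (12 * K / stripDist ρ τ) ^ (i : ℕ)) *
            (K * (12 * K / stripDist ρ τ) ^ (n - i))) := by
            gcongr <;> exact norm_grad_flow_le_geometric hV hK hgrad _ _ hτ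
        _ = (N : ℝ) ^ 2 * K ^ 2 * (12 * K / stripDist ρ τ) ^ ((i : ℕ) + (n - i)) := by
            rw [pow_add]; ring
        _ = _ := by rw [← hi]
    simp only [Finset.sum_const, Finset.card_univ, Fintype.card_fin, nsmul_eq_mul] at h1
    have hhalf : ‖(1 / 2 : ℂ)‖ = 1 / 2 := by norm_num
    rw [hhalf]
    have h2 := norm_nonneg (∑ i : Fin (n + 1), pairing (flow V i s) (flow V (n - i) s) τ)
    push_cast at h1
    nlinarith
  rw [flow_succ, duhamel]
  refine (intervalIntegral.norm_integral_le_of_norm_le_const (C := (N : ℝ) ^ 2 * K ^ 2 *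
    ((n + 1) * (12 * K / stripDist ρ σ) ^ n)) fun s _ => norm_heat_le fun z => ?_).trans ?_
  · have := hsrc s _ (add_hermitian_mem_strip hσ (herm_isHermitian z))
    rwa [stripDist_add_hermitian ρ σ (herm_isHermitian z)] at this
  · refine mul_le_of_le_one_right (by positivity) ?_
    rw [abs_of_nonneg (by linarith [clamp_le_one u])]
    linarith [clamp_nonneg u]

end Bounds

/-! ### Exponentiation of the expansion -/

section Exponential

variable {N : ℕ} {ρ : ℝ} {V : Mat N → ℂ} {σ : Mat N}

theorem pderiv_sum {ι : Type*} {s : Finset ι} {f : ι → Mat N → ℂ}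
    (hf : ∀ i ∈ s, DifferentiableOn ℂ (f i) (strip ρ)) (hσ : σ ∈ strip ρ) (a : Fin N × Fin N) :
    pderiv a (fun τ => ∑ i ∈ s, f i τ) σ = ∑ i ∈ s, pderiv a (f i) σ := by
  unfold pderiv
  rw [fderiv_fun_sum fun i hi => (hf i hi).differentiableAt ((isOpen_strip ρ).mem_nhds hσ)]
  simp

theorem differentiableOn_pderiv {f : Mat N → ℂ} (hf : DifferentiableOn ℂ f (strip ρ))
    (a : Fin N × Fin N) : DifferentiableOn ℂ (pderiv a f) (strip ρ) := fun _ hσ =>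
  (((differentiableOn_fderiv (isOpen_strip ρ) hf).differentiableAt
    ((isOpen_strip ρ).mem_nhds hσ)).clm_apply (differentiableAt_const _)).differentiableWithinAt

theorem pderiv_congr {f g : Mat N → ℂ} (h : ∀ τ ∈ strip ρ, f τ = g τ) (hσ : σ ∈ strip ρ)
    (a : Fin N × Fin N) : pderiv a f σ = pderiv a g σ := by
  unfold pderiv
  rw [fderiv_congr_strip h hσ]

theorem lap_sum {ι : Type*} {s : Finset ι} {f : ι → Mat N → ℂ}
    (hf : ∀ i ∈ s, DifferentiableOn ℂ (f i) (strip ρ)) (hσ : σ ∈ strip ρ) :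
    lap (fun τ => ∑ i ∈ s, f i τ) σ = ∑ i ∈ s, lap (f i) σ := by
  unfold lap
  rw [Finset.sum_comm]
  refine Finset.sum_congr rfl fun a _ => ?_
  rw [pderiv_congr (fun τ hτ => pderiv_sum hf hτ a) hσ,
    pderiv_sum (fun i hi => differentiableOn_pderiv (hf i hi) a) hσ]

theorem pairing_sum {ι : Type*} {s : Finset ι} {f : ι → Mat N → ℂ}
    (hf : ∀ i ∈ s, DifferentiableOn ℂ (f i) (strip ρ)) (hσ : σ ∈ strip ρ) :
    pairing (fun τ => ∑ i ∈ s, f i τ) (fun τ => ∑ i ∈ s, f i τ) σ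
      = ∑ p ∈ s ×ˢ s, pairing (f p.1) (f p.2) σ := by
  unfold pairing
  rw [Finset.sum_comm]
  refine Finset.sum_congr rfl fun a _ => ?_
  rw [pderiv_sum hf hσ, pderiv_sum hf hσ, Finset.sum_mul_sum, Finset.sum_product]

/-- Exponentiation linearizes the flow equation. -/
theorem lap_exp {f : Mat N → ℂ} (hf : DifferentiableOn ℂ f (strip ρ)) (hσ : σ ∈ strip ρ) :
    lap (fun τ => Complex.exp (f τ)) σ = Complex.exp (f σ) * (lap f σ + pairing f f σ) := by
  have hd : ∀ τ ∈ strip ρ, DifferentiableAt ℂ f τ := fun τ hτ =>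
    hf.differentiableAt ((isOpen_strip ρ).mem_nhds hτ)
  have h1 : ∀ a : Fin N × Fin N, ∀ τ ∈ strip ρ,
      pderiv a (fun τ => Complex.exp (f τ)) τ = Complex.exp (f τ) * pderiv a f τ := by
    intro a τ hτ
    simp [pderiv, (hd τ hτ).hasFDerivAt.cexp.fderiv]
  unfold lap pairing
  rw [← Finset.sum_add_distrib, Finset.mul_sum]
  refine Finset.sum_congr rfl fun a _ => ?_
  rw [pderiv_congr (h1 a) hσ]
  have h2 := (hd σ hσ).hasFDerivAt.cexp.mul ((differentiableOn_pderiv hf a).differentiableAt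
    ((isOpen_strip ρ).mem_nhds hσ)).hasFDerivAt
  have h3 : pderiv a.swap (fun τ => Complex.exp (f τ) * pderiv a f τ) σ
      = (Complex.exp (f σ) • fderiv ℂ (pderiv a f) σ + pderiv a f σ •
        (Complex.exp (f σ) • fderiv ℂ f σ)) (Matrix.single a.swap.1 a.swap.2 1) := by
    rw [← h2.fderiv]; rfl
  rw [h3]
  simp only [add_apply, smul_apply, smul_eq_mul]
  unfold pderiv
  ring

/-- The expansion of the effective potential up to order `m`. -/
def partialFlow (V : Mat N → ℂ) (m : ℕ) (u : ℝ) (σ : Mat N) : ℂ :=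
  ∑ n ∈ Finset.range (m + 1), flow V n u σ

/-- The error committed by truncating the flow equation at order `m`. -/
def truncation (V : Mat N → ℂ) (m : ℕ) (u : ℝ) (σ : Mat N) : ℂ :=
  ∑ p ∈ (Finset.range (m + 1) ×ˢ Finset.range (m + 1)).filter (fun p => ¬ p.1 + p.2 < m),
    pairing (flow V p.1 u) (flow V p.2 u) σ

/-- The sources up to order `m - 1` exhaust the square of the gradient of the partial sum, except
for the pairs of total order at least `m`. -/
theorem two_mul_sum_source (V : Mat N → ℂ) (m : ℕ) (u : ℝ) (σ : Mat N) :
    2 * ∑ n ∈ Finset.range m, source V n u σ + truncation V m u σ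
      = ∑ p ∈ Finset.range (m + 1) ×ˢ Finset.range (m + 1),
        pairing (flow V p.1 u) (flow V p.2 u) σ := by
  rw [← Finset.sum_filter_add_sum_filter_not _ (fun p : ℕ × ℕ => p.1 + p.2 < m)]
  congr 1
  rw [← Finset.sum_fiberwise_of_maps_to (t := Finset.range m) (g := fun p : ℕ × ℕ => p.1 + p.2)
    (by simp), Finset.mul_sum]
  refine Finset.sum_congr rfl fun n hn => ?_
  have hS : ((Finset.range (m + 1) ×ˢ Finset.range (m + 1)).filter
      (fun p : ℕ × ℕ => p.1 + p.2 < m)).filter (fun p => p.1 + p.2 = n)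
      = Finset.HasAntidiagonal.antidiagonal n := by
    ext p
    simp only [Finset.mem_range] at hn
    simp only [Finset.mem_filter, Finset.mem_product, Finset.mem_range, Finset.HasAntidiagonal.mem_antidiagonal]
    omega
  rw [hS, Finset.Nat.sum_antidiagonal_eq_sum_range_succ
    (fun i j => pairing (flow V i u) (flow V j u) σ), source, Finset.sum_range]
  ring

theorem lipHolo_partialFlow (hV : LipHolo ρ (fun _ : Unit => V)) (m : ℕ) :
    LipHolo ρ (partialFlow V m) where
  holo := HoloFamily.sum fun n _ => (lipHolo_flow hV n).holo
  bdd ε hε := by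
    choose C hC using fun n => (lipHolo_flow hV n).bdd ε hε
    refine ⟨∑ n ∈ Finset.range (m + 1), C n, fun u σ hσ => ?_⟩
    have hmem : σ ∈ strip ρ := lt_of_lt_of_le hε hσ
    unfold partialFlow
    beta_reduce
    rw [fderiv_fun_sum fun n _ => (lipHolo_flow hV n).holo.differentiableAt (isOpen_strip ρ) u hmem]
    exact norm_sum_le_of_le _ fun n _ => hC n u σ hσ

theorem re_heat_le {t C : ℝ} (hC : 0 ≤ C) {f : Mat N → ℂ} (h : ∀ x, (f (σ + herm x)).re ≤ C) :
    (heat t f σ).re ≤ C := by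
  unfold heat
  by_cases hi : Integrable (fun x => f (σ + herm (√t • x))) (stdGaussian (Coord N))
  · have h1 := integral_re hi
    simp only [RCLike.re_to_complex] at h1
    rw [← h1]
    refine (integral_mono hi.re (integrable_const C) fun x => h _).trans ?_
    simp
  -- Without integrability the integral is `0`, which `0 ≤ C` covers.
  · rw [integral_undef hi]
    simpa

variable {C₀ K : ℝ}

/-- Uniformly in the order of truncation, the effective potential is bounded above. -/
theorem re_partialFlow_le (hC₀ : 0 ≤ C₀)
    (hre : ∀ σ ∈ strip ρ, (V σ).re ≤ C₀) (m : ℕ) (u : ℝ) {B : ℕ → ℝ} (hσ : σ ∈ strip ρ)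
    (hB : ∀ n, ‖flow V (n + 1) u σ‖ ≤ B n) :
    (partialFlow V m u σ).re ≤ C₀ + ∑ n ∈ Finset.range m, B n := by
  rw [partialFlow, Finset.sum_range_succ', Complex.add_re, Complex.re_sum, add_comm]
  refine add_le_add ?_ (Finset.sum_le_sum fun n _ => (Complex.re_le_norm _).trans (hB n))
  rw [flow_zero]
  exact re_heat_le hC₀ fun x => hre _ (add_hermitian_mem_strip hσ (herm_isHermitian x))

theorem bddHolo_exp_partialFlow (hV : LipHolo ρ (fun _ : Unit => V)) (hC₀ : 0 ≤ C₀)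
    (hre : ∀ σ ∈ strip ρ, (V σ).re ≤ C₀) (m : ℕ) :
    BddHolo ρ (fun u σ => Complex.exp (partialFlow V m u σ)) where
  holo := (lipHolo_partialFlow hV m).holo.exp
  bdd ε hε := by
    choose C hC using fun n => (bddHolo_flow_succ hV n).bdd ε hε
    refine ⟨Real.exp (C₀ + ∑ n ∈ Finset.range m, C n), fun u σ hσ => ?_⟩
    rw [Complex.norm_exp]
    exact Real.exp_le_exp.2 (re_partialFlow_le hC₀ hre m u (lt_of_lt_of_le hε hσ)
      fun n => hC n u σ hσ)

theorem bddHolo_truncation (hV : LipHolo ρ (fun _ : Unit => V)) (m : ℕ) :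
    BddHolo ρ (truncation V m) :=
  BddHolo.sum fun _ _ => (lipHolo_flow hV _).pairing (lipHolo_flow hV _)

/-- Along the flow, the average of the exponentiated potential changes by the truncation error
only. -/
theorem hasDerivAt_heat_exp (hV : LipHolo ρ (fun _ : Unit => V)) (hC₀ : 0 ≤ C₀)
    (hre : ∀ σ ∈ strip ρ, (V σ).re ≤ C₀) (m : ℕ) (hσ : σ ∈ strip ρ) {u : ℝ}
    (hu : u ∈ Set.Ioo (0 : ℝ) 1) :
    HasDerivAt (fun u => heat u (fun τ => Complex.exp (partialFlow V m u τ)) σ)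
      (heat u (fun τ => Complex.exp (partialFlow V m u τ) * (1 / 2 * truncation V m u τ)) σ) u := by
  have hG := bddHolo_exp_partialFlow hV hC₀ hre m
  have hφ := lipHolo_partialFlow hV m
  let P : ℝ → Mat N → ℂ := fun u τ => ∑ n ∈ Finset.range (m + 1),
    (-1) * ((1 / 2) * lap (flow V n u) τ + if n = 0 then 0 else source V (n - 1) u τ)
  have hP : BddHolo ρ P := BddHolo.sum fun n _ => by
    refine (BddHolo.const _).mul (((BddHolo.const _).mul (lipHolo_flow hV n).lap).add ?_)
    split_ifs
    · exact BddHolo.const 0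
    · exact bddHolo_source hV _
  have hGP := hG.mul hP
  have hd := hasDerivAt_heat hG.lipHolo hGP (fun u hu τ hτ => by
    have : HasDerivAt (fun u => partialFlow V m u τ) (P u τ) u := by
      unfold partialFlow
      refine HasDerivAt.fun_sum fun n _ => ?_
      rw [neg_one_mul]
      exact hasDerivAt_flow hV n hτ hu
    exact this.cexp) hσ hu
  convert hd using 1
  have hi1 := hGP.integrable_comp hσ u u
  have hi2 := hG.lipHolo.lap.integrable_comp hσ u u
  unfold heat
  rw [← integral_const_mul, ← integral_add hi1 (hi2.const_mul _)]
  refine integral_congr_ae (.of_forall fun x => ?_)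
  beta_reduce
  have hτ : σ + herm (√u • x) ∈ strip ρ := add_hermitian_mem_strip hσ (herm_isHermitian _)
  generalize σ + herm (√u • x) = τ at hτ
  rw [lap_exp (hφ.holo.holo u) hτ]
  have hfl : ∀ n ∈ Finset.range (m + 1), DifferentiableOn ℂ (flow V n u) (strip ρ) := fun n _ =>
    (lipHolo_flow hV n).holo.holo u
  have h1 : lap (partialFlow V m u) τ = ∑ n ∈ Finset.range (m + 1), lap (flow V n u) τ :=
    lap_sum hfl hτ
  have h2 : pairing (partialFlow V m u) (partialFlow V m u) τ
      = 2 * ∑ n ∈ Finset.range m, source V n u τ + truncation V m u τ :=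
    (pairing_sum hfl hτ).trans (two_mul_sum_source V m u τ).symm
  have h3 : P u τ = -(1 / 2 * ∑ n ∈ Finset.range (m + 1), lap (flow V n u) τ)
      - ∑ n ∈ Finset.range m, source V n u τ := by
    simp only [P, neg_one_mul, neg_add]
    rw [Finset.sum_add_distrib, Finset.sum_neg_distrib, ← Finset.mul_sum, sub_eq_add_neg]
    congr 1
    rw [Finset.sum_range_succ']
    simp
  -- The terms in `lap` and the sources cancel; half the truncation error remains.
  rw [h1, h2, h3]
  ring

theorem flow_one_zero (V : Mat N → ℂ) : flow V 0 1 = V := by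
  funext σ
  rw [flow_zero]
  simp only [clamp_of_mem (Set.right_mem_Icc.2 zero_le_one), sub_self]
  exact heat_of_nonpos le_rfl V σ

theorem flow_one_succ (V : Mat N → ℂ) (n : ℕ) : flow V (n + 1) 1 = 0 := by
  funext σ
  rw [flow_succ, duhamel, clamp_of_mem (Set.right_mem_Icc.2 zero_le_one)]
  simp

theorem partialFlow_one (V : Mat N → ℂ) (m : ℕ) : partialFlow V m 1 = V := by
  funext σ
  simp [partialFlow, Finset.sum_range_succ', flow_one_zero, flow_one_succ]

/-- At most `(m + 1) ^ 2` pairs occur in the truncation error, each of total order at least `m`. -/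
theorem norm_truncation_le (hV : LipHolo ρ (fun _ : Unit => V)) (hK : 0 ≤ K)
    (hgrad : ∀ σ ∈ strip ρ, ‖grad V σ‖ ≤ K) {q : ℝ} (hq : 12 * K / stripDist ρ σ = q) (hq1 : q ≤ 1)
    (m : ℕ) (u : ℝ) (hσ : σ ∈ strip ρ) :
    ‖truncation V m u σ‖ ≤ (N : ℝ) ^ 2 * K ^ 2 * ((m + 1) ^ 2 * q ^ m) := by
  have hδ : 0 < stripDist ρ σ := hσ
  have hq0 : 0 ≤ q := by rw [← hq]; positivity
  have h1 : ‖truncation V m u σ‖ ≤ ∑ _p ∈ (Finset.range (m + 1) ×ˢ Finset.range (m + 1)).filter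
      (fun p => ¬ p.1 + p.2 < m), (N : ℝ) ^ 2 * K ^ 2 * q ^ m := by
    refine norm_sum_le_of_le _ fun p hp => (norm_pairing_le _ _ _).trans ?_
    have hm : m ≤ p.1 + p.2 := by
      simp only [Finset.mem_filter] at hp; omega
    have hg := fun n => hq ▸ norm_grad_flow_le_geometric hV hK hgrad n u hσ
    calc _ ≤ (N : ℝ) ^ 2 * ((K * q ^ p.1) * (K * q ^ p.2)) := by
          gcongr <;> exact hg _
      _ = (N : ℝ) ^ 2 * K ^ 2 * q ^ (p.1 + p.2) := by rw [pow_add]; ring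
      _ ≤ _ := mul_le_mul_of_nonneg_left (pow_le_pow_of_le_one hq0 hq1 hm) (by positivity)
  refine h1.trans ?_
  rw [Finset.sum_const, nsmul_eq_mul]
  have hcard : ((Finset.range (m + 1) ×ˢ Finset.range (m + 1)).filter
      (fun p => ¬ p.1 + p.2 < m)).card ≤ (m + 1) ^ 2 := by
    refine (Finset.card_filter_le _ _).trans ?_
    simp [sq]
  have : (((Finset.range (m + 1) ×ˢ Finset.range (m + 1)).filter
      (fun p => ¬ p.1 + p.2 < m)).card : ℝ) ≤ ((m : ℝ) + 1) ^ 2 := by exact_mod_cast hcard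
  calc _ ≤ ((m : ℝ) + 1) ^ 2 * ((N : ℝ) ^ 2 * K ^ 2 * q ^ m) := by gcongr
    _ = _ := by ring

theorem summable_succ_mul_geometric {q : ℝ} (hq0 : 0 ≤ q) (hq1 : q < 1) :
    Summable fun n : ℕ => ((n : ℝ) + 1) * q ^ n := by
  have hn : ‖q‖ < 1 := by rwa [Real.norm_of_nonneg hq0]
  have h1 := summable_pow_mul_geometric_of_norm_lt_one 1 hn
  have h2 := summable_geometric_of_lt_one hq0 hq1
  simpa [add_mul] using h1.add h2

theorem summable_flow (hV : LipHolo ρ (fun _ : Unit => V)) (hK : 0 ≤ K)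
    (hgrad : ∀ σ ∈ strip ρ, ‖grad V σ‖ ≤ K) (hq1 : 12 * K / stripDist ρ σ < 1) (u : ℝ)
    (hσ : σ ∈ strip ρ) : Summable fun n => flow V n u σ := by
  have hδ : 0 < stripDist ρ σ := hσ
  refine (summable_nat_add_iff 1).1 ?_
  exact Summable.of_norm_bounded ((summable_succ_mul_geometric (by positivity) hq1).mul_left _)
    fun n => norm_flow_succ_le hV hK hgrad n u hσ

/-- The series of the expansion coefficients is a logarithm of the average of `exp V`. -/
theorem heat_exp_eq_exp_tsum (hV : LipHolo ρ (fun _ : Unit => V)) (hρ : 0 < ρ) (hC₀ : 0 ≤ C₀)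
    (hre : ∀ σ ∈ strip ρ, (V σ).re ≤ C₀) (hK : 0 ≤ K)
    (hgrad : ∀ σ ∈ strip ρ, ‖grad V σ‖ ≤ K) (hq1 : 12 * K / ρ < 1) :
    heat 1 (fun τ => Complex.exp (V τ)) 0 = Complex.exp (∑' n, flow V n 0 0) := by
  have hH : (0 : Mat N).IsHermitian := Matrix.isHermitian_zero
  have h0 : (0 : Mat N) ∈ strip ρ := hermitian_mem_strip hρ hH
  have hx : ∀ x : Coord N, (0 : Mat N) + herm x ∈ strip ρ := fun x =>
    add_hermitian_mem_strip h0 (herm_isHermitian x)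
  have hdist : ∀ x : Coord N, stripDist ρ ((0 : Mat N) + herm x) = ρ := fun x => by
    rw [zero_add, stripDist_hermitian ρ (herm_isHermitian x)]
  set q := 12 * K / ρ with hq
  have hq0 : 0 ≤ q := by positivity
  let B : ℕ → ℝ := fun n => (N : ℝ) ^ 2 * K ^ 2 * ((n + 1) * q ^ n)
  have hBs : Summable B := (summable_succ_mul_geometric hq0 hq1).mul_left _
  have hB0 : ∀ n, 0 ≤ B n := fun n => by positivity
  -- A bound on the exponentials that is uniform in the order of truncation.
  let A := Real.exp (C₀ + ∑' n, B n)
  let e : ℕ → ℝ := fun m => A * (1 / 2 * ((N : ℝ) ^ 2 * K ^ 2 * ((m + 1) ^ 2 * q ^ m)))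
  have hexp : ∀ m u (x : Coord N), ‖Complex.exp (partialFlow V m u (0 + herm x))‖ ≤ A := by
    intro m u x
    rw [Complex.norm_exp]
    refine Real.exp_le_exp.2 ((re_partialFlow_le hC₀ hre m u (B := B) (hx x) fun n => ?_).trans ?_)
    · have := norm_flow_succ_le hV hK hgrad n u (hx x)
      rwa [hdist] at this
    · gcongr
      exact hBs.sum_le_tsum _ fun n _ => hB0 n
  have hdiff : ∀ m, ‖heat 1 (fun τ => Complex.exp (V τ)) 0
      - Complex.exp (∑ n ∈ Finset.range (m + 1), flow V n 0 0)‖ ≤ e m := by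
    intro m
    have hG := bddHolo_exp_partialFlow hV hC₀ hre m
    have hc : Continuous fun u => heat u (fun τ => Complex.exp (partialFlow V m u τ)) 0 :=
      (hG.heat (τ := id) continuous_id).lipHolo.continuous_param h0
    have hE := hG.mul ((BddHolo.const (1 / 2)).mul (bddHolo_truncation hV m))
    have hc' : Continuous fun u => heat u (fun τ => Complex.exp (partialFlow V m u τ) *
        (1 / 2 * truncation V m u τ)) 0 :=
      (hE.heat (τ := id) continuous_id).lipHolo.continuous_param h0
    have hftc := intervalIntegral.integral_eq_sub_of_hasDerivAt_of_le zero_le_one hc.continuousOn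
      (fun u hu => hasDerivAt_heat_exp hV hC₀ hre m h0 hu) (hc'.intervalIntegrable _ _)
    -- At `u = 1` the potential is `V` and the average is over the full Gaussian; at `u = 0` nothing
    -- is left to average.
    rw [heat_of_nonpos le_rfl, partialFlow_one] at hftc
    have hle := intervalIntegral.norm_integral_le_of_norm_le_const (a := 0) (b := 1) (C := e m)
      (f := fun u => heat u (fun τ => Complex.exp (partialFlow V m u τ) *
        (1 / 2 * truncation V m u τ)) 0) fun u _ => norm_heat_le fun x => by
      have h1 := norm_truncation_le hV hK hgrad (q := q) (by rw [hdist]) hq1.le m u (hx x)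
      have hhalf : ‖(1 / 2 : ℂ)‖ = 1 / 2 := by norm_num
      rw [norm_mul, norm_mul, hhalf]
      exact mul_le_mul (hexp m u x) (mul_le_mul_of_nonneg_left h1 (by norm_num)) (by positivity)
        (Real.exp_nonneg _)
    rw [hftc] at hle
    simpa [partialFlow] using hle
  have he : Tendsto e atTop (𝓝 0) := by
    have hn : ‖q‖ < 1 := by rwa [Real.norm_of_nonneg hq0]
    have h1 := (summable_pow_mul_geometric_of_norm_lt_one 2 hn).tendsto_atTop_zero
    have h2 := (summable_pow_mul_geometric_of_norm_lt_one 1 hn).tendsto_atTop_zero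
    have h3 := (summable_geometric_of_lt_one hq0 hq1).tendsto_atTop_zero
    have h4 := ((h1.add (h2.const_mul 2)).add h3).const_mul (A * (1 / 2 * ((N : ℝ) ^ 2 * K ^ 2)))
    simp only [mul_zero, add_zero] at h4
    refine h4.congr fun m => ?_
    simp only [e, pow_one]
    ring
  have hs : Summable fun n => flow V n 0 (0 : Mat N) :=
    summable_flow hV hK hgrad (by rwa [stripDist_hermitian ρ hH]) 0 h0
  have ht1 : Tendsto (fun m => Complex.exp (∑ n ∈ Finset.range (m + 1), flow V n 0 (0 : Mat N))) atTop
      (𝓝 (Complex.exp (∑' n, flow V n 0 0))) :=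
    (Complex.continuous_exp.tendsto _).comp
      ((tendsto_add_atTop_iff_nat 1).2 hs.hasSum.tendsto_sum_nat)
  have ht2 : Tendsto (fun m => Complex.exp (∑ n ∈ Finset.range (m + 1), flow V n 0 (0 : Mat N))) atTop
      (𝓝 (heat 1 (fun τ => Complex.exp (V τ)) 0)) := by
    rw [tendsto_iff_norm_sub_tendsto_zero]
    refine squeeze_zero (fun _ => norm_nonneg _) (fun m => ?_) he
    rw [norm_sub_rev]
    exact hdiff m
  exact tendsto_nhds_unique ht2 ht1

/-! ### Reality of the expansion coefficients -/

/-- The symmetry of the loop vertex under `σ ↦ -σᴴ` and complex conjugation. -/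
def ConjSymm (ρ : ℝ) (f : Mat N → ℂ) : Prop :=
  ∀ σ ∈ strip ρ, starRingEnd ℂ (f σ) = f (-σ.conjTranspose)

theorem stripDist_neg_conjTranspose (ρ : ℝ) (σ : Mat N) :
    stripDist ρ (-σ.conjTranspose) = stripDist ρ σ := by
  unfold stripDist
  rw [Matrix.conjTranspose_neg, Matrix.conjTranspose_conjTranspose]
  congr 3
  abel

theorem neg_conjTranspose_mem_strip (hσ : σ ∈ strip ρ) : -σ.conjTranspose ∈ strip ρ := by
  rwa [strip, Set.mem_ofPred_eq, stripDist_neg_conjTranspose]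

theorem ConjSymm.heat {f : Mat N → ℂ} (hf : ConjSymm ρ f) (t : ℝ) :
    ConjSymm ρ (LoopVertex.heat t f) := by
  intro σ hσ
  unfold LoopVertex.heat
  rw [← integral_conj]
  -- The substitution `x ↦ -x` compensates for the sign in `σ ↦ -σᴴ`.
  have hmap := stdGaussian_map (LinearIsometryEquiv.neg ℝ (E := Coord N))
  have hemb : MeasurableEmbedding (LinearIsometryEquiv.neg ℝ (E := Coord N)) :=
    (LinearIsometryEquiv.neg ℝ (E := Coord N)).toHomeomorph.measurableEmbedding
  conv_rhs => rw [← hmap, hemb.integral_map]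
  refine integral_congr_ae (.of_forall fun x => ?_)
  beta_reduce
  rw [hf _ (add_hermitian_mem_strip hσ (herm_isHermitian _)), Matrix.conjTranspose_add,
    (herm_isHermitian _).eq]
  congr 1
  simp [add_comm]

/-- The symmetry exchanges the two indices of a derivative, with a sign that cancels in pairings. -/
theorem ConjSymm.pderiv {f : Mat N → ℂ} (hf : ConjSymm ρ f) (hd : DifferentiableOn ℂ f (strip ρ))
    (hσ : σ ∈ strip ρ) (a : Fin N × Fin N) :
    starRingEnd ℂ (LoopVertex.pderiv a f σ) = -LoopVertex.pderiv a.swap f (-σ.conjTranspose) := by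
  have hline : ∀ τ ∈ strip (N := N) ρ, ∀ X : Mat N,
      HasDerivAt (fun z : ℂ => f (τ + z • X)) (fderiv ℂ f τ X) 0 := by
    intro τ hτ X
    have h1 : HasDerivAt (fun z : ℂ => τ + z • X) X 0 := by
      simpa using ((hasDerivAt_id (0 : ℂ)).smul_const X).const_add τ
    have h2 : HasFDerivAt f (fderiv ℂ f τ) (τ + (0 : ℂ) • X) := by
      simpa using (hd.differentiableAt ((isOpen_strip ρ).mem_nhds hτ)).hasFDerivAt
    exact h2.comp_hasDerivAt (0 : ℂ) h1
  have h1 := (hline σ hσ (Matrix.single a.1 a.2 1)).conj_conj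
  have h2 := hline _ (neg_conjTranspose_mem_strip hσ) (-(Matrix.single a.2 a.1 1))
  rw [map_zero] at h1
  have h3 : (starRingEnd ℂ ∘ (fun z : ℂ => f (σ + z • Matrix.single a.1 a.2 1)) ∘ starRingEnd ℂ)
      =ᶠ[𝓝 0] fun z : ℂ => f (-σ.conjTranspose + z • -(Matrix.single a.2 a.1 1)) := by
    have hcont : ContinuousAt (fun z : ℂ => σ + (starRingEnd ℂ z) • Matrix.single a.1 a.2 (1 : ℂ))
        0 := by
      have : Continuous fun z : ℂ => σ + (starRingEnd ℂ z) • Matrix.single a.1 a.2 (1 : ℂ) :=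
        continuous_const.add (Complex.continuous_conj.smul continuous_const)
      exact this.continuousAt
    have hev := hcont.eventually ((isOpen_strip ρ).mem_nhds (by simpa using hσ))
    filter_upwards [hev] with z hz
    simp only [Function.comp_apply]
    rw [hf _ hz]
    congr 1
    rw [Matrix.conjTranspose_add, Matrix.conjTranspose_smul, neg_add]
    simp [Matrix.conjTranspose_single]
  have h4 := h1.unique (h2.congr_of_eventuallyEq h3)
  rw [map_neg] at h4
  exact h4

theorem ConjSymm.pairing {f g : Mat N → ℂ} (hf : ConjSymm ρ f) (hg : ConjSymm ρ g)
    (hdf : DifferentiableOn ℂ f (strip ρ)) (hdg : DifferentiableOn ℂ g (strip ρ)) :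
    ConjSymm ρ (LoopVertex.pairing f g) := by
  intro σ hσ
  unfold LoopVertex.pairing
  rw [map_sum, ← (Equiv.prodComm (Fin N) (Fin N)).sum_comp]
  refine Finset.sum_congr rfl fun a _ => ?_
  rw [map_mul, hf.pderiv hdf hσ, hg.pderiv hdg hσ]
  simp

theorem conjSymm_flow (hV : LipHolo ρ (fun _ : Unit => V)) (hsymm : ConjSymm ρ V) (n : ℕ) :
    ∀ u, ConjSymm ρ (flow V n u) := by
  induction n using Nat.strong_induction_on with
  | _ n ih =>
    intro u
    rcases n with _ | n
    · rw [flow_zero]; exact hsymm.heat _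
    · intro σ hσ
      rw [flow_succ, duhamel, duhamel, intervalIntegral.integral_of_le (clamp_le_one u),
        intervalIntegral.integral_of_le (clamp_le_one u), ← integral_conj]
      refine integral_congr_ae (.of_forall fun s => ?_)
      beta_reduce
      refine ConjSymm.heat (fun τ hτ => ?_) _ σ hσ
      have hp : ∀ i : Fin (n + 1), ConjSymm ρ (LoopVertex.pairing (flow V i s) (flow V (n - i) s)) :=
        fun i => (ih i (by omega) s).pairing (ih (n - i) (by omega) s)
          ((lipHolo_flow hV _).holo.holo s) ((lipHolo_flow hV _).holo.holo s)
      rw [source, source, map_mul, map_sum]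
      congr 1
      · rw [map_div₀, map_one, map_ofNat]
      · exact Finset.sum_congr rfl fun i _ => hp i τ hτ

/-- The series of the expansion coefficients is the logarithm of the average of `exp V`. -/
theorem hasSum_flow (hV : LipHolo ρ (fun _ : Unit => V)) (hρ : 0 < ρ) (hC₀ : 0 ≤ C₀)
    (hre : ∀ σ ∈ strip ρ, (V σ).re ≤ C₀) (hK : 0 ≤ K)
    (hgrad : ∀ σ ∈ strip ρ, ‖grad V σ‖ ≤ K) (hq1 : 12 * K / ρ < 1) (hsymm : ConjSymm ρ V)
    {Z : ℝ} (hZ : (Z : ℂ) = heat 1 (fun τ => Complex.exp (V τ)) 0) :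
    HasSum (fun n => flow V n 0 (0 : Mat N)) ((Real.log Z : ℝ) : ℂ) := by
  have hH : (0 : Mat N).IsHermitian := Matrix.isHermitian_zero
  have h0 : (0 : Mat N) ∈ strip ρ := hermitian_mem_strip hρ hH
  have hs : Summable fun n => flow V n 0 (0 : Mat N) :=
    summable_flow hV hK hgrad (by rwa [stripDist_hermitian ρ hH]) 0 h0
  have hreal : ∀ n, starRingEnd ℂ (flow V n 0 (0 : Mat N)) = flow V n 0 0 := by
    intro n
    have := conjSymm_flow hV hsymm n 0 0 h0
    simpa using this
  have hS : starRingEnd ℂ (∑' n, flow V n 0 (0 : Mat N)) = ∑' n, flow V n 0 (0 : Mat N) := by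
    rw [Complex.conj_tsum]
    simp only [hreal]
  -- As the sum `S` is real, `Z = exp S` determines it: no branch of the logarithm is left to
  -- choose.
  obtain ⟨S, hS'⟩ := Complex.conj_eq_iff_real.1 hS
  rw [heat_exp_eq_exp_tsum hV hρ hC₀ hre hK hgrad hq1, hS', ← Complex.ofReal_exp] at hZ
  have hZ' : Z = Real.exp S := by exact_mod_cast hZ
  rw [hZ', Real.log_exp, ← hS']
  exact hs.hasSum

end Exponential

/-! ### Trees on a set of vertices -/

section Trees

variable {α : Type*}

/-- A tree on the vertex set `S`, seen as a graph on the ambient type. -/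
structure IsTreeOn (G : SimpleGraph α) (S : Finset α) : Prop where
  mem_left : ∀ {a b}, G.Adj a b → a ∈ S
  acyclic : G.IsAcyclic
  nonempty : S.Nonempty
  reachable : ∀ a ∈ S, ∀ b ∈ S, G.Reachable a b

theorem IsTreeOn.mem_right {G : SimpleGraph α} {S : Finset α} (h : IsTreeOn G S) {a b : α}
    (hab : G.Adj a b) : b ∈ S := h.mem_left hab.symm

theorem isTreeOn_univ [Fintype α] {G : SimpleGraph α} : IsTreeOn G Finset.univ ↔ G.IsTree := by
  refine ⟨fun h => ⟨?_, h.acyclic⟩, fun h => ⟨fun _ => Finset.mem_univ _, h.isAcyclic, ?_, ?_⟩⟩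
  · obtain ⟨a, -⟩ := h.nonempty
    exact { preconnected := fun a b => h.reachable a (Finset.mem_univ _) b (Finset.mem_univ _)
            nonempty := ⟨a⟩ }
  · exact @Finset.univ_nonempty _ _ h.connected.nonempty
  · exact fun a _ b _ => h.connected.preconnected a b

/-- A tree on a singleton has no edge. -/
theorem isTreeOn_singleton {G : SimpleGraph α} {v : α} : IsTreeOn G {v} ↔ G = ⊥ := by
  constructor
  · intro h
    ext a b
    simp only [SimpleGraph.bot_adj, iff_false]
    intro hab
    have ha := h.mem_left hab
    have hb := h.mem_right hab
    rw [Finset.mem_singleton] at ha hb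
    exact hab.ne (ha.trans hb.symm)
  · rintro rfl
    refine ⟨fun h => h.elim, SimpleGraph.isAcyclic_bot, Finset.singleton_nonempty v, ?_⟩
    intro a ha b hb
    rw [Finset.mem_singleton] at ha hb
    rw [ha, hb]

theorem IsTreeOn.exists_adj {G : SimpleGraph α} {S : Finset α} (h : IsTreeOn G S)
    (hS : 1 < S.card) {a : α} (ha : a ∈ S) : ∃ b, G.Adj a b := by
  obtain ⟨b, hb, hab⟩ := Finset.exists_mem_ne hS a
  obtain ⟨p⟩ := h.reachable a ha b hb
  cases p with
  | nil => exact (hab rfl).elim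
  | cons hadj _ => exact ⟨_, hadj⟩

/-- The tree on `S` is obtained from trees on the two parts `S₁`, `S₂` of `S` by adding the edge
between `v₁ ∈ S₁` and `v₂ ∈ S₂`. -/
structure Split (G : SimpleGraph α) (v₁ v₂ : α) (S₁ S₂ : Finset α) (G₁ G₂ : SimpleGraph α) :
    Prop where
  eq : G = G₁ ⊔ G₂ ⊔ SimpleGraph.edge v₁ v₂
  disjoint : Disjoint S₁ S₂
  mem₁ : v₁ ∈ S₁
  mem₂ : v₂ ∈ S₂
  tree₁ : IsTreeOn G₁ S₁
  tree₂ : IsTreeOn G₂ S₂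

namespace Split

variable {G G₁ G₂ : SimpleGraph α} {v₁ v₂ : α} {S₁ S₂ : Finset α}

theorem symm (h : Split G v₁ v₂ S₁ S₂ G₁ G₂) : Split G v₂ v₁ S₂ S₁ G₂ G₁ where
  eq := by rw [h.eq, SimpleGraph.edge_comm, sup_comm G₂]
  disjoint := h.disjoint.symm
  mem₁ := h.mem₂
  mem₂ := h.mem₁
  tree₁ := h.tree₂
  tree₂ := h.tree₁

theorem not_mem₂ (h : Split G v₁ v₂ S₁ S₂ G₁ G₂) {a : α} (ha : a ∈ S₁) : a ∉ S₂ :=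
  Finset.disjoint_left.1 h.disjoint ha

theorem ne (h : Split G v₁ v₂ S₁ S₂ G₁ G₂) : v₁ ≠ v₂ := fun e => h.not_mem₂ h.mem₁ (e ▸ h.mem₂)

theorem adj_iff (h : Split G v₁ v₂ S₁ S₂ G₁ G₂) {a b : α} :
    G.Adj a b ↔ G₁.Adj a b ∨ G₂.Adj a b ∨ s(a, b) = s(v₁, v₂) := by
  rw [h.eq]
  simp only [SimpleGraph.sup_adj, SimpleGraph.edge_adj, or_assoc, Sym2.eq_iff]
  have := h.ne
  constructor
  · rintro (h | h | ⟨h, -⟩) <;> simp_all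
  · rintro (h | h | h)
    · exact Or.inl h
    · exact Or.inr (Or.inl h)
    · refine Or.inr (Or.inr ⟨by tauto, ?_⟩)
      rcases h with ⟨rfl, rfl⟩ | ⟨rfl, rfl⟩
      · exact this
      · exact this.symm

theorem adj (h : Split G v₁ v₂ S₁ S₂ G₁ G₂) : G.Adj v₁ v₂ := h.adj_iff.2 (by simp)

theorem le₁ (h : Split G v₁ v₂ S₁ S₂ G₁ G₂) : G₁ ≤ G := by
  rw [h.eq, sup_assoc]; exact le_sup_left

/-- Without the joining edge one cannot leave `S₁`. -/
theorem walk_mem (h : Split G v₁ v₂ S₁ S₂ G₁ G₂) {a b : α} (p : (G₁ ⊔ G₂).Walk a b) (ha : a ∈ S₁) :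
    b ∈ S₁ ∧ ∀ e ∈ p.edges, e ∈ G₁.edgeSet := by
  induction p with
  | nil => exact ⟨ha, by simp⟩
  | @cons a c b hadj p ih =>
    have h1 : G₁.Adj a c := by
      rcases hadj with h1 | h2
      · exact h1
      · exact (h.not_mem₂ ha (h.tree₂.mem_left h2)).elim
    have := ih (h.tree₁.mem_right h1)
    refine ⟨this.1, fun e he => ?_⟩
    rw [SimpleGraph.Walk.edges_cons, List.mem_cons] at he
    rcases he with rfl | he
    · exact h1
    · exact this.2 e he

theorem not_reachable (h : Split G v₁ v₂ S₁ S₂ G₁ G₂) : ¬ (G₁ ⊔ G₂).Reachable v₁ v₂ := by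
  rintro ⟨p⟩
  exact h.not_mem₂ (h.walk_mem p h.mem₁).1 h.mem₂

theorem acyclic_sup (h : Split G v₁ v₂ S₁ S₂ G₁ G₂) : (G₁ ⊔ G₂).IsAcyclic := by
  have key : ∀ {G₁ G₂ : SimpleGraph α} {S₁ S₂ : Finset α} {v₁ v₂ : α},
      Split G v₁ v₂ S₁ S₂ G₁ G₂ → ∀ a ∈ S₁, ∀ p : (G₁ ⊔ G₂).Walk a a, ¬ p.IsCycle := by
    intro G₁ G₂ S₁ S₂ v₁ v₂ h a ha p hp
    exact h.tree₁.acyclic _ (hp.transfer (H := G₁) (h.walk_mem p ha).2)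
  intro a p hp
  cases p with
  | nil => exact hp.ne_nil rfl
  | cons hadj p =>
    rcases hadj with h1 | h2
    · exact key h a (h.tree₁.mem_left h1) _ hp
    · have hle : ∀ e ∈ (SimpleGraph.Walk.cons (Or.inr h2) p).edges, e ∈ (G₂ ⊔ G₁).edgeSet := by
        intro e he
        rw [sup_comm]
        exact SimpleGraph.Walk.edges_subset_edgeSet _ he
      exact key h.symm a (h.tree₂.mem_left h2) _ (hp.transfer hle)

theorem isTreeOn [DecidableEq α] (h : Split G v₁ v₂ S₁ S₂ G₁ G₂) : IsTreeOn G (S₁ ∪ S₂) where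
  mem_left {a b} hab := by
    rw [Finset.mem_union]
    rcases h.adj_iff.1 hab with h1 | h2 | h3
    · exact Or.inl (h.tree₁.mem_left h1)
    · exact Or.inr (h.tree₂.mem_left h2)
    · rcases Sym2.eq_iff.1 h3 with ⟨rfl, -⟩ | ⟨rfl, -⟩
      · exact Or.inl h.mem₁
      · exact Or.inr h.mem₂
  acyclic := by
    rw [h.eq]
    exact h.acyclic_sup.sup_edge_of_not_reachable h.not_reachable
  nonempty := ⟨v₁, Finset.mem_union_left _ h.mem₁⟩
  reachable := by
    have h1 : ∀ a ∈ S₁ ∪ S₂, G.Reachable a v₁ := by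
      intro a ha
      rcases Finset.mem_union.1 ha with ha | ha
      · exact (h.tree₁.reachable a ha v₁ h.mem₁).mono h.le₁
      · exact ((h.tree₂.reachable a ha v₂ h.mem₂).mono h.symm.le₁).trans h.symm.adj.reachable
    exact fun a ha b hb => (h1 a ha).trans (h1 b hb).symm

theorem deleteEdges_eq (h : Split G v₁ v₂ S₁ S₂ G₁ G₂) :
    G.deleteEdges {s(v₁, v₂)} = G₁ ⊔ G₂ := by
  ext a b
  rw [SimpleGraph.deleteEdges_adj, h.adj_iff, SimpleGraph.sup_adj, Set.mem_singleton_iff]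
  constructor
  · rintro ⟨h1 | h2 | h3, h4⟩
    · exact Or.inl h1
    · exact Or.inr h2
    · exact (h4 h3).elim
  · rintro (h1 | h2)
    · refine ⟨Or.inl h1, fun e => ?_⟩
      rcases Sym2.eq_iff.1 e with ⟨-, rfl⟩ | ⟨rfl, -⟩
      · exact h.not_mem₂ (h.tree₁.mem_right h1) h.mem₂
      · exact h.not_mem₂ (h.tree₁.mem_left h1) h.mem₂
    · refine ⟨Or.inr (Or.inl h2), fun e => ?_⟩
      rcases Sym2.eq_iff.1 e with ⟨rfl, -⟩ | ⟨-, rfl⟩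
      · exact h.not_mem₂ h.mem₁ (h.tree₂.mem_left h2)
      · exact h.not_mem₂ h.mem₁ (h.tree₂.mem_right h2)

end Split

/-- The edges of `G` inside `S`. -/
def restr (G : SimpleGraph α) (S : Finset α) : SimpleGraph α where
  Adj a b := G.Adj a b ∧ a ∈ S ∧ b ∈ S
  symm := ⟨fun _ _ h => ⟨h.1.symm, h.2.2, h.2.1⟩⟩
  loopless := ⟨fun _ h => h.1.ne rfl⟩

open Classical in
/-- The vertices of `S` that are connected to `v`. -/
def component (H : SimpleGraph α) (S : Finset α) (v : α) : Finset α :=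
  S.filter fun a => H.Reachable v a

theorem mem_component {H : SimpleGraph α} {S : Finset α} {v a : α} :
    a ∈ component H S v ↔ a ∈ S ∧ H.Reachable v a := by
  simp [component]

theorem isTreeOn_component {H : SimpleGraph α} {S : Finset α} (hH : H.IsAcyclic)
    (hS : ∀ {a b}, H.Adj a b → a ∈ S) {v : α} (hv : v ∈ S) :
    IsTreeOn (restr H (component H S v)) (component H S v) where
  mem_left h := h.2.1
  acyclic := hH.anti fun _ _ h => h.1
  nonempty := ⟨v, by simp [mem_component, hv]⟩
  reachable := by
    -- A walk in `H` that starts in the component never leaves it.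
    have key : ∀ {x a : α} (p : H.Walk x a), x ∈ component H S v →
        (restr H (component H S v)).Reachable x a := by
      intro x a p
      induction p with
      | nil => exact fun _ => .refl _
      | cons hadj p ih =>
        intro hx
        rw [mem_component] at hx
        have hy := mem_component.2 ⟨hS hadj.symm, hx.2.trans hadj.reachable⟩
        have hadj' : (restr H (component H S v)).Adj _ _ :=
          ⟨hadj, mem_component.2 hx, hy⟩
        exact hadj'.reachable.trans (ih hy)
    have hv' : v ∈ component H S v := by simp [mem_component, hv]
    have h1 : ∀ a ∈ component H S v, (restr H (component H S v)).Reachable v a := by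
      intro a ha
      obtain ⟨p⟩ := (mem_component.1 ha).2
      exact key p hv'
    exact fun a ha b hb => (h1 a ha).symm.trans (h1 b hb)

theorem Split.restr_eq {G G₁ G₂ : SimpleGraph α} {v₁ v₂ : α} {S₁ S₂ : Finset α}
    (h : Split G v₁ v₂ S₁ S₂ G₁ G₂) :
    restr (G.deleteEdges {s(v₁, v₂)}) S₁ = G₁ := by
  ext a b
  simp only [restr, h.deleteEdges_eq, SimpleGraph.sup_adj]
  constructor
  · rintro ⟨h1 | h2, ha, -⟩
    · exact h1
    · exact (h.not_mem₂ ha (h.tree₂.mem_left h2)).elim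
  · exact fun h1 => ⟨Or.inl h1, h.tree₁.mem_left h1, h.tree₁.mem_right h1⟩

variable [DecidableEq α]

/-- Removing an edge from a tree splits it into two trees. -/
theorem IsTreeOn.split {G : SimpleGraph α} {S : Finset α} (h : IsTreeOn G S) {v₁ v₂ : α}
    (hadj : G.Adj v₁ v₂) :
    Split G v₁ v₂ (component (G.deleteEdges {s(v₁, v₂)}) S v₁)
      (component (G.deleteEdges {s(v₁, v₂)}) S v₂)
      (restr (G.deleteEdges {s(v₁, v₂)}) (component (G.deleteEdges {s(v₁, v₂)}) S v₁))
      (restr (G.deleteEdges {s(v₁, v₂)}) (component (G.deleteEdges {s(v₁, v₂)}) S v₂)) ∧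
    component (G.deleteEdges {s(v₁, v₂)}) S v₁ ∪ component (G.deleteEdges {s(v₁, v₂)}) S v₂ = S := by
  set H := G.deleteEdges {s(v₁, v₂)} with hH
  have hHG : H ≤ G := SimpleGraph.deleteEdges_le _
  have hHa : H.IsAcyclic := h.acyclic.anti hHG
  have hHS : ∀ {a b}, H.Adj a b → a ∈ S := fun hab => h.mem_left (hHG hab)
  have hnr : ¬ H.Reachable v₁ v₂ :=
    SimpleGraph.isBridge_iff.1 (SimpleGraph.isAcyclic_iff_forall_isBridge.1 h.acyclic hadj)
  have hadjH : ∀ {a b}, G.Adj a b → s(a, b) ≠ s(v₁, v₂) → H.Adj a b := fun hab hne => by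
    rw [hH, SimpleGraph.deleteEdges_adj]
    exact ⟨hab, hne⟩
  -- Along a walk in the tree, crossing the removed edge only leads from one of its ends to the
  -- other.
  have hor : ∀ {x a : α} (p : G.Walk x a), H.Reachable v₁ x ∨ H.Reachable v₂ x →
      H.Reachable v₁ a ∨ H.Reachable v₂ a := by
    intro x a p
    induction p with
    | nil => exact id
    | @cons x y a hxy p ih =>
      intro hx
      refine ih ?_
      by_cases he : s(x, y) = s(v₁, v₂)
      · rcases Sym2.eq_iff.1 he with ⟨-, rfl⟩ | ⟨-, rfl⟩
        · exact Or.inr (.refl _)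
        · exact Or.inl (.refl _)
      · exact hx.imp (fun h => h.trans (hadjH hxy he).reachable)
          fun h => h.trans (hadjH hxy he).reachable
  have hcover : ∀ a ∈ S, H.Reachable v₁ a ∨ H.Reachable v₂ a := fun a ha => by
    obtain ⟨p⟩ := h.reachable v₁ (h.mem_left hadj) a ha
    exact hor p (Or.inl (.refl _))
  refine ⟨⟨?_, ?_, ?_, ?_, ?_, ?_⟩, ?_⟩
  · ext a b
    simp only [SimpleGraph.sup_adj, SimpleGraph.edge_adj, restr, mem_component]
    constructor
    · intro hab
      by_cases he : s(a, b) = s(v₁, v₂)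
      · exact Or.inr ⟨Sym2.eq_iff.1 he, hab.ne⟩
      · have hH' := hadjH hab he
        refine Or.inl ?_
        rcases hcover a (h.mem_left hab) with h1 | h1
        · exact Or.inl ⟨hH', ⟨h.mem_left hab, h1⟩, h.mem_right hab, h1.trans hH'.reachable⟩
        · exact Or.inr ⟨hH', ⟨h.mem_left hab, h1⟩, h.mem_right hab, h1.trans hH'.reachable⟩
    · rintro ((⟨h1, -⟩ | ⟨h1, -⟩) | ⟨⟨rfl, rfl⟩ | ⟨rfl, rfl⟩, -⟩)
      · exact hHG h1
      · exact hHG h1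
      · exact hadj
      · exact hadj.symm
  · rw [Finset.disjoint_left]
    intro a h1 h2
    exact hnr ((mem_component.1 h1).2.trans (mem_component.1 h2).2.symm)
  · exact mem_component.2 ⟨h.mem_left hadj, .refl _⟩
  · exact mem_component.2 ⟨h.mem_right hadj, .refl _⟩
  · exact isTreeOn_component hHa hHS (h.mem_left hadj)
  · exact isTreeOn_component hHa hHS (h.mem_right hadj)
  · ext a
    simp only [Finset.mem_union, mem_component]
    constructor
    · rintro (h1 | h1) <;> exact h1.1
    · exact fun ha => (hcover a ha).imp (fun h => ⟨ha, h⟩) fun h => ⟨ha, h⟩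

theorem Split.component_eq {G G₁ G₂ : SimpleGraph α} {v₁ v₂ : α} {S₁ S₂ : Finset α}
    (h : Split G v₁ v₂ S₁ S₂ G₁ G₂) :
    component (G.deleteEdges {s(v₁, v₂)}) (S₁ ∪ S₂) v₁ = S₁ := by
  ext a
  simp only [mem_component, h.deleteEdges_eq, Finset.mem_union]
  constructor
  · rintro ⟨-, ⟨p⟩⟩
    exact (h.walk_mem p h.mem₁).1
  · exact fun ha => ⟨Or.inl ha, (h.tree₁.reachable v₁ h.mem₁ a ha).mono le_sup_left⟩

open Classical in
/-- Trees with a marked oriented edge correspond to pairs of trees with a marked vertex each. -/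
theorem sum_tree_dart [Fintype α] {M : Type*} [AddCommMonoid M] (S : Finset α)
    (g : SimpleGraph α → α → α → M) :
    ∑ G : SimpleGraph α with IsTreeOn G S, ∑ v₁, ∑ v₂, (if G.Adj v₁ v₂ then g G v₁ v₂ else 0)
      = ∑ S₁ ∈ S.powerset, ∑ G₁ : SimpleGraph α with IsTreeOn G₁ S₁,
          ∑ G₂ : SimpleGraph α with IsTreeOn G₂ (S \ S₁), ∑ v₁ ∈ S₁, ∑ v₂ ∈ S \ S₁,
            g (G₁ ⊔ G₂ ⊔ SimpleGraph.edge v₁ v₂) v₁ v₂ := by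
  have hL : ∑ G : SimpleGraph α with IsTreeOn G S, ∑ v₁, ∑ v₂,
      (if G.Adj v₁ v₂ then g G v₁ v₂ else 0)
      = ∑ x : SimpleGraph α × α × α with IsTreeOn x.1 S ∧ x.1.Adj x.2.1 x.2.2,
        g x.1 x.2.1 x.2.2 := by
    rw [Finset.sum_filter, Finset.sum_filter, Fintype.sum_prod_type]
    refine Finset.sum_congr rfl fun G _ => ?_
    rw [Fintype.sum_prod_type]
    by_cases hG : IsTreeOn G S <;> simp [hG]
  have hR : ∑ S₁ ∈ S.powerset, ∑ G₁ : SimpleGraph α with IsTreeOn G₁ S₁,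
          ∑ G₂ : SimpleGraph α with IsTreeOn G₂ (S \ S₁), ∑ v₁ ∈ S₁, ∑ v₂ ∈ S \ S₁,
            g (G₁ ⊔ G₂ ⊔ SimpleGraph.edge v₁ v₂) v₁ v₂
      = ∑ y : Finset α × SimpleGraph α × SimpleGraph α × α × α with
          y.1 ⊆ S ∧ IsTreeOn y.2.1 y.1 ∧ IsTreeOn y.2.2.1 (S \ y.1) ∧ y.2.2.2.1 ∈ y.1 ∧
            y.2.2.2.2 ∈ S \ y.1, g (y.2.1 ⊔ y.2.2.1 ⊔ SimpleGraph.edge y.2.2.2.1 y.2.2.2.2)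
              y.2.2.2.1 y.2.2.2.2 := by
    rw [Finset.sum_filter, Fintype.sum_prod_type, ← Finset.sum_subset (Finset.subset_univ S.powerset)]
    · refine Finset.sum_congr rfl fun S₁ hS₁ => ?_
      rw [Finset.mem_powerset] at hS₁
      rw [Finset.sum_filter, Fintype.sum_prod_type]
      refine Finset.sum_congr rfl fun G₁ _ => ?_
      rw [Fintype.sum_prod_type]
      by_cases h1 : IsTreeOn G₁ S₁
      · rw [if_pos h1, Finset.sum_filter]
        refine Finset.sum_congr rfl fun G₂ _ => ?_
        rw [Fintype.sum_prod_type]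
        by_cases h2 : IsTreeOn G₂ (S \ S₁)
        · rw [if_pos h2, ← Finset.sum_subset (Finset.subset_univ S₁)]
          · refine Finset.sum_congr rfl fun v₁ hv₁ => ?_
            rw [← Finset.sum_subset (Finset.subset_univ (S \ S₁))]
            · refine Finset.sum_congr rfl fun v₂ hv₂ => ?_
              rw [if_pos ⟨hS₁, h1, h2, hv₁, hv₂⟩]
            · intro v₂ _ hv₂
              rw [if_neg fun h => hv₂ h.2.2.2.2]
          · intro v₁ _ hv₁
            exact Finset.sum_eq_zero fun v₂ _ => if_neg fun (h : _ ∧ _) => hv₁ h.2.2.2.1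
        · rw [if_neg h2]
          exact (Finset.sum_eq_zero fun v₁ _ => Finset.sum_eq_zero fun v₂ _ =>
            if_neg fun (h : _ ∧ _) => h2 h.2.2.1).symm
      · rw [if_neg h1]
        exact (Finset.sum_eq_zero fun y _ => Finset.sum_eq_zero fun z _ => by
          rw [if_neg]
          rintro ⟨-, h, -⟩
          exact h1 h).symm
    · intro S₁ _ hS₁
      exact Finset.sum_eq_zero fun y _ => if_neg fun (h : _ ∧ _) => hS₁ (Finset.mem_powerset.2 h.1)
  have hsplit : ∀ {S₁ : Finset α} {G₁ G₂ : SimpleGraph α} {v₁ v₂ : α},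
      IsTreeOn G₁ S₁ → IsTreeOn G₂ (S \ S₁) → v₁ ∈ S₁ → v₂ ∈ S \ S₁ →
      Split (G₁ ⊔ G₂ ⊔ SimpleGraph.edge v₁ v₂) v₁ v₂ S₁ (S \ S₁) G₁ G₂ := fun h1 h2 h3 h4 =>
    ⟨rfl, Finset.disjoint_sdiff, h3, h4, h1, h2⟩
  -- Both sides are now sums over filtered finite types, matched by cutting at the marked edge and
  -- by joining the two marked vertices.
  rw [hL, hR]
  refine Finset.sum_bij' (fun x _ =>
    (component (x.1.deleteEdges {s(x.2.1, x.2.2)}) S x.2.1,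
      restr (x.1.deleteEdges {s(x.2.1, x.2.2)}) (component (x.1.deleteEdges {s(x.2.1, x.2.2)}) S x.2.1),
      restr (x.1.deleteEdges {s(x.2.1, x.2.2)}) (component (x.1.deleteEdges {s(x.2.1, x.2.2)}) S x.2.2),
      x.2.1, x.2.2))
    (fun y _ => (y.2.1 ⊔ y.2.2.1 ⊔ SimpleGraph.edge y.2.2.2.1 y.2.2.2.2, y.2.2.2.1, y.2.2.2.2))
    ?_ ?_ ?_ ?_ ?_
  · rintro ⟨G, v₁, v₂⟩ hx
    simp only [Finset.mem_filter, Finset.mem_univ, true_and] at hx ⊢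
    obtain ⟨hs, hu⟩ := hx.1.split hx.2
    have hsd : S \ component (G.deleteEdges {s(v₁, v₂)}) S v₁
        = component (G.deleteEdges {s(v₁, v₂)}) S v₂ := by
      have := Finset.union_sdiff_cancel_left hs.disjoint
      rwa [hu] at this
    rw [hsd]
    exact ⟨fun a ha => (mem_component.1 ha).1, hs.tree₁, hs.tree₂, hs.mem₁, hs.mem₂⟩
  · rintro ⟨S₁, G₁, G₂, v₁, v₂⟩ hy
    simp only [Finset.mem_filter, Finset.mem_univ, true_and] at hy ⊢
    have hs := hsplit hy.2.1 hy.2.2.1 hy.2.2.2.1 hy.2.2.2.2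
    have := hs.isTreeOn
    rw [Finset.union_sdiff_of_subset hy.1] at this
    exact ⟨this, hs.adj⟩
  · rintro ⟨G, v₁, v₂⟩ hx
    simp only [Finset.mem_filter, Finset.mem_univ, true_and] at hx
    exact Prod.ext (hx.1.split hx.2).1.eq.symm rfl
  · rintro ⟨S₁, G₁, G₂, v₁, v₂⟩ hy
    simp only [Finset.mem_filter, Finset.mem_univ, true_and] at hy
    have hs := hsplit hy.2.1 hy.2.2.1 hy.2.2.2.1 hy.2.2.2.2
    have hu : S₁ ∪ S \ S₁ = S := Finset.union_sdiff_of_subset hy.1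
    have h1 := hs.component_eq
    have h2 := hs.symm.component_eq
    rw [Finset.union_comm, Sym2.eq_swap] at h2
    rw [hu] at h1 h2
    have h3 := hs.symm.restr_eq
    rw [Sym2.eq_swap] at h3
    simp only [h1, h2, hs.restr_eq, h3]
  · rintro ⟨G, v₁, v₂⟩ hx
    simp only [Finset.mem_filter, Finset.mem_univ, true_and] at hx
    simp only
    rw [← (hx.1.split hx.2).1.eq]

end Trees

/-! ### Path weights -/

section Weights

variable {n : ℕ} {G G₁ G₂ : SimpleGraph (Fin n)} {S S₁ S₂ : Finset (Fin n)} {v₁ v₂ : Fin n}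

/-- The path weight for line weights that are given on all pairs of vertices. -/
def pathWeight (G : SimpleGraph (Fin n)) (t : Sym2 (Fin n) → ℝ) : Matrix (Fin n) (Fin n) ℝ :=
  treeWeight G fun ℓ => t ℓ

theorem pathWeight_self (G : SimpleGraph (Fin n)) (t : Sym2 (Fin n) → ℝ) (a : Fin n) :
    pathWeight G t a a = 1 := by
  simp [pathWeight, treeWeight]

/-- In a forest the infimum is taken along the one path between the two vertices. -/
theorem pathWeight_of_isPath (hG : G.IsAcyclic) (t : Sym2 (Fin n) → ℝ) {a b : Fin n} (hab : a ≠ b)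
    (p : G.Walk a b) (hp : p.IsPath) :
    pathWeight G t a b = sInf (t '' {e | e ∈ p.edges}) := by
  simp only [pathWeight, treeWeight, if_neg hab]
  congr 1
  ext x
  simp only [Set.mem_ofPred_eq, Set.mem_image]
  constructor
  · rintro ⟨q, ℓ, hq, hℓ, rfl⟩
    have := (hG.subsingleton_path a b).elim ⟨q, hq⟩ ⟨p, hp⟩
    have hqp : q = p := congrArg Subtype.val this
    exact ⟨ℓ, hqp ▸ hℓ, rfl⟩
  · rintro ⟨e, he, rfl⟩
    exact ⟨p, ⟨e, p.edges_subset_edgeSet he⟩, hp, he, rfl⟩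

theorem edges_nonempty {a b : Fin n} (hab : a ≠ b) (p : G.Walk a b) : {e | e ∈ p.edges}.Nonempty := by
  cases p with
  | nil => exact (hab rfl).elim
  | cons h p => exact ⟨_, List.mem_cons_self⟩

theorem exists_isPath {a b : Fin n} (h : G.Reachable a b) : ∃ p : G.Walk a b, p.IsPath := by
  classical
  obtain ⟨p⟩ := h
  exact ⟨p.toPath, p.toPath.2⟩

theorem pathWeight_congr (hG : IsTreeOn G S) {t t' : Sym2 (Fin n) → ℝ}
    (h : ∀ e ∈ G.edgeSet, t e = t' e) {a b : Fin n} (ha : a ∈ S) (hb : b ∈ S) :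
    pathWeight G t a b = pathWeight G t' a b := by
  by_cases hab : a = b
  · subst hab; simp [pathWeight_self]
  obtain ⟨p, hp⟩ := exists_isPath (hG.reachable a ha b hb)
  rw [pathWeight_of_isPath hG.acyclic t hab p hp, pathWeight_of_isPath hG.acyclic t' hab p hp]
  congr 1
  exact Set.image_congr fun e he => h e (p.edges_subset_edgeSet he)

/-- A monotone affine change of the line weights that fixes `1`, the diagonal value, passes to the
path weights. -/
theorem pathWeight_affine (hG : IsTreeOn G S) (t : Sym2 (Fin n) → ℝ) {r : ℝ} (hr : r ≤ 1)
    {a b : Fin n} (ha : a ∈ S) (hb : b ∈ S) :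
    pathWeight G (fun e => r + (1 - r) * t e) a b = r + (1 - r) * pathWeight G t a b := by
  by_cases hab : a = b
  · subst hab; simp [pathWeight_self]
  obtain ⟨p, hp⟩ := exists_isPath (hG.reachable a ha b hb)
  rw [pathWeight_of_isPath hG.acyclic t hab p hp, pathWeight_of_isPath hG.acyclic _ hab p hp]
  have hmono : Monotone fun x : ℝ => r + (1 - r) * x := fun x y hxy => by
    have : 0 ≤ 1 - r := by linarith
    dsimp only
    gcongr
  have hcont : Continuous fun x : ℝ => r + (1 - r) * x := by fun_prop
  have hfin : (t '' {e | e ∈ p.edges}).Finite := (List.finite_toSet p.edges).image t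
  have := hmono.map_csInf_of_continuousAt (A := t '' {e | e ∈ p.edges}) hcont.continuousAt
    ((edges_nonempty hab p).image t) hfin.bddBelow
  rw [this, Set.image_image]

theorem continuous_pathWeight (hG : G.IsAcyclic) (a b : Fin n) :
    Continuous fun t => pathWeight G t a b := by
  by_cases hab : a = b
  · subst hab; simp only [pathWeight_self]; exact continuous_const
  by_cases hr : G.Reachable a b
  · obtain ⟨p, hp⟩ := exists_isPath hr
    have hne : p.edges.toFinset.Nonempty := by
      obtain ⟨e, he⟩ := edges_nonempty hab p
      exact ⟨e, List.mem_toFinset.2 he⟩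
    have : (fun t => pathWeight G t a b) = fun t => p.edges.toFinset.inf' hne t := by
      funext t
      rw [pathWeight_of_isPath hG t hab p hp, Finset.inf'_eq_csInf_image]
      congr 2
      ext e
      simp
    rw [this]
    exact Continuous.finset_inf'_apply hne fun e _ => continuous_apply e
  -- Between vertices that no path connects, the infimum is over the empty set, that is `0`.
  · have : (fun t => pathWeight G t a b) = fun _ => 0 := by
      funext t
      have : {x : ℝ | ∃ (p : G.Walk a b) (ℓ : G.edgeSet),
          p.IsPath ∧ (ℓ : Sym2 (Fin n)) ∈ p.edges ∧ x = t ℓ} = ∅ := by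
        ext x
        simp only [Set.mem_ofPred_eq, Set.mem_empty_iff_false, iff_false]
        rintro ⟨p, -⟩
        exact hr p.reachable
      simp only [pathWeight, treeWeight, if_neg hab, this, Real.sInf_empty]
    rw [this]
    exact continuous_const

namespace Split

theorem edgeSet_eq (h : Split G v₁ v₂ S₁ S₂ G₁ G₂) :
    G.edgeSet = insert s(v₁, v₂) (G₁.edgeSet ∪ G₂.edgeSet) := by
  ext e
  induction e with
  | _ a b =>
    simp only [SimpleGraph.mem_edgeSet, h.adj_iff, Set.mem_insert_iff, Set.mem_union]
    tauto

theorem pathWeight_left (h : Split G v₁ v₂ S₁ S₂ G₁ G₂) (t : Sym2 (Fin n) → ℝ) {a b : Fin n}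
    (ha : a ∈ S₁) (hb : b ∈ S₁) : pathWeight G t a b = pathWeight G₁ t a b := by
  by_cases hab : a = b
  · subst hab; simp [pathWeight_self]
  obtain ⟨p, hp⟩ := exists_isPath (h.tree₁.reachable a ha b hb)
  rw [pathWeight_of_isPath h.tree₁.acyclic t hab p hp, pathWeight_of_isPath h.isTreeOn.acyclic t hab
    (p.mapLe h.le₁) (hp.mapLe h.le₁), SimpleGraph.Walk.edges_mapLe_eq_edges]

/-- Every path from `S₁` to `S₂` uses the joining edge, which carries the smallest weight. -/
theorem pathWeight_cross (h : Split G v₁ v₂ S₁ S₂ G₁ G₂) {t : Sym2 (Fin n) → ℝ}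
    (ht : ∀ e ∈ G.edgeSet, t s(v₁, v₂) ≤ t e) {a b : Fin n} (ha : a ∈ S₁) (hb : b ∈ S₂) :
    pathWeight G t a b = t s(v₁, v₂) := by
  have hab : a ≠ b := fun e => h.not_mem₂ ha (e ▸ hb)
  obtain ⟨p, hp⟩ := exists_isPath (h.isTreeOn.reachable a (Finset.mem_union_left _ ha) b
    (Finset.mem_union_right _ hb))
  rw [pathWeight_of_isPath h.isTreeOn.acyclic t hab p hp]
  have hmem : s(v₁, v₂) ∈ p.edges := by
    by_contra hn
    have hle : ∀ e ∈ p.edges, e ∈ (G₁ ⊔ G₂).edgeSet := by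
      intro e he
      have h1 := p.edges_subset_edgeSet he
      rw [← h.deleteEdges_eq, SimpleGraph.edgeSet_deleteEdges]
      exact ⟨h1, fun e' => hn (Set.mem_singleton_iff.1 e' ▸ he)⟩
    exact h.not_mem₂ (h.walk_mem (p.transfer _ hle) ha).1 hb
  refine IsLeast.csInf_eq ⟨⟨_, hmem, rfl⟩, ?_⟩
  rintro _ ⟨e, he, rfl⟩
  exact ht e (p.edges_subset_edgeSet he)

end Split

/-- The path weights between vertices of `S`, extended by zero. -/
def maskedWeight (G : SimpleGraph (Fin n)) (S : Finset (Fin n)) (t : Sym2 (Fin n) → ℝ) :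
    Matrix (Fin n) (Fin n) ℝ :=
  Matrix.of fun a b => if a ∈ S ∧ b ∈ S then pathWeight G t a b else 0

/-- The indicator vector of `S`. -/
def indicatorVec (S : Finset (Fin n)) : Fin n → ℝ := fun a => if a ∈ S then 1 else 0

theorem maskedWeight_univ (G : SimpleGraph (Fin n)) (t : Sym2 (Fin n) → ℝ) :
    maskedWeight G Finset.univ t = pathWeight G t := by
  ext a b; simp [maskedWeight]

theorem maskedWeight_congr (hG : IsTreeOn G S) {t t' : Sym2 (Fin n) → ℝ}
    (h : ∀ e ∈ G.edgeSet, t e = t' e) : maskedWeight G S t = maskedWeight G S t' := by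
  ext a b
  by_cases hab : a ∈ S ∧ b ∈ S
  · simp only [maskedWeight, Matrix.of_apply, if_pos hab]
    exact pathWeight_congr hG h hab.1 hab.2
  · simp [maskedWeight, if_neg hab]

theorem maskedWeight_singleton (G : SimpleGraph (Fin n)) (v : Fin n) (t : Sym2 (Fin n) → ℝ) :
    maskedWeight G {v} t
      = Matrix.vecMulVec (indicatorVec {v}) (indicatorVec {v}) := by
  ext a b
  simp only [maskedWeight, Matrix.of_apply, Finset.mem_singleton, Matrix.vecMulVec_apply,
    indicatorVec]
  by_cases ha : a = v <;> by_cases hb : b = v <;> simp [ha, hb, pathWeight_self]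

theorem continuous_maskedWeight (hG : G.IsAcyclic) (S : Finset (Fin n)) :
    Continuous fun t => maskedWeight G S t := by
  refine continuous_matrix fun a b => ?_
  simp only [maskedWeight, Matrix.of_apply]
  split_ifs
  · exact continuous_pathWeight hG a b
  · exact continuous_const

/-- At the smallest line weight `r`, the weight matrix splits into a part that is common to all
vertices and the rescaled weight matrices of the two parts of the tree. -/
theorem Split.maskedWeight_eq (h : Split G v₁ v₂ S₁ S₂ G₁ G₂) {t t' : Sym2 (Fin n) → ℝ} {r : ℝ}
    (hr : r ≤ 1) (ht : t s(v₁, v₂) = r)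
    (ht' : ∀ e ∈ G₁.edgeSet ∪ G₂.edgeSet, t e = r + (1 - r) * t' e)
    (h0 : ∀ e ∈ G₁.edgeSet ∪ G₂.edgeSet, 0 ≤ t' e) :
    maskedWeight G (S₁ ∪ S₂) t
      = r • Matrix.vecMulVec (indicatorVec (S₁ ∪ S₂)) (indicatorVec (S₁ ∪ S₂))
        + (1 - r) • (maskedWeight G₁ S₁ t' + maskedWeight G₂ S₂ t') := by
  have hmin : ∀ e ∈ G.edgeSet, t s(v₁, v₂) ≤ t e := by
    intro e he
    rw [h.edgeSet_eq] at he
    rcases he with rfl | he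
    · exact le_rfl
    · rw [ht, ht' e he]
      nlinarith [h0 e he]
  have hsame : ∀ {G₁ G₂ : SimpleGraph (Fin n)} {S₁ S₂ : Finset (Fin n)} {v₁ v₂ : Fin n},
      Split G v₁ v₂ S₁ S₂ G₁ G₂ → (∀ e ∈ G₁.edgeSet, t e = r + (1 - r) * t' e) →
      ∀ a ∈ S₁, ∀ b ∈ S₁, pathWeight G t a b = r + (1 - r) * pathWeight G₁ t' a b := by
    intro G₁ G₂ S₁ S₂ v₁ v₂ h ht' a ha b hb
    rw [h.pathWeight_left t ha hb, pathWeight_congr h.tree₁ ht' ha hb,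
      pathWeight_affine h.tree₁ t' hr ha hb]
  have hmin' : ∀ e ∈ G.edgeSet, t s(v₂, v₁) ≤ t e := by rwa [Sym2.eq_swap]
  ext a b
  simp only [maskedWeight, Matrix.of_apply, Matrix.add_apply, Matrix.smul_apply, smul_eq_mul,
    Matrix.vecMulVec_apply, indicatorVec, Finset.mem_union]
  by_cases ha1 : a ∈ S₁ <;> by_cases hb1 : b ∈ S₁
  · have ha2 := h.not_mem₂ ha1
    simp [ha1, hb1, ha2, hsame h (fun e he => ht' e (Or.inl he)) a ha1 b hb1]
  · by_cases hb2 : b ∈ S₂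
    · have ha2 := h.not_mem₂ ha1
      simp [ha1, hb1, ha2, hb2, h.pathWeight_cross hmin ha1 hb2, ht]
    · simp [ha1, hb1, hb2]
  · by_cases ha2 : a ∈ S₂
    · have hb2 := h.not_mem₂ hb1
      simp [ha1, hb1, ha2, hb2, h.symm.pathWeight_cross hmin' ha2 hb1, Sym2.eq_swap (a := v₂), ht]
    · simp [ha1, hb1, ha2]
  · by_cases ha2 : a ∈ S₂ <;> by_cases hb2 : b ∈ S₂
    · simp [ha1, hb1, ha2, hb2, hsame h.symm (fun e he => ht' e (Or.inr he)) a ha2 b hb2]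
    all_goals simp [ha1, hb1, ha2, hb2]

/-- Cutting a tree with at least two vertices at a line of smallest weight. -/
theorem IsTreeOn.exists_min_split (hG : IsTreeOn G S) (hS : 1 < S.card) (t : Sym2 (Fin n) → ℝ) :
    ∃ v₁ v₂ S₁ S₂ G₁ G₂, Split G v₁ v₂ S₁ S₂ G₁ G₂ ∧ S₁ ∪ S₂ = S ∧
      ∀ e ∈ G.edgeSet, t s(v₁, v₂) ≤ t e := by
  obtain ⟨a, ha⟩ := hG.nonempty
  obtain ⟨b, hab⟩ := hG.exists_adj hS ha
  obtain ⟨ℓ, hℓ, hmin⟩ := Set.exists_min_image G.edgeSet t (Set.toFinite _) ⟨s(a, b), hab⟩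
  induction ℓ with
  | _ v₁ v₂ =>
    obtain ⟨hs, hu⟩ := hG.split hℓ
    exact ⟨v₁, v₂, _, _, _, _, hs, hu, hmin⟩

theorem posSemidef_vecMulVec (x : Fin n → ℝ) : (Matrix.vecMulVec x x).PosSemidef := by
  simpa using Matrix.posSemidef_vecMulVec_self_star x

/-- Path weights with line weights in the unit interval are positive semidefinite. -/
theorem posSemidef_maskedWeight (hG : IsTreeOn G S) {t : Sym2 (Fin n) → ℝ}
    (ht : ∀ e ∈ G.edgeSet, t e ∈ Set.Icc (0 : ℝ) 1) : (maskedWeight G S t).PosSemidef := by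
  induction hc : S.card using Nat.strong_induction_on generalizing G S t with
  | _ k ih =>
  have hpos := hG.nonempty.card_pos
  by_cases h1 : S.card = 1
  · obtain ⟨v, rfl⟩ := Finset.card_eq_one.1 h1
    rw [maskedWeight_singleton]
    exact posSemidef_vecMulVec _
  obtain ⟨v₁, v₂, S₁, S₂, G₁, G₂, hs, rfl, hmin⟩ := hG.exists_min_split (by omega) t
  have hcard := Finset.card_union_of_disjoint hs.disjoint
  have hc1 : 0 < S₁.card := Finset.card_pos.2 ⟨_, hs.mem₁⟩
  have hc2 : 0 < S₂.card := Finset.card_pos.2 ⟨_, hs.mem₂⟩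
  have hr := ht s(v₁, v₂) hs.adj
  set r := t s(v₁, v₂)
  have hsub : ∀ e ∈ G₁.edgeSet ∪ G₂.edgeSet, e ∈ G.edgeSet := fun e he => by
    rw [hs.edgeSet_eq]; exact Or.inr he
  have hr1 : 0 ≤ 1 - r := by linarith [hr.2]
  -- The line weights on the two sides of the cut, rescaled from `[r, 1]` to `[0, 1]`. For `r = 1`
  -- all of them equal `1`, and the value `0` of the quotient does no harm.
  let t' : Sym2 (Fin n) → ℝ := fun e => (t e - r) / (1 - r)
  have ht' : ∀ e ∈ G₁.edgeSet ∪ G₂.edgeSet, t e = r + (1 - r) * t' e := by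
    intro e he
    by_cases hr1' : r = 1
    · have h1 := hmin e (hsub e he)
      have h2 := (ht e (hsub e he)).2
      rw [hr1'] at h1 ⊢
      linarith
    · have : 1 - r ≠ 0 := fun h => hr1' (by linarith)
      simp only [t']
      field_simp
      ring
  have h0 : ∀ e ∈ G₁.edgeSet ∪ G₂.edgeSet, t' e ∈ Set.Icc (0 : ℝ) 1 := fun e he =>
    ⟨div_nonneg (by linarith [hmin e (hsub e he)]) hr1,
      div_le_one_of_le₀ (by linarith [(ht e (hsub e he)).2]) hr1⟩
  rw [hs.maskedWeight_eq (t' := t') hr.2 rfl ht' fun e he => (h0 e he).1]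
  refine ((posSemidef_vecMulVec _).smul hr.1).add (Matrix.PosSemidef.smul (.add ?_ ?_) hr1)
  · exact ih _ (by omega) hs.tree₁ (fun e he => h0 e (Or.inl he)) rfl
  · exact ih _ (by omega) hs.tree₂ (fun e he => h0 e (Or.inr he)) rfl

end Weights

/-! ### Gaussian tuples -/

section GaussianTuples

open scoped MatrixOrder RealInnerProductSpace

variable {n N : ℕ}

/-- The real coordinates of an `n`-tuple of Hermitian matrices. -/
abbrev TupleCoord (n N : ℕ) : Type := EuclideanSpace ℝ (Fin n × Fin N × Fin N)

/-- The coordinates of the matrix with index `v`. -/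
def slot (v : Fin n) : TupleCoord n N →L[ℝ] Coord N :=
  LinearMap.toContinuousLinearMap
    { toFun := fun x => WithLp.toLp 2 fun a => x (v, a)
      map_add' := fun x y => by ext a; simp
      map_smul' := fun c x => by ext a; simp }

/-- The tuple that repeats one matrix at all indices in `S`. -/
def spread (S : Finset (Fin n)) : Coord N →L[ℝ] TupleCoord n N :=
  LinearMap.toContinuousLinearMap
    { toFun := fun x => WithLp.toLp 2 fun p => indicatorVec S p.1 * x p.2
      map_add' := fun x y => by ext a; simp [mul_add]
      map_smul' := fun c x => by ext a; simp [mul_left_comm] }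

/-- The sum of the matrices with index in `S`. -/
def gather (S : Finset (Fin n)) (x : TupleCoord n N) : Coord N :=
  WithLp.toLp 2 fun a => ∑ v, indicatorVec S v * x (v, a)

/-- Removal of the matrices with index outside `S`. -/
def maskTuple (S : Finset (Fin n)) : TupleCoord n N →L[ℝ] TupleCoord n N :=
  LinearMap.toContinuousLinearMap
    { toFun := fun x => WithLp.toLp 2 fun p => indicatorVec S p.1 * x p
      map_add' := fun x y => by ext a; simp [mul_add]
      map_smul' := fun c x => by ext a; simp [mul_left_comm] }

@[simp] theorem slot_apply (v : Fin n) (x : TupleCoord n N) (a : Fin N × Fin N) :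
    slot v x a = x (v, a) := rfl

@[simp] theorem spread_apply (S : Finset (Fin n)) (x : Coord N) (p : Fin n × Fin N × Fin N) :
    spread S x p = indicatorVec S p.1 * x p.2 := rfl

@[simp] theorem maskTuple_apply (S : Finset (Fin n)) (x : TupleCoord n N)
    (p : Fin n × Fin N × Fin N) : maskTuple S x p = indicatorVec S p.1 * x p := rfl

/-- The law of the coordinates of a Gaussian tuple of covariance `W`. -/
def tupleGaussian (N : ℕ) (W : Matrix (Fin n) (Fin n) ℝ) : Measure (TupleCoord n N) :=
  multivariateGaussian 0 (W ⊗ₖ (1 : Matrix (Fin N × Fin N) (Fin N × Fin N) ℝ))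

instance (W : Matrix (Fin n) (Fin n) ℝ) : IsProbabilityMeasure (tupleGaussian N W) := by
  unfold tupleGaussian; infer_instance

/-- The quadratic form of the covariance of a Gaussian tuple. -/
def covForm (W : Matrix (Fin n) (Fin n) ℝ) (x : TupleCoord n N) : ℝ :=
  ∑ v, ∑ v', W v v' * ∑ a, x (v, a) * x (v', a)

theorem posSemidef_kronecker_one {W : Matrix (Fin n) (Fin n) ℝ} (hW : W.PosSemidef) :
    (W ⊗ₖ (1 : Matrix (Fin N × Fin N) (Fin N × Fin N) ℝ)).PosSemidef :=
  hW.kronecker Matrix.PosSemidef.one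

theorem charFun_tupleGaussian {W : Matrix (Fin n) (Fin n) ℝ} (hW : W.PosSemidef)
    (x : TupleCoord n N) :
    charFun (tupleGaussian N W) x = Complex.exp (-(covForm W x : ℂ) / 2) := by
  rw [tupleGaussian, charFun_multivariateGaussian (posSemidef_kronecker_one hW)]
  have : x.ofLp ⬝ᵥ (W ⊗ₖ (1 : Matrix (Fin N × Fin N) (Fin N × Fin N) ℝ)).mulVec x.ofLp
      = covForm W x := by
    simp only [dotProduct, Matrix.mulVec, covForm]
    rw [Fintype.sum_prod_type]
    refine Finset.sum_congr rfl fun v _ => ?_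
    simp only [Fintype.sum_prod_type (α₁ := Fin n), Matrix.kroneckerMap_apply, Matrix.one_apply,
      Finset.mul_sum]
    rw [Finset.sum_comm]
    refine Finset.sum_congr rfl fun v' _ => Finset.sum_congr rfl fun a _ => ?_
    rw [Finset.sum_eq_single a]
    · simp; ring
    · intro b _ hb; simp [hb.symm]
    · simp
  rw [this]
  simp [neg_div]

/-- The constant covariance on `S` has the square of the sum over `S` as its quadratic form. -/
theorem covForm_ones (S : Finset (Fin n)) (x : TupleCoord n N) :
    covForm (Matrix.vecMulVec (indicatorVec S) (indicatorVec S)) x = ‖gather S x‖ ^ 2 := by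
  rw [EuclideanSpace.real_norm_sq_eq]
  have hsq : ∀ a, (gather S x a) ^ 2 = ∑ v, ∑ v', (indicatorVec S v * x (v, a)) *
      (indicatorVec S v' * x (v', a)) := fun a => by
    rw [sq, gather, Finset.sum_mul_sum]
  simp only [hsq]
  rw [Finset.sum_comm]
  refine Finset.sum_congr rfl fun v _ => ?_
  rw [Finset.sum_comm]
  refine Finset.sum_congr rfl fun v' _ => ?_
  rw [Matrix.vecMulVec_apply, Finset.mul_sum]
  exact Finset.sum_congr rfl fun a _ => by ring

theorem covForm_maskTuple {W : Matrix (Fin n) (Fin n) ℝ} {S : Finset (Fin n)}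
    (hW : ∀ v v', ¬ (v ∈ S ∧ v' ∈ S) → W v v' = 0) (x : TupleCoord n N) :
    covForm W (maskTuple S x) = covForm W x := by
  simp only [covForm, maskTuple_apply]
  refine Finset.sum_congr rfl fun v _ => Finset.sum_congr rfl fun v' _ => ?_
  by_cases h : v ∈ S ∧ v' ∈ S
  · simp [indicatorVec, h.1, h.2]
  · simp [hW v v' h]

theorem inner_spread (S : Finset (Fin n)) (x : Coord N) (t : TupleCoord n N) :
    ⟪spread S x, t⟫ = ⟪x, gather S t⟫ := by
  simp only [PiLp.inner_apply, spread_apply, gather, RCLike.inner_apply, conj_trivial,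
    Fintype.sum_prod_type (α₁ := Fin n), Finset.sum_mul]
  rw [Finset.sum_comm]
  exact Finset.sum_congr rfl fun a _ => Finset.sum_congr rfl fun v _ => by ring

theorem inner_maskTuple (S : Finset (Fin n)) (x t : TupleCoord n N) :
    ⟪maskTuple S x, t⟫ = ⟪x, maskTuple S t⟫ := by
  simp only [PiLp.inner_apply, maskTuple_apply, RCLike.inner_apply, conj_trivial]
  exact Finset.sum_congr rfl fun a _ => by ring

/-- A constant covariance on `S` means that all members of the tuple with index in `S` coincide. -/
theorem tupleGaussian_ones (S : Finset (Fin n)) :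
    tupleGaussian N (Matrix.vecMulVec (indicatorVec S) (indicatorVec S))
      = (stdGaussian (Coord N)).map (spread S) := by
  have : IsProbabilityMeasure ((stdGaussian (Coord N)).map (spread S)) :=
    Measure.isProbabilityMeasure_map (spread S).continuous.aemeasurable
  refine Measure.ext_of_charFun (funext fun t => ?_)
  rw [charFun_tupleGaussian (posSemidef_vecMulVec _), covForm_ones, charFun_apply,
    integral_map (spread S).continuous.aemeasurable
      (Continuous.aestronglyMeasurable (by fun_prop))]
  simp only [inner_spread]
  rw [← charFun_apply, charFun_stdGaussian]
  push_cast
  rfl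

/-- A Gaussian tuple with a common component and two independent families. -/
theorem tupleGaussian_split {W W₁ W₂ : Matrix (Fin n) (Fin n) ℝ} {S S₁ S₂ : Finset (Fin n)}
    {r : ℝ} (hr : r ∈ Set.Icc (0 : ℝ) 1) (hW₁ : W₁.PosSemidef) (hW₂ : W₂.PosSemidef)
    (h₁ : ∀ v v', ¬ (v ∈ S₁ ∧ v' ∈ S₁) → W₁ v v' = 0)
    (h₂ : ∀ v v', ¬ (v ∈ S₂ ∧ v' ∈ S₂) → W₂ v v' = 0)
    (hW : W = r • Matrix.vecMulVec (indicatorVec S) (indicatorVec S) + (1 - r) • (W₁ + W₂)) :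
    tupleGaussian N W
      = ((stdGaussian (Coord N)).prod ((tupleGaussian N W₁).prod (tupleGaussian N W₂))).map
        fun p => √r • spread S p.1 + √(1 - r) • (maskTuple S₁ p.2.1 + maskTuple S₂ p.2.2) := by
  have hcont : Continuous fun p : Coord N × TupleCoord n N × TupleCoord n N =>
      √r • spread S p.1 + √(1 - r) • (maskTuple S₁ p.2.1 + maskTuple S₂ p.2.2) := by fun_prop
  have : IsProbabilityMeasure (((stdGaussian (Coord N)).prod
      ((tupleGaussian N W₁).prod (tupleGaussian N W₂))).map fun p =>
        √r • spread S p.1 + √(1 - r) • (maskTuple S₁ p.2.1 + maskTuple S₂ p.2.2)) :=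
    Measure.isProbabilityMeasure_map hcont.aemeasurable
  have hr1 : 0 ≤ 1 - r := by linarith [hr.2]
  have hpsd : W.PosSemidef := by
    rw [hW]
    exact ((posSemidef_vecMulVec _).smul hr.1).add (Matrix.PosSemidef.smul (.add hW₁ hW₂) hr1)
  have hform : ∀ t : TupleCoord n N, covForm W t = r * ‖gather S t‖ ^ 2
      + (1 - r) * (covForm W₁ (maskTuple S₁ t) + covForm W₂ (maskTuple S₂ t)) := by
    intro t
    rw [covForm_maskTuple h₁, covForm_maskTuple h₂, ← covForm_ones, hW]
    simp only [covForm, Finset.mul_sum, ← Finset.sum_add_distrib, Matrix.add_apply,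
      Matrix.smul_apply, smul_eq_mul]
    refine Finset.sum_congr rfl fun v _ => Finset.sum_congr rfl fun v' _ =>
      Finset.sum_congr rfl fun a _ => by ring
  have hscale : ∀ (W : Matrix (Fin n) (Fin n) ℝ) (c : ℝ) (t : TupleCoord n N), 0 ≤ c →
      covForm W (√c • t) = c * covForm W t := by
    intro W c t hc
    have hs : √c * √c = c := Real.mul_self_sqrt hc
    simp only [covForm, Finset.mul_sum, PiLp.smul_apply, smul_eq_mul]
    refine Finset.sum_congr rfl fun v _ => Finset.sum_congr rfl fun v' _ =>
      Finset.sum_congr rfl fun a _ => ?_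
    linear_combination W v v' * t (v, a) * t (v', a) * hs
  -- Both sides have the characteristic function `exp (-covForm W t / 2)`.
  refine Measure.ext_of_charFun (funext fun t => ?_)
  rw [charFun_tupleGaussian hpsd, hform, charFun_apply, integral_map hcont.aemeasurable
    (Continuous.aestronglyMeasurable (by fun_prop))]
  have hexp : ∀ p : Coord N × TupleCoord n N × TupleCoord n N,
      Complex.exp ((⟪√r • spread S p.1 + √(1 - r) • (maskTuple S₁ p.2.1 + maskTuple S₂ p.2.2), t⟫ : ℝ)
        * Complex.I)
      = Complex.exp ((⟪p.1, √r • gather S t⟫ : ℝ) * Complex.I) *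
        (Complex.exp ((⟪p.2.1, √(1 - r) • maskTuple S₁ t⟫ : ℝ) * Complex.I) *
          Complex.exp ((⟪p.2.2, √(1 - r) • maskTuple S₂ t⟫ : ℝ) * Complex.I)) := by
    intro p
    rw [← Complex.exp_add, ← Complex.exp_add]
    congr 1
    simp only [inner_add_left, real_inner_smul_left, real_inner_smul_right, inner_spread,
      inner_maskTuple]
    push_cast
    ring
  simp only [hexp]
  rw [integral_prod_mul (fun x : Coord N => Complex.exp ((⟪x, √r • gather S t⟫ : ℝ) * Complex.I))
    (fun q : TupleCoord n N × TupleCoord n N =>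
      Complex.exp ((⟪q.1, √(1 - r) • maskTuple S₁ t⟫ : ℝ) * Complex.I) *
          Complex.exp ((⟪q.2, √(1 - r) • maskTuple S₂ t⟫ : ℝ) * Complex.I)),
    integral_prod_mul (fun x : TupleCoord n N =>
      Complex.exp ((⟪x, √(1 - r) • maskTuple S₁ t⟫ : ℝ) * Complex.I))
    (fun x => Complex.exp ((⟪x, √(1 - r) • maskTuple S₂ t⟫ : ℝ) * Complex.I)),
    ← charFun_apply, ← charFun_apply, ← charFun_apply, charFun_stdGaussian,
    charFun_tupleGaussian hW₁, charFun_tupleGaussian hW₂, ← Complex.exp_add, ← Complex.exp_add,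
    hscale _ _ _ hr1, hscale _ _ _ hr1, norm_smul, Real.norm_of_nonneg (Real.sqrt_nonneg r)]
  congr 1
  have hs : ((√r : ℝ) : ℂ) * √r = r := by exact_mod_cast Real.mul_self_sqrt hr.1
  push_cast
  linear_combination -(1 / 2 : ℂ) * (‖gather S t‖ : ℂ) ^ 2 * hs.symm

theorem integrable_prod_of_bounded {ι E : Type*} [TopologicalSpace E] [MeasurableSpace E]
    [OpensMeasurableSpace E] {μ : Measure E} [IsFiniteMeasure μ] {S : Finset ι} {g : ι → E → ℂ}
    (hg : ∀ v ∈ S, Continuous (g v)) {C : ι → ℝ} (hC : ∀ v ∈ S, ∀ x, ‖g v x‖ ≤ C v)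
    [SecondCountableTopologyEither E ℂ] :
    Integrable (fun x => ∏ v ∈ S, g v x) μ := by
  refine Integrable.of_bound (C := ∏ v ∈ S, C v)
    (continuous_finsetProd S hg).aestronglyMeasurable (.of_forall fun x => ?_)
  rw [norm_prod]
  exact Finset.prod_le_prod (fun _ _ => norm_nonneg _) fun v hv => hC v hv x

/-- Conditionally on the common component, the two families are independent, so that the average of
a product factorizes. -/
theorem integral_tupleGaussian_split {W W₁ W₂ : Matrix (Fin n) (Fin n) ℝ} {S₁ S₂ : Finset (Fin n)}
    {r : ℝ} (hr : r ∈ Set.Icc (0 : ℝ) 1) (hW₁ : W₁.PosSemidef) (hW₂ : W₂.PosSemidef)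
    (h₁ : ∀ v v', ¬ (v ∈ S₁ ∧ v' ∈ S₁) → W₁ v v' = 0)
    (h₂ : ∀ v v', ¬ (v ∈ S₂ ∧ v' ∈ S₂) → W₂ v v' = 0) (hdisj : Disjoint S₁ S₂)
    (hW : W = r • Matrix.vecMulVec (indicatorVec (S₁ ∪ S₂)) (indicatorVec (S₁ ∪ S₂))
      + (1 - r) • (W₁ + W₂)) {f : Fin n → Coord N → ℂ} (hf : ∀ v ∈ S₁ ∪ S₂, Continuous (f v))
    {C : Fin n → ℝ} (hC : ∀ v ∈ S₁ ∪ S₂, ∀ x, ‖f v x‖ ≤ C v) :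
    ∫ x, ∏ v ∈ S₁ ∪ S₂, f v (slot v x) ∂(tupleGaussian N W)
      = ∫ x, (∫ y, ∏ v ∈ S₁, f v (√r • x + √(1 - r) • slot v y) ∂(tupleGaussian N W₁)) *
          (∫ y, ∏ v ∈ S₂, f v (√r • x + √(1 - r) • slot v y) ∂(tupleGaussian N W₂))
          ∂(stdGaussian (Coord N)) := by
  have hcont : Continuous fun p : Coord N × TupleCoord n N × TupleCoord n N =>
      √r • spread (S₁ ∪ S₂) p.1 + √(1 - r) • (maskTuple S₁ p.2.1 + maskTuple S₂ p.2.2) := by fun_prop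
  have hfs : Continuous fun x : TupleCoord n N => ∏ v ∈ S₁ ∪ S₂, f v (slot v x) :=
    continuous_finsetProd _ fun v hv => (hf v hv).comp (slot v).continuous
  rw [tupleGaussian_split hr hW₁ hW₂ h₁ h₂ hW, integral_map hcont.aemeasurable
    hfs.aestronglyMeasurable, integral_prod]
  · refine integral_congr_ae (.of_forall fun x => ?_)
    beta_reduce
    rw [← integral_prod_mul]
    refine integral_congr_ae (.of_forall fun q => ?_)
    beta_reduce
    rw [Finset.prod_union hdisj]
    congr 1
    · refine Finset.prod_congr rfl fun v hv => ?_
      congr 1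
      ext a
      have hv2 : v ∉ S₂ := Finset.disjoint_left.1 hdisj hv
      simp [indicatorVec, hv, hv2]
    · refine Finset.prod_congr rfl fun v hv => ?_
      congr 1
      ext a
      have hv1 : v ∉ S₁ := Finset.disjoint_right.1 hdisj hv
      simp [indicatorVec, hv, hv1]
  · exact integrable_prod_of_bounded
      (g := fun v (p : Coord N × TupleCoord n N × TupleCoord n N) =>
        f v (slot v (√r • spread (S₁ ∪ S₂) p.1 + √(1 - r) • (maskTuple S₁ p.2.1 + maskTuple S₂ p.2.2))))
      (fun v hv => (hf v hv).comp ((slot v).continuous.comp hcont)) fun v hv x => hC v hv _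

theorem integral_tupleGaussian_singleton (v : Fin n) (f : Coord N → ℂ) (hf : Continuous f) :
    ∫ x, f (slot v x) ∂(tupleGaussian N (Matrix.vecMulVec (indicatorVec {v}) (indicatorVec {v})))
      = ∫ x, f x ∂(stdGaussian (Coord N)) := by
  have hfs : Continuous fun x : TupleCoord n N => f (slot v x) := hf.comp (slot v).continuous
  rw [tupleGaussian_ones, integral_map (spread {v}).continuous.aemeasurable
    hfs.aestronglyMeasurable]
  refine integral_congr_ae (.of_forall fun x => ?_)
  beta_reduce
  congr 1
  ext a
  simp [indicatorVec]

/-- The square root of the covariance, as a linear map on tuples. -/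
def sqrtCov (N : ℕ) (W : Matrix (Fin n) (Fin n) ℝ) : TupleCoord n N →L[ℝ] TupleCoord n N :=
  Matrix.toEuclideanCLM (𝕜 := ℝ)
    (CFC.sqrt (W ⊗ₖ (1 : Matrix (Fin N × Fin N) (Fin N × Fin N) ℝ)))

theorem tupleGaussian_eq_map (W : Matrix (Fin n) (Fin n) ℝ) :
    tupleGaussian N W = (stdGaussian (TupleCoord n N)).map (sqrtCov N W) := by
  simp [tupleGaussian, multivariateGaussian, sqrtCov]

/-- The square root of a positive semidefinite matrix depends continuously on it. This makes
averages over Gaussian tuples continuous in the line weights, including degenerate covariances. -/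
theorem continuous_sqrtCov {Y : Type*} [TopologicalSpace Y] {W : Y → Matrix (Fin n) (Fin n) ℝ}
    (hW : Continuous W) (hpsd : ∀ y, (W y).PosSemidef) : Continuous fun y => sqrtCov N (W y) := by
  have h1 : Continuous fun y => W y ⊗ₖ (1 : Matrix (Fin N × Fin N) (Fin N × Fin N) ℝ) :=
    continuous_matrix fun i j => by
      simp only [Matrix.kroneckerMap_apply]
      exact (hW.matrix_elem i.1 j.1).mul continuous_const
  have h2 : Continuous fun y =>
      CFC.sqrt (W y ⊗ₖ (1 : Matrix (Fin N × Fin N) (Fin N × Fin N) ℝ)) :=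
    (CFC.continuousOn_sqrt (A := Matrix (Fin n × Fin N × Fin N) (Fin n × Fin N × Fin N)
      ℝ)).comp_continuous h1 fun y => (posSemidef_kronecker_one (hpsd y)).nonneg
  have h3 : Continuous fun A : Matrix (Fin n × Fin N × Fin N) (Fin n × Fin N × Fin N) ℝ =>
      Matrix.toEuclideanCLM (𝕜 := ℝ) A :=
    LinearMap.continuous_of_finiteDimensional
      (Matrix.toEuclideanCLM (𝕜 := ℝ) (n := Fin n × Fin N × Fin N)).toAlgEquiv.toLinearMap
  exact h3.comp h2

theorem integral_tupleGaussian (W : Matrix (Fin n) (Fin n) ℝ) {f : TupleCoord n N → ℂ}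
    (hf : Continuous f) :
    ∫ x, f x ∂(tupleGaussian N W) = ∫ x, f (sqrtCov N W x) ∂(stdGaussian (TupleCoord n N)) := by
  rw [tupleGaussian_eq_map, integral_map (sqrtCov N W).continuous.aemeasurable
    hf.aestronglyMeasurable]

end GaussianTuples

/-! ### The polarized expansion -/

section PolyFlow

variable {n N : ℕ} {ρ : ℝ} {σ : Mat N}

/-- The nonempty proper subsets. -/
def properParts (S : Finset (Fin n)) : Finset (Finset (Fin n)) := S.ssubsets.erase ∅

theorem mem_properParts {S S₁ : Finset (Fin n)} :
    S₁ ∈ properParts S ↔ S₁.Nonempty ∧ S₁ ⊂ S := by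
  simp [properParts, Finset.mem_ssubsets, Finset.nonempty_iff_ne_empty]

theorem card_lt_of_mem_properParts {S S₁ : Finset (Fin n)} (h : S₁ ∈ properParts S) :
    S₁.card < S.card ∧ (S \ S₁).card < S.card := by
  rw [mem_properParts] at h
  refine ⟨Finset.card_lt_card h.2, ?_⟩
  rw [Finset.card_sdiff_of_subset h.2.subset]
  have := h.1.card_pos
  have := Finset.card_lt_card h.2
  omega

/-- The multilinear version of `flow`, with a potential `F v` for each vertex `v`: the total
contribution of the trees on the vertex set `S`. -/
def polyFlow (F : Fin n → Mat N → ℂ) (S : Finset (Fin n)) : ℝ → Mat N → ℂ :=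
  if S.card = 1 then fun u => heat (1 - clamp u) fun σ => ∏ v ∈ S, F v σ
  else duhamel fun s σ => 1 / 2 * ∑ S₁ : properParts S,
    pairing (polyFlow F S₁ s) (polyFlow F (S \ S₁) s) σ
termination_by S.card
decreasing_by
  · exact (card_lt_of_mem_properParts S₁.2).1
  · exact (card_lt_of_mem_properParts S₁.2).2

/-- The source term of the equation for `polyFlow`. -/
def polySource (F : Fin n → Mat N → ℂ) (S : Finset (Fin n)) (s : ℝ) (σ : Mat N) : ℂ :=
  1 / 2 * ∑ S₁ ∈ properParts S, pairing (polyFlow F S₁ s) (polyFlow F (S \ S₁) s) σ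

theorem polyFlow_singleton (F : Fin n → Mat N → ℂ) (v : Fin n) :
    polyFlow F {v} = fun u => heat (1 - clamp u) (F v) := by
  rw [polyFlow]
  simp

theorem polyFlow_of_card_ne_one (F : Fin n → Mat N → ℂ) {S : Finset (Fin n)} (hS : S.card ≠ 1) :
    polyFlow F S = duhamel (polySource F S) := by
  rw [polyFlow, if_neg hS]
  congr 1
  funext s σ
  rw [polySource]
  congr 1
  exact Finset.sum_coe_sort (properParts S) fun S₁ =>
    pairing (polyFlow F S₁ s) (polyFlow F (S \ S₁) s) σ

theorem lipHolo_polyFlow {F : Fin n → Mat N → ℂ} (hF : ∀ v, LipHolo ρ (fun _ : Unit => F v))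
    (S : Finset (Fin n)) : LipHolo ρ (polyFlow F S) := by
  induction hc : S.card using Nat.strong_induction_on generalizing S with
  | _ k ih =>
  by_cases h1 : S.card = 1
  · obtain ⟨v, rfl⟩ := Finset.card_eq_one.1 h1
    rw [polyFlow_singleton]
    have := continuous_clamp
    exact (((hF v).const (T' := ℝ) ()).heat (τ := fun u => 1 - clamp u) (by fun_prop)).1
  · rw [polyFlow_of_card_ne_one F h1]
    refine (BddHolo.duhamel ?_).1.lipHolo
    refine (BddHolo.const (T := ℝ) (1 / 2)).mul (BddHolo.sum fun S₁ hS₁ => ?_)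
    have := card_lt_of_mem_properParts hS₁
    exact (ih _ (hc ▸ this.1) _ rfl).pairing (ih _ (hc ▸ this.2) _ rfl)

theorem bddHolo_polySource {F : Fin n → Mat N → ℂ} (hF : ∀ v, LipHolo ρ (fun _ : Unit => F v))
    (S : Finset (Fin n)) : BddHolo ρ (polySource F S) :=
  (BddHolo.const (T := ℝ) (1 / 2)).mul (BddHolo.sum fun _ _ =>
    (lipHolo_polyFlow hF _).pairing (lipHolo_polyFlow hF _))

theorem polyFlow_congr {F F' : Fin n → Mat N → ℂ} {S : Finset (Fin n)} (h : ∀ v ∈ S, F v = F' v) :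
    polyFlow F S = polyFlow F' S := by
  induction hc : S.card using Nat.strong_induction_on generalizing S with
  | _ k ih =>
  by_cases h1 : S.card = 1
  · obtain ⟨v, rfl⟩ := Finset.card_eq_one.1 h1
    rw [polyFlow_singleton, polyFlow_singleton, h v (Finset.mem_singleton_self v)]
  · rw [polyFlow_of_card_ne_one F h1, polyFlow_of_card_ne_one F' h1]
    congr 1
    funext s σ
    rw [polySource, polySource]
    congr 1
    refine Finset.sum_congr rfl fun S₁ hS₁ => ?_
    have := card_lt_of_mem_properParts hS₁
    have hsub := (mem_properParts.1 hS₁).2.subset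
    rw [ih _ (hc ▸ this.1) (fun v hv => h v (hsub hv)) rfl,
      ih _ (hc ▸ this.2) (fun v hv => h v (Finset.sdiff_subset hv)) rfl]

theorem heat_congr {f g : Mat N → ℂ} (h : ∀ τ ∈ strip ρ, f τ = g τ) (hσ : σ ∈ strip ρ) (t : ℝ) :
    heat t f σ = heat t g σ :=
  integral_congr_ae (.of_forall fun _ => h _ (add_hermitian_mem_strip hσ (herm_isHermitian _)))

theorem duhamel_congr {Q Q' : ℝ → Mat N → ℂ} {u : ℝ}
    (h : ∀ s ∈ Set.Ioc (clamp u) 1, ∀ τ ∈ strip ρ, Q s τ = Q' s τ)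
    (hσ : σ ∈ strip ρ) : duhamel Q u σ = duhamel Q' u σ := by
  rw [duhamel, duhamel, intervalIntegral.integral_of_le (clamp_le_one u),
    intervalIntegral.integral_of_le (clamp_le_one u)]
  exact setIntegral_congr_fun measurableSet_Ioc fun s hs => heat_congr (h s hs) hσ _

theorem heat_sum {ι : Type*} {s : Finset ι} {f : ι → Mat N → ℂ}
    (hf : ∀ i ∈ s, BddHolo ρ (fun _ : Unit => f i)) (hσ : σ ∈ strip ρ) (t : ℝ) :
    heat t (fun τ => ∑ i ∈ s, f i τ) σ = ∑ i ∈ s, heat t (f i) σ :=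
  integral_finsetSum _ fun i hi => (hf i hi).integrable_comp hσ () t

theorem BddHolo.const_param {T T' : Type*} [TopologicalSpace T] [TopologicalSpace T']
    {φ : T → Mat N → ℂ} (hφ : BddHolo ρ φ) (t : T) : BddHolo ρ (fun _ : T' => φ t) :=
  hφ.comp_param continuous_const

theorem duhamel_sum {ι : Type*} {s : Finset ι} {Q : ι → ℝ → Mat N → ℂ}
    (hQ : ∀ i ∈ s, BddHolo ρ (Q i)) (hσ : σ ∈ strip ρ) (u : ℝ) :
    duhamel (fun r τ => ∑ i ∈ s, Q i r τ) u σ = ∑ i ∈ s, duhamel (Q i) u σ := by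
  unfold duhamel
  rw [← intervalIntegral.integral_finsetSum]
  · congr 1
    funext r
    exact heat_sum (fun i hi => (hQ i hi).const_param r) hσ _
  · intro i hi
    exact (((hQ i hi).heat (τ := fun s => s - clamp u) (by fun_prop)).lipHolo.continuous_param
      hσ).intervalIntegrable _ _

theorem heat_const_mul (c : ℂ) (f : Mat N → ℂ) (t : ℝ) (σ : Mat N) :
    heat t (fun τ => c * f τ) σ = c * heat t f σ := integral_const_mul _ _

theorem duhamel_const_mul (c : ℂ) (Q : ℝ → Mat N → ℂ) (u : ℝ) (σ : Mat N) :
    duhamel (fun r τ => c * Q r τ) u σ = c * duhamel Q u σ := by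
  unfold duhamel
  simp only [heat_const_mul]
  exact intervalIntegral.integral_const_mul _ _

theorem pairing_congr {f f' g g' : Mat N → ℂ} (hf : ∀ τ ∈ strip ρ, f τ = f' τ)
    (hg : ∀ τ ∈ strip ρ, g τ = g' τ) (hσ : σ ∈ strip ρ) : pairing f g σ = pairing f' g' σ := by
  unfold pairing
  exact Finset.sum_congr rfl fun a _ => by rw [pderiv_congr hf hσ, pderiv_congr hg hσ]

theorem pairing_comm (f g : Mat N → ℂ) (σ : Mat N) : pairing f g σ = pairing g f σ := by
  unfold pairing
  rw [← (Equiv.prodComm (Fin N) (Fin N)).sum_comp]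
  exact Finset.sum_congr rfl fun a _ => mul_comm _ _

theorem pairing_sum_left {ι : Type*} {s : Finset ι} {f : ι → Mat N → ℂ} (g : Mat N → ℂ)
    (hf : ∀ i ∈ s, DifferentiableOn ℂ (f i) (strip ρ)) (hσ : σ ∈ strip ρ) :
    pairing (fun τ => ∑ i ∈ s, f i τ) g σ = ∑ i ∈ s, pairing (f i) g σ := by
  unfold pairing
  rw [Finset.sum_comm]
  refine Finset.sum_congr rfl fun a _ => ?_
  rw [pderiv_sum hf hσ, Finset.sum_mul]

theorem pairing_const_mul {f g : Mat N → ℂ} (hf : DifferentiableOn ℂ f (strip ρ))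
    (hg : DifferentiableOn ℂ g (strip ρ)) (c d : ℂ) (hσ : σ ∈ strip ρ) :
    pairing (fun τ => c * f τ) (fun τ => d * g τ) σ = c * d * pairing f g σ := by
  have h : ∀ {f : Mat N → ℂ}, DifferentiableOn ℂ f (strip ρ) → ∀ (c : ℂ) a,
      pderiv a (fun τ => c * f τ) σ = c * pderiv a f σ := fun hf c a => by
    unfold pderiv
    rw [fderiv_const_mul (hf.differentiableAt ((isOpen_strip ρ).mem_nhds hσ))]
    rfl
  unfold pairing
  rw [Finset.mul_sum]
  refine Finset.sum_congr rfl fun a _ => ?_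
  rw [h hf, h hg]
  ring

/-- The family of potentials in which one member is replaced by a derivative. -/
def derivAt (F : Fin n → Mat N → ℂ) (v : Fin n) (X : Mat N) : Fin n → Mat N → ℂ :=
  Function.update F v fun τ => fderiv ℂ (F v) τ X

theorem lipHolo_derivAt {F : Fin n → Mat N → ℂ} (hF : ∀ v, LipHolo ρ (fun _ : Unit => F v))
    (v : Fin n) (X : Mat N) (v' : Fin n) : LipHolo ρ (fun _ : Unit => derivAt F v X v') := by
  by_cases h : v' = v
  · subst h
    simpa [derivAt] using ((hF v').fderiv_apply X).lipHolo
  · simpa [derivAt, h] using hF v'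

/-- The product rule for the polarized expansion. -/
theorem fderiv_polyFlow {F : Fin n → Mat N → ℂ} (hF : ∀ v, LipHolo ρ (fun _ : Unit => F v))
    (S : Finset (Fin n)) (X : Mat N) (u : ℝ) (hσ : σ ∈ strip ρ) :
    fderiv ℂ (polyFlow F S u) σ X = ∑ v ∈ S, polyFlow (derivAt F v X) S u σ := by
  induction hc : S.card using Nat.strong_induction_on generalizing S u σ with
  | _ k ih =>
  by_cases h1 : S.card = 1
  · obtain ⟨v, rfl⟩ := Finset.card_eq_one.1 h1
    rw [Finset.sum_singleton, polyFlow_singleton, polyFlow_singleton,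
      ((hF v).heat (τ := fun _ => 1 - clamp u) continuous_const).2 () σ hσ]
    simp [derivAt]
  · rw [polyFlow_of_card_ne_one F h1, (bddHolo_polySource hF S).duhamel.2 u σ hσ]
    have hd : ∀ S' s, DifferentiableOn ℂ (polyFlow F S' s) (strip ρ) := fun S' s =>
      (lipHolo_polyFlow hF S').holo.holo s
    have key : ∀ s, ∀ τ ∈ strip ρ, fderiv ℂ (polySource F S s) τ X
        = ∑ v ∈ S, polySource (derivAt F v X) S s τ := by
      intro s τ hτ
      have h2 : HasFDerivAt (polySource F S s) ((1 / 2 : ℂ) • ∑ S₁ ∈ properParts S,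
          fderiv ℂ (pairing (polyFlow F S₁ s) (polyFlow F (S \ S₁) s)) τ) τ := by
        unfold polySource
        exact (HasFDerivAt.fun_sum fun S₁ _ => (((lipHolo_polyFlow hF S₁).pairing
          (lipHolo_polyFlow hF (S \ S₁))).holo.differentiableAt (isOpen_strip ρ) s
            hτ).hasFDerivAt).const_mul _
      rw [h2.fderiv]
      simp only [_root_.sum_apply, smul_apply, smul_eq_mul, polySource]
      rw [← Finset.mul_sum, Finset.sum_comm (s := S)]
      congr 1
      refine Finset.sum_congr rfl fun S₁ hS₁ => ?_
      have hcard := card_lt_of_mem_properParts hS₁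
      have hsub := (mem_properParts.1 hS₁).2.subset
      rw [fderiv_pairing (hd _ s) (hd _ s) hτ, ← pairing_eq_fderiv, ← pairing_eq_fderiv,
        pairing_congr (fun τ' hτ' => ih _ (hc ▸ hcard.1) S₁ s hτ' rfl) (fun _ _ => rfl) hτ,
        pairing_congr (fun τ' hτ' => ih _ (hc ▸ hcard.2) (S \ S₁) s hτ' rfl) (fun _ _ => rfl) hτ,
        pairing_sum_left _ (fun v _ => (lipHolo_polyFlow (lipHolo_derivAt hF v X) _).holo.holo s) hτ,
        pairing_sum_left _ (fun v _ => (lipHolo_polyFlow (lipHolo_derivAt hF v X) _).holo.holo s) hτ]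
      -- A derivative at a vertex of one part leaves the factor of the other part unchanged.
      rw [← Finset.sum_sdiff hsub, add_comm]
      congr 1
      · refine Finset.sum_congr rfl fun v hv => ?_
        rw [pairing_comm, polyFlow_congr (F := F) (F' := derivAt F v X) fun v' hv' => ?_]
        have : v' ≠ v := fun e => (Finset.mem_sdiff.1 hv).2 (e ▸ hv')
        simp [derivAt, this]
      · refine Finset.sum_congr rfl fun v hv => ?_
        rw [polyFlow_congr (F := F) (F' := derivAt F v X) fun v' hv' => ?_]
        have : v' ≠ v := fun e => (Finset.mem_sdiff.1 hv').2 (e ▸ hv)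
        simp [derivAt, this]
    rw [duhamel_congr (fun s _ τ hτ => key s τ hτ) hσ,
      duhamel_sum (fun v _ => bddHolo_polySource (lipHolo_derivAt hF v X) S) hσ]
    exact Finset.sum_congr rfl fun v _ => by
      rw [polyFlow_of_card_ne_one _ h1]

/-- With equal potentials, the polarized expansion counts `flow` with the number of orderings of
the vertices. -/
theorem polyFlow_const {V : Mat N → ℂ} (hV : LipHolo ρ (fun _ : Unit => V)) {S : Finset (Fin n)}
    (hS : S.Nonempty) (u : ℝ) (hσ : σ ∈ strip ρ) :
    polyFlow (fun _ => V) S u σ = (S.card.factorial : ℂ) * flow V (S.card - 1) u σ := by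
  induction hc : S.card using Nat.strong_induction_on generalizing S u σ with
  | _ k ih =>
  by_cases h1 : S.card = 1
  · obtain ⟨v, rfl⟩ := Finset.card_eq_one.1 h1
    rw [← hc, polyFlow_singleton]
    simp [flow_zero]
  · obtain ⟨m, rfl⟩ : ∃ m, k = m + 2 := ⟨k - 2, by have := hS.card_pos; omega⟩
    rw [polyFlow_of_card_ne_one _ h1, show m + 2 - 1 = m + 1 by omega, flow_succ,
      ← duhamel_const_mul]
    refine duhamel_congr (fun s _ τ hτ => ?_) hσ
    have hd : ∀ i, DifferentiableOn ℂ (flow V i s) (strip ρ) := fun i =>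
      (lipHolo_flow hV i).holo.holo s
    -- The contribution of a part of `j` vertices depends on `j` only.
    let f : ℕ → ℂ := fun j => if j = 0 ∨ j = m + 2 then 0 else
      (j.factorial : ℂ) * ((m + 2 - j).factorial : ℂ) *
        pairing (flow V (j - 1) s) (flow V (m + 2 - j - 1) s) τ
    have hterm : ∀ S₁ ∈ properParts S, pairing (polyFlow (fun _ => V) S₁ s)
        (polyFlow (fun _ => V) (S \ S₁) s) τ = f S₁.card := by
      intro S₁ hS₁
      have hcard := card_lt_of_mem_properParts hS₁
      obtain ⟨hne, hss⟩ := mem_properParts.1 hS₁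
      have hsd := Finset.card_sdiff_of_subset hss.subset
      have hpos := hne.card_pos
      have hne2 : (S \ S₁).Nonempty := by
        rw [← Finset.card_pos]; omega
      rw [pairing_congr (fun τ' hτ' => ih _ (by omega) hne s hτ' rfl)
        (fun τ' hτ' => ih _ (by omega) hne2 s hτ' rfl) hτ, pairing_const_mul (hd _) (hd _) _ _ hτ,
        hsd, hc]
      simp only [f]
      rw [if_neg (by omega)]
    have hsum : ∑ S₁ ∈ properParts S, pairing (polyFlow (fun _ => V) S₁ s)
        (polyFlow (fun _ => V) (S \ S₁) s) τ = ∑ S₁ ∈ S.powerset, f S₁.card := by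
      rw [Finset.sum_congr rfl hterm]
      refine Finset.sum_subset (fun S₁ hS₁ => ?_) fun S₁ h2 h3 => ?_
      · exact Finset.mem_powerset.2 (mem_properParts.1 hS₁).2.subset
      · rw [Finset.mem_powerset] at h2
        rw [mem_properParts, not_and_or] at h3
        rcases h3 with h3 | h3
        · rw [Finset.not_nonempty_iff_eq_empty] at h3
          simp [f, h3]
        · have : S₁ = S := by
            by_contra hne
            exact h3 (h2.ssubset_of_ne hne)
          simp [f, this, hc]
    -- The number of parts of size `j` is `(m + 2).choose j`, and `choose * j! * (m + 2 - j)! = (m +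
    -- 2)!`.
    rw [polySource, hsum, Finset.sum_powerset_apply_card f, hc, source, Finset.sum_range_succ,
      Finset.sum_range_succ']
    simp only [f, true_or, or_true, if_true, smul_zero, add_zero]
    rw [Finset.sum_range, mul_left_comm]
    congr 1
    rw [Finset.mul_sum]
    refine Finset.sum_congr rfl fun i _ => ?_
    have hi : (i : ℕ) + 1 ≤ m + 2 := by omega
    rw [if_neg (by omega), nsmul_eq_mul, ← Nat.choose_mul_factorial_mul_factorial hi]
    have e1 : (i : ℕ) + 1 - 1 = i := by omega
    have e2 : m + 2 - ((i : ℕ) + 1) - 1 = m - i := by omega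
    rw [e1, e2]
    push_cast
    ring

end PolyFlow

/-! ### Independent line weights and the smallest of them -/

section Lines

variable {A : Type*} [MeasurableSpace A] (κ : Measure A) {ι : Type*}

/-- The law of a line: a uniform weight in the unit interval and a label with law `κ`. -/
def lineMeasure : Measure (ℝ × A) := ((volume : Measure ℝ).restrict (Set.Icc 0 1)).prod κ

variable [IsProbabilityMeasure κ]

instance isProbabilityMeasure_Icc :
    IsProbabilityMeasure ((volume : Measure ℝ).restrict (Set.Icc 0 1)) := ⟨by simp⟩

instance isProbabilityMeasure_lineMeasure : IsProbabilityMeasure (lineMeasure κ) := by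
  unfold lineMeasure; infer_instance

omit [IsProbabilityMeasure κ] in
theorem ae_lineMeasure_mem : ∀ᵐ x ∂(lineMeasure κ), x.1 ∈ Set.Icc (0 : ℝ) 1 :=
  Measure.quasiMeasurePreserving_fst.ae (ae_restrict_mem measurableSet_Icc)

omit [IsProbabilityMeasure κ] in
theorem ae_lineMeasure_ne (r : ℝ) : ∀ᵐ x ∂(lineMeasure κ), x.1 ≠ r :=
  Measure.quasiMeasurePreserving_fst.ae (Measure.ae_ne _ r)

variable {κ}

theorem integrable_of_measurable_bounded {E : Type*} [MeasurableSpace E] {μ : Measure E}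
    [IsFiniteMeasure μ] {g : E → ℂ} (hg : Measurable g) {C : ℝ} (hC : ∀ x, ‖g x‖ ≤ C) :
    Integrable g μ :=
  Integrable.of_bound hg.aestronglyMeasurable C (.of_forall hC)

theorem integral_Icc_indicator {r : ℝ} (hr : r ∈ Set.Icc (0 : ℝ) 1) (f : ℝ → ℂ) :
    ∫ s in Set.Icc (0 : ℝ) 1, (if r < s then f s else 0)
      = ((1 - r : ℝ) : ℂ) * ∫ s in Set.Icc (0 : ℝ) 1, f (r + (1 - r) * s) := by
  have h1 : ∀ s, (if r < s then f s else 0) = (Set.Ioi r).indicator f s := fun s => by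
    simp [Set.indicator_apply]
  simp only [h1]
  rw [setIntegral_indicator measurableSet_Ioi, integral_Icc_eq_integral_Ioc]
  have h2 : Set.Icc (0 : ℝ) 1 ∩ Set.Ioi r = Set.Ioc r 1 := by
    ext s
    simp only [Set.mem_inter_iff, Set.mem_Icc, Set.mem_Ioi, Set.mem_Ioc]
    constructor
    · rintro ⟨⟨_, h⟩, h'⟩; exact ⟨h', h⟩
    · rintro ⟨h, h'⟩; exact ⟨⟨hr.1.trans h.le, h'⟩, h⟩
  have := intervalIntegral.smul_integral_comp_add_mul (a := 0) (b := 1) f (1 - r) r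
  simp only [mul_zero, add_zero, mul_one, add_sub_cancel] at this
  rw [h2, ← intervalIntegral.integral_of_le hr.2, ← intervalIntegral.integral_of_le zero_le_one,
    ← this, Complex.real_smul]

theorem integral_lineMeasure_indicator {r : ℝ} (hr : r ∈ Set.Icc (0 : ℝ) 1) {f : ℝ × A → ℂ}
    (hf : Measurable f) {C : ℝ} (hC : ∀ x, ‖f x‖ ≤ C) :
    ∫ x, (if r < x.1 then f x else 0) ∂(lineMeasure κ)
      = ((1 - r : ℝ) : ℂ) * ∫ x, f (r + (1 - r) * x.1, x.2) ∂(lineMeasure κ) := by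
  have hm : Measurable fun x : ℝ × A => if r < x.1 then f x else 0 :=
    Measurable.ite (measurableSet_lt measurable_const measurable_fst) hf measurable_const
  have hb : ∀ x : ℝ × A, ‖(if r < x.1 then f x else 0)‖ ≤ C := fun x => by
    split_ifs
    · exact hC x
    · simpa using (norm_nonneg _).trans (hC x)
  unfold lineMeasure
  rw [integral_prod_symm _ (integrable_of_measurable_bounded hm hb),
    integral_prod_symm (fun x : ℝ × A => f (r + (1 - r) * x.1, x.2))
      (integrable_of_measurable_bounded (hf.comp (by fun_prop)) fun x => hC _),
    ← integral_const_mul]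
  exact integral_congr_ae (.of_forall fun a => integral_Icc_indicator hr fun s => f (s, a))

variable [Fintype ι] [DecidableEq ι]

/-- Resampling one of independent variables does not change an average. -/
theorem integral_pi_update {α : Type*} [MeasurableSpace α] (μ : Measure α) [IsProbabilityMeasure μ]
    (a : ι) {g : (ι → α) → ℂ} (hg : Measurable g) {C : ℝ} (hC : ∀ x, ‖g x‖ ≤ C) :
    ∫ θ, g θ ∂(Measure.pi fun _ : ι => μ)
      = ∫ θ, ∫ x, g (Function.update θ a x) ∂μ ∂(Measure.pi fun _ : ι => μ) := by
  have hm := measurePreserving_update (ι := ι) μ a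
  rw [← hm.map_eq, integral_map hm.measurable.aemeasurable hg.aestronglyMeasurable, integral_prod]
  · rw [hm.map_eq]
  · exact integrable_of_measurable_bounded (hg.comp hm.measurable) fun p => hC _

variable (κ) in
/-- Independent lines. -/
def lines (ι : Type*) [Fintype ι] : Measure (ι → ℝ × A) := Measure.pi fun _ => lineMeasure κ

instance isProbabilityMeasure_lines : IsProbabilityMeasure (lines κ ι) := by
  unfold lines; infer_instance

omit [DecidableEq ι] in
theorem ae_lines_mem : ∀ᵐ θ ∂(lines κ ι), ∀ e, (θ e).1 ∈ Set.Icc (0 : ℝ) 1 :=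
  ae_all_iff.2 fun e => (Measure.quasiMeasurePreserving_eval (fun _ : ι => lineMeasure κ) e).ae
    (p := fun x => x.1 ∈ Set.Icc (0 : ℝ) 1) (ae_lineMeasure_mem κ)

theorem ae_lines_ne {e ℓ : ι} (h : e ≠ ℓ) : ∀ᵐ θ ∂(lines κ ι), (θ e).1 ≠ (θ ℓ).1 := by
  have hm := measurePreserving_update (ι := ι) (lineMeasure κ) e
  have hmeas : MeasurableSet {θ : ι → ℝ × A | (θ e).1 ≠ (θ ℓ).1} := by
    refine (measurableSet_eq_fun ?_ ?_).compl <;> fun_prop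
  have hmeas' : MeasurableSet {p : (ι → ℝ × A) × (ℝ × A) | p.2.1 ≠ (p.1 ℓ).1} := by
    refine (measurableSet_eq_fun ?_ ?_).compl <;> fun_prop
  unfold lines
  rw [← hm.map_eq, ae_map_iff hm.measurable.aemeasurable hmeas]
  simp only [Function.update_self, Function.update_of_ne h.symm]
  rw [Measure.ae_prod_iff_ae_ae hmeas']
  exact .of_forall fun θ => ae_lineMeasure_ne κ (θ ℓ).1

/-- Weights on `E` rescaled from the unit interval to `[r, 1]`. -/
def rescale (E : Finset ι) (r : ℝ) (θ : ι → ℝ × A) : ι → ℝ × A :=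
  fun e => if e ∈ E then (r + (1 - r) * (θ e).1, (θ e).2) else θ e

omit [Fintype ι] in
theorem measurable_rescale (E : Finset ι) (ℓ : ι) :
    Measurable fun θ : ι → ℝ × A => rescale E (θ ℓ).1 θ := by
  refine measurable_pi_iff.2 fun e => ?_
  unfold rescale
  split_ifs <;> fun_prop

/-- Conditioning a uniform weight to exceed `(θ ℓ).1 = r` amounts to rescaling it to `[r, 1]`, with
Jacobian `1 - r`. The truncation by `clamp` keeps the factor bounded and acts on a null set only. -/
theorem integral_lines_lt {e ℓ : ι} (h : e ≠ ℓ) {g : (ι → ℝ × A) → ℂ} (hg : Measurable g)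
    {C : ℝ} (hC : ∀ θ, ‖g θ‖ ≤ C) :
    ∫ θ, (if (θ ℓ).1 < (θ e).1 then g θ else 0) ∂(lines κ ι)
      = ∫ θ, ((1 - clamp (θ ℓ).1 : ℝ) : ℂ) * g (rescale {e} (θ ℓ).1 θ) ∂(lines κ ι) := by
  have hm : Measurable fun θ : ι → ℝ × A => if (θ ℓ).1 < (θ e).1 then g θ else 0 :=
    Measurable.ite (measurableSet_lt (by fun_prop) (by fun_prop)) hg measurable_const
  have hb : ∀ θ : ι → ℝ × A, ‖(if (θ ℓ).1 < (θ e).1 then g θ else 0)‖ ≤ C := fun θ => by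
    split_ifs
    · exact hC θ
    · simpa using (norm_nonneg _).trans (hC θ)
  have hcl : Measurable clamp := continuous_clamp.measurable
  have hm' : Measurable fun θ : ι → ℝ × A =>
      ((1 - clamp (θ ℓ).1 : ℝ) : ℂ) * g (rescale {e} (θ ℓ).1 θ) :=
    (Complex.measurable_ofReal.comp (by fun_prop)).mul (hg.comp (measurable_rescale _ _))
  have hb' : ∀ θ : ι → ℝ × A,
      ‖((1 - clamp (θ ℓ).1 : ℝ) : ℂ) * g (rescale {e} (θ ℓ).1 θ)‖ ≤ C := fun θ => by
    have h0 := clamp_nonneg (θ ℓ).1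
    have h1 := clamp_le_one (θ ℓ).1
    rw [norm_mul, Complex.norm_real, Real.norm_eq_abs, abs_of_nonneg (by linarith)]
    exact (mul_le_of_le_one_left (norm_nonneg _) (by linarith)).trans (hC _)
  unfold lines
  rw [integral_pi_update _ e hm hb, integral_pi_update _ e hm' hb']
  refine integral_congr_ae ?_
  have hae : ∀ᵐ θ ∂(lines κ ι), ∀ e, (θ e).1 ∈ Set.Icc (0 : ℝ) 1 := ae_lines_mem
  unfold lines at hae
  filter_upwards [hae] with θ hθ
  have hr := hθ ℓ
  simp only [Function.update_self, Function.update_of_ne h.symm, clamp_of_mem hr]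
  have hup : Measurable fun x : ℝ × A => g (Function.update θ e x) :=
    hg.comp (measurable_update θ)
  rw [integral_lineMeasure_indicator hr hup fun x => hC _, ← integral_const_mul]
  refine integral_congr_ae (.of_forall fun x => ?_)
  beta_reduce
  congr 2
  funext e'
  rcases eq_or_ne e' e with rfl | h'
  · simp [rescale]
  · simp [rescale, h']

/-- Conditioning all weights on `E` to exceed the weight of `ℓ`. -/
theorem integral_lines_lt_all {E : Finset ι} {ℓ : ι} (h : ℓ ∉ E) {g : (ι → ℝ × A) → ℂ}
    (hg : Measurable g) {C : ℝ} (hC : ∀ θ, ‖g θ‖ ≤ C) :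
    ∫ θ, (if ∀ e ∈ E, (θ ℓ).1 < (θ e).1 then g θ else 0) ∂(lines κ ι)
      = ∫ θ, ((1 - clamp (θ ℓ).1 : ℝ) : ℂ) ^ E.card * g (rescale E (θ ℓ).1 θ) ∂(lines κ ι) := by
  induction E using Finset.induction_on generalizing g with
  | empty =>
    have : ∀ r (θ : ι → ℝ × A), rescale ∅ r θ = θ := fun r θ => by funext e; simp [rescale]
    simp [this]
  | insert e E he ih =>
    have heℓ : e ≠ ℓ := fun h' => h (h' ▸ Finset.mem_insert_self _ _)
    have hE : ℓ ∉ E := fun h' => h (Finset.mem_insert_of_mem h')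
    have hset : MeasurableSet {θ : ι → ℝ × A | ∀ e ∈ E, (θ ℓ).1 < (θ e).1} := by
      have : {θ : ι → ℝ × A | ∀ e ∈ E, (θ ℓ).1 < (θ e).1}
          = ⋂ e ∈ E, {θ : ι → ℝ × A | (θ ℓ).1 < (θ e).1} := by ext; simp
      rw [this]
      exact Finset.measurableSet_biInter E fun e _ =>
        measurableSet_lt (by fun_prop) (by fun_prop)
    have hm : Measurable fun θ : ι → ℝ × A =>
        if ∀ e ∈ E, (θ ℓ).1 < (θ e).1 then g θ else 0 := Measurable.ite hset hg measurable_const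
    have hb : ∀ θ : ι → ℝ × A, ‖(if ∀ e ∈ E, (θ ℓ).1 < (θ e).1 then g θ else 0)‖ ≤ C := fun θ => by
      split_ifs
      · exact hC θ
      · simpa using (norm_nonneg _).trans (hC θ)
    have h1 : ∀ θ : ι → ℝ × A, (if ∀ e' ∈ insert e E, (θ ℓ).1 < (θ e').1 then g θ else 0)
        = if (θ ℓ).1 < (θ e).1 then (if ∀ e ∈ E, (θ ℓ).1 < (θ e).1 then g θ else 0) else 0 := by
      intro θ
      simp only [Finset.forall_mem_insert, ← ite_and]
    simp only [h1]
    rw [integral_lines_lt heℓ hm hb]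
    have hout : ∀ (e' : ι) (r : ℝ) (θ : ι → ℝ × A), e' ≠ e → rescale {e} r θ e' = θ e' :=
      fun e' r θ h' => by simp [rescale, h']
    have h2 : ∀ θ : ι → ℝ × A, ((1 - clamp (θ ℓ).1 : ℝ) : ℂ) *
        (if ∀ e' ∈ E, (rescale {e} (θ ℓ).1 θ ℓ).1 < (rescale {e} (θ ℓ).1 θ e').1
          then g (rescale {e} (θ ℓ).1 θ) else 0)
        = if ∀ e ∈ E, (θ ℓ).1 < (θ e).1
          then ((1 - clamp (θ ℓ).1 : ℝ) : ℂ) * g (rescale {e} (θ ℓ).1 θ) else 0 := by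
      intro θ
      have : (∀ e' ∈ E, (rescale {e} (θ ℓ).1 θ ℓ).1 < (rescale {e} (θ ℓ).1 θ e').1)
          ↔ ∀ e ∈ E, (θ ℓ).1 < (θ e).1 := by
        refine forall₂_congr fun e' he' => ?_
        rw [hout ℓ _ _ heℓ.symm, hout e' _ _ fun h' => he (h' ▸ he')]
      simp only [this, mul_ite, mul_zero]
    simp only [h2]
    have hcl : Measurable clamp := continuous_clamp.measurable
    rw [ih hE (g := fun θ => ((1 - clamp (θ ℓ).1 : ℝ) : ℂ) * g (rescale {e} (θ ℓ).1 θ))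
      ((Complex.measurable_ofReal.comp (by fun_prop)).mul (hg.comp (measurable_rescale _ _)))]
    · refine integral_congr_ae (.of_forall fun θ => ?_)
      have hl : rescale E (θ ℓ).1 θ ℓ = θ ℓ := by simp [rescale, hE]
      beta_reduce
      rw [Finset.card_insert_of_notMem he, pow_succ, hl, mul_assoc]
      congr 3
      funext e'
      simp only [rescale, Finset.mem_insert, Finset.mem_singleton]
      by_cases h' : e' = e
      · subst h'; simp [he]
      · simp [h']
    · intro θ
      have h0 := clamp_nonneg (θ ℓ).1
      have h1 := clamp_le_one (θ ℓ).1
      rw [norm_mul, Complex.norm_real, Real.norm_eq_abs, abs_of_nonneg (by linarith)]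
      exact (mul_le_of_le_one_left (norm_nonneg _) (by linarith)).trans (hC _)

/-- Decomposition of an average according to the line of smallest weight. -/
theorem integral_lines_min {E : Finset ι} (hE : E.Nonempty) {g : (ι → ℝ × A) → ℂ}
    (hg : Measurable g) {C : ℝ} (hC : ∀ θ, ‖g θ‖ ≤ C) :
    ∫ θ, g θ ∂(lines κ ι) = ∑ ℓ ∈ E, ∫ θ, ((1 - clamp (θ ℓ).1 : ℝ) : ℂ) ^ (E.erase ℓ).card *
      g (rescale (E.erase ℓ) (θ ℓ).1 θ) ∂(lines κ ι) := by
  have h1 : ∀ ℓ ∈ E, ∫ θ, ((1 - clamp (θ ℓ).1 : ℝ) : ℂ) ^ (E.erase ℓ).card *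
      g (rescale (E.erase ℓ) (θ ℓ).1 θ) ∂(lines κ ι)
      = ∫ θ, (if ∀ e ∈ E.erase ℓ, (θ ℓ).1 < (θ e).1 then g θ else 0) ∂(lines κ ι) := fun ℓ _ =>
    (integral_lines_lt_all (Finset.notMem_erase ℓ E) hg hC).symm
  rw [Finset.sum_congr rfl h1, ← integral_finsetSum]
  · refine integral_congr_ae ?_
    -- Ties between weights have measure zero.
    have hne : ∀ᵐ θ ∂(lines κ ι), ∀ e ℓ : ι, e ≠ ℓ → (θ e).1 ≠ (θ ℓ).1 := by
      refine ae_all_iff.2 fun e => ae_all_iff.2 fun ℓ => ?_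
      by_cases h : e = ℓ
      · simp [h]
      · filter_upwards [ae_lines_ne h] with θ hθ _ using hθ
    filter_upwards [hne] with θ hθ
    obtain ⟨ℓ, hℓ, hmin⟩ := E.exists_min_image (fun e => (θ e).1) hE
    rw [Finset.sum_eq_single_of_mem ℓ hℓ, if_pos]
    · intro e he
      exact lt_of_le_of_ne (hmin e (Finset.mem_of_mem_erase he))
        (hθ ℓ e (Finset.ne_of_mem_erase he).symm)
    · intro e he hne
      rw [if_neg]
      intro h
      exact absurd (h ℓ (Finset.mem_erase.2 ⟨hne.symm, hℓ⟩)) (not_lt.2 (hmin e he))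
  · intro ℓ _
    have hset : MeasurableSet {θ : ι → ℝ × A | ∀ e ∈ E.erase ℓ, (θ ℓ).1 < (θ e).1} := by
      have : {θ : ι → ℝ × A | ∀ e ∈ E.erase ℓ, (θ ℓ).1 < (θ e).1}
          = ⋂ e ∈ E.erase ℓ, {θ : ι → ℝ × A | (θ ℓ).1 < (θ e).1} := by ext; simp
      rw [this]
      exact Finset.measurableSet_biInter _ fun e _ =>
        measurableSet_lt (by fun_prop) (by fun_prop)
    refine integrable_of_measurable_bounded (C := C) (Measurable.ite hset hg measurable_const)
      fun θ => ?_
    split_ifs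
    · exact hC θ
    · simpa using (norm_nonneg _).trans (hC θ)

/-- Functions of disjoint sets of lines are independent. -/
theorem integral_lines_mul {E₁ E₂ : Finset ι} (hE : Disjoint E₁ E₂) {f g : (ι → ℝ × A) → ℂ}
    (hf : Measurable f) (hg : Measurable g)
    (hf' : ∀ θ θ', (∀ e ∈ E₁, θ e = θ' e) → f θ = f θ')
    (hg' : ∀ θ θ', (∀ e ∈ E₂, θ e = θ' e) → g θ = g θ') :
    ∫ θ, f θ * g θ ∂(lines κ ι) = (∫ θ, f θ ∂(lines κ ι)) * ∫ θ, g θ ∂(lines κ ι) := by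
  have : Nonempty (ι → ℝ × A) := nonempty_of_isProbabilityMeasure (lines κ ι)
  obtain ⟨θ₀⟩ := this
  let ext (E : Finset ι) (y : E → ℝ × A) : ι → ℝ × A := fun e => if h : e ∈ E then y ⟨e, h⟩ else θ₀ e
  have hext : ∀ E, Measurable (ext E) := fun E => measurable_pi_iff.2 fun e => by
    by_cases h : e ∈ E
    · simp only [ext, h, dif_pos]; fun_prop
    · simp only [ext, h, dif_neg, not_false_iff]; fun_prop
  have hind := iIndepFun_pi (μ := fun _ : ι => lineMeasure κ) (X := fun _ x => x)
    fun _ => aemeasurable_id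
  have h12 := hind.indepFun_finset E₁ E₂ hE fun i => by fun_prop
  have h := h12.comp (hf.comp (hext E₁)) (hg.comp (hext E₂))
  have e1 : (f ∘ ext E₁) ∘ (fun (θ : ι → ℝ × A) (i : E₁) => θ i) = f := by
    funext θ
    exact hf' _ _ fun e he => by simp [ext, he]
  have e2 : (g ∘ ext E₂) ∘ (fun (θ : ι → ℝ × A) (i : E₂) => θ i) = g := by
    funext θ
    exact hg' _ _ fun e he => by simp [ext, he]
  rw [e1, e2] at h
  exact h.integral_fun_mul_eq_mul_integral hf.aestronglyMeasurable hg.aestronglyMeasurable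

end Lines

/-! ### Averages of a product of vertices along a tree -/

section Families

variable {T Y : Type*} [TopologicalSpace T] [TopologicalSpace Y] {N : ℕ} {ρ : ℝ} {σ : Mat N}

theorem BddHolo.continuous_at {φ : T → Mat N → ℂ} (hφ : BddHolo ρ φ) (hσ : σ ∈ strip ρ) :
    Continuous fun t => φ t σ :=
  continuous_iff_continuousAt.2 fun t => ContinuousAt.comp (f := fun t : T => (t, σ)) (x := t)
    (hφ.holo.cont t σ hσ) (Continuous.continuousAt (by fun_prop))

theorem BddHolo.bounded_at {φ : T → Mat N → ℂ} (hφ : BddHolo ρ φ) (hσ : σ ∈ strip ρ) :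
    ∃ C, ∀ t, ‖φ t σ‖ ≤ C := by
  obtain ⟨C, hC⟩ := hφ.bdd _ hσ
  exact ⟨C, fun t => hC t σ le_rfl⟩

/-- A family over a finite discrete parameter space. -/
theorem BddHolo.of_finite [DiscreteTopology T] [Finite T] {φ : T → Mat N → ℂ}
    (h : ∀ t, BddHolo ρ (fun _ : Unit => φ t)) : BddHolo ρ φ where
  holo := ⟨fun t σ hσ => continuousAt_prod_of_discrete_left.2
      (((h t).holo.holo ()).differentiableAt ((isOpen_strip ρ).mem_nhds hσ)).continuousAt,
    fun t => (h t).holo.holo ()⟩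
  bdd ε hε := by
    choose C hC using fun t => (h t).bdd ε hε
    obtain ⟨M, hM⟩ := Set.Finite.bddAbove (Set.finite_range C)
    exact ⟨M, fun t σ hσ => (hC t () σ hσ).trans (hM ⟨t, rfl⟩)⟩

theorem BddHolo.integral_param [FirstCountableTopology T] [MeasurableSpace Y]
    [OpensMeasurableSpace Y] [SecondCountableTopologyEither Y ℂ] (ν : Measure Y)
    [IsFiniteMeasure ν] {φ : Y × T → Mat N → ℂ} (hφ : BddHolo ρ φ) :
    BddHolo ρ (fun t σ => ∫ y, φ (y, t) σ ∂ν) := by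
  refine (BddHolo.integral (φ := fun y t => φ (y, t)) (fun t σ hσ => ?_) (fun y => ?_) ?_).1
  · exact ((hφ.continuous_at hσ).comp (by fun_prop : Continuous fun y : Y => (y, t))).aestronglyMeasurable
  · exact (hφ.comp_param (by fun_prop : Continuous fun t : T => (y, t))).holo
  · intro ε hε
    obtain ⟨C, hC⟩ := hφ.bdd ε hε
    exact ⟨C, fun y t => hC (y, t)⟩

/-- The heat semigroup commutes with averages over a parameter. -/
theorem heat_integral [MeasurableSpace T] [OpensMeasurableSpace T] [SecondCountableTopology T]
    (ν : Measure T) [IsFiniteMeasure ν] {φ : T → Mat N → ℂ} (hφ : BddHolo ρ φ) (hσ : σ ∈ strip ρ)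
    (s : ℝ) : ∫ t, heat s (φ t) σ ∂ν = heat s (fun τ => ∫ t, φ t τ ∂ν) σ := by
  unfold heat
  have h := hφ.translate (T' := T × Coord N) continuous_fst
    (y := fun p => herm (√s • p.2)) (by fun_prop) fun p => herm_isHermitian _
  obtain ⟨C, hC⟩ := h.bounded_at hσ
  rw [integral_integral_swap]
  exact integrable_of_measurable_bounded (h.continuous_at hσ).measurable hC

end Families

section IterDeriv

variable {N : ℕ} {ρ : ℝ} {σ : Mat N}

/-- Iterated partial derivatives, the head of the list being applied last. -/
def iterDeriv (l : List (Fin N × Fin N)) (f : Mat N → ℂ) : Mat N → ℂ := l.foldr pderiv f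

theorem differentiableOn_iterDeriv (l : List (Fin N × Fin N)) {f : Mat N → ℂ}
    (hf : DifferentiableOn ℂ f (strip ρ)) : DifferentiableOn ℂ (iterDeriv l f) (strip ρ) := by
  induction l with
  | nil => exact hf
  | cons a l ih => exact differentiableOn_pderiv ih a

theorem iterDeriv_perm {l l' : List (Fin N × Fin N)} (h : l.Perm l') {f : Mat N → ℂ}
    (hf : DifferentiableOn ℂ f (strip ρ)) (hσ : σ ∈ strip ρ) : iterDeriv l f σ = iterDeriv l' f σ := by
  induction h generalizing σ with
  | nil => rfl
  | cons a _ ih => exact pderiv_congr (fun τ hτ => ih hτ) hσ a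
  | swap a b l => exact fderiv_fderiv_comm (differentiableOn_iterDeriv l hf) hσ _ _
  | trans _ _ ih₁ ih₂ => exact (ih₁ hσ).trans (ih₂ hσ)

theorem iterDeriv_append (l l' : List (Fin N × Fin N)) (f : Mat N → ℂ) :
    iterDeriv (l ++ l') f = iterDeriv l (iterDeriv l' f) := List.foldr_append

theorem lipHolo_iterDeriv (l : List (Fin N × Fin N)) {f : Mat N → ℂ}
    (hf : LipHolo ρ (fun _ : Unit => f)) : LipHolo ρ (fun _ : Unit => iterDeriv l f) := by
  induction l with
  | nil => exact hf
  | cons a l ih => exact (ih.fderiv_apply _).lipHolo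

theorem bddHolo_iterDeriv_cons (a : Fin N × Fin N) (l : List (Fin N × Fin N)) {f : Mat N → ℂ}
    (hf : LipHolo ρ (fun _ : Unit => f)) : BddHolo ρ (fun _ : Unit => iterDeriv (a :: l) f) :=
  (lipHolo_iterDeriv l hf).fderiv_apply _

theorem bddHolo_iterDeriv_of_ne_nil {l : List (Fin N × Fin N)} (hl : l ≠ []) {f : Mat N → ℂ}
    (hf : LipHolo ρ (fun _ : Unit => f)) : BddHolo ρ (fun _ : Unit => iterDeriv l f) := by
  obtain ⟨a, l, rfl⟩ := List.exists_cons_of_ne_nil hl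
  exact bddHolo_iterDeriv_cons a l hf

end IterDeriv

section VertexFun

variable {n N : ℕ} {ρ : ℝ} {G G₁ G₂ : SimpleGraph (Fin n)} {S S₁ S₂ : Finset (Fin n)}
  {v₁ v₂ : Fin n} {σ : Mat N}

/-- The edges of `G`. -/
def edges (G : SimpleGraph (Fin n)) : Finset (Sym2 (Fin n)) := G.edgeFinset

theorem mem_edges {e : Sym2 (Fin n)} : e ∈ edges G ↔ e ∈ G.edgeSet := by simp [edges]

/-- The label of an edge as seen from its end `v`: the two ends carry transposed indices. -/
def leg (e : Sym2 (Fin n)) (v : Fin n) (a : Fin N × Fin N) : Fin N × Fin N :=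
  if v = e.inf then a else a.swap

theorem leg_leg (e : Sym2 (Fin n)) (v : Fin n) (a : Fin N × Fin N) : leg e v (leg e v a) = a := by
  unfold leg; split_ifs <;> simp

/-- The derivatives that act on the vertex `v`, one for each edge at `v`. -/
def legs (G : SimpleGraph (Fin n)) (c : Sym2 (Fin n) → Fin N × Fin N) (v : Fin n) :
    List (Fin N × Fin N) :=
  ((edges G).filter (v ∈ ·)).toList.map fun e => leg e v (c e)

/-- The factor of the vertex `v`: its potential, differentiated once for each edge at `v`. -/
def vertexFun (G : SimpleGraph (Fin n)) (F : Fin n → Mat N → ℂ)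
    (c : Sym2 (Fin n) → Fin N × Fin N) (v : Fin n) : Mat N → ℂ := iterDeriv (legs G c v) (F v)

theorem vertexFun_congr {c c' : Sym2 (Fin n) → Fin N × Fin N} (h : ∀ e ∈ edges G, c e = c' e)
    (F : Fin n → Mat N → ℂ) (v : Fin n) : vertexFun G F c v = vertexFun G F c' v := by
  unfold vertexFun legs
  congr 1
  refine List.map_congr_left fun e he => ?_
  rw [h e (Finset.mem_filter.1 (Finset.mem_toList.1 he)).1]

/-- In a tree with at least two vertices every vertex is differentiated, which makes its factor
bounded although the potential is not. -/
theorem legs_ne_nil (hG : IsTreeOn G S) (hS : 1 < S.card) {v : Fin n} (hv : v ∈ S)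
    (c : Sym2 (Fin n) → Fin N × Fin N) : legs G c v ≠ [] := by
  obtain ⟨w, hw⟩ := hG.exists_adj hS hv
  intro h
  have hmem : s(v, w) ∈ ((edges G).filter (v ∈ ·)).toList := by
    rw [Finset.mem_toList, Finset.mem_filter, mem_edges]
    exact ⟨hw, Sym2.mem_mk_left v w⟩
  rw [legs, List.map_eq_nil_iff] at h
  rw [h] at hmem
  exact absurd hmem (List.not_mem_nil)

theorem bddHolo_vertexFun {F : Fin n → Mat N → ℂ} (hF : ∀ v, LipHolo ρ (fun _ : Unit => F v))
    (hG : IsTreeOn G S) (hS : 1 < S.card) {v : Fin n} (hv : v ∈ S)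
    (c : Sym2 (Fin n) → Fin N × Fin N) : BddHolo ρ (fun _ : Unit => vertexFun G F c v) :=
  bddHolo_iterDeriv_of_ne_nil (legs_ne_nil hG hS hv c) (hF v)

namespace Split

theorem edges_eq (h : Split G v₁ v₂ S₁ S₂ G₁ G₂) :
    edges G = insert s(v₁, v₂) (edges G₁ ∪ edges G₂) := by
  ext e
  simp only [mem_edges, Finset.mem_insert, Finset.mem_union, h.edgeSet_eq, Set.mem_insert_iff,
    Set.mem_union]

theorem mem_of_mem_edges (h : Split G v₁ v₂ S₁ S₂ G₁ G₂) {e : Sym2 (Fin n)} (he : e ∈ edges G₁)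
    {v : Fin n} (hv : v ∈ e) : v ∈ S₁ := by
  rw [mem_edges] at he
  induction e with
  | _ a b =>
    rcases Sym2.mem_iff.1 hv with rfl | rfl
    · exact h.tree₁.mem_left he
    · exact h.tree₁.mem_right he

theorem notMem_edges₁ (h : Split G v₁ v₂ S₁ S₂ G₁ G₂) : s(v₁, v₂) ∉ edges G₁ := fun he =>
  h.not_mem₂ (h.mem_of_mem_edges he (Sym2.mem_mk_right v₁ v₂)) h.mem₂

theorem notMem_edges₂ (h : Split G v₁ v₂ S₁ S₂ G₁ G₂) : s(v₁, v₂) ∉ edges G₂ := by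
  rw [Sym2.eq_swap]; exact h.symm.notMem_edges₁

theorem disjoint_edges (h : Split G v₁ v₂ S₁ S₂ G₁ G₂) : Disjoint (edges G₁) (edges G₂) := by
  rw [Finset.disjoint_left]
  intro e h1 h2
  induction e with
  | _ a b =>
    exact h.not_mem₂ (h.mem_of_mem_edges h1 (Sym2.mem_mk_left a b))
      (h.symm.mem_of_mem_edges h2 (Sym2.mem_mk_left a b))

theorem edges_erase (h : Split G v₁ v₂ S₁ S₂ G₁ G₂) :
    (edges G).erase s(v₁, v₂) = edges G₁ ∪ edges G₂ := by
  rw [h.edges_eq, Finset.erase_insert]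
  rw [Finset.mem_union, not_or]
  exact ⟨h.notMem_edges₁, h.notMem_edges₂⟩

theorem filter_edges (h : Split G v₁ v₂ S₁ S₂ G₁ G₂) {v : Fin n} (hv : v ∈ S₁) :
    (edges G).filter (v ∈ ·) = if v = v₁ then insert s(v₁, v₂) ((edges G₁).filter (v ∈ ·))
      else (edges G₁).filter (v ∈ ·) := by
  have h2 : (edges G₂).filter (v ∈ ·) = ∅ := by
    rw [Finset.filter_eq_empty_iff]
    intro e he hve
    exact h.not_mem₂ hv (h.symm.mem_of_mem_edges he hve)
  have hv2 : v ≠ v₂ := fun e => h.not_mem₂ hv (e ▸ h.mem₂)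
  rw [h.edges_eq, Finset.filter_insert, Finset.filter_union, h2, Finset.union_empty]
  simp only [Sym2.mem_iff, hv2, or_false]

/-- Cutting a tree at an edge turns the derivative of that edge into a change of potential. -/
theorem vertexFun_eq (h : Split G v₁ v₂ S₁ S₂ G₁ G₂) {F : Fin n → Mat N → ℂ}
    (hF : ∀ v, DifferentiableOn ℂ (F v) (strip ρ)) (c : Sym2 (Fin n) → Fin N × Fin N)
    {X : Mat N} (hX : X = Matrix.single (leg s(v₁, v₂) v₁ (c s(v₁, v₂))).1
      (leg s(v₁, v₂) v₁ (c s(v₁, v₂))).2 1) {v : Fin n} (hv : v ∈ S₁) (hσ : σ ∈ strip ρ) :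
    vertexFun G F c v σ = vertexFun G₁ (derivAt F v₁ X) c v σ := by
  by_cases hv1 : v = v₁
  · subst hv1
    -- Derivatives commute, so the one of the cut edge may be taken first.
    have hp : (legs G c v).Perm (legs G₁ c v ++ [leg s(v, v₂) v (c s(v, v₂))]) := by
      rw [legs, h.filter_edges hv, if_pos rfl]
      have hnot : s(v, v₂) ∉ (edges G₁).filter (v ∈ ·) := fun he =>
        h.notMem_edges₁ (Finset.mem_filter.1 he).1
      refine ((Finset.toList_insert hnot).map _).trans ?_
      rw [List.map_cons]
      exact (List.perm_append_singleton _ _).symm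
    rw [vertexFun, iterDeriv_perm hp (hF v) hσ, iterDeriv_append, vertexFun]
    congr 1
    funext τ
    simp [derivAt, iterDeriv, pderiv, hX]
  · have : legs G c v = legs G₁ c v := by
      rw [legs, h.filter_edges hv, if_neg hv1, legs]
    rw [vertexFun, this, vertexFun]
    simp [derivAt, hv1]

end Split

end VertexFun

/-! ### Tree averages and cutting at the line of smallest weight -/

section TreeAverage

variable {n N : ℕ} {ρ : ℝ} {G G₁ G₂ : SimpleGraph (Fin n)} {S S₁ S₂ : Finset (Fin n)}
  {v₁ v₂ : Fin n} {σ : Mat N}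

/-- Configurations of lines: a weight and a matrix index for each pair of vertices. -/
abbrev LineConfig (n N : ℕ) : Type := Sym2 (Fin n) → ℝ × (Fin N × Fin N)

/-- The weights of a configuration. -/
def weights (θ : LineConfig n N) : Sym2 (Fin n) → ℝ := fun e => clamp (θ e).1

/-- The labels of a configuration. -/
def labels (θ : LineConfig n N) : Sym2 (Fin n) → Fin N × Fin N := fun e => (θ e).2

/-- The Gaussian average of the differentiated vertices of a tree on `S`, around the mean `σ` and
with total variance `1 - u`, for given line weights and labels. -/
def treeAverage (G : SimpleGraph (Fin n)) (S : Finset (Fin n)) (F : Fin n → Mat N → ℂ)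
    (θ : LineConfig n N) (u : ℝ) (σ : Mat N) : ℂ :=
  ∫ x, ∏ v ∈ S, vertexFun G F (labels θ) v (σ + herm (√(1 - clamp u) • slot v x))
    ∂(tupleGaussian N (maskedWeight G S (weights θ)))

theorem weights_mem (θ : LineConfig n N) (e : Sym2 (Fin n)) : weights θ e ∈ Set.Icc (0 : ℝ) 1 :=
  ⟨clamp_nonneg _, clamp_le_one _⟩

theorem continuous_weights : Continuous (weights (n := n) (N := N)) :=
  continuous_pi fun e => continuous_clamp.comp (by fun_prop)

theorem continuous_labels : Continuous (labels (n := n) (N := N)) :=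
  continuous_pi fun e => by unfold labels; fun_prop

/-- A tree average depends on the configuration on the edges of the tree only. -/
theorem treeAverage_congr (hG : IsTreeOn G S) (F : Fin n → Mat N → ℂ) {θ θ' : LineConfig n N}
    (h : ∀ e ∈ edges G, θ e = θ' e) : treeAverage G S F θ = treeAverage G S F θ' := by
  funext u σ
  have h1 : maskedWeight G S (weights θ) = maskedWeight G S (weights θ') :=
    maskedWeight_congr hG fun e he => by rw [weights, weights, h e (mem_edges.2 he)]
  have h2 : vertexFun G F (labels θ) = vertexFun G F (labels θ') := funext fun v =>
    vertexFun_congr (fun e he => by rw [labels, labels, h e he]) F v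
  rw [treeAverage, treeAverage, h1, h2]

/-- All differentiated vertices are bounded. -/
def BddVertices (ρ : ℝ) (G : SimpleGraph (Fin n)) (S : Finset (Fin n)) (F : Fin n → Mat N → ℂ) :
    Prop :=
  ∀ v ∈ S, ∀ c, BddHolo ρ (fun _ : Unit => vertexFun G F c v)

theorem BddVertices.family (hB : BddVertices ρ G S F) {v : Fin n} (hv : v ∈ S) :
    BddHolo ρ (fun c : Sym2 (Fin n) → Fin N × Fin N => vertexFun G F c v) :=
  BddHolo.of_finite fun c => hB v hv c

theorem BddVertices.continuous (hB : BddVertices ρ G S F) {v : Fin n} (hv : v ∈ S)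
    (c : Sym2 (Fin n) → Fin N × Fin N) (hσ : σ ∈ strip ρ) (s : ℝ) :
    Continuous fun x : Coord N => vertexFun G F c v (σ + herm (s • x)) :=
  ((hB v hv c).translate (T' := Coord N) (a := fun _ => ()) (y := fun x => herm (s • x))
    continuous_const (by fun_prop) fun _ => herm_isHermitian _).continuous_at hσ

theorem bddHolo_treeAverage (hG : IsTreeOn G S) {F : Fin n → Mat N → ℂ} (hB : BddVertices ρ G S F) :
    BddHolo ρ (fun p : LineConfig n N × ℝ => treeAverage G S F p.1 p.2) := by
  have hcl := continuous_clamp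
  have hW : Continuous fun θ : LineConfig n N => sqrtCov N (maskedWeight G S (weights θ)) :=
    continuous_sqrtCov ((continuous_maskedWeight hG.acyclic S).comp continuous_weights)
      fun θ => posSemidef_maskedWeight hG fun e _ => weights_mem θ e
  have hW2 : Continuous fun q : TupleCoord n N × LineConfig n N × ℝ =>
      sqrtCov N (maskedWeight G S (weights q.2.1)) q.1 :=
    (hW.comp (by fun_prop : Continuous fun q : TupleCoord n N × LineConfig n N × ℝ =>
      q.2.1)).clm_apply continuous_fst
  -- Pulling the average back to a standard Gaussian moves the dependence on the weights from the
  -- measure into the integrand.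
  have h1 : BddHolo ρ (fun (q : TupleCoord n N × LineConfig n N × ℝ) σ =>
      ∏ v ∈ S, vertexFun G F (labels q.2.1) v (σ + herm (√(1 - clamp q.2.2) •
        slot v (sqrtCov N (maskedWeight G S (weights q.2.1)) q.1)))) :=
    BddHolo.prod fun v hv => (hB.family hv).translate
      (continuous_labels.comp (by fun_prop)) (by fun_prop) fun _ => herm_isHermitian _
  refine (h1.integral_param (stdGaussian (TupleCoord n N))).congr fun p σ hσ => ?_
  rw [treeAverage, integral_tupleGaussian]
  exact continuous_finsetProd _ fun v hv =>
    (hB.continuous hv _ hσ _).comp (slot v).continuous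

/-- Boundedness is inherited by the two sides of a cut: each vertex function of a side, with the
derivative of the cut edge restored, is one of the whole tree. -/
theorem Split.bddVertices (h : Split G v₁ v₂ S₁ S₂ G₁ G₂) {F : Fin n → Mat N → ℂ}
    (hF : ∀ v, DifferentiableOn ℂ (F v) (strip ρ)) (hB : BddVertices ρ G (S₁ ∪ S₂) F)
    (a : Fin N × Fin N) : BddVertices ρ G₁ S₁ (derivAt F v₁ (Matrix.single a.1 a.2 1)) := by
  intro v hv c
  let c' := Function.update c s(v₁, v₂) (leg s(v₁, v₂) v₁ a)
  have hc : vertexFun G₁ (derivAt F v₁ (Matrix.single a.1 a.2 1)) c v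
      = vertexFun G₁ (derivAt F v₁ (Matrix.single a.1 a.2 1)) c' v := by
    refine vertexFun_congr (fun e he => ?_) _ v
    have hne : e ≠ s(v₁, v₂) := fun h' => h.notMem_edges₁ (h' ▸ he)
    simp [c', hne]
  refine (hB v (Finset.mem_union_left _ hv) c').congr fun _ τ hτ => ?_
  rw [hc]
  exact (h.vertexFun_eq hF c' (by simp [c', leg_leg]) hv hτ).symm

theorem clamp_affine (u : ℝ) {r : ℝ} (hr : r ∈ Set.Icc (0 : ℝ) 1) :
    clamp (clamp u + (1 - clamp u) * r) = clamp u + (1 - clamp u) * r := by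
  have h0 := clamp_nonneg u
  have h1 := clamp_le_one u
  refine clamp_of_mem ⟨?_, ?_⟩
  · nlinarith [hr.1]
  · nlinarith [hr.2]

/-- At the line of smallest weight `r`, the average over the tree factorizes after a heat flow
for the time `r`. -/
theorem Split.treeAverage_rescale (h : Split G v₁ v₂ S₁ S₂ G₁ G₂) {F : Fin n → Mat N → ℂ}
    (hF : ∀ v, DifferentiableOn ℂ (F v) (strip ρ)) (hB : BddVertices ρ G (S₁ ∪ S₂) F)
    {θ : LineConfig n N} (hθ : ∀ e, (θ e).1 ∈ Set.Icc (0 : ℝ) 1) (u : ℝ) (hσ : σ ∈ strip ρ)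
    {r : ℝ} {a : Fin N × Fin N} (hr : θ s(v₁, v₂) = (r, leg s(v₁, v₂) v₁ a)) :
    treeAverage G (S₁ ∪ S₂) F (rescale (edges G₁ ∪ edges G₂) r θ) u σ
      = heat ((1 - clamp u) * r) (fun τ =>
          treeAverage G₁ S₁ (derivAt F v₁ (Matrix.single a.1 a.2 1)) θ
            (clamp u + (1 - clamp u) * r) τ *
          treeAverage G₂ S₂ (derivAt F v₂ (Matrix.single a.2 a.1 1)) θ
            (clamp u + (1 - clamp u) * r) τ) σ := by
  have hr01 : r ∈ Set.Icc (0 : ℝ) 1 := by simpa [hr] using hθ s(v₁, v₂)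
  have hu0 := clamp_nonneg u
  have hu1 := clamp_le_one u
  set θ' := rescale (edges G₁ ∪ edges G₂) r θ with hθ'
  have hlab : labels θ' = labels θ := by
    funext e; simp only [labels, hθ', rescale]; split_ifs <;> rfl
  have hℓ : s(v₁, v₂) ∉ edges G₁ ∪ edges G₂ := by
    rw [Finset.mem_union, not_or]; exact ⟨h.notMem_edges₁, h.notMem_edges₂⟩
  have hw1 : weights θ' s(v₁, v₂) = r := by
    simp [weights, hθ', rescale, hℓ, hr, clamp_of_mem hr01]
  have hmem : ∀ e ∈ G₁.edgeSet ∪ G₂.edgeSet, e ∈ edges G₁ ∪ edges G₂ := fun e he => by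
    simpa [mem_edges] using he
  have hw2 : ∀ e ∈ G₁.edgeSet ∪ G₂.edgeSet, weights θ' e = r + (1 - r) * weights θ e := by
    intro e he
    have h2 := hθ e
    simp only [weights, hθ', rescale, hmem e he, if_true]
    rw [clamp_of_mem h2, clamp_of_mem]
    exact ⟨by nlinarith [h2.1, hr01.1, hr01.2], by nlinarith [h2.2, hr01.1, hr01.2]⟩
  have hmask : ∀ (G : SimpleGraph (Fin n)) (S : Finset (Fin n)) t v v', ¬ (v ∈ S ∧ v' ∈ S) →
      maskedWeight G S t v v' = 0 := fun G S t v v' hv => by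
    simp only [maskedWeight, Matrix.of_apply, if_neg hv]
  have hbd : ∀ v, ∃ C, v ∈ S₁ ∪ S₂ → ∀ x : Coord N,
      ‖vertexFun G F (labels θ) v (σ + herm (√(1 - clamp u) • x))‖ ≤ C := fun v => by
    by_cases hv : v ∈ S₁ ∪ S₂
    · obtain ⟨C, hC⟩ := (hB v hv (labels θ)).bdd _ hσ
      exact ⟨C, fun _ x => hC () _ (by rw [stripDist_add_hermitian ρ σ (herm_isHermitian _)])⟩
    · exact ⟨0, fun h => absurd h hv⟩
  choose C hC using hbd
  rw [treeAverage, hlab, integral_tupleGaussian_split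
    (f := fun v x => vertexFun G F (labels θ) v (σ + herm (√(1 - clamp u) • x))) hr01
    (posSemidef_maskedWeight h.tree₁ fun e _ => weights_mem θ e)
    (posSemidef_maskedWeight h.tree₂ fun e _ => weights_mem θ e) (hmask _ _ _) (hmask _ _ _)
    h.disjoint (h.maskedWeight_eq hr01.2 hw1 hw2 fun e _ => (weights_mem θ e).1)
    (fun v hv => hB.continuous hv _ hσ _) (C := C) fun v hv => hC v hv]
  unfold heat
  -- The variance `1 - u` splits into `(1 - u) r` for the common component, which becomes the heat
  -- flow, and `(1 - u) (1 - r)` for the two sides, whose scale is `u + (1 - u) r`.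
  have harg : ∀ (x y : Coord N), σ + herm (√(1 - clamp u) • (√r • x + √(1 - r) • y))
      = σ + herm (√((1 - clamp u) * r) • x) +
        herm (√(1 - clamp (clamp u + (1 - clamp u) * r)) • y) := by
    intro x y
    rw [clamp_affine u hr01, show 1 - (clamp u + (1 - clamp u) * r) = (1 - clamp u) * (1 - r) by ring,
      Real.sqrt_mul (by linarith), Real.sqrt_mul (by linarith), add_assoc, ← map_add]
    simp only [smul_add, smul_smul]
  have hlabel : labels θ s(v₁, v₂) = leg s(v₁, v₂) v₁ a := by simp [labels, hr]
  have hne := h.ne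
  -- The second end of the cut edge carries the transposed label.
  have hflip : leg s(v₂, v₁) v₂ (labels θ s(v₂, v₁)) = a.swap := by
    rw [Sym2.eq_swap, hlabel]
    unfold leg
    rcases lt_or_gt_of_ne hne with hlt | hlt
    · have : s(v₁, v₂).inf = v₁ := by simp [hlt.le]
      simp [this, hne.symm]
    · have : s(v₁, v₂).inf = v₂ := by simp [hlt.le]
      simp [this, hne]
  refine integral_congr_ae (.of_forall fun x => ?_)
  beta_reduce
  rw [treeAverage, treeAverage]
  have hmemσ : ∀ x y, σ + herm (√((1 - clamp u) * r) • x) +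
        herm (√(1 - clamp (clamp u + (1 - clamp u) * r)) • y) ∈ strip ρ := fun x y =>
    add_hermitian_mem_strip (add_hermitian_mem_strip hσ (herm_isHermitian _)) (herm_isHermitian _)
  congr 1
  · refine integral_congr_ae (.of_forall fun y => Finset.prod_congr rfl fun v hv => ?_)
    rw [harg]
    exact h.vertexFun_eq hF _ (by rw [hlabel, leg_leg]) hv (hmemσ _ _)
  · refine integral_congr_ae (.of_forall fun y => Finset.prod_congr rfl fun v hv => ?_)
    rw [harg]
    exact h.symm.vertexFun_eq hF _ (by rw [hflip]; rfl) hv (hmemσ _ _)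

end TreeAverage

/-! ### The tree expansion of the polarized flow -/

section TreeExpansion

variable {n N : ℕ} {ρ : ℝ} {G G₁ G₂ : SimpleGraph (Fin n)} {S S₁ S₂ : Finset (Fin n)}
  {v₁ v₂ : Fin n} {σ : Mat N}

/-- The uniform probability measure on pairs of matrix indices. -/
def uniformLabel (N : ℕ) : Measure (Fin N × Fin N) := ((N : ENNReal) ^ 2)⁻¹ • Measure.count

instance isProbabilityMeasure_uniformLabel [NeZero N] : IsProbabilityMeasure (uniformLabel N) where
  measure_univ := by
    have hN : (N : ENNReal) ≠ 0 := Nat.cast_ne_zero.2 (NeZero.ne N)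
    rw [uniformLabel, Measure.smul_apply, Measure.count_univ]
    simp only [ENat.card_eq_coe_fintype_card, Fintype.card_prod, Fintype.card_fin, smul_eq_mul]
    push_cast
    rw [← pow_two]
    exact ENNReal.inv_mul_cancel (pow_ne_zero 2 hN) (ENNReal.pow_ne_top (ENNReal.natCast_ne_top N))

/-- Averages over labels instead of sums keep all measures probability measures; the powers of `N`
in `treeContribution` restore the sums. -/
theorem integral_uniformLabel (f : Fin N × Fin N → ℂ) :
    ∫ a, f a ∂(uniformLabel N) = ((N : ℂ) ^ 2)⁻¹ * ∑ a, f a := by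
  rw [uniformLabel, integral_smul_measure, integral_count]
  simp [ENNReal.toReal_inv, ENNReal.toReal_pow]

/-- The contribution of one tree on `S`: the integral over line weights and the sum over line
labels of the Gaussian average. -/
def treeContribution (G : SimpleGraph (Fin n)) (S : Finset (Fin n)) (F : Fin n → Mat N → ℂ) (u : ℝ)
    (σ : Mat N) : ℂ :=
  (N : ℂ) ^ (2 * (edges G).card) * ((1 - clamp u : ℝ) : ℂ) ^ (edges G).card *
    ∫ θ, treeAverage G S F θ u σ ∂(lines (uniformLabel N) (Sym2 (Fin n)))

theorem BddHolo.of_param {T : Type*} [TopologicalSpace T] {a : T → ℂ} (ha : Continuous a) {C : ℝ}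
    (hC : ∀ t, ‖a t‖ ≤ C) : BddHolo ρ (fun t (_ : Mat N) => a t) where
  holo := by simpa using (HoloFamily.const (T := T) (U := strip (N := N) ρ) (1 : ℂ)).param_mul ha
  bdd _ _ := ⟨C, fun t _ _ => hC t⟩

theorem continuous_one_sub_clamp_pow (k : ℕ) : Continuous fun u => ((1 - clamp u : ℝ) : ℂ) ^ k := by
  have := continuous_clamp
  fun_prop

theorem norm_one_sub_clamp_pow_le (k : ℕ) (u : ℝ) : ‖((1 - clamp u : ℝ) : ℂ) ^ k‖ ≤ 1 := by
  have h0 := clamp_nonneg u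
  have h1 := clamp_le_one u
  rw [norm_pow, Complex.norm_real, Real.norm_eq_abs, abs_of_nonneg (by linarith)]
  exact pow_le_one₀ (by linarith) (by linarith)

variable [NeZero N]

theorem bddHolo_integral_treeAverage (hG : IsTreeOn G S) {F : Fin n → Mat N → ℂ}
    (hB : BddVertices ρ G S F) :
    BddHolo ρ (fun u σ => ∫ θ, treeAverage G S F θ u σ ∂(lines (uniformLabel N) (Sym2 (Fin n)))) :=
  (bddHolo_treeAverage hG hB).integral_param _

theorem bddHolo_treeContribution (hG : IsTreeOn G S) {F : Fin n → Mat N → ℂ}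
    (hB : BddVertices ρ G S F) : BddHolo ρ (treeContribution G S F) :=
  ((BddHolo.const _).mul (BddHolo.of_param (continuous_one_sub_clamp_pow _)
    (norm_one_sub_clamp_pow_le _))).mul (bddHolo_integral_treeAverage hG hB)

/-- The part of the contribution of a tree in which the line `ℓ` has the smallest weight. -/
def minLineContribution (G : SimpleGraph (Fin n)) (S : Finset (Fin n)) (F : Fin n → Mat N → ℂ)
    (ℓ : Sym2 (Fin n)) (u : ℝ) (σ : Mat N) : ℂ :=
  (N : ℂ) ^ (2 * (edges G).card) * ((1 - clamp u : ℝ) : ℂ) ^ (edges G).card *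
    ∫ θ, ((1 - clamp (θ ℓ).1 : ℝ) : ℂ) ^ ((edges G).erase ℓ).card *
      treeAverage G S F (rescale ((edges G).erase ℓ) (θ ℓ).1 θ) u σ
      ∂(lines (uniformLabel N) (Sym2 (Fin n)))

/-- Decomposition of a tree contribution according to the line of smallest weight. -/
theorem treeContribution_eq_sum (hG : IsTreeOn G S) (hS : 1 < S.card) {F : Fin n → Mat N → ℂ}
    (hB : BddVertices ρ G S F) (u : ℝ) (hσ : σ ∈ strip ρ) :
    treeContribution G S F u σ = ∑ ℓ ∈ edges G, minLineContribution G S F ℓ u σ := by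
  have hY := (bddHolo_treeAverage hG hB).comp_param
    (by fun_prop : Continuous fun θ : LineConfig n N => (θ, u))
  obtain ⟨C, hC⟩ := hY.bounded_at hσ
  have hne : (edges G).Nonempty := by
    obtain ⟨a, ha⟩ := hG.nonempty
    obtain ⟨b, hab⟩ := hG.exists_adj hS ha
    exact ⟨s(a, b), mem_edges.2 hab⟩
  rw [treeContribution, integral_lines_min hne (hY.continuous_at hσ).measurable hC, Finset.mul_sum]
  rfl

/-- Once the weight `r` and the label of the smallest line are fixed, the lines on its two sides are
independent again. -/
theorem Split.integral_rescale (h : Split G v₁ v₂ S₁ S₂ G₁ G₂) {F : Fin n → Mat N → ℂ}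
    (hF : ∀ v, DifferentiableOn ℂ (F v) (strip ρ)) (hB : BddVertices ρ G (S₁ ∪ S₂) F) (u : ℝ)
    (hσ : σ ∈ strip ρ) :
    ∫ θ, ((1 - clamp (θ s(v₁, v₂)).1 : ℝ) : ℂ) ^ ((edges G).erase s(v₁, v₂)).card *
      treeAverage G (S₁ ∪ S₂) F (rescale ((edges G).erase s(v₁, v₂)) (θ s(v₁, v₂)).1 θ) u σ
      ∂(lines (uniformLabel N) (Sym2 (Fin n)))
    = ∫ r in Set.Icc (0 : ℝ) 1, ((N : ℂ) ^ 2)⁻¹ * ∑ a : Fin N × Fin N,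
        ((1 - r : ℝ) : ℂ) ^ ((edges G₁).card + (edges G₂).card) *
        heat ((1 - clamp u) * r) (fun τ =>
          (∫ θ, treeAverage G₁ S₁ (derivAt F v₁ (Matrix.single a.1 a.2 1)) θ
            (clamp u + (1 - clamp u) * r) τ ∂(lines (uniformLabel N) (Sym2 (Fin n)))) *
          ∫ θ, treeAverage G₂ S₂ (derivAt F v₂ (Matrix.single a.2 a.1 1)) θ
            (clamp u + (1 - clamp u) * r) τ ∂(lines (uniformLabel N) (Sym2 (Fin n)))) σ := by
  set ℓ := s(v₁, v₂) with hℓ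
  set k := (edges G₁).card + (edges G₂).card with hk
  have hErase : (edges G).erase ℓ = edges G₁ ∪ edges G₂ := h.edges_erase
  have hcard : ((edges G).erase ℓ).card = k := by
    rw [hErase, Finset.card_union_of_disjoint h.disjoint_edges]
  have hY := (bddHolo_treeAverage h.isTreeOn hB).comp_param
    (by fun_prop : Continuous fun θ : LineConfig n N => (θ, u))
  obtain ⟨C, hC⟩ := hY.bounded_at hσ
  set g : LineConfig n N → ℂ := fun θ => ((1 - clamp (θ ℓ).1 : ℝ) : ℂ) ^ k *
    treeAverage G (S₁ ∪ S₂) F (rescale (edges G₁ ∪ edges G₂) (θ ℓ).1 θ) u σ with hg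
  have hgm : Measurable g :=
    ((continuous_one_sub_clamp_pow k).measurable.comp (by fun_prop)).mul
      ((hY.continuous_at hσ).measurable.comp (measurable_rescale _ _))
  have hgb : ∀ θ, ‖g θ‖ ≤ C := fun θ => by
    rw [hg, norm_mul]
    exact (mul_le_of_le_one_left (norm_nonneg _) (norm_one_sub_clamp_pow_le _ _)).trans (hC _)
  have hB₁ := fun a => h.bddVertices hF hB a
  have hB₂ : ∀ a : Fin N × Fin N, BddVertices ρ G₂ S₂ (derivAt F v₂ (Matrix.single a.2 a.1 1)) :=
    fun a => h.symm.bddVertices hF (Finset.union_comm S₁ S₂ ▸ hB) a.swap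
  have hY₁ := fun a => bddHolo_treeAverage h.tree₁ (hB₁ a)
  have hY₂ := fun a => bddHolo_treeAverage h.tree₂ (hB₂ a)
  let ψ : ℝ → Fin N × Fin N → ℂ := fun r a => ((1 - r : ℝ) : ℂ) ^ k *
    heat ((1 - clamp u) * r) (fun τ =>
      (∫ θ, treeAverage G₁ S₁ (derivAt F v₁ (Matrix.single a.1 a.2 1)) θ
        (clamp u + (1 - clamp u) * r) τ ∂(lines (uniformLabel N) (Sym2 (Fin n)))) *
      ∫ θ, treeAverage G₂ S₂ (derivAt F v₂ (Matrix.single a.2 a.1 1)) θ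
        (clamp u + (1 - clamp u) * r) τ ∂(lines (uniformLabel N) (Sym2 (Fin n)))) σ
  -- the average over all lines but `ℓ`
  have hinner : ∀ x : ℝ × (Fin N × Fin N), x.1 ∈ Set.Icc (0 : ℝ) 1 →
      ∫ θ, g (Function.update θ ℓ x) ∂(lines (uniformLabel N) (Sym2 (Fin n)))
        = ψ x.1 (leg ℓ v₁ x.2) := by
    intro x hx
    set a := leg ℓ v₁ x.2 with ha
    have h1 : ∀ᵐ θ ∂(lines (uniformLabel N) (Sym2 (Fin n))), g (Function.update θ ℓ x)
        = ((1 - x.1 : ℝ) : ℂ) ^ k * heat ((1 - clamp u) * x.1) (fun τ =>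
          treeAverage G₁ S₁ (derivAt F v₁ (Matrix.single a.1 a.2 1)) θ
            (clamp u + (1 - clamp u) * x.1) τ *
          treeAverage G₂ S₂ (derivAt F v₂ (Matrix.single a.2 a.1 1)) θ
            (clamp u + (1 - clamp u) * x.1) τ) σ := by
      filter_upwards [ae_lines_mem (κ := uniformLabel N)] with θ hθ
      have hθ' : ∀ e, (Function.update θ ℓ x e).1 ∈ Set.Icc (0 : ℝ) 1 := fun e => by
        rcases eq_or_ne e ℓ with rfl | he
        · simpa using hx
        · simpa [he] using hθ e
      have hout : ∀ e, e ≠ ℓ → Function.update θ ℓ x e = θ e := fun e he =>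
        Function.update_of_ne he _ _
      simp only [hg, Function.update_self, clamp_of_mem hx]
      rw [h.treeAverage_rescale hF hB hθ' u hσ (r := x.1) (a := a)
        (by rw [← hℓ, Function.update_self, ha, leg_leg]),
        treeAverage_congr h.tree₁ _ fun e he => hout e (ne_of_mem_of_not_mem he h.notMem_edges₁),
        treeAverage_congr h.tree₂ _ fun e he => hout e (ne_of_mem_of_not_mem he h.notMem_edges₂)]
    rw [integral_congr_ae h1, integral_const_mul]
    have hc : Continuous fun θ : LineConfig n N => (θ, clamp u + (1 - clamp u) * x.1) := by fun_prop
    have hswap := heat_integral (lines (uniformLabel N) (Sym2 (Fin n)))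
      (((hY₁ a).comp_param hc).mul ((hY₂ a).comp_param hc)) hσ ((1 - clamp u) * x.1)
    refine congrArg _ (hswap.trans ?_)
    refine heat_congr (fun τ hτ => ?_) hσ _
    exact integral_lines_mul h.disjoint_edges
      (((hY₁ a).comp_param hc).continuous_at hτ).measurable
      (((hY₂ a).comp_param hc).continuous_at hτ).measurable
      (fun θ θ' he => by rw [treeAverage_congr h.tree₁ _ he])
      (fun θ θ' he => by rw [treeAverage_congr h.tree₂ _ he])
  have hmp := measurePreserving_update (ι := Sym2 (Fin n)) (lineMeasure (uniformLabel N)) ℓ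
  have hint : Integrable (fun p : LineConfig n N × (ℝ × (Fin N × Fin N)) =>
      g (Function.update p.1 ℓ p.2)) ((lines (uniformLabel N) (Sym2 (Fin n))).prod
        (lineMeasure (uniformLabel N))) :=
    integrable_of_measurable_bounded (hgm.comp hmp.measurable) fun p => hgb _
  have hae : (fun x : ℝ × (Fin N × Fin N) => ∫ θ, g (Function.update θ ℓ x)
      ∂(lines (uniformLabel N) (Sym2 (Fin n)))) =ᵐ[lineMeasure (uniformLabel N)]
      fun x => ψ x.1 (leg ℓ v₁ x.2) := by
    filter_upwards [ae_lineMeasure_mem (uniformLabel N)] with x hx using hinner x hx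
  have hint2 : Integrable (fun x : ℝ × (Fin N × Fin N) => ψ x.1 (leg ℓ v₁ x.2))
      (lineMeasure (uniformLabel N)) := hint.integral_prod_right.congr hae
  have hfirst : ∫ θ, g θ ∂(lines (uniformLabel N) (Sym2 (Fin n)))
      = ∫ x, ψ x.1 (leg ℓ v₁ x.2) ∂(lineMeasure (uniformLabel N)) := by
    rw [← integral_congr_ae hae, ← integral_prod_symm _ hint]
    unfold lines
    conv_lhs => rw [← hmp.map_eq, integral_map hmp.measurable.aemeasurable hgm.aestronglyMeasurable]
  rw [hcard, hErase]
  refine hfirst.trans ?_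
  unfold lineMeasure at hint2 ⊢
  rw [integral_prod _ hint2]
  refine integral_congr_ae (.of_forall fun r => ?_)
  beta_reduce
  rw [integral_uniformLabel]
  congr 1
  exact Equiv.sum_comp (Function.Involutive.toPerm (leg ℓ v₁) (leg_leg ℓ v₁)) (ψ r)

/-- The contribution of the configurations in which a given line is the smallest one is an integral
over the weight of this line; the trees on both sides start afresh. -/
theorem Split.minLineContribution_eq (h : Split G v₁ v₂ S₁ S₂ G₁ G₂) {F : Fin n → Mat N → ℂ}
    (hF : ∀ v, DifferentiableOn ℂ (F v) (strip ρ)) (hB : BddVertices ρ G (S₁ ∪ S₂) F) (u : ℝ)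
    (hσ : σ ∈ strip ρ) :
    minLineContribution G (S₁ ∪ S₂) F s(v₁, v₂) u σ
      = duhamel (fun s τ => ∑ a : Fin N × Fin N,
          treeContribution G₁ S₁ (derivAt F v₁ (Matrix.single a.1 a.2 1)) s τ *
          treeContribution G₂ S₂ (derivAt F v₂ (Matrix.single a.2 a.1 1)) s τ) u σ := by
  have hB₁ := fun a => h.bddVertices hF hB a
  have hB₂ : ∀ a : Fin N × Fin N, BddVertices ρ G₂ S₂ (derivAt F v₂ (Matrix.single a.2 a.1 1)) :=
    fun a => h.symm.bddVertices hF (Finset.union_comm S₁ S₂ ▸ hB) a.swap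
  have hcard : (edges G).card = (edges G₁).card + (edges G₂).card + 1 := by
    rw [h.edges_eq, Finset.card_insert_of_notMem, Finset.card_union_of_disjoint h.disjoint_edges]
    rw [Finset.mem_union, not_or]
    exact ⟨h.notMem_edges₁, h.notMem_edges₂⟩
  have hN : (N : ℂ) ≠ 0 := Nat.cast_ne_zero.2 (NeZero.ne N)
  rw [minLineContribution, h.integral_rescale hF hB u hσ, duhamel_eq, integral_Icc_eq_integral_Ioc,
    hcard, ← integral_const_mul, ← integral_const_mul]
  refine setIntegral_congr_fun measurableSet_Ioc fun r hr => ?_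
  have hr' : r ∈ Set.Icc (0 : ℝ) 1 := ⟨hr.1.le, hr.2⟩
  rw [heat_sum (fun a _ => ((bddHolo_treeContribution h.tree₁ (hB₁ a)).const_param _).mul
    ((bddHolo_treeContribution h.tree₂ (hB₂ a)).const_param _)) hσ, Finset.mul_sum,
    Finset.mul_sum, Finset.mul_sum]
  refine Finset.sum_congr rfl fun a _ => ?_
  set p : Mat N → ℂ := fun τ => (∫ θ, treeAverage G₁ S₁ (derivAt F v₁ (Matrix.single a.1 a.2 1)) θ
            (clamp u + (1 - clamp u) * r) τ ∂(lines (uniformLabel N) (Sym2 (Fin n)))) *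
          ∫ θ, treeAverage G₂ S₂ (derivAt F v₂ (Matrix.single a.2 a.1 1)) θ
            (clamp u + (1 - clamp u) * r) τ ∂(lines (uniformLabel N) (Sym2 (Fin n))) with hp
  have h1 : (fun τ => treeContribution G₁ S₁ (derivAt F v₁ (Matrix.single a.1 a.2 1))
        (clamp u + (1 - clamp u) * r) τ *
      treeContribution G₂ S₂ (derivAt F v₂ (Matrix.single a.2 a.1 1))
        (clamp u + (1 - clamp u) * r) τ)
      = fun τ => (N : ℂ) ^ (2 * ((edges G₁).card + (edges G₂).card)) *
        (((1 - clamp u : ℝ) : ℂ) * ((1 - r : ℝ) : ℂ)) ^ ((edges G₁).card + (edges G₂).card) *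
          p τ := by
    funext τ
    rw [treeContribution, treeContribution, clamp_affine u hr',
      show 1 - (clamp u + (1 - clamp u) * r) = (1 - clamp u) * (1 - r) by ring, hp]
    push_cast
    ring
  rw [h1, heat_const_mul]
  -- The factors `1 - u` and `1 - r` of the lines combine into those of the two sides at the scale
  -- `s = u + (1 - u) r`; one factor `1 - u` is left for `ds = (1 - u) dr`.
  rw [show 2 * ((edges G₁).card + (edges G₂).card + 1)
    = 2 * ((edges G₁).card + (edges G₂).card) + 2 by ring, pow_add, pow_succ _ ((edges G₁).card + (edges G₂).card), mul_pow]
  have hN2 : (N : ℂ) ^ 2 * ((N : ℂ) ^ 2)⁻¹ = 1 := mul_inv_cancel₀ (pow_ne_zero 2 hN)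
  linear_combination ((N : ℂ) ^ (2 * ((edges G₁).card + (edges G₂).card)) *
    ((1 - clamp u : ℝ) : ℂ) ^ ((edges G₁).card + (edges G₂).card) * ((1 - clamp u : ℝ) : ℂ) *
    ((1 - r : ℝ) : ℂ) ^ ((edges G₁).card + (edges G₂).card) *
      heat ((1 - clamp u) * r) p σ) * hN2

end TreeExpansion

section TreeSum

variable {n N : ℕ} {ρ : ℝ} {G : SimpleGraph (Fin n)} {S : Finset (Fin n)} {σ : Mat N}

/-- An edge sum is half a sum over oriented edges. -/
theorem sum_edges_eq {M : Type*} [Field M] [CharZero M] (G : SimpleGraph (Fin n))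
    (f : Sym2 (Fin n) → M) :
    ∑ e ∈ edges G, f e = 1 / 2 * ∑ v₁, ∑ v₂, open Classical in if G.Adj v₁ v₂ then f s(v₁, v₂) else 0 := by
  classical
  have h1 : ∑ v₁, ∑ v₂, (if G.Adj v₁ v₂ then f s(v₁, v₂) else 0)
      = ∑ d : G.Dart, f d.edge := by
    rw [← Finset.sum_product', ← Finset.sum_filter]
    symm
    refine Finset.sum_bij (fun d _ => d.toProd) (fun d _ => ?_) (fun d _ d' _ h => ?_)
      (fun p hp => ?_) fun d _ => rfl
    · simp [d.adj]
    · exact SimpleGraph.Dart.ext _ _ h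
    · exact ⟨⟨p, by simpa using hp⟩, Finset.mem_univ _, rfl⟩
  have h2 : ∑ d : G.Dart, f d.edge = ∑ e ∈ edges G, 2 * f e := by
    rw [← Finset.sum_fiberwise_of_maps_to (t := edges G) (g := fun d : G.Dart => d.edge)
      (fun d _ => mem_edges.2 d.edge_mem)]
    refine Finset.sum_congr rfl fun e he => ?_
    rw [Finset.sum_congr rfl (g := fun _ => f e) fun d hd => by rw [(Finset.mem_filter.1 hd).2],
      Finset.sum_const]
    have := G.dart_edge_fiber_card e (mem_edges.1 he)
    rw [this]
    simp
  rw [h1, h2, ← Finset.mul_sum]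
  ring

/-- The tree without lines contributes the potential itself, averaged. -/
theorem treeContribution_singleton [NeZero N] {F : Fin n → Mat N → ℂ}
    (hF : ∀ v, LipHolo ρ (fun _ : Unit => F v)) (v : Fin n) (u : ℝ) (hσ : σ ∈ strip ρ) :
    treeContribution ⊥ {v} F u σ = heat (1 - clamp u) (F v) σ := by
  have he : edges (⊥ : SimpleGraph (Fin n)) = ∅ := by
    ext e; simp [mem_edges]
  have h1 : ∀ θ : LineConfig n N, treeAverage ⊥ {v} F θ u σ = heat (1 - clamp u) (F v) σ := by
    intro θ
    have hl : vertexFun ⊥ F (labels θ) v = F v := by simp [vertexFun, legs, he, iterDeriv]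
    rw [treeAverage, maskedWeight_singleton]
    simp only [Finset.prod_singleton, hl]
    rw [integral_tupleGaussian_singleton v (fun x => F v (σ + herm (√(1 - clamp u) • x)))
      ((hF v).continuous_comp hσ () _)]
    rfl
  rw [treeContribution]
  simp [he, h1]

open Classical in
/-- The polarized flow is the sum over trees. -/
theorem sum_treeContribution [NeZero N] {F : Fin n → Mat N → ℂ}
    (hF : ∀ v, LipHolo ρ (fun _ : Unit => F v)) (hS : S.Nonempty) (u : ℝ) (hσ : σ ∈ strip ρ) :
    ∑ G : SimpleGraph (Fin n) with IsTreeOn G S, treeContribution G S F u σ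
      = polyFlow F S u σ := by
  induction hc : S.card using Nat.strong_induction_on generalizing S F u σ with
  | _ k ih =>
  by_cases h1 : S.card = 1
  · obtain ⟨v, rfl⟩ := Finset.card_eq_one.1 h1
    rw [polyFlow_singleton, Finset.sum_eq_single_of_mem ⊥, treeContribution_singleton hF v u hσ]
    · exact Finset.mem_filter.2 ⟨Finset.mem_univ _, isTreeOn_singleton.2 rfl⟩
    · intro G hG hne
      exact absurd (isTreeOn_singleton.1 (Finset.mem_filter.1 hG).2) hne
  have hcard : 1 < S.card := by have := hS.card_pos; omega
  have hFd : ∀ v, DifferentiableOn ℂ (F v) (strip ρ) := fun v => (hF v).holo.holo ()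
  have hBdd : ∀ G, IsTreeOn G S → BddVertices ρ G S F := fun G hG v hv c =>
    bddHolo_vertexFun hF hG hcard hv c
  -- One side of a cut tree; the derivative of the cut line acts at `v₁`.
  let X₁ (S₁ : Finset (Fin n)) (G₁ : SimpleGraph (Fin n)) (v₁ : Fin n) (a : Fin N × Fin N) :
    ℝ → Mat N → ℂ := treeContribution G₁ S₁ (derivAt F v₁ (Matrix.single a.1 a.2 1))
  -- By induction and the product rule, one side of the cut trees adds up to a derivative of the
  -- flow.
  have hXsum : ∀ S₁ : Finset (Fin n), S₁.card < S.card → S₁.Nonempty → ∀ (a : Fin N × Fin N) (s : ℝ),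
      ∀ τ ∈ strip ρ, ∑ G₁ : SimpleGraph (Fin n) with IsTreeOn G₁ S₁, ∑ v₁ ∈ S₁, X₁ S₁ G₁ v₁ a s τ
        = pderiv a (polyFlow F S₁ s) τ := by
    intro S₁ h1 h2 a s τ hτ
    rw [Finset.sum_comm, pderiv, fderiv_polyFlow hF S₁ _ s hτ]
    refine Finset.sum_congr rfl fun v₁ _ => ?_
    exact ih _ (hc ▸ h1) (lipHolo_derivAt hF v₁ _) h2 s hτ rfl
  -- The factor `1 / 2` accounts for the two orientations of the line of smallest weight; it is the
  -- factor `1 / 2` of the source term.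
  have hstep : ∑ G : SimpleGraph (Fin n) with IsTreeOn G S, treeContribution G S F u σ
      = 1 / 2 * ∑ G : SimpleGraph (Fin n) with IsTreeOn G S, ∑ v₁, ∑ v₂,
        if G.Adj v₁ v₂ then minLineContribution G S F s(v₁, v₂) u σ else 0 := by
    rw [Finset.mul_sum]
    refine Finset.sum_congr rfl fun G hG => ?_
    have hG' := (Finset.mem_filter.1 hG).2
    rw [treeContribution_eq_sum hG' hcard (hBdd G hG') u hσ, sum_edges_eq]
  rw [hstep, sum_tree_dart S fun G v₁ v₂ => minLineContribution G S F s(v₁, v₂) u σ]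
  -- Neither side of a cut is empty.
  have hsub : ∑ S₁ ∈ S.powerset, ∑ G₁ : SimpleGraph (Fin n) with IsTreeOn G₁ S₁,
      ∑ G₂ : SimpleGraph (Fin n) with IsTreeOn G₂ (S \ S₁), ∑ v₁ ∈ S₁, ∑ v₂ ∈ S \ S₁,
        minLineContribution (G₁ ⊔ G₂ ⊔ SimpleGraph.edge v₁ v₂) S F s(v₁, v₂) u σ
      = ∑ S₁ ∈ properParts S, ∑ G₁ : SimpleGraph (Fin n) with IsTreeOn G₁ S₁,
      ∑ G₂ : SimpleGraph (Fin n) with IsTreeOn G₂ (S \ S₁), ∑ v₁ ∈ S₁, ∑ v₂ ∈ S \ S₁,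
        minLineContribution (G₁ ⊔ G₂ ⊔ SimpleGraph.edge v₁ v₂) S F s(v₁, v₂) u σ := by
    symm
    refine Finset.sum_subset (fun S₁ h => Finset.mem_powerset.2 (mem_properParts.1 h).2.subset)
      fun S₁ h2 h3 => ?_
    rw [Finset.mem_powerset] at h2
    rw [mem_properParts, not_and_or, Finset.not_nonempty_iff_eq_empty] at h3
    rcases h3 with rfl | h3
    · simp
    · have : S₁ = S := by
        by_contra hne
        exact h3 (h2.ssubset_of_ne hne)
      simp [this]
  have hbdd₁ : ∀ {S₁ : Finset (Fin n)} {G₁ G₂ : SimpleGraph (Fin n)} {v₁ v₂ : Fin n},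
      S₁ ⊆ S → IsTreeOn G₁ S₁ → IsTreeOn G₂ (S \ S₁) → v₁ ∈ S₁ → v₂ ∈ S \ S₁ →
      Split (G₁ ⊔ G₂ ⊔ SimpleGraph.edge v₁ v₂) v₁ v₂ S₁ (S \ S₁) G₁ G₂ :=
    fun hs h1 h2 hv1 hv2 => ⟨rfl, Finset.disjoint_sdiff, hv1, hv2, h1, h2⟩
  have hX : ∀ {S₁ : Finset (Fin n)} {G₁ G₂ : SimpleGraph (Fin n)} {v₁ v₂ : Fin n},
      S₁ ⊆ S → Split (G₁ ⊔ G₂ ⊔ SimpleGraph.edge v₁ v₂) v₁ v₂ S₁ (S \ S₁) G₁ G₂ →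
      ∀ a, BddHolo ρ (fun s τ => X₁ S₁ G₁ v₁ a s τ * X₁ (S \ S₁) G₂ v₂ a.swap s τ) := by
    intro S₁ G₁ G₂ v₁ v₂ hs h a
    have htree := h.isTreeOn
    rw [Finset.union_sdiff_of_subset hs] at htree
    have hB := hBdd _ htree
    rw [← Finset.union_sdiff_of_subset hs] at hB
    have hB' := hB
    rw [Finset.union_comm] at hB'
    exact (bddHolo_treeContribution h.tree₁ (h.bddVertices hFd hB a)).mul
      (bddHolo_treeContribution h.tree₂ (h.symm.bddVertices hFd hB' a.swap))
  have hterm : ∀ S₁ ∈ properParts S, ∑ G₁ : SimpleGraph (Fin n) with IsTreeOn G₁ S₁,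
      ∑ G₂ : SimpleGraph (Fin n) with IsTreeOn G₂ (S \ S₁), ∑ v₁ ∈ S₁, ∑ v₂ ∈ S \ S₁,
        minLineContribution (G₁ ⊔ G₂ ⊔ SimpleGraph.edge v₁ v₂) S F s(v₁, v₂) u σ
      = duhamel (fun s τ => pairing (polyFlow F S₁ s) (polyFlow F (S \ S₁) s) τ) u σ := by
    intro S₁ hS₁
    have hlt := card_lt_of_mem_properParts hS₁
    obtain ⟨hne, hss⟩ := mem_properParts.1 hS₁
    have hs := hss.subset
    have hne2 : (S \ S₁).Nonempty := Finset.sdiff_nonempty.2 hss.2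
    have hpair : ∀ s, ∀ τ ∈ strip ρ, pairing (polyFlow F S₁ s) (polyFlow F (S \ S₁) s) τ
        = ∑ G₁ : SimpleGraph (Fin n) with IsTreeOn G₁ S₁,
          ∑ G₂ : SimpleGraph (Fin n) with IsTreeOn G₂ (S \ S₁), ∑ v₁ ∈ S₁, ∑ v₂ ∈ S \ S₁,
            ∑ a, X₁ S₁ G₁ v₁ a s τ * X₁ (S \ S₁) G₂ v₂ a.swap s τ := by
      intro s τ hτ
      have e1 : ∀ a, pderiv a (polyFlow F S₁ s) τ * pderiv a.swap (polyFlow F (S \ S₁) s) τ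
          = ∑ G₁ : SimpleGraph (Fin n) with IsTreeOn G₁ S₁,
            ∑ G₂ : SimpleGraph (Fin n) with IsTreeOn G₂ (S \ S₁), ∑ v₁ ∈ S₁, ∑ v₂ ∈ S \ S₁,
              X₁ S₁ G₁ v₁ a s τ * X₁ (S \ S₁) G₂ v₂ a.swap s τ := by
        intro a
        rw [← hXsum S₁ hlt.1 hne a s τ hτ, ← hXsum (S \ S₁) hlt.2 hne2 a.swap s τ hτ,
          Finset.sum_mul_sum]
        exact Finset.sum_congr rfl fun G₁ _ => Finset.sum_congr rfl fun G₂ _ =>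
          Finset.sum_mul_sum _ _ _ _
      unfold pairing
      rw [Finset.sum_congr rfl fun a _ => e1 a, Finset.sum_comm]
      refine Finset.sum_congr rfl fun G₁ _ => ?_
      rw [Finset.sum_comm]
      refine Finset.sum_congr rfl fun G₂ _ => ?_
      rw [Finset.sum_comm]
      refine Finset.sum_congr rfl fun v₁ _ => ?_
      rw [Finset.sum_comm]
    have hsp : ∀ {G₁ G₂ : SimpleGraph (Fin n)} {v₁ v₂ : Fin n},
        G₁ ∈ Finset.univ.filter (fun G₁ => IsTreeOn G₁ S₁) →
        G₂ ∈ Finset.univ.filter (fun G₂ => IsTreeOn G₂ (S \ S₁)) → v₁ ∈ S₁ → v₂ ∈ S \ S₁ →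
        Split (G₁ ⊔ G₂ ⊔ SimpleGraph.edge v₁ v₂) v₁ v₂ S₁ (S \ S₁) G₁ G₂ :=
      fun h1 h2 hv1 hv2 => hbdd₁ hs (Finset.mem_filter.1 h1).2 (Finset.mem_filter.1 h2).2 hv1 hv2
    rw [duhamel_congr (fun s _ τ hτ => hpair s τ hτ) hσ]
    rw [duhamel_sum (fun G₁ h1 => BddHolo.sum fun G₂ h2 => BddHolo.sum fun v₁ hv1 =>
      BddHolo.sum fun v₂ hv2 => BddHolo.sum fun a _ => hX hs (hsp h1 h2 hv1 hv2) a) hσ]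
    refine Finset.sum_congr rfl fun G₁ h1 => ?_
    rw [duhamel_sum (fun G₂ h2 => BddHolo.sum fun v₁ hv1 =>
      BddHolo.sum fun v₂ hv2 => BddHolo.sum fun a _ => hX hs (hsp h1 h2 hv1 hv2) a) hσ]
    refine Finset.sum_congr rfl fun G₂ h2 => ?_
    rw [duhamel_sum (fun v₁ hv1 => BddHolo.sum fun v₂ hv2 => BddHolo.sum fun a _ =>
      hX hs (hsp h1 h2 hv1 hv2) a) hσ]
    refine Finset.sum_congr rfl fun v₁ hv1 => ?_
    rw [duhamel_sum (fun v₂ hv2 => BddHolo.sum fun a _ => hX hs (hsp h1 h2 hv1 hv2) a) hσ]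
    refine Finset.sum_congr rfl fun v₂ hv2 => ?_
    have hsplit := hsp h1 h2 hv1 hv2
    have hu := Finset.union_sdiff_of_subset hs
    have htree := hsplit.isTreeOn
    rw [hu] at htree
    have hB := hBdd _ htree
    rw [← hu] at hB
    have := hsplit.minLineContribution_eq hFd hB u hσ
    rw [hu] at this
    exact this
  rw [hsub, Finset.sum_congr rfl hterm, polyFlow_of_card_ne_one F h1]
  have hq : polySource F S = fun s τ => (1 / 2 : ℂ) * ∑ S₁ ∈ properParts S,
      pairing (polyFlow F S₁ s) (polyFlow F (S \ S₁) s) τ := rfl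
  rw [hq, duhamel_const_mul, duhamel_sum (fun S₁ _ => (lipHolo_polyFlow hF S₁).pairing
    (lipHolo_polyFlow hF (S \ S₁))) hσ]

end TreeSum

/-! ### Evaluation of the tree integrand -/

section Integrand

variable {n N : ℕ} {ρ : ℝ}

/-- The loop vertex as a function of a matrix. -/
def vertexPotential (lam : ℝ) (N : ℕ) : Mat N → ℂ := fun τ => loopVertex lam (Matrix.of.symm τ)

/-- Tuples of matrices in the strip. -/
def tupleStrip (ρ : ℝ) (n N : ℕ) : Set (Fin n → MatField N) :=
  {σ | ∀ v, (Matrix.of (σ v) : Mat N) ∈ strip ρ}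

/-- A partial derivative of a product of functions of the single matrices. -/
theorem sigmaDeriv_prod {g : Fin n → Mat N → ℂ} (hg : ∀ v, DifferentiableOn ℂ (g v) (strip ρ))
    {d : ℂ} {F : (Fin n → MatField N) → ℂ}
    (hF : ∀ σ ∈ tupleStrip ρ n N, F σ = d * ∏ v, g v (Matrix.of (σ v))) (v : Fin n) (a : Fin N × Fin N)
    {σ : Fin n → MatField N} (hσ : σ ∈ tupleStrip ρ n N) :
    sigmaDeriv v a.1 a.2 F σ
      = d * ∏ w, Function.update g v (pderiv a (g v)) w (Matrix.of (σ w)) := by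
  let E : Mat N := Matrix.single a.1 a.2 1
  let shift : ℂ → Fin n → MatField N := fun z => Function.update σ v fun i j =>
    σ v i j + if i = a.1 ∧ j = a.2 then z else 0
  have hshift : ∀ z, (Matrix.of (shift z v) : Mat N) = Matrix.of (σ v) + z • E := by
    intro z
    ext i j
    simp only [shift, Function.update_self, Matrix.of_apply, Matrix.add_apply, Matrix.smul_apply, E,
      Matrix.single_apply, smul_eq_mul, mul_ite, mul_one, mul_zero, eq_comm (a := a.1),
      eq_comm (a := a.2)]
  have hother : ∀ z w, w ≠ v → shift z w = σ w := fun z w hw => by simp [shift, hw]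
  have hline : HasDerivAt (fun z : ℂ => (Matrix.of (σ v) : Mat N) + z • E) E 0 := by
    simpa using ((hasDerivAt_id (0 : ℂ)).smul_const E).const_add (Matrix.of (σ v) : Mat N)
  have hcont : ContinuousAt (fun z : ℂ => (Matrix.of (σ v) : Mat N) + z • E) 0 := hline.continuousAt
  have hev : ∀ᶠ z in 𝓝 (0 : ℂ), (Matrix.of (σ v) : Mat N) + z • E ∈ strip ρ :=
    hcont.eventually ((isOpen_strip ρ).mem_nhds (by simpa using hσ v))
  have hev2 : (fun z => F (shift z)) =ᶠ[𝓝 0] fun z =>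
      d * (∏ w ∈ Finset.univ.erase v, g w (Matrix.of (σ w))) * g v (Matrix.of (σ v) + z • E) := by
    filter_upwards [hev] with z hz
    have hmem : shift z ∈ tupleStrip ρ n N := fun w => by
      rcases eq_or_ne w v with rfl | hw
      · rw [hshift]; exact hz
      · rw [hother z w hw]; exact hσ w
    rw [hF _ hmem, ← Finset.mul_prod_erase _ _ (Finset.mem_univ v), hshift,
      Finset.prod_congr rfl fun w hw => by rw [hother z w (Finset.ne_of_mem_erase hw)]]
    ring
  have hd : HasDerivAt (fun z : ℂ => g v ((Matrix.of (σ v) : Mat N) + z • E))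
      (pderiv a (g v) (Matrix.of (σ v))) 0 := by
    have h1 : HasFDerivAt (g v) (fderiv ℂ (g v) (Matrix.of (σ v)))
        ((Matrix.of (σ v) : Mat N) + (0 : ℂ) • E) := by
      rw [zero_smul, add_zero]
      exact ((hg v).differentiableAt ((isOpen_strip ρ).mem_nhds (hσ v))).hasFDerivAt
    exact h1.comp_hasDerivAt (0 : ℂ) hline
  have hmain : sigmaDeriv v a.1 a.2 F σ = d * (∏ w ∈ Finset.univ.erase v, g w (Matrix.of (σ w))) *
      pderiv a (g v) (Matrix.of (σ v)) := hev2.deriv_eq.trans (hd.const_mul _).deriv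
  rw [hmain, ← Finset.mul_prod_erase _ _ (Finset.mem_univ v), Function.update_self,
    Finset.prod_congr rfl fun w hw => by
      rw [← Function.update_of_ne (Finset.ne_of_mem_erase hw) (pderiv a (g v)) g]]
  ring

/-- The factor `δ_il δ_jk` of a line. -/
def lineDelta (c : LineIndex N) : ℂ := (if c.i = c.l then 1 else 0) * (if c.j = c.k then 1 else 0)

/-- The indices of the derivative that a line applies to its end `v`. -/
def lineLeg (e : Sym2 (Fin n)) (v : Fin n) (c : LineIndex N) : Fin N × Fin N :=
  if v = e.inf then (c.i, c.j) else (c.k, c.l)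

theorem inf_ne_sup {e : Sym2 (Fin n)} (he : ¬ e.IsDiag) : e.inf ≠ e.sup := by
  induction e with
  | _ a b => simpa using he

theorem mem_iff_inf_sup (e : Sym2 (Fin n)) (v : Fin n) : v ∈ e ↔ v = e.inf ∨ v = e.sup := by
  induction e with
  | _ a b =>
    rcases le_total a b with h | h
    · simp [h]
    · simp [h, or_comm]

/-- Applying the operators of a list of lines to a product of vertices differentiates each vertex
once for each line that ends at it. -/
theorem lineOps_prod {T : SimpleGraph (Fin n)} {V : Mat N → ℂ} (hV : DifferentiableOn ℂ V (strip ρ))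
    (c : T.edgeSet → LineIndex N) (l : List T.edgeSet) {σ : Fin n → MatField N}
    (hσ : σ ∈ tupleStrip ρ n N) :
    l.foldr (fun (ℓ : T.edgeSet) F => lineOp ℓ.1 (c ℓ) F) (fun σ => ∏ v, V (Matrix.of (σ v))) σ
      = (l.map fun ℓ => lineDelta (c ℓ)).prod *
        ∏ v, iterDeriv ((l.filter fun ℓ => v ∈ ℓ.1).map fun ℓ => lineLeg ℓ.1 v (c ℓ)) V
          (Matrix.of (σ v)) := by
  induction l generalizing σ with
  | nil => simp [iterDeriv]
  | cons ℓ l ih =>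
    set g : Fin n → Mat N → ℂ := fun v =>
      iterDeriv ((l.filter fun ℓ => v ∈ ℓ.1).map fun ℓ => lineLeg ℓ.1 v (c ℓ)) V with hg
    have hgd : ∀ v, DifferentiableOn ℂ (g v) (strip ρ) := fun v => differentiableOn_iterDeriv _ hV
    have hne : ℓ.1.inf ≠ ℓ.1.sup := inf_ne_sup (T.not_isDiag_of_mem_edgeSet ℓ.2)
    have h1 := fun (σ : Fin n → MatField N) (hσ : σ ∈ tupleStrip ρ n N) =>
      sigmaDeriv_prod hgd (fun σ hσ => ih hσ) ℓ.1.sup ((c ℓ).k, (c ℓ).l) hσ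
    have hgd' : ∀ v, DifferentiableOn ℂ (Function.update g ℓ.1.sup
        (pderiv ((c ℓ).k, (c ℓ).l) (g ℓ.1.sup)) v) (strip ρ) := fun v => by
      rcases eq_or_ne v ℓ.1.sup with rfl | hv
      · rw [Function.update_self]; exact differentiableOn_pderiv (hgd _) _
      · rw [Function.update_of_ne hv]; exact hgd v
    have h2 := sigmaDeriv_prod hgd' h1 ℓ.1.inf ((c ℓ).i, (c ℓ).j) hσ
    rw [List.foldr_cons, lineOp]
    refine (congrArg _ h2).trans ?_
    rw [List.map_cons, List.prod_cons, ← mul_assoc, lineDelta]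
    congr 1
    refine Finset.prod_congr rfl fun v _ => ?_
    rw [Function.update_of_ne hne]
    rcases eq_or_ne v ℓ.1.inf with rfl | hv
    · have hm : ℓ.1.inf ∈ ℓ.1 := (mem_iff_inf_sup _ _).2 (Or.inl rfl)
      rw [Function.update_self, List.filter_cons_of_pos (by simpa using hm), List.map_cons]
      simp [iterDeriv, hg, lineLeg]
    · rw [Function.update_of_ne hv]
      rcases eq_or_ne v ℓ.1.sup with rfl | hv'
      · have hm : ℓ.1.sup ∈ ℓ.1 := (mem_iff_inf_sup _ _).2 (Or.inr rfl)
        rw [Function.update_self, List.filter_cons_of_pos (by simpa using hm), List.map_cons]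
        simp [iterDeriv, hg, lineLeg, hv]
      · have hm : v ∉ ℓ.1 := fun h => ((mem_iff_inf_sup _ _).1 h).elim hv hv'
        rw [Function.update_of_ne hv', List.filter_cons_of_neg (by simpa using hm)]

/-- The labels on the edges of `T`, extended to all pairs. -/
def extendLabels [NeZero N] {T : SimpleGraph (Fin n)} (a : T.edgeSet → Fin N × Fin N) :
    Sym2 (Fin n) → Fin N × Fin N := open Classical in
  fun e => if h : e ∈ T.edgeSet then a ⟨e, h⟩ else (0, 0)

theorem extendLabels_coe [NeZero N] {T : SimpleGraph (Fin n)} (a : T.edgeSet → Fin N × Fin N)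
    (ℓ : T.edgeSet) : extendLabels a ℓ.1 = a ℓ := by
  rw [extendLabels, dif_pos ℓ.2]

/-- The tree integrand is a product of differentiated vertices. -/
theorem treeIntegrand_eq [NeZero N] {lam : ℝ} {T : SimpleGraph (Fin n)}
    (hV : DifferentiableOn ℂ (vertexPotential lam N) (strip ρ)) (c : T.edgeSet → LineIndex N)
    {σ : Fin n → MatField N} (hσ : σ ∈ tupleStrip ρ n N) :
    treeIntegrand lam T c σ = (∏ ℓ, lineDelta (c ℓ)) *
      ∏ v, vertexFun T (fun _ => vertexPotential lam N) (extendLabels fun ℓ => ((c ℓ).i, (c ℓ).j)) v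
        (Matrix.of (σ v)) := by
  have h := lineOps_prod hV c (Finset.univ : Finset T.edgeSet).toList hσ
  rw [Finset.prod_map_toList] at h
  refine Eq.trans ?_ (h.trans ?_)
  · rfl
  -- For a nonzero factor `δ_il δ_jk` the derivative at the second end of a line is the transpose of
  -- that at the first; otherwise both sides vanish.
  by_cases h0 : ∏ ℓ, lineDelta (c ℓ) = 0
  · rw [h0, zero_mul, zero_mul]
  congr 1
  refine Finset.prod_congr rfl fun v _ => ?_
  refine iterDeriv_perm ?_ hV (hσ v)
  have hleg : ∀ ℓ : T.edgeSet, lineLeg ℓ.1 v (c ℓ)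
      = leg ℓ.1 v (extendLabels (fun ℓ => ((c ℓ).i, (c ℓ).j)) ℓ.1) := by
    intro ℓ
    have hℓ := Finset.prod_ne_zero_iff.1 h0 ℓ (Finset.mem_univ ℓ)
    have h1 : (c ℓ).i = (c ℓ).l := by
      by_contra h; simp [lineDelta, h] at hℓ
    have h2 : (c ℓ).j = (c ℓ).k := by
      by_contra h; simp [lineDelta, h] at hℓ
    rw [extendLabels_coe, lineLeg, leg, h1, h2]
    rfl
  have hmap : (((Finset.univ : Finset T.edgeSet).toList.filter fun ℓ => v ∈ ℓ.1).map
      fun ℓ => lineLeg ℓ.1 v (c ℓ)) = (((Finset.univ : Finset T.edgeSet).toList.filter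
        fun ℓ => v ∈ ℓ.1).map Subtype.val).map
          fun e => leg e v (extendLabels (fun ℓ => ((c ℓ).i, (c ℓ).j)) e) := by
    rw [List.map_map]
    exact List.map_congr_left fun ℓ _ => hleg ℓ
  rw [hmap, legs]
  refine List.Perm.map _ ?_
  refine (List.perm_ext_iff_of_nodup ?_ (Finset.nodup_toList _)).2 fun e => ?_
  · exact ((Finset.nodup_toList _).filter _).map Subtype.val_injective
  · simp only [List.mem_map, List.mem_filter, Finset.mem_toList, Finset.mem_univ, true_and,
      decide_eq_true_eq, Finset.mem_filter, mem_edges]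
    constructor
    · rintro ⟨ℓ, h1, rfl⟩; exact ⟨ℓ.2, h1⟩
    · rintro ⟨h1, h2⟩; exact ⟨⟨e, h1⟩, h2, rfl⟩

end Integrand

/-! ### Tree amplitudes as tree contributions -/

section RestrictLines

variable {A : Type*} [MeasurableSpace A] {κ : Measure A} [IsProbabilityMeasure κ] {ι : Type*}
  [Fintype ι] {p : ι → Prop} [Fintype {i // p i}]

/-- The lines outside a subset integrate to one. -/
theorem map_lines_restrict : (lines κ ι).map (fun θ (i : {i // p i}) => θ i) = lines κ {i // p i} := by
  have hind := (iIndepFun_pi (μ := fun _ : ι => lineMeasure κ) (X := fun _ x => x)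
    fun _ => aemeasurable_id).precomp (g := ((↑) : {i // p i} → ι)) Subtype.val_injective
  have h := (iIndepFun_iff_map_fun_eq_pi_map fun i => (measurable_pi_apply i.1).aemeasurable).1 hind
  refine h.trans ?_
  unfold lines
  congr 1
  funext i
  exact (measurePreserving_eval (fun _ : ι => lineMeasure κ) i.1).map_eq

/-- The average over lines with discrete labels, as an integral over the unit cube of a weighted
sum. -/
theorem integral_lines_unzip [DecidableEq {i // p i}] [Fintype A] [MeasurableSingletonClass A]
    {g : ({i // p i} → ℝ × A) → ℂ} (hg : Measurable g) {C : ℝ} (hC : ∀ y, ‖g y‖ ≤ C) :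
    ∫ y, g y ∂(lines κ {i // p i}) = ∫ w in Set.Icc (0 : {i // p i} → ℝ) 1,
      ∑ a : {i // p i} → A, (Measure.pi fun _ => κ).real {a} • g fun i => (w i, a i) := by
  have hmp := measurePreserving_arrowProdEquivProdArrow ℝ A {i // p i}
    (fun _ => (volume : Measure ℝ).restrict (Set.Icc 0 1)) (fun _ => κ)
  have hicc : (Measure.pi fun _ : {i // p i} => (volume : Measure ℝ).restrict (Set.Icc 0 1))
      = (volume : Measure ({i // p i} → ℝ)).restrict (Set.Icc 0 1) := by
    rw [← Measure.restrict_pi_pi, volume_pi, Set.pi_univ_Icc]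
    rfl
  have hmeas : Measurable fun q : ({i // p i} → ℝ) × ({i // p i} → A) => g fun i => (q.1 i, q.2 i) :=
    hg.comp (by fun_prop)
  have hint := integrable_of_measurable_bounded (μ := (Measure.pi fun _ : {i // p i} =>
    (volume : Measure ℝ).restrict (Set.Icc 0 1)).prod (Measure.pi fun _ => κ)) hmeas fun q => hC _
  have h1 : ∫ y, g y ∂(lines κ {i // p i}) = ∫ q, g (fun i => (q.1 i, q.2 i))
      ∂((Measure.pi fun _ : {i // p i} => (volume : Measure ℝ).restrict (Set.Icc 0 1)).prod
        (Measure.pi fun _ => κ)) := by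
    rw [← hmp.map_eq, integral_map hmp.measurable.aemeasurable hmeas.aestronglyMeasurable]
    rfl
  rw [h1, integral_prod _ hint, hicc]
  refine integral_congr_ae (.of_forall fun w => ?_)
  beta_reduce
  rw [integral_fintype]
  exact integrable_of_measurable_bounded (hg.comp (by fun_prop)) fun q => hC _

end RestrictLines

section Amplitude

variable {n N : ℕ} {ρ lam : ℝ} {T : SimpleGraph (Fin n)}

theorem of_hermitianFields (x : TupleCoord n N) (v : Fin n) :
    (Matrix.of (hermitianFields x v) : Mat N) = herm (slot v x) := rfl

/-- `hermitianFields` as a linear map. -/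
def hermitianFieldsₗ (n N : ℕ) : TupleCoord n N →ₗ[ℝ] (Fin n → MatField N) where
  toFun := hermitianFields
  map_add' x y := by
    funext v i j
    simp only [hermitianFields, PiLp.add_apply, Pi.add_apply, Complex.ofReal_add]
    ring
  map_smul' r x := by
    funext v i j
    simp only [hermitianFields, PiLp.smul_apply, Pi.smul_apply, smul_eq_mul,
      Complex.ofReal_mul, RingHom.id_apply, Complex.real_smul]
    ring

theorem measurableEmbedding_hermitianFields (n N : ℕ) :
    MeasurableEmbedding (hermitianFields (n := n) (N := N)) := by
  refine (LinearMap.isClosedEmbedding_of_injective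
    (f := hermitianFieldsₗ n N) ?_).measurableEmbedding
  refine LinearMap.ker_eq_bot.2 fun x y hxy => ?_
  ext ⟨v, i, j⟩
  have h : hermitianFields x v i j = hermitianFields y v i j := congrFun (congrFun (congrFun hxy v) i) j
  have hre := congrArg Complex.re h
  have him := congrArg Complex.im h
  simp only [hermitianFields, Complex.div_ofNat_re, Complex.div_ofNat_im, Complex.add_re,
    Complex.add_im, Complex.mul_re, Complex.mul_im, Complex.one_re, Complex.one_im, Complex.I_re,
    Complex.I_im, Complex.sub_re, Complex.sub_im, Complex.ofReal_re, Complex.ofReal_im] at hre him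
  linarith

theorem integral_gaussianFields (W : Matrix (Fin n) (Fin n) ℝ) (f : (Fin n → MatField N) → ℂ) :
    ∫ σ, f σ ∂(gaussianFields N W) = ∫ x, f (hermitianFields x) ∂(tupleGaussian N W) :=
  (measurableEmbedding_hermitianFields n N).integral_map f

theorem integrable_gaussianFields {W : Matrix (Fin n) (Fin n) ℝ} {f : (Fin n → MatField N) → ℂ} :
    Integrable f (gaussianFields N W)
      ↔ Integrable (fun x => f (hermitianFields x)) (tupleGaussian N W) :=
  (measurableEmbedding_hermitianFields n N).integrable_map_iff

theorem hermitianFields_mem_tupleStrip (hρ : 0 < ρ) (x : TupleCoord n N) :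
    hermitianFields x ∈ tupleStrip ρ n N := fun v => by
  rw [of_hermitianFields]
  exact hermitian_mem_strip hρ (herm_isHermitian _)

variable [NeZero N]

/-- The configuration with given weights and labels on the edges of `T`. -/
def edgeConfig (w : T.edgeSet → ℝ) (a : T.edgeSet → Fin N × Fin N) : LineConfig n N :=
  open Classical in fun e => (if h : e ∈ T.edgeSet then w ⟨e, h⟩ else 0, extendLabels a e)

theorem edgeConfig_coe (w : T.edgeSet → ℝ) (a : T.edgeSet → Fin N × Fin N) (ℓ : T.edgeSet) :
    edgeConfig w a ℓ.1 = (w ℓ, a ℓ) := by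
  rw [edgeConfig, extendLabels_coe, dif_pos ℓ.2]

theorem continuous_edgeConfig (a : T.edgeSet → Fin N × Fin N) :
    Continuous fun w : T.edgeSet → ℝ => edgeConfig w a := by
  refine continuous_pi fun e => ?_
  by_cases h : e ∈ T.edgeSet
  · simp only [edgeConfig, dif_pos h]; fun_prop
  · simp only [edgeConfig, dif_neg h]; fun_prop

theorem maskedWeight_edgeConfig {w : T.edgeSet → ℝ} (hw : w ∈ Set.Icc (0 : T.edgeSet → ℝ) 1)
    (a : T.edgeSet → Fin N × Fin N) :
    maskedWeight T Finset.univ (weights (edgeConfig w a)) = treeWeight T w := by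
  rw [maskedWeight_univ, pathWeight]
  congr 1
  funext ℓ
  rw [weights, edgeConfig_coe]
  exact clamp_of_mem ⟨hw.1 ℓ, hw.2 ℓ⟩

/-- The tree integrand on Hermitian fields. -/
theorem treeIntegrand_hermitianFields (hρ : 0 < ρ)
    (hV : DifferentiableOn ℂ (vertexPotential lam N) (strip ρ)) (c : T.edgeSet → LineIndex N)
    (w : T.edgeSet → ℝ) (x : TupleCoord n N) :
    treeIntegrand lam T c (hermitianFields x) = (∏ ℓ, lineDelta (c ℓ)) *
      ∏ v, vertexFun T (fun _ => vertexPotential lam N)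
        (labels (edgeConfig w fun ℓ => ((c ℓ).i, (c ℓ).j))) v
        (0 + herm (√(1 - clamp 0) • slot v x)) := by
  rw [treeIntegrand_eq hV c (hermitianFields_mem_tupleStrip hρ x)]
  congr 1
  refine Finset.prod_congr rfl fun v _ => ?_
  rw [of_hermitianFields, zero_add, clamp_of_mem (by simp), sub_zero, Real.sqrt_one, one_smul]
  rfl

/-- At scale `0` and mean `0` the tree average is the tree expectation. -/
theorem treeExpectation_eq (hρ : 0 < ρ)
    (hV : DifferentiableOn ℂ (vertexPotential lam N) (strip ρ)) (c : T.edgeSet → LineIndex N)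
    {w : T.edgeSet → ℝ} (hw : w ∈ Set.Icc (0 : T.edgeSet → ℝ) 1) :
    treeExpectation lam T c w = (∏ ℓ, lineDelta (c ℓ)) *
      treeAverage T Finset.univ (fun _ => vertexPotential lam N)
        (edgeConfig w fun ℓ => ((c ℓ).i, (c ℓ).j)) 0 0 := by
  rw [treeExpectation, integral_gaussianFields, treeAverage, maskedWeight_edgeConfig hw,
    ← integral_const_mul]
  exact integral_congr_ae (.of_forall fun x => treeIntegrand_hermitianFields hρ hV c w x)

omit [NeZero N] in
/-- The sum over the four indices of each line reduces to two indices. -/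
theorem sum_lineDelta (f : (T.edgeSet → Fin N × Fin N) → ℂ) :
    ∑ c : T.edgeSet → LineIndex N, (∏ ℓ, lineDelta (c ℓ)) * f (fun ℓ => ((c ℓ).i, (c ℓ).j))
      = ∑ a, f a := by
  symm
  refine Finset.sum_of_injOn (fun a ℓ => ⟨(a ℓ).1, (a ℓ).2, (a ℓ).2, (a ℓ).1⟩)
    (fun a _ b _ h => ?_) (fun _ _ => by simp) (fun c _ hc => ?_) fun a _ => ?_
  · funext ℓ
    have := congrFun h ℓ
    simp only [LineIndex.mk.injEq] at this
    exact Prod.ext this.1 this.2.1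
  · have h0 : ∏ ℓ, lineDelta (c ℓ) = 0 := by
      by_contra h0
      refine hc ⟨fun ℓ => ((c ℓ).i, (c ℓ).j), by simp, ?_⟩
      funext ℓ
      have hℓ := Finset.prod_ne_zero_iff.1 h0 ℓ (Finset.mem_univ ℓ)
      have h1 : (c ℓ).i = (c ℓ).l := by
        by_contra h; simp [lineDelta, h] at hℓ
      have h2 : (c ℓ).j = (c ℓ).k := by
        by_contra h; simp [lineDelta, h] at hℓ
      calc (⟨(c ℓ).i, (c ℓ).j, (c ℓ).j, (c ℓ).i⟩ : LineIndex N)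
          = ⟨(c ℓ).i, (c ℓ).j, (c ℓ).k, (c ℓ).l⟩ := by rw [← h2, ← h1]
        _ = c ℓ := rfl
    rw [h0, zero_mul]
  · simp [lineDelta]

/-- The tree average at the origin depends continuously on the weights and is bounded. -/
theorem continuous_bounded_treeAverage (hρ : 0 < ρ)
    (hV : LipHolo ρ (fun _ : Unit => vertexPotential lam N)) (hT : T.IsTree) :
    Continuous (fun θ => treeAverage T Finset.univ (fun _ => vertexPotential lam N) θ 0 0) ∧
      ∃ C, ∀ θ, ‖treeAverage T Finset.univ (fun _ => vertexPotential lam N) θ 0 0‖ ≤ C := by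
  have hT' := isTreeOn_univ.2 hT
  have h0 : (0 : Mat N) ∈ strip ρ := hermitian_mem_strip hρ (by simp [Matrix.IsHermitian])
  rcases lt_or_ge 1 (Finset.univ : Finset (Fin n)).card with hn | hn
  · have := (bddHolo_treeAverage hT' fun v hv c =>
      bddHolo_vertexFun (fun _ => hV) hT' hn hv c).comp_param
        (by fun_prop : Continuous fun θ : LineConfig n N => (θ, (0 : ℝ)))
    exact ⟨this.continuous_at h0, this.bounded_at h0⟩
  -- A tree with one vertex has no lines, and its average does not depend on the configuration.
  · have hempty : ∀ e, e ∉ edges T := by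
      intro e he
      rw [mem_edges] at he
      induction e with
      | _ a b => exact T.ne_of_adj he (Finset.card_le_one.1 hn a (Finset.mem_univ a) b (Finset.mem_univ b))
    have hc : ∀ θ θ', treeAverage T Finset.univ (fun _ => vertexPotential lam N) θ 0 0
        = treeAverage T Finset.univ (fun _ => vertexPotential lam N) θ' 0 0 := fun θ θ' => by
      rw [treeAverage_congr hT' _ fun e he => absurd he (hempty e)]
    exact ⟨continuous_of_const hc, _, fun θ => (congrArg norm (hc θ 0)).le⟩

/-- The tree amplitude, an integral over the weights and a sum over the labels of the lines of `T`
alone, as an average over lines between all pairs of vertices. -/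
theorem treeAmplitude_eq (hρ : 0 < ρ) (hV : LipHolo ρ (fun _ : Unit => vertexPotential lam N))
    (hT : T.IsTree) :
    treeAmplitude lam N T
      = treeContribution T Finset.univ (fun _ => vertexPotential lam N) 0 0 := by
  obtain ⟨hcont, C, hC⟩ := continuous_bounded_treeAverage hρ hV hT
  set Y : LineConfig n N → ℂ := fun θ =>
    treeAverage T Finset.univ (fun _ => vertexPotential lam N) θ 0 0 with hY
  have hYc : ∀ θ θ', (∀ e ∈ edges T, θ e = θ' e) → Y θ = Y θ' := fun θ θ' h => by
    simp only [hY]; rw [treeAverage_congr (isTreeOn_univ.2 hT) _ h]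
  have h1 : treeAmplitude lam N T = ∫ w in Set.Icc (0 : T.edgeSet → ℝ) 1,
      ∑ a : T.edgeSet → Fin N × Fin N, Y (edgeConfig w a) := by
    refine setIntegral_congr_fun measurableSet_Icc fun w hw => ?_
    rw [← sum_lineDelta]
    exact Finset.sum_congr rfl fun c _ => treeExpectation_eq hρ (hV.holo.holo ()) c hw
  let ext (y : T.edgeSet → ℝ × (Fin N × Fin N)) : LineConfig n N :=
    edgeConfig (fun ℓ => (y ℓ).1) fun ℓ => (y ℓ).2
  have hext : Measurable ext := by
    refine measurable_pi_iff.2 fun e => ?_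
    by_cases h : e ∈ T.edgeSet
    · simp only [ext, edgeConfig, extendLabels, dif_pos h]; fun_prop
    · simp only [ext, edgeConfig, extendLabels, dif_neg h]; fun_prop
  have hmeas : Measurable fun y => Y (ext y) := hcont.measurable.comp hext
  have h2 : ∫ θ, Y θ ∂(lines (uniformLabel N) (Sym2 (Fin n)))
      = ∫ y, Y (ext y) ∂(lines (uniformLabel N) T.edgeSet) := by
    have := map_lines_restrict (κ := uniformLabel N) (p := fun e => e ∈ T.edgeSet)
    rw [show lines (uniformLabel N) T.edgeSet = _ from this.symm,
      integral_map (measurable_pi_lambda _ fun i => measurable_pi_apply _).aemeasurable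
        hmeas.aestronglyMeasurable]
    refine integral_congr_ae (.of_forall fun θ => hYc _ _ fun e he => ?_)
    exact (edgeConfig_coe (fun ℓ => (θ ℓ.1).1) (fun ℓ => (θ ℓ.1).2) ⟨e, mem_edges.1 he⟩).symm
  have hN : (N : ℂ) ≠ 0 := Nat.cast_ne_zero.2 (NeZero.ne N)
  have hmass : ∀ a : T.edgeSet → Fin N × Fin N,
      (((Measure.pi fun _ : T.edgeSet => uniformLabel N).real {a} : ℝ) : ℂ)
        = ((N : ℂ) ^ (2 * (edges T).card))⁻¹ := by
    intro a
    have hcard : Fintype.card T.edgeSet = (edges T).card := by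
      rw [edges, SimpleGraph.edgeFinset_card]
    rw [Measure.real, Measure.pi_singleton]
    simp only [uniformLabel, Measure.smul_apply, Measure.count_singleton, smul_eq_mul, mul_one,
      Finset.prod_const, Finset.card_univ, hcard]
    simp [ENNReal.toReal_inv, ENNReal.toReal_pow, pow_mul]
  rw [h1, treeContribution, h2,
    integral_lines_unzip (p := fun e => e ∈ T.edgeSet) hmeas fun y => hC _,
    clamp_of_mem (by simp), sub_zero, Complex.ofReal_one, one_pow, mul_one, ← integral_const_mul]
  refine integral_congr_ae (.of_forall fun w => ?_)
  beta_reduce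
  rw [Finset.mul_sum]
  refine Finset.sum_congr rfl fun a _ => ?_
  rw [Complex.real_smul]
  erw [hmass a]
  rw [← mul_assoc, mul_inv_cancel₀ (pow_ne_zero _ hN), one_mul]

open Classical in
/-- The terms of the tree expansion are the terms of the flow. -/
theorem treeTerm_eq_flow (hρ : 0 < ρ) (hV : LipHolo ρ (fun _ : Unit => vertexPotential lam N))
    (m : ℕ) : treeTerm lam N (m + 1) = flow (vertexPotential lam N) m 0 0 := by
  have h0 : (0 : Mat N) ∈ strip ρ := hermitian_mem_strip hρ (by simp [Matrix.IsHermitian])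
  have h1 := sum_treeContribution (n := m + 1) (S := Finset.univ) (fun _ => hV)
    Finset.univ_nonempty 0 h0
  rw [polyFlow_const hV Finset.univ_nonempty 0 h0] at h1
  have h2 : ∑ T : {T : SimpleGraph (Fin (m + 1)) // T.IsTree}, treeAmplitude lam N T.1
      = ∑ G : SimpleGraph (Fin (m + 1)) with IsTreeOn G Finset.univ,
        treeContribution G Finset.univ (fun _ => vertexPotential lam N) 0 0 := by
    rw [Finset.sum_congr rfl fun T _ => treeAmplitude_eq hρ hV T.2]
    exact (Finset.sum_subtype _ (fun G => by simp [isTreeOn_univ]) fun T : SimpleGraph (Fin (m + 1)) =>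
      treeContribution T Finset.univ (fun _ => vertexPotential lam N) 0 0).symm
  rw [treeTerm]
  refine (congrArg _ (h2.trans h1)).trans ?_
  -- The factor `1 / n!` cancels the number of orderings of the vertices.
  have h3 : (((m + 1).factorial : ℕ) : ℂ) ≠ 0 := Nat.cast_ne_zero.2 (Nat.factorial_ne_zero _)
  rw [Finset.card_univ, Fintype.card_fin, Nat.add_sub_cancel, ← mul_assoc, inv_mul_cancel₀ h3,
    one_mul]

end Amplitude

/-! ### Integrability of the tree integrands -/

section Integrability

variable {n N : ℕ} [NeZero N] {ρ lam : ℝ} {T : SimpleGraph (Fin n)}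

/-- With at least two vertices every vertex is differentiated and the integrand is bounded; on the
one-vertex tree it is the potential, which grows at most linearly. -/
theorem integrable_treeIntegrand (hρ : 0 < ρ)
    (hV : LipHolo ρ (fun _ : Unit => vertexPotential lam N)) (hT : T.IsTree)
    (c : T.edgeSet → LineIndex N) (w : T.edgeSet → ℝ) :
    Integrable (treeIntegrand lam T c) (gaussianFields N (treeWeight T w)) := by
  have h0 : (0 : Mat N) ∈ strip ρ := hermitian_mem_strip hρ (by simp [Matrix.IsHermitian])
  have hT' := isTreeOn_univ.2 hT
  rw [integrable_gaussianFields]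
  simp only [treeIntegrand_hermitianFields hρ (hV.holo.holo ()) c w]
  refine Integrable.const_mul ?_ _
  rcases lt_or_ge 1 (Finset.univ : Finset (Fin n)).card with hn | hn
  · have hB : BddVertices ρ T Finset.univ fun _ => vertexPotential lam N := fun v hv c =>
      bddHolo_vertexFun (fun _ => hV) hT' hn hv c
    choose C hC using fun v => (hB v (Finset.mem_univ v)
      (labels (edgeConfig w fun ℓ => ((c ℓ).i, (c ℓ).j)))).bdd _ h0
    exact integrable_prod_of_bounded (fun v hv => (hB.continuous hv _ h0 _).comp
      (slot v).continuous) fun v _ x => hC v () _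
        (by rw [stripDist_add_hermitian ρ 0 (herm_isHermitian _)])
  -- There are no lines: linear growth against a Gaussian measure.
  · obtain ⟨v, hv⟩ := Finset.card_eq_one.1 (le_antisymm hn hT'.nonempty.card_pos)
    have hlegs : ∀ c' : Sym2 (Fin n) → Fin N × Fin N, legs T c' v = [] := by
      intro c'
      have : edges T = ∅ := by
        ext e
        simp only [Finset.notMem_empty, iff_false, mem_edges]
        intro he
        induction e with
        | _ a b =>
          exact T.ne_of_adj he (Finset.card_le_one.1 hn a (Finset.mem_univ a) b (Finset.mem_univ b))
      simp [legs, this]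
    rw [hv]
    simp only [Finset.prod_singleton, vertexFun, hlegs, iterDeriv, List.foldr_nil]
    obtain ⟨C, hC⟩ := hV.bdd _ h0
    have hbound : ∀ X : Mat N, X.IsHermitian → ‖vertexPotential lam N (0 + X)‖
        ≤ ‖vertexPotential lam N 0‖ + C * ‖X‖ := fun X hX => by
      have h1 := norm_sub_le_of_hermitian (hV.holo.holo ()) h0 hX (C := C) fun τ hτ =>
        hC () τ hτ.ge
      have h2 := norm_sub_norm_le (vertexPotential lam N (0 + X)) (vertexPotential lam N 0)
      linarith
    have hid : Integrable (fun x : TupleCoord n N => x) (tupleGaussian N (treeWeight T w)) := by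
      unfold tupleGaussian; exact IsGaussian.integrable_id
    have hlin := ((herm (N := N)).comp ((√(1 - clamp 0)) • slot v)).integrable_comp hid
    refine Integrable.mono' ((integrable_const ‖vertexPotential lam N 0‖).add (hlin.norm.const_mul C))
      (Continuous.aestronglyMeasurable ?_) (.of_forall fun x => hbound _ (herm_isHermitian _))
    exact (hV.continuous_comp h0 () (1 - clamp 0)).comp (slot v).continuous

theorem integrableOn_treeExpectation (hρ : 0 < ρ)
    (hV : LipHolo ρ (fun _ : Unit => vertexPotential lam N)) (hT : T.IsTree)
    (c : T.edgeSet → LineIndex N) :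
    IntegrableOn (treeExpectation lam T c) (Set.Icc (0 : T.edgeSet → ℝ) 1) := by
  have hc := (continuous_bounded_treeAverage hρ hV hT).1.comp
    (continuous_edgeConfig fun ℓ => ((c ℓ).i, (c ℓ).j))
  have h1 : IntegrableOn (fun w => (∏ ℓ, lineDelta (c ℓ)) *
      treeAverage T Finset.univ (fun _ => vertexPotential lam N)
        (edgeConfig w fun ℓ => ((c ℓ).i, (c ℓ).j)) 0 0) (Set.Icc (0 : T.edgeSet → ℝ) 1) :=
    (continuous_const.mul hc).continuousOn.integrableOn_compact isCompact_Icc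
  exact h1.congr_fun (fun w hw => (treeExpectation_eq hρ (hV.holo.holo ()) c hw).symm)
    measurableSet_Icc

end Integrability

/-! ### Covariance of the Gaussian fields -/

section Covariance

variable {n N : ℕ}

theorem memLp_coord {ι : Type*} [Fintype ι] [DecidableEq ι] (W : Matrix ι ι ℝ) (p : ι) :
    MemLp (fun x : EuclideanSpace ℝ ι => x p) 2 (multivariateGaussian 0 W) :=
  IsGaussian.memLp_dual _ (EuclideanSpace.proj p) 2 (by simp)

theorem integral_coord {ι : Type*} [Fintype ι] [DecidableEq ι] (W : Matrix ι ι ℝ) (p : ι) :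
    ∫ x : EuclideanSpace ℝ ι, x p ∂(multivariateGaussian 0 W) = 0 := by
  have h := (EuclideanSpace.proj (𝕜 := ℝ) p).integral_comp_comm
    (IsGaussian.integrable_id (μ := multivariateGaussian (0 : EuclideanSpace ℝ ι) W))
  simp only [id, integral_id_multivariateGaussian] at h
  simpa using h

theorem integral_coord_mul {ι : Type*} [Fintype ι] [DecidableEq ι] {W : Matrix ι ι ℝ}
    (hW : W.PosSemidef) (p q : ι) :
    ∫ x : EuclideanSpace ℝ ι, x p * x q ∂(multivariateGaussian 0 W) = W p q := by
  have h := covariance_eval_multivariateGaussian (μ := (0 : EuclideanSpace ℝ ι)) hW p q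
  simpa [covariance, integral_coord] using h

/-- The coefficients `(1 ± i) / 2` of the two real coordinates of an entry are chosen so that the
products of coordinates with the same index add up and the others cancel. -/
theorem hasMatrixCovariance_gaussianFields {W : Matrix (Fin n) (Fin n) ℝ} (hW : W.PosSemidef) :
    HasMatrixCovariance (gaussianFields N W) W := by
  set μ := tupleGaussian N W with hμ
  have hK := posSemidef_kronecker_one (N := N) hW
  have hcoord : ∀ p, Integrable (fun x : TupleCoord n N => ((x p : ℝ) : ℂ)) μ := fun p =>
    ((memLp_coord _ p).integrable (by simp)).ofReal
  have hmul : ∀ p q, Integrable (fun x : TupleCoord n N => ((x p * x q : ℝ) : ℂ)) μ := fun p q =>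
    ((memLp_coord _ p).integrable_mul (memLp_coord _ q)).ofReal
  have hE : ∀ p q : Fin n × Fin N × Fin N, ∫ x : TupleCoord n N, ((x p * x q : ℝ) : ℂ) ∂μ
      = if p.2 = q.2 then (W p.1 q.1 : ℂ) else 0 := fun p q => by
    rw [integral_complex_ofReal, hμ, tupleGaussian, integral_coord_mul hK]
    simp only [Matrix.kroneckerMap_apply, Matrix.one_apply, mul_ite, mul_one, mul_zero]
    split_ifs <;> simp
  refine ⟨?_, ?_, fun v i j => ?_, fun v v' i j k l => ?_⟩
  · exact isGaussian_map (μ := multivariateGaussian (0 : TupleCoord n N) (W ⊗ₖ 1))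
      (LinearMap.toContinuousLinearMap (hermitianFieldsₗ n N))
  · refine (measurableEmbedding_hermitianFields n N).ae_map_iff.2 (.of_forall fun x v => ?_)
    exact herm_isHermitian (slot v x)
  · rw [integral_gaussianFields]
    simp only [hermitianFields]
    rw [integral_div, integral_add ((hcoord _).const_mul _) ((hcoord _).const_mul _),
      integral_const_mul, integral_const_mul, integral_complex_ofReal, integral_complex_ofReal]
    have h0 : ∀ p, ∫ x : TupleCoord n N, x p ∂μ = 0 := fun p => integral_coord _ p
    simp [h0]
  · have hI : Complex.I ^ 2 = -1 := Complex.I_sq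
    have hexp : ∀ x : TupleCoord n N, hermitianFields x v i j * hermitianFields x v' k l
        = (Complex.I / 2) * ((x (v, i, j) * x (v', k, l) : ℝ) : ℂ)
          + (-Complex.I / 2) * ((x (v, j, i) * x (v', l, k) : ℝ) : ℂ)
          + (1 / 2) * ((x (v, i, j) * x (v', l, k) : ℝ) : ℂ)
          + (1 / 2) * ((x (v, j, i) * x (v', k, l) : ℝ) : ℂ) := by
      intro x
      simp only [hermitianFields]
      push_cast
      linear_combination ((x (v, i, j) : ℂ) * x (v', k, l) + x (v, j, i) * x (v', l, k)
        - x (v, i, j) * x (v', l, k) - x (v, j, i) * x (v', k, l)) / 4 * hI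
    have hint : ∀ (a : ℂ) p q, Integrable (fun x : TupleCoord n N => a * ((x p * x q : ℝ) : ℂ)) μ :=
      fun a p q => (hmul p q).const_mul a
    have h1 := (hint (Complex.I / 2) (v, i, j) (v', k, l)).add
      (hint (-Complex.I / 2) (v, j, i) (v', l, k))
    have h2 := h1.add (hint (1 / 2) (v, i, j) (v', l, k))
    have h3 := h2.add (hint (1 / 2) (v, j, i) (v', k, l))
    constructor
    · rw [integrable_gaussianFields]
      exact h3.congr (.of_forall fun x => (hexp x).symm)
    · rw [integral_gaussianFields]
      simp only [hexp]
      refine (integral_add h2 (hint (1 / 2) (v, j, i) (v', k, l))).trans ?_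
      rw [integral_add' h1 (hint _ _ _), integral_add' (hint _ _ _) (hint _ _ _)]
      simp only [integral_const_mul, hE, Prod.mk.injEq]
      simp only [and_comm (a := j = l), and_comm (a := j = k)]
      split_ifs <;> ring

theorem posSemidef_treeWeight {T : SimpleGraph (Fin n)} (hT : T.IsTree) {w : T.edgeSet → ℝ}
    (hw : w ∈ Set.Icc (0 : T.edgeSet → ℝ) 1) : (treeWeight T w).PosSemidef := by
  rw [← maskedWeight_edgeConfig (N := 1) hw fun _ => (0, 0)]
  exact posSemidef_maskedWeight (isTreeOn_univ.2 hT) fun e _ => weights_mem _ e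

end Covariance

/-! ### The Gaussian unitary ensemble -/

section GUE

variable {N : ℕ}

/-- The Gaussian unitary ensemble is the law of `herm x` for a standard Gaussian vector `x`. Since
`herm` is a measurable embedding, integrals transfer without measurability assumptions on the
integrand. -/
theorem gue_eq_map (N : ℕ) : MeasurableEmbedding (fun x : Coord N => (Matrix.of.symm (herm x) : MatField N)) ∧
    gue N = (stdGaussian (Coord N)).map fun x => Matrix.of.symm (herm x) := by
  have hs : MeasurableEmbedding (spread (N := N) (Finset.univ : Finset (Fin 1))) := by
    refine (LinearMap.isClosedEmbedding_of_injective
      (f := (spread (N := N) (Finset.univ : Finset (Fin 1))).toLinearMap) ?_).measurableEmbedding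
    refine LinearMap.ker_eq_bot.2 fun x y hxy => ?_
    ext a
    have := congrArg (fun z : TupleCoord 1 N => z (0, a)) hxy
    simpa [indicatorVec] using this
  have h0 : MeasurableEmbedding (fun σ : Fin 1 → MatField N => σ 0) :=
    (MeasurableEquiv.funUnique (Fin 1) (MatField N)).measurableEmbedding
  have hcomp : (fun σ : Fin 1 → MatField N => σ 0) ∘ hermitianFields ∘
      spread (N := N) (Finset.univ : Finset (Fin 1)) = fun x => Matrix.of.symm (herm x) := by
    funext x i j
    simp [hermitianFields, indicatorVec, herm_apply]
  have hemb := (h0.comp (measurableEmbedding_hermitianFields 1 N)).comp hs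
  have hW : (1 : Matrix (Fin 1) (Fin 1) ℝ)
      = Matrix.vecMulVec (indicatorVec Finset.univ) (indicatorVec Finset.univ) := by
    ext i j
    rw [Subsingleton.elim i j]
    simp [Matrix.vecMulVec_apply, indicatorVec, Subsingleton.elim j 0]
  refine ⟨hcomp ▸ hemb, ?_⟩
  have hg : gaussianFields N (1 : Matrix (Fin 1) (Fin 1) ℝ)
      = (tupleGaussian N (1 : Matrix (Fin 1) (Fin 1) ℝ)).map hermitianFields := rfl
  rw [gue, hg, hW, tupleGaussian_ones,
    Measure.map_map (measurableEmbedding_hermitianFields 1 N).measurable hs.measurable,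
    Measure.map_map h0.measurable
      ((measurableEmbedding_hermitianFields 1 N).measurable.comp hs.measurable), hcomp]

theorem integral_gue (f : MatField N → ℂ) :
    ∫ σ, f σ ∂(gue N) = ∫ x, f (Matrix.of.symm (herm x)) ∂(stdGaussian (Coord N)) := by
  rw [(gue_eq_map N).2, (gue_eq_map N).1.integral_map]

theorem integrable_gue {f : MatField N → ℂ} :
    Integrable f (gue N) ↔ Integrable (fun x => f (Matrix.of.symm (herm x))) (stdGaussian (Coord N)) := by
  rw [(gue_eq_map N).2, (gue_eq_map N).1.integrable_map_iff]
  rfl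

end GUE

/-! ### Coercive matrices and the logarithm of the determinant -/

section Coercive

variable {N : ℕ} {M : Mat N}

/-- Jacobi's formula along a line. -/
theorem hasDerivAt_det_line (A X : Mat N) {t : ℂ} (h : (A + t • X).det ≠ 0) :
    HasDerivAt (fun z : ℂ => (A + z • X).det)
      ((A + t • X).det * ((A + t • X)⁻¹ * X).trace) t := by
  set B := A + t • X with hB
  set Y := B⁻¹ * X with hY
  have hdec : ∀ z : ℂ, (A + z • X).det = B.det * (1 + Y.trace * (z - t) +
      (Matrix.det (1 + (Polynomial.X : Polynomial ℂ) • Y.map Polynomial.C)).divX.divX.eval (z - t)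
        * (z - t) ^ 2) := by
    intro z
    rw [← Matrix.det_one_add_smul, ← Matrix.det_mul, mul_add, mul_one, mul_smul_comm, hY,
      Matrix.mul_nonsing_inv_cancel_left _ _ (isUnit_iff_ne_zero.2 h), hB, sub_smul]
    congr 1
    abel
  simp only [hdec]
  set p := (Matrix.det (1 + (Polynomial.X : Polynomial ℂ) • Y.map Polynomial.C)).divX.divX
  have h1 : HasDerivAt (fun z : ℂ => z - t) 1 t := (hasDerivAt_id t).sub_const t
  have h2 : HasDerivAt (fun z : ℂ => p.eval (z - t)) (p.derivative.eval (t - t) * 1) t :=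
    HasDerivAt.comp (h := fun z : ℂ => z - t) t (p.hasDerivAt (t - t)) h1
  have h3 := (((h1.const_mul Y.trace).const_add 1).add (h2.mul (h1.pow 2))).const_mul B.det
  refine h3.congr_deriv ?_
  simp

/-- The lower bound `Re M ≥ 1/2` for the Hermitian part of `M`. -/
def Coercive (M : Mat N) : Prop :=
  ∀ x : EuclideanSpace ℂ (Fin N), ‖x‖ ^ 2 / 2 ≤
    (inner ℂ x (Matrix.toEuclideanCLM (𝕜 := ℂ) M x)).re

/-- The eigenvalues of a coercive matrix have real part at least `1 / 2`. -/
theorem Coercive.half_le_re (hM : Coercive M) {z : ℂ} (hz : (Matrix.scalar (Fin N) z - M).det = 0) :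
    1 / 2 ≤ z.re := by
  obtain ⟨v, hv, h⟩ := Matrix.exists_mulVec_eq_zero_iff.2 hz
  set x : EuclideanSpace ℂ (Fin N) := WithLp.toLp 2 v with hx
  have hx0 : 0 < ‖x‖ := norm_pos_iff.2 (by simpa [hx] using hv)
  have h1 : Matrix.toEuclideanCLM (𝕜 := ℂ) M x = z • x := by
    rw [Matrix.sub_mulVec, sub_eq_zero] at h
    refine (WithLp.ofLp_injective 2) ?_
    rw [Matrix.ofLp_toEuclideanCLM, WithLp.ofLp_smul, hx, ← h]
    simp [Matrix.smul_mulVec, ← Matrix.smul_one_eq_diagonal]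
  have h2 := hM x
  rw [h1, inner_smul_right, inner_self_eq_norm_sq_to_K] at h2
  have h3 : (z * ((‖x‖ : ℂ)) ^ 2).re = z.re * ‖x‖ ^ 2 := by
    rw [← Complex.ofReal_pow, Complex.re_mul_ofReal]
  have h4 : ‖x‖ ^ 2 / 2 ≤ z.re * ‖x‖ ^ 2 := by rw [← h3]; exact h2
  have : 0 < ‖x‖ ^ 2 := by positivity
  nlinarith

theorem Coercive.det_ne_zero (hM : Coercive M) : M.det ≠ 0 := fun h => by
  have := hM.half_le_re (z := 0) (by simp [Matrix.det_neg, h])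
  norm_num at this

theorem Coercive.norm_inv_le (hM : Coercive M) : ‖M⁻¹‖ ≤ 2 := by
  rw [← Matrix.l2_opNorm_toEuclideanCLM]
  refine ContinuousLinearMap.opNorm_le_bound _ zero_le_two fun y => ?_
  set x := Matrix.toEuclideanCLM (𝕜 := ℂ) M⁻¹ y with hx
  have h1 : Matrix.toEuclideanCLM (𝕜 := ℂ) M x = y := by
    rw [hx, ← mul_apply_eq_comp, ← map_mul,
      Matrix.mul_nonsing_inv _ (isUnit_iff_ne_zero.2 hM.det_ne_zero), map_one,
      one_apply_eq_self]
  have h2 := hM x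
  rw [h1] at h2
  have h3 : (inner ℂ x y).re ≤ ‖x‖ * ‖y‖ := (Complex.re_le_norm _).trans (norm_inner_le_norm x y)
  by_contra! h
  nlinarith [norm_nonneg x, norm_nonneg y]

/-- Coercivity passes to the segment that joins the matrix to the identity. -/
theorem Coercive.segment (hM : Coercive M) {t : ℝ} (h0 : 0 ≤ t) (h1 : t ≤ 1) :
    Coercive (1 + (t : ℂ) • (M - 1)) := by
  intro x
  have h := hM x
  have e : (inner ℂ x (Matrix.toEuclideanCLM (𝕜 := ℂ) (1 + (t : ℂ) • (M - 1)) x)).re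
      = ‖x‖ ^ 2 + t * ((inner ℂ x (Matrix.toEuclideanCLM (𝕜 := ℂ) M x)).re - ‖x‖ ^ 2) := by
    have hself : (inner ℂ x x).re = ‖x‖ ^ 2 := by
      rw [inner_self_eq_norm_sq_to_K]
      exact (congrArg Complex.re (Complex.ofReal_pow ‖x‖ 2)).symm
    simp only [map_add, map_one, map_smul, map_sub, _root_.add_apply,
      one_apply_eq_self, _root_.smul_apply,
      _root_.sub_apply, inner_add_right, inner_smul_right, inner_sub_right,
      Complex.add_re, Complex.re_ofReal_mul, Complex.sub_re, hself]
  rw [e]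
  nlinarith [sq_nonneg ‖x‖]

theorem Coercive.half_le_re_of_mem_roots (hM : Coercive M) {z : ℂ} (hz : z ∈ M.charpoly.roots) :
    1 / 2 ≤ z.re := by
  refine hM.half_le_re ?_
  rw [← Matrix.eval_charpoly]
  exact (Polynomial.mem_roots'.1 hz).2

theorem card_roots_charpoly (M : Mat N) : Multiset.card M.charpoly.roots = N := by
  rw [← (IsAlgClosed.splits M.charpoly).natDegree_eq_card_roots,
    Matrix.charpoly_natDegree_eq_dim, Fintype.card_fin]

theorem exp_sum_log (s : Multiset ℂ) (h : ∀ z ∈ s, z ≠ 0) :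
    Complex.exp (s.map Complex.log).sum = s.prod := by
  induction s using Multiset.induction_on with
  | empty => simp
  | cons a s ih =>
    simp only [Multiset.map_cons, Multiset.sum_cons, Multiset.prod_cons, Complex.exp_add]
    rw [Complex.exp_log (h a (Multiset.mem_cons_self a s)),
      ih fun z hz => h z (Multiset.mem_cons_of_mem hz)]

/-- The sum of the principal logarithms of the eigenvalues is a logarithm of the determinant. -/
theorem Coercive.exp_trLog (hM : Coercive M) : Complex.exp (trLog M) = M.det := by
  rw [trLog, exp_sum_log, Matrix.det_eq_prod_roots_charpoly]
  intro z hz h0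
  have := hM.half_le_re_of_mem_roots hz
  rw [h0] at this
  norm_num at this

theorem Coercive.neg_log_two_le_re_trLog (hM : Coercive M) :
    -(N * Real.log 2) ≤ (trLog M).re := by
  have key : ∀ s : Multiset ℂ, (∀ z ∈ s, 1 / 2 ≤ z.re) →
      -(Multiset.card s * Real.log 2) ≤ (s.map Complex.log).sum.re := by
    intro s
    induction s using Multiset.induction_on with
    | empty => simp
    | cons a s ih =>
      intro h
      have h1 := ih fun z hz => h z (Multiset.mem_cons_of_mem hz)
      have h2 := h a (Multiset.mem_cons_self a s)
      have h3 : -Real.log 2 ≤ (Complex.log a).re := by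
        rw [Complex.log_re, ← Real.log_inv]
        refine Real.log_le_log (by norm_num) (le_trans ?_ (Complex.re_le_norm a))
        norm_num at h2 ⊢
        linarith
      simp only [Multiset.card_cons, Multiset.map_cons, Multiset.sum_cons, Complex.add_re]
      push_cast
      linarith
  have := key _ fun z hz => hM.half_le_re_of_mem_roots hz
  rwa [card_roots_charpoly] at this

/-- The determinant along the segment from `1` to `M` in terms of the eigenvalues of `M`. -/
theorem det_segment (M : Mat N) (t : ℂ) :
    (1 + t • (M - 1)).det = (M.charpoly.roots.map fun z => 1 + t * (z - 1)).prod := by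
  rcases eq_or_ne t 0 with rfl | ht
  · simp
  have h1 : (1 + t • (M - 1) : Mat N) = (-t) • (Matrix.scalar (Fin N) ((t - 1) / t) - M) := by
    ext i j
    by_cases h : i = j
    · subst h; simp; field_simp; ring
    · simp [h]
  rw [h1, Matrix.det_smul, Fintype.card_fin, ← Matrix.eval_charpoly,
    (IsAlgClosed.splits M.charpoly).eval_eq_prod_roots_of_monic M.charpoly_monic]
  have h2 : (-t) ^ N = (M.charpoly.roots.map fun _ => -t).prod := by
    rw [Multiset.map_const', Multiset.prod_replicate, card_roots_charpoly]
  rw [h2, ← Multiset.prod_map_mul]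
  refine congrArg _ (Multiset.map_congr rfl fun z _ => ?_)
  field_simp
  ring

/-- The logarithm of the determinant along the segment from `1` to a coercive matrix: the branch is
the principal one because the eigenvalues keep a positive real part. -/
theorem Coercive.trLog_eq_integral (hM : Coercive M) :
    trLog M = ∫ t in (0 : ℝ)..1, ((1 + (t : ℂ) • (M - 1))⁻¹ * (M - 1)).trace := by
  set G : ℝ → ℂ := fun t => (M.charpoly.roots.map fun z => Complex.log (1 + t * (z - 1))).sum
    with hG
  have hre : ∀ t : ℝ, 0 ≤ t → t ≤ 1 → ∀ z ∈ M.charpoly.roots, 0 < (1 + (t : ℂ) * (z - 1)).re := by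
    intro t h0 h1 z hz
    have := hM.half_le_re_of_mem_roots hz
    simp only [Complex.add_re, Complex.one_re, Complex.re_ofReal_mul, Complex.sub_re]
    nlinarith
  have hexp : ∀ t : ℝ, 0 ≤ t → t ≤ 1 → Complex.exp (G t) = (1 + (t : ℂ) • (M - 1)).det := by
    intro t h0 h1
    rw [det_segment, ← exp_sum_log, Multiset.map_map]
    · rfl
    · intro z hz
      obtain ⟨y, hy, rfl⟩ := Multiset.mem_map.1 hz
      intro h
      have := hre t h0 h1 y hy
      rw [h] at this
      simp at this
  have hdiff : ∀ t : ℝ, 0 ≤ t → t ≤ 1 → DifferentiableAt ℝ G t := by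
    intro t h0 h1
    have key : ∀ s : Multiset ℂ, (∀ z ∈ s, 0 < (1 + (t : ℂ) * (z - 1)).re) →
        DifferentiableAt ℝ (fun t : ℝ => (s.map fun z => Complex.log (1 + t * (z - 1))).sum) t := by
      intro s
      induction s using Multiset.induction_on with
      | empty => simp
      | cons a s ih =>
        intro h
        simp only [Multiset.map_cons, Multiset.sum_cons]
        refine DifferentiableAt.add ?_ (ih fun z hz => h z (Multiset.mem_cons_of_mem hz))
        have h1 : HasDerivAt (fun t : ℝ => 1 + (t : ℂ) * (a - 1)) (1 * (a - 1)) t :=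
          ((hasDerivAt_id (t : ℂ)).comp_ofReal.mul_const _).const_add _
        exact (h1.clog_real (Or.inl (h a (Multiset.mem_cons_self a s)))).differentiableAt
    exact key _ (hre t h0 h1)
  have hderiv : ∀ t ∈ Set.uIcc (0 : ℝ) 1, HasDerivAt G
      (((1 + (t : ℂ) • (M - 1))⁻¹ * (M - 1)).trace) t := by
    intro t ht
    rw [Set.uIcc_of_le zero_le_one] at ht
    have hne := (hM.segment ht.1 ht.2).det_ne_zero
    have h1 : HasDerivWithinAt (fun u : ℝ => Complex.exp (G u))
        (Complex.exp (G t) * deriv G t) (Set.Icc 0 1) t :=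
      (hdiff t ht.1 ht.2).hasDerivAt.cexp.hasDerivWithinAt
    have h2 : HasDerivWithinAt (fun u : ℝ => Complex.exp (G u))
        ((1 + (t : ℂ) • (M - 1)).det * ((1 + (t : ℂ) • (M - 1))⁻¹ * (M - 1)).trace)
        (Set.Icc 0 1) t := by
      refine ((hasDerivAt_det_line 1 (M - 1) hne).comp_ofReal.hasDerivWithinAt).congr
        (fun u hu => hexp u hu.1 hu.2) (hexp t ht.1 ht.2)
    have h3 := (uniqueDiffOn_Icc zero_lt_one t ht).eq_deriv _ h1 h2
    rw [hexp t ht.1 ht.2] at h3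
    rw [← mul_left_cancel₀ hne h3]
    exact (hdiff t ht.1 ht.2).hasDerivAt
  have hcont : ContinuousOn (fun t : ℝ => ((1 + (t : ℂ) • (M - 1))⁻¹ * (M - 1)).trace)
      (Set.uIcc (0 : ℝ) 1) := by
    rw [Set.uIcc_of_le zero_le_one]
    intro t ht
    have hu : IsUnit (1 + (t : ℂ) • (M - 1)) :=
      (Matrix.isUnit_iff_isUnit_det _).2 (isUnit_iff_ne_zero.2 (hM.segment ht.1 ht.2).det_ne_zero)
    have h1 : ContinuousAt (fun A : Mat N => A⁻¹) (1 + (t : ℂ) • (M - 1)) := by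
      simp only [Matrix.nonsing_inv_eq_ringInverse]
      obtain ⟨u, hu⟩ := hu
      rw [← hu]
      exact NormedRing.inverse_continuousAt u
    have h2 : ContinuousAt (fun t : ℝ => (1 + (t : ℂ) • (M - 1))⁻¹) t :=
      ContinuousAt.comp (f := fun t : ℝ => (1 + (t : ℂ) • (M - 1) : Mat N)) h1
        (Continuous.continuousAt (by fun_prop))
    have h3 : Continuous (fun A : Mat N => (A * (M - 1)).trace) :=
      Continuous.matrix_trace (by fun_prop)
    exact (h3.continuousAt.comp h2).continuousWithinAt
  rw [intervalIntegral.integral_eq_sub_of_hasDerivAt hderiv hcont.intervalIntegrable]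
  simp [hG, trLog]

end Coercive

/-! ### The loop vertex -/

section Vertex

variable {N : ℕ} {lam ρ : ℝ} {σ : Mat N}

/-- The scalar `√(2 lam / N)` in front of `σ`. -/
def coupling (lam : ℝ) (N : ℕ) : ℝ := Real.sqrt (2 * lam / N)

/-- The factor `1 + i √(2 lam / N) σ` of `1 ⊗ 1 + i H`. -/
def vertexMatrix (lam : ℝ) (σ : Mat N) : Mat N := 1 + (Complex.I * coupling lam N) • σ

/-- The eigenvalues of `1 ⊗ M` are those of `M`, each repeated `N` times. -/
theorem charpoly_one_kronecker (M : Mat N) :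
    ((1 : Mat N) ⊗ₖ M).charpoly = M.charpoly ^ N := by
  have h : ((1 : Mat N) ⊗ₖ M).charmatrix = (1 : Matrix (Fin N) (Fin N) (Polynomial ℂ)) ⊗ₖ
      M.charmatrix := by
    ext ⟨i, j⟩ ⟨k, l⟩ : 2
    by_cases h1 : i = k <;> by_cases h2 : j = l <;>
      simp [Matrix.kroneckerMap_apply, h1, h2]
  rw [Matrix.charpoly, h, Matrix.det_kronecker, Matrix.det_one, one_pow, one_mul,
    Fintype.card_fin, Matrix.charpoly]

theorem trLog_one_kronecker (M : Mat N) : trLog ((1 : Mat N) ⊗ₖ M) = N * trLog M := by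
  rw [trLog, charpoly_one_kronecker, Polynomial.roots_pow, Multiset.map_nsmul, Multiset.sum_nsmul,
    nsmul_eq_mul, trLog]

theorem vertexPotential_eq (lam : ℝ) (σ : Mat N) :
    vertexPotential lam N σ = -(N * trLog (vertexMatrix lam σ)) := by
  have h : 1 + Complex.I • fieldOp lam (Matrix.of.symm σ) = (1 : Mat N) ⊗ₖ vertexMatrix lam σ := by
    rw [fieldOp, vertexMatrix, Matrix.kronecker_add, Matrix.one_kronecker_one,
      Matrix.kronecker_smul, smul_smul]
    rfl
  rw [vertexPotential, loopVertex, h, trLog_one_kronecker]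

/-- Only the anti-Hermitian part of `σ`, which is small on the strip, contributes to the Hermitian
part of `i s σ` for real `s`. -/
theorem coercive_vertexMatrix (h : ρ * coupling lam N ≤ 1 / 2) (hσ : σ ∈ strip ρ) :
    Coercive (vertexMatrix lam σ) := by
  intro x
  set s := coupling lam N
  have hs : 0 ≤ s := Real.sqrt_nonneg _
  set L := Matrix.toEuclideanCLM (𝕜 := ℂ) (n := Fin N)
  set a : ℂ := inner ℂ x (L σ x) with ha
  have him : |a.im| ≤ ρ * ‖x‖ ^ 2 := by
    have h1 : inner ℂ x (L (σ - σ.conjTranspose) x) = a - starRingEnd ℂ a := by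
      have h2 : L σ.conjTranspose = ContinuousLinearMap.adjoint (L σ) := map_star L σ
      rw [map_sub, h2, _root_.sub_apply, inner_sub_right, ContinuousLinearMap.adjoint_inner_right,
        ha, inner_conj_symm]
    have h2 : ‖a - starRingEnd ℂ a‖ = 2 * |a.im| := by
      rw [Complex.sub_conj, norm_mul, Complex.norm_I, mul_one, Complex.norm_real, norm_mul]
      norm_num
    have h3 : ‖inner ℂ x (L (σ - σ.conjTranspose) x)‖ ≤ ‖x‖ * (‖σ - σ.conjTranspose‖ * ‖x‖) := by
      refine (norm_inner_le_norm _ _).trans ?_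
      gcongr
      rw [← Matrix.l2_opNorm_toEuclideanCLM (σ - _)]
      exact ContinuousLinearMap.le_opNorm _ _
    rw [h1, h2] at h3
    have h4 : 0 < ρ - ‖σ - σ.conjTranspose‖ / 2 := hσ
    nlinarith [sq_nonneg ‖x‖]
  have hself : (inner ℂ x x).re = ‖x‖ ^ 2 := by
    rw [inner_self_eq_norm_sq_to_K]
    exact (congrArg Complex.re (Complex.ofReal_pow ‖x‖ 2)).symm
  have he : (inner ℂ x (L (vertexMatrix lam σ) x)).re = ‖x‖ ^ 2 - s * a.im := by
    simp only [vertexMatrix, map_add, map_one, map_smul, _root_.add_apply, one_apply_eq_self,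
      _root_.smul_apply, inner_add_right, inner_smul_right, Complex.add_re, hself]
    rw [← ha]
    simp [s]
    ring
  change _ ≤ (inner ℂ x (L (vertexMatrix lam σ) x)).re
  rw [he]
  have h5 : s * a.im ≤ s * (ρ * ‖x‖ ^ 2) :=
    mul_le_mul_of_nonneg_left ((le_abs_self _).trans him) hs
  nlinarith [sq_nonneg ‖x‖]

theorem norm_trace_le (A : Mat N) : ‖A.trace‖ ≤ N * ‖A‖ := by
  have h : ∀ i, ‖A i i‖ ≤ ‖A‖ := fun i => by
    have h1 := Matrix.l2_opNorm_mulVec A (EuclideanSpace.single i (1 : ℂ))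
    rw [PiLp.norm_single, norm_one, mul_one] at h1
    refine le_trans ?_ h1
    refine le_trans (le_of_eq ?_) (PiLp.norm_apply_le _ i)
    simp
  refine (norm_sum_le _ _).trans ((Finset.sum_le_sum fun i _ => h i).trans (le_of_eq ?_))
  simp

theorem differentiableAt_inv {A : Mat N} (h : A.det ≠ 0) :
    DifferentiableAt ℂ (fun B : Mat N => B⁻¹) A := by
  simp only [Matrix.nonsing_inv_eq_ringInverse]
  obtain ⟨u, hu⟩ := (Matrix.isUnit_iff_isUnit_det A).2 (isUnit_iff_ne_zero.2 h)
  rw [← hu]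
  exact differentiableAt_inverse u.isUnit

/-- Holomorphy comes from the representation of `trLog` as an integral of resolvents along a
segment, so that neither branches of the logarithm nor the regularity of eigenvalues enter. -/
theorem differentiableOn_trLog_vertexMatrix (h : ρ * coupling lam N ≤ 1 / 2) :
    DifferentiableOn ℂ (fun σ : Mat N => trLog (vertexMatrix lam σ)) (strip ρ) := by
  set c : ℂ := Complex.I * coupling lam N
  let A : ℝ → Mat N → Mat N := fun y σ => 1 + (clamp y : ℂ) • (c • σ)
  have hA : ∀ y, ∀ σ ∈ strip ρ, Coercive (A y σ) := fun y σ hσ => by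
    have := (coercive_vertexMatrix h hσ).segment (clamp_nonneg y) (clamp_le_one y)
    rwa [vertexMatrix, add_sub_cancel_left] at this
  let φ : ℝ → Unit → Mat N → ℂ := fun y _ σ => ((A y σ)⁻¹ * (c • σ)).trace
  have hφ : ∀ y, DifferentiableOn ℂ (φ y ()) (strip ρ) := fun y σ hσ => by
    have h1 : DifferentiableAt ℂ (fun τ => (A y τ)⁻¹) σ :=
      DifferentiableAt.comp (f := A y) σ (differentiableAt_inv (hA y σ hσ).det_ne_zero)
        (by fun_prop)
    have h2 : DifferentiableAt ℂ (fun τ => (A y τ)⁻¹ * (c • τ)) σ :=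
      h1.mul (differentiableAt_id.const_smul c)
    exact ((Matrix.traceLinearMap (Fin N) ℂ ℂ).toContinuousLinearMap.differentiableAt.comp σ
      h2).differentiableWithinAt
  have hφc : ∀ σ ∈ strip ρ, Continuous fun y => φ y () σ := fun σ hσ => by
    refine continuous_iff_continuousAt.2 fun y => ?_
    have h1 : ContinuousAt (fun y => (A y σ)⁻¹) y :=
      ContinuousAt.comp (f := fun y => A y σ)
        (differentiableAt_inv (hA y σ hσ).det_ne_zero).continuousAt
        (Continuous.continuousAt (by have := continuous_clamp; fun_prop))
    have h3 : Continuous (fun B : Mat N => (B * (c • σ)).trace) :=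
      Continuous.matrix_trace (by fun_prop)
    exact h3.continuousAt.comp h1
  have key := (HoloFamily.integral (ν := (volume : Measure ℝ).restrict (Set.Ioc 0 1))
    (isOpen_strip ρ) (φ := φ) (fun _ σ hσ => (hφc σ hσ).aestronglyMeasurable)
    (fun y => HoloFamily.of_differentiableOn (isOpen_strip ρ) (hφ y)) ?_).1.holo ()
  · refine key.congr fun σ hσ => ?_
    rw [(coercive_vertexMatrix h hσ).trLog_eq_integral,
      intervalIntegral.integral_of_le zero_le_one]
    refine setIntegral_congr_fun measurableSet_Ioc fun y hy => ?_
    simp only [φ, A, vertexMatrix, add_sub_cancel_left, c]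
    rw [clamp_of_mem ⟨hy.1.le, hy.2⟩]
  · intro _ σ hσ
    refine ⟨fun _ => N * (2 * (‖c‖ * (‖σ‖ + 1))), integrable_const _, ?_⟩
    have h1 : ∀ᶠ p : Unit × Mat N in 𝓝 ((), σ), p.2 ∈ strip ρ :=
      continuous_snd.continuousAt.eventually ((isOpen_strip ρ).mem_nhds hσ)
    have h2 : ∀ᶠ p : Unit × Mat N in 𝓝 ((), σ), ‖p.2‖ < ‖σ‖ + 1 :=
      (continuous_norm.comp continuous_snd).continuousAt.eventually_lt continuousAt_const (by simp)
    filter_upwards [h1, h2] with p hp1 hp2 y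
    refine (norm_trace_le _).trans ?_
    gcongr
    refine (norm_mul_le _ _).trans ?_
    rw [norm_smul]
    gcongr
    exact (hA y _ hp1).norm_inv_le

/-- The derivative of the potential is the trace against the resolvent. -/
theorem fderiv_vertexPotential (h : ρ * coupling lam N ≤ 1 / 2) (hσ : σ ∈ strip ρ) (X : Mat N) :
    fderiv ℂ (vertexPotential lam N) σ X
      = -(N * (Complex.I * coupling lam N)) * ((vertexMatrix lam σ)⁻¹ * X).trace := by
  set c : ℂ := Complex.I * coupling lam N with hc
  have hd : DifferentiableAt ℂ (fun σ : Mat N => trLog (vertexMatrix lam σ)) σ :=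
    (differentiableOn_trLog_vertexMatrix h).differentiableAt ((isOpen_strip ρ).mem_nhds hσ)
  have hne := (coercive_vertexMatrix h hσ).det_ne_zero
  -- both sides of `exp (trLog A) = det A` are differentiated along the line `σ + z X`
  have h1 : HasDerivAt (fun z : ℂ => Complex.exp (trLog (vertexMatrix lam (σ + z • X))))
      (Complex.exp (trLog (vertexMatrix lam σ)) *
        fderiv ℂ (fun σ : Mat N => trLog (vertexMatrix lam σ)) σ X) 0 := by
    have hl : HasDerivAt (fun z : ℂ => σ + z • X) X 0 := by
      simpa using ((hasDerivAt_id (0 : ℂ)).smul_const X).const_add σ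
    have := (HasFDerivAt.comp_hasDerivAt_of_eq (0 : ℂ) hd.hasFDerivAt hl (by simp)).cexp
    simpa using this
  have h2 : HasDerivAt (fun z : ℂ => (vertexMatrix lam (σ + z • X)).det)
      ((vertexMatrix lam σ).det * ((vertexMatrix lam σ)⁻¹ * (c • X)).trace) 0 := by
    have := hasDerivAt_det_line (vertexMatrix lam σ) (c • X) (t := 0) (by simpa using hne)
    rw [zero_smul, add_zero] at this
    refine this.congr_of_eventuallyEq (.of_forall fun z => ?_)
    simp only [vertexMatrix, ← hc, smul_add, add_assoc, smul_comm z c]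
  have h3 : (fun z : ℂ => Complex.exp (trLog (vertexMatrix lam (σ + z • X)))) =ᶠ[𝓝 0]
      fun z : ℂ => (vertexMatrix lam (σ + z • X)).det := by
    have : ContinuousAt (fun z : ℂ => σ + z • X) 0 := Continuous.continuousAt (by fun_prop)
    filter_upwards [this.eventually ((isOpen_strip ρ).mem_nhds (by simpa using hσ))] with z hz
    exact (coercive_vertexMatrix h hz).exp_trLog
  have h4 := h1.unique (h2.congr_of_eventuallyEq h3)
  rw [(coercive_vertexMatrix h hσ).exp_trLog] at h4
  have h5 : vertexPotential lam N = fun σ => -(N * trLog (vertexMatrix lam σ)) :=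
    funext (vertexPotential_eq lam)
  rw [h5, fderiv_fun_neg, fderiv_const_mul hd, _root_.neg_apply, _root_.smul_apply,
    mul_left_cancel₀ hne h4, mul_smul_comm, Matrix.trace_smul, smul_eq_mul, smul_eq_mul]
  ring

theorem norm_scalar_vertexPotential (lam : ℝ) (N : ℕ) :
    ‖-((N : ℂ) * (Complex.I * coupling lam N))‖ = N * coupling lam N := by
  simp [coupling, abs_of_nonneg (Real.sqrt_nonneg _)]

theorem lipHolo_vertexPotential (h : ρ * coupling lam N ≤ 1 / 2) :
    LipHolo ρ (fun _ : Unit => vertexPotential lam N) where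
  holo := by
    refine HoloFamily.of_differentiableOn (isOpen_strip ρ) ?_
    rw [funext (vertexPotential_eq (N := N) lam)]
    exact ((differentiableOn_trLog_vertexMatrix h).const_mul _).neg
  bdd ε hε := by
    refine ⟨N * coupling lam N * (N * 2), fun _ σ hσ => ?_⟩
    have hs : 0 ≤ coupling lam N := Real.sqrt_nonneg _
    have hσ' : σ ∈ strip ρ := lt_of_lt_of_le hε hσ
    refine ContinuousLinearMap.opNorm_le_bound _ (by positivity) fun X => ?_
    rw [fderiv_vertexPotential h hσ', norm_mul, norm_scalar_vertexPotential,
      mul_assoc (N * coupling lam N : ℝ)]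
    refine mul_le_mul_of_nonneg_left ?_ (by positivity)
    refine (norm_trace_le _).trans ?_
    rw [mul_assoc]
    gcongr
    refine (norm_mul_le _ _).trans ?_
    gcongr
    exact (coercive_vertexMatrix h hσ').norm_inv_le

/-- The gradient is a multiple of the resolvent, whose norm is at most `2`. -/
theorem norm_grad_vertexPotential_le (h : ρ * coupling lam N ≤ 1 / 2) (hσ : σ ∈ strip ρ) :
    ‖grad (vertexPotential lam N) σ‖ ≤ 2 * (N * coupling lam N) := by
  have hs : 0 ≤ coupling lam N := Real.sqrt_nonneg _
  refine norm_grad_le (by positivity) fun x y => ?_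
  have ht : ((vertexMatrix lam σ)⁻¹ * rankOne x y).trace
      = inner ℂ x (Matrix.toEuclideanCLM (𝕜 := ℂ) (vertexMatrix lam σ)⁻¹ y) := by
    rw [EuclideanSpace.inner_eq_star_dotProduct, Matrix.ofLp_toEuclideanCLM, rankOne,
      Matrix.mul_vecMulVec, Matrix.trace_vecMulVec]
  rw [fderiv_vertexPotential h hσ, norm_mul, norm_scalar_vertexPotential, ht]
  have h1 : ‖inner ℂ x (Matrix.toEuclideanCLM (𝕜 := ℂ) (vertexMatrix lam σ)⁻¹ y)‖
      ≤ ‖x‖ * (2 * ‖y‖) := by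
    refine (norm_inner_le_norm _ _).trans ?_
    gcongr
    refine (ContinuousLinearMap.le_opNorm _ _).trans ?_
    rw [Matrix.l2_opNorm_toEuclideanCLM]
    gcongr
    exact (coercive_vertexMatrix h hσ).norm_inv_le
  calc _ ≤ N * coupling lam N * (‖x‖ * (2 * ‖y‖)) := by gcongr
    _ = _ := by ring

theorem re_vertexPotential_le (h : ρ * coupling lam N ≤ 1 / 2) (hσ : σ ∈ strip ρ) :
    (vertexPotential lam N σ).re ≤ N * (N * Real.log 2) := by
  rw [vertexPotential_eq, Complex.neg_re, ← Complex.ofReal_natCast, Complex.re_ofReal_mul, neg_le,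
    ← mul_neg]
  exact mul_le_mul_of_nonneg_left (coercive_vertexMatrix h hσ).neg_log_two_le_re_trLog
    (Nat.cast_nonneg N)

/-- The principal logarithm commutes with conjugation off the negative real axis. -/
theorem Coercive.trLog_conjTranspose {M : Mat N} (hM : Coercive M) :
    trLog M.conjTranspose = starRingEnd ℂ (trLog M) := by
  have hroots : M.conjTranspose.charpoly.roots = M.charpoly.roots.map (starRingEnd ℂ) := by
    have : M.conjTranspose = M.transpose.map (starRingEnd ℂ) := rfl
    rw [this, Matrix.charpoly_map, Matrix.charpoly_transpose]
    exact (IsAlgClosed.splits M.charpoly).roots_map _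
  rw [trLog, hroots, trLog, map_multiset_sum, Multiset.map_map, Multiset.map_map]
  refine congrArg _ (Multiset.map_congr rfl fun z hz => ?_)
  have hz' := hM.half_le_re_of_mem_roots hz
  exact Complex.log_conj _ fun h => by
    have := (Complex.arg_eq_pi_iff.1 h).1
    linarith

theorem conjSymm_vertexPotential (h : ρ * coupling lam N ≤ 1 / 2) :
    ConjSymm ρ (vertexPotential lam N) := by
  intro σ hσ
  have h1 : vertexMatrix lam (-σ.conjTranspose) = (vertexMatrix lam σ).conjTranspose := by
    simp [vertexMatrix, Matrix.conjTranspose_add, Matrix.conjTranspose_smul]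
  rw [vertexPotential_eq, vertexPotential_eq, h1,
    (coercive_vertexMatrix h hσ).trLog_conjTranspose, map_neg, map_mul, Complex.conj_natCast]

theorem exp_vertexPotential (h : ρ * coupling lam N ≤ 1 / 2) (hσ : σ ∈ strip ρ) :
    Complex.exp (vertexPotential lam N σ) = ((vertexMatrix lam σ).det ^ N)⁻¹ := by
  rw [vertexPotential_eq, Complex.exp_neg, Complex.exp_nat_mul,
    (coercive_vertexMatrix h hσ).exp_trLog]

end Vertex

/-! ### The intermediate field representation of the partition function -/

section PartitionFunction

variable {N : ℕ} {lam ρ : ℝ}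

theorem trace_gram_mul_diagonal (Φ : Mat N) (b : Fin N → ℂ) :
    (Φ.conjTranspose * Φ * Matrix.diagonal b).trace = ∑ i, ∑ j, b j * (‖Φ i j‖ : ℂ) ^ 2 := by
  rw [Finset.sum_comm]
  simp only [Matrix.trace, Matrix.diag_apply, Matrix.mul_diagonal]
  simp only [Matrix.mul_apply, Matrix.conjTranspose_apply, RCLike.star_def, Finset.sum_mul]
  refine Finset.sum_congr rfl fun j _ => Finset.sum_congr rfl fun i _ => ?_
  rw [Complex.conj_mul', mul_comm]

theorem trace_gram_re (Φ : Mat N) :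
    (Φ.conjTranspose * Φ).trace.re = ∑ i, ∑ j, ‖Φ i j‖ ^ 2 := by
  have h := trace_gram_mul_diagonal Φ 1
  rw [show Matrix.diagonal (1 : Fin N → ℂ) = 1 from Matrix.diagonal_one, mul_one] at h
  rw [h]
  have : ∑ i, ∑ j, (1 : Fin N → ℂ) j * (‖Φ i j‖ : ℂ) ^ 2
      = ((∑ i, ∑ j, ‖Φ i j‖ ^ 2 : ℝ) : ℂ) := by push_cast; simp
  rw [this, Complex.ofReal_re]

/-- A product of one-dimensional complex Gaussian integrals. -/
theorem integral_exp_neg_diagonal (b : Fin N → ℂ) (hb : ∀ j, 0 < (b j).re) :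
    ∫ Φ : MatField N, Complex.exp (-∑ i, ∑ j, b j * (‖Φ i j‖ : ℂ) ^ 2)
      = (Real.pi : ℂ) ^ (N ^ 2) * ((∏ j, b j) ^ N)⁻¹ := by
  have h1 : ∀ j, ∫ z : ℂ, Complex.exp (-b j * (‖z‖ : ℂ) ^ 2) = Real.pi / b j := fun j => by
    rw [GaussianFourier.integral_cexp_neg_mul_sq_norm (hb j), Complex.finrank_real_complex]
    norm_num
  have h2 : ∫ r : Fin N → ℂ, ∏ j, Complex.exp (-b j * (‖r j‖ : ℂ) ^ 2)
      = ∏ j, (Real.pi / b j : ℂ) := by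
    rw [integral_fintype_prod_volume_eq_prod (fun j z => Complex.exp (-b j * (‖z‖ : ℂ) ^ 2))]
    exact Finset.prod_congr rfl fun j _ => h1 j
  have h3 := integral_fintype_prod_volume_eq_pow (ι := Fin N)
    (fun r : Fin N → ℂ => ∏ j, Complex.exp (-b j * (‖r j‖ : ℂ) ^ 2))
  rw [h2] at h3
  simp only [← Finset.sum_neg_distrib, Complex.exp_sum, ← neg_mul]
  rw [h3, Fintype.card_fin, Finset.prod_div_distrib, Finset.prod_const, Finset.card_univ,
    Fintype.card_fin, div_pow, ← pow_mul, sq, div_eq_mul_inv]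

theorem integrable_exp_neg_sq : Integrable (fun Φ : MatField N =>
    Real.exp (-∑ i, ∑ j, ‖Φ i j‖ ^ 2)) := by
  have h1 : Integrable (fun z : ℂ => Real.exp (-‖z‖ ^ 2)) := by
    have h := (GaussianFourier.integrable_cexp_neg_mul_sq_norm_add (V := ℂ) (b := 1)
      (by simp) 0 0).norm
    refine h.congr (.of_forall fun z => ?_)
    simp [Complex.norm_exp, ← Complex.ofReal_pow]
  have h2 : Integrable (fun r : Fin N → ℂ => ∏ j, Real.exp (-‖r j‖ ^ 2)) :=
    Integrable.fintype_prod (f := fun _ z => Real.exp (-‖z‖ ^ 2)) fun _ => h1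
  have h3 := Integrable.fintype_prod (ι := Fin N)
    (f := fun _ (r : Fin N → ℂ) => ∏ j, Real.exp (-‖r j‖ ^ 2)) fun _ => h2
  refine h3.congr (.of_forall fun Φ => ?_)
  simp only [← Finset.sum_neg_distrib, Real.exp_sum]

/-- Lebesgue measure on matrices is invariant under right multiplication by a unitary matrix: it
is scaled by a constant, which the integral of the Gaussian weight shows to be one. -/
theorem integral_comp_mul_unitary (U : Matrix.unitaryGroup (Fin N) ℂ) (g : MatField N → ℂ) :
    ∫ Φ : MatField N, g (Matrix.of.symm (Matrix.of Φ * (U : Mat N))) = ∫ Φ, g Φ := by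
  let R : Mat N → MatField N →ₗ[ℝ] MatField N := fun A =>
    { toFun := fun Φ => Matrix.of.symm (Matrix.of Φ * A)
      map_add' := fun Φ Ψ => add_mul (Matrix.of Φ) (Matrix.of Ψ) A
      map_smul' := fun c Φ => smul_mul_assoc c (Matrix.of Φ) A }
  have hR : ∀ A B : Mat N, A * B = 1 → (R B) ∘ₗ (R A) = LinearMap.id := fun A B h => by
    refine LinearMap.ext fun Φ => ?_
    change Matrix.of.symm (Matrix.of Φ * A * B) = Φ
    rw [mul_assoc, h, mul_one]
    rfl
  have hU1 : (U : Mat N) * star (U : Mat N) = 1 := Unitary.mul_star_self_of_mem U.2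
  have hU2 : star (U : Mat N) * (U : Mat N) = 1 := Unitary.star_mul_self_of_mem U.2
  let e : MatField N ≃ₗ[ℝ] MatField N := LinearEquiv.ofLinearMap (R U) (R (star (U : Mat N)))
    (hR _ _ hU2) (hR _ _ hU1)
  let m : MatField N ≃ᵐ MatField N := e.toContinuousLinearEquiv.toHomeomorph.toMeasurableEquiv
  have hdet : LinearMap.det (R U) ≠ 0 := (LinearEquiv.isUnit_det' e).ne_zero
  set c : ENNReal := ENNReal.ofReal |(LinearMap.det (R U))⁻¹|
  have hvol : (volume : Measure (MatField N)).IsAddHaarMeasure :=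
    Measure.pi.isAddHaarMeasure (μ := fun _ : Fin N => (volume : Measure (Fin N → ℂ)))
  have hmap : (volume : Measure (MatField N)).map m = c • volume :=
    Measure.map_linearMap_addHaar_eq_smul_addHaar volume hdet
  have hc : ∀ g : MatField N → ℂ, ∫ Φ, g (m Φ) = c.toReal • ∫ Φ, g Φ := fun g => by
    rw [← integral_map_equiv, hmap, integral_smul_measure]
  have h0 := hc fun Φ => Complex.exp (-∑ i, ∑ j, (1 : Fin N → ℂ) j * (‖Φ i j‖ : ℂ) ^ 2)
  have hinv : ∀ Φ : MatField N, ∑ i, ∑ j, (1 : Fin N → ℂ) j * (‖m Φ i j‖ : ℂ) ^ 2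
      = ∑ i, ∑ j, (1 : Fin N → ℂ) j * (‖Φ i j‖ : ℂ) ^ 2 := fun Φ => by
    have h1 := trace_gram_mul_diagonal (Matrix.of Φ) 1
    have h2 := trace_gram_mul_diagonal (Matrix.of Φ * (U : Mat N)) 1
    rw [show Matrix.diagonal (1 : Fin N → ℂ) = 1 from Matrix.diagonal_one, mul_one] at h1 h2
    refine h2.symm.trans (Eq.trans ?_ h1)
    rw [Matrix.conjTranspose_mul, mul_assoc, ← mul_assoc _ (Matrix.of Φ), Matrix.trace_mul_comm,
      mul_assoc, show (U : Mat N) * (U : Mat N).conjTranspose = 1 from hU1, mul_one]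
  simp only [hinv] at h0
  have hne : ∫ Φ : MatField N, Complex.exp (-∑ i, ∑ j, (1 : Fin N → ℂ) j * (‖Φ i j‖ : ℂ) ^ 2)
      ≠ 0 := by
    rw [integral_exp_neg_diagonal 1 (by simp)]
    simp [Real.pi_ne_zero]
  have hc1 : c.toReal = 1 := by
    rw [Complex.real_smul] at h0
    have := mul_right_cancel₀ hne ((one_mul _).trans h0)
    exact_mod_cast this.symm
  have := hc g
  rw [hc1, one_smul] at this
  exact this

theorem continuous_gram : Continuous fun Φ : MatField N =>
    (Matrix.of Φ).conjTranspose * Matrix.of Φ := by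
  have h : Continuous fun Φ : MatField N => (Matrix.of Φ : Mat N) := continuous_id
  exact h.matrix_conjTranspose.matrix_mul h

theorem measurable_gaussian_density : Measurable fun Φ : MatField N =>
    ENNReal.ofReal ((Real.pi ^ (N ^ 2))⁻¹ *
      Real.exp (-((Matrix.of Φ).conjTranspose * Matrix.of Φ).trace.re)) := by
  have h : Continuous fun Φ : MatField N =>
      ((Matrix.of Φ).conjTranspose * Matrix.of Φ).trace.re :=
    Complex.continuous_re.comp continuous_gram.matrix_trace
  exact ENNReal.measurable_ofReal.comp
    ((Real.continuous_exp.comp h.neg).measurable.const_mul _)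

instance isFiniteMeasure_complexGaussian : IsFiniteMeasure (complexGaussian N) := by
  refine isFiniteMeasure_withDensity_ofReal (Integrable.hasFiniteIntegral ?_)
  simp only [trace_gram_re, Matrix.of_apply]
  exact integrable_exp_neg_sq.const_mul _

/-- The Gaussian integral over `Φ` in the presence of a Hermitian matrix `σ`. -/
theorem integral_complexGaussian_exp {σ : Mat N} (hσ : σ.IsHermitian) (s : ℝ) :
    ∫ Φ, Complex.exp (-(Complex.I * s) *
        ((Matrix.of Φ).conjTranspose * Matrix.of Φ * σ).trace) ∂(complexGaussian N)
      = ((1 + (Complex.I * s) • σ).det ^ N)⁻¹ := by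
  -- Rotating `Φ` by the unitary matrix of eigenvectors makes the quadratic form diagonal.
  set U := hσ.eigenvectorUnitary
  set d : Fin N → ℂ := fun j => (hσ.eigenvalues j : ℂ)
  set b : Fin N → ℂ := fun j => 1 + Complex.I * s * d j
  have hU1 : (U : Mat N) * star (U : Mat N) = 1 := Unitary.mul_star_self_of_mem U.2
  have hspec : σ = (U : Mat N) * Matrix.diagonal d * star (U : Mat N) := by
    conv_lhs => rw [hσ.spectral_theorem, Unitary.conjStarAlgAut_apply]
    rfl
  have hb : 1 + (Complex.I * s) • σ = (U : Mat N) * Matrix.diagonal b * star (U : Mat N) := by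
    have h1 : Matrix.diagonal b = 1 + (Complex.I * s) • Matrix.diagonal d := by
      rw [← Matrix.diagonal_one, ← Matrix.diagonal_smul, Matrix.diagonal_add]
      rfl
    rw [h1, mul_add, add_mul, mul_one, hU1, mul_smul_comm, smul_mul_assoc, ← hspec]
  have hdet : (1 + (Complex.I * s) • σ).det = ∏ j, b j := by
    rw [hb, Matrix.det_mul_right_comm, hU1, one_mul, Matrix.det_diagonal]
  rw [complexGaussian, integral_withDensity_eq_integral_toReal_smul measurable_gaussian_density
    (.of_forall fun _ => ENNReal.ofReal_lt_top), hdet]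
  have hint : ∀ Φ : MatField N, (ENNReal.ofReal ((Real.pi ^ (N ^ 2))⁻¹ *
      Real.exp (-((Matrix.of Φ).conjTranspose * Matrix.of Φ).trace.re))).toReal •
      Complex.exp (-(Complex.I * s) * ((Matrix.of Φ).conjTranspose * Matrix.of Φ * σ).trace)
      = ((Real.pi : ℂ) ^ (N ^ 2))⁻¹ * Complex.exp (-∑ i, ∑ j, b j *
        (‖Matrix.of.symm (Matrix.of Φ * (U : Mat N)) i j‖ : ℂ) ^ 2) := fun Φ => by
    have h1 : ((((Matrix.of Φ).conjTranspose * Matrix.of Φ).trace.re : ℝ) : ℂ)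
        = ((Matrix.of Φ).conjTranspose * Matrix.of Φ).trace := by
      have h := trace_gram_mul_diagonal (Matrix.of Φ) 1
      rw [show Matrix.diagonal (1 : Fin N → ℂ) = 1 from Matrix.diagonal_one, mul_one] at h
      rw [trace_gram_re, h]
      push_cast
      simp
    have h2 : ∑ i, ∑ j, b j * (‖Matrix.of.symm (Matrix.of Φ * (U : Mat N)) i j‖ : ℂ) ^ 2
        = ((Matrix.of Φ).conjTranspose * Matrix.of Φ * (1 + (Complex.I * s) • σ)).trace := by
      refine (trace_gram_mul_diagonal (Matrix.of Φ * (U : Mat N)) b).symm.trans ?_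
      rw [hb, Matrix.conjTranspose_mul, mul_assoc, mul_assoc, Matrix.trace_mul_comm,
        Matrix.star_eq_conjTranspose]
      simp only [mul_assoc]
    rw [ENNReal.toReal_ofReal (by positivity), h2, mul_add, mul_one, Matrix.trace_add,
      mul_smul_comm, Matrix.trace_smul, Complex.real_smul]
    push_cast
    rw [h1, mul_assoc, ← Complex.exp_add, smul_eq_mul]
    congr 2
    ring
  simp only [hint]
  rw [integral_const_mul, integral_comp_mul_unitary U
    (fun Φ => Complex.exp (-∑ i, ∑ j, b j * (‖Φ i j‖ : ℂ) ^ 2)), integral_exp_neg_diagonal,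
    ← mul_assoc, inv_mul_cancel₀ (by simp [Real.pi_ne_zero]), one_mul]
  intro j
  simp [b, d]

/-- The Hubbard–Stratonovich transformation: the quartic weight is the Fourier transform of the
Gaussian measure on Hermitian matrices. -/
theorem integral_exp_trace_herm {Q : Mat N} (hQ : Q.IsHermitian) (s : ℝ) :
    ∫ x, Complex.exp (-(Complex.I * s) * (Q * herm x).trace) ∂(stdGaussian (Coord N))
      = Complex.exp (-((s ^ 2 / 2 * (Q * Q).trace.re : ℝ) : ℂ)) := by
  -- The coordinates of the linear form `x ↦ Tr (Q * herm x)`.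
  let q : Coord N := WithLp.toLp 2 fun a => (Q a.2 a.1).re - (Q a.2 a.1).im
  have hQ' : ∀ i j, Q i j = starRingEnd ℂ (Q j i) := fun i j => (hQ.apply i j).symm
  have htr : ∀ x : Coord N, (Q * herm x).trace = ((inner ℝ x q : ℝ) : ℂ) := fun x => by
    have h1 : (Q * herm x).trace = ∑ i, ∑ j, Q j i * ((1 + Complex.I) * x (i, j) / 2)
        + ∑ i, ∑ j, Q i j * ((1 - Complex.I) * x (i, j) / 2) := by
      conv_lhs => rw [Matrix.trace_mul_comm]
      simp only [Matrix.trace, Matrix.diag_apply, Matrix.mul_apply, herm_apply]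
      rw [Finset.sum_comm (f := fun i j => Q i j * ((1 - Complex.I) * x (i, j) / 2)),
        ← Finset.sum_add_distrib]
      refine Finset.sum_congr rfl fun i _ => ?_
      rw [← Finset.sum_add_distrib]
      exact Finset.sum_congr rfl fun j _ => by ring
    rw [h1, ← Finset.sum_add_distrib, PiLp.inner_apply, Fintype.sum_prod_type]
    push_cast
    refine Finset.sum_congr rfl fun i _ => ?_
    rw [← Finset.sum_add_distrib]
    refine Finset.sum_congr rfl fun j _ => ?_
    rw [hQ' i j]
    apply Complex.ext <;> simp [q] <;> ring
  have hq : ‖q‖ ^ 2 = (Q * Q).trace.re := by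
    rw [EuclideanSpace.real_norm_sq_eq, Fintype.sum_prod_type]
    have h1 : (Q * Q).trace.re = ∑ i, ∑ j, ((Q j i).re ^ 2 + (Q j i).im ^ 2) := by
      simp only [Matrix.trace, Matrix.diag_apply, Matrix.mul_apply, Complex.re_sum]
      refine Finset.sum_congr rfl fun i _ => Finset.sum_congr rfl fun j _ => ?_
      rw [hQ' i j]
      simp
      ring
    -- the real part of `Q` is symmetric and its imaginary part antisymmetric
    have h2 : ∑ i, ∑ j, (Q j i).re * (Q j i).im = 0 := by
      have h3 : ∑ i, ∑ j, (Q j i).re * (Q j i).im = -∑ i, ∑ j, (Q j i).re * (Q j i).im := by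
        conv_lhs => rw [Finset.sum_comm]
        simp only [← Finset.sum_neg_distrib]
        refine Finset.sum_congr rfl fun i _ => Finset.sum_congr rfl fun j _ => ?_
        rw [hQ' i j]
        simp
      linarith
    have h4 : ∀ i j, (q (i, j)) ^ 2
        = ((Q j i).re ^ 2 + (Q j i).im ^ 2) - 2 * ((Q j i).re * (Q j i).im) := fun i j => by
      simp only [q]
      ring
    simp only [h4, Finset.sum_sub_distrib, ← Finset.mul_sum, h2, h1]
    ring
  have h := charFun_stdGaussian (E := Coord N) (-s • q)
  rw [charFun_apply] at h
  refine Eq.trans ?_ (h.trans ?_)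
  · congr 1
    funext x
    rw [htr, inner_smul_right]
    push_cast
    congr 1
    ring
  · rw [norm_smul, norm_neg, Real.norm_eq_abs, ← hq]
    congr 1
    push_cast
    rw [mul_pow, ← Complex.ofReal_pow |s|, sq_abs]
    push_cast
    ring

theorem integrable_exp_vertexPotential (hρ : 0 < ρ) (h : ρ * coupling lam N ≤ 1 / 2) :
    Integrable (fun x => Complex.exp (vertexPotential lam N (herm x))) (stdGaussian (Coord N)) := by
  have hmem : ∀ x : Coord N, herm x ∈ strip ρ := fun x =>
    hermitian_mem_strip hρ (herm_isHermitian x)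
  refine Integrable.mono' (integrable_const (Real.exp (N * (N * Real.log 2)))) ?_
    (.of_forall fun x => ?_)
  · refine Continuous.aestronglyMeasurable (continuous_iff_continuousAt.2 fun x => ?_)
    have h1 : ContinuousAt (vertexPotential lam N) (herm x) :=
      ((lipHolo_vertexPotential h).holo.differentiableAt (isOpen_strip ρ) ()
        (hmem x)).continuousAt
    exact Complex.continuous_exp.continuousAt.comp
      (ContinuousAt.comp (f := herm) h1 herm.continuous.continuousAt)
  · rw [Complex.norm_exp]
    exact Real.exp_le_exp.2 (re_vertexPotential_le h (hmem x))

/-- The intermediate field representation. After the Hubbard–Stratonovich transformation and an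
exchange of integrals, the Gaussian integral over `Φ` is `det⁻ᴺ`, which is the exponential of the
potential. -/
theorem partitionFunction_eq (hlam : 0 ≤ lam) (hρ : 0 < ρ) (h : ρ * coupling lam N ≤ 1 / 2) :
    ((partitionFunction lam N : ℝ) : ℂ)
      = ∫ x, Complex.exp (vertexPotential lam N (herm x)) ∂(stdGaussian (Coord N)) := by
  set s := coupling lam N with hs
  have hs2 : s ^ 2 / 2 = lam / N := by
    rw [hs, coupling, Real.sq_sqrt (by positivity)]
    ring
  have hherm : ∀ Φ : MatField N, ((Matrix.of Φ).conjTranspose * Matrix.of Φ).IsHermitian :=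
    fun Φ => Matrix.isHermitian_conjTranspose_mul_self _
  have h1 : ((partitionFunction lam N : ℝ) : ℂ) = ∫ Φ, ∫ x, Complex.exp (-(Complex.I * s) *
      ((Matrix.of Φ).conjTranspose * Matrix.of Φ * herm x).trace) ∂(stdGaussian (Coord N))
        ∂(complexGaussian N) := by
    rw [partitionFunction, ← integral_complex_ofReal]
    congr 1
    funext Φ
    rw [integral_exp_trace_herm (hherm Φ), hs2, Complex.ofReal_exp, mul_assoc _ _ (Matrix.of Φ),
      ← Complex.ofReal_neg, neg_mul]
  rw [h1, integral_integral_swap]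
  · congr 1
    funext x
    rw [integral_complexGaussian_exp (herm_isHermitian x),
      exp_vertexPotential h (hermitian_mem_strip hρ (herm_isHermitian x))]
    rfl
  · -- the integrand has modulus one, since `Tr (Φ⋆Φ σ)` is real
    refine Integrable.mono' (integrable_const (1 : ℝ)) ?_ (.of_forall fun p => ?_)
    · have hc : Continuous fun p : MatField N × Coord N =>
          ((Matrix.of p.1).conjTranspose * Matrix.of p.1 * herm p.2).trace :=
        ((continuous_gram.comp continuous_fst).matrix_mul
          (herm.continuous.comp continuous_snd)).matrix_trace
      exact (Complex.continuous_exp.comp (continuous_const.mul hc)).aestronglyMeasurable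
    · have hreal : ∀ A B : Mat N, A.IsHermitian → B.IsHermitian → (A * B).trace.im = 0 := by
        intro A B hA hB
        refine Complex.conj_eq_iff_im.1 ?_
        rw [← RCLike.star_def, ← Matrix.trace_conjTranspose, Matrix.conjTranspose_mul, hA.eq,
          hB.eq, Matrix.trace_mul_comm]
      have := hreal _ _ (hherm p.1) (herm_isHermitian p.2)
      simp only [Function.uncurry]
      rw [Complex.norm_exp]
      simp [this]

end PartitionFunction

end LoopVertex

end

open LoopVertex in
theorem mainTheorem2 :
    (∀ (N n : ℕ) (T : SimpleGraph (Fin n)) (w : T.edgeSet → ℝ), T.IsTree →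
      w ∈ Set.Icc (0 : T.edgeSet → ℝ) 1 →
        (treeWeight T w).PosSemidef ∧
        HasMatrixCovariance (gaussianFields N (treeWeight T w)) (treeWeight T w)) ∧
    ∃ lam₀ : ℝ, 0 < lam₀ ∧ ∀ N : ℕ, 1 ≤ N → ∀ lam : ℝ, 0 < lam → lam < lam₀ →
      Integrable (fun σ => Complex.exp (loopVertex lam σ)) (gue N) ∧
      ((partitionFunction lam N : ℝ) : ℂ) = ∫ σ, Complex.exp (loopVertex lam σ) ∂(gue N) ∧
      (∀ (n : ℕ) (T : SimpleGraph (Fin n)) (c : T.edgeSet → LineIndex N), T.IsTree →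
        (∀ w ∈ Set.Icc (0 : T.edgeSet → ℝ) 1,
          Integrable (treeIntegrand lam T c) (gaussianFields N (treeWeight T w))) ∧
        IntegrableOn (treeExpectation lam T c) (Set.Icc (0 : T.edgeSet → ℝ) 1)) ∧
      HasSum (fun n : ℕ => treeTerm lam N (n + 1)) ((Real.log (partitionFunction lam N) : ℝ) : ℂ) := by
  refine ⟨fun N n T w hT hw => ⟨posSemidef_treeWeight hT hw,
    hasMatrixCovariance_gaussianFields (posSemidef_treeWeight hT hw)⟩, 1 / 96, by norm_num,
    fun N hN lam hlam hlam₀ => ?_⟩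
  have : NeZero N := ⟨by omega⟩
  have hN0 : (0 : ℝ) < N := by exact_mod_cast hN
  have hs : 0 < coupling lam N := Real.sqrt_pos.2 (by positivity)
  have hs2 : coupling lam N ^ 2 = 2 * lam / N := Real.sq_sqrt (by positivity)
  obtain ⟨ρ, hρ, hρs⟩ : ∃ ρ, 0 < ρ ∧ ρ * coupling lam N = 1 / 2 :=
    ⟨1 / (2 * coupling lam N), by positivity, by field_simp⟩
  have hV := lipHolo_vertexPotential hρs.le
  have hint := integrable_exp_vertexPotential hρ hρs.le
  have hZ := partitionFunction_eq hlam.le hρ hρs.le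
  refine ⟨integrable_gue.2 hint, ?_, fun n T c hT => ⟨fun w _ =>
    integrable_treeIntegrand hρ hV hT c w, integrableOn_treeExpectation hρ hV hT c⟩, ?_⟩
  · rw [integral_gue, hZ]
    rfl
  -- the Lipschitz constant `K = 2 √(2 lam N)` and the width `ρ` satisfy `K / ρ = 8 lam`
  have hq : 12 * (2 * (N * coupling lam N)) / ρ < 1 := by
    rw [div_lt_one hρ]
    have h1 : 12 * (2 * (N * coupling lam N)) * coupling lam N < ρ * coupling lam N := by
      have : N * coupling lam N ^ 2 = 2 * lam := by rw [hs2]; field_simp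
      rw [hρs]
      nlinarith
    exact lt_of_mul_lt_mul_right h1 hs.le
  simp only [treeTerm_eq_flow hρ hV]
  refine hasSum_flow hV hρ (C₀ := N * (N * Real.log 2)) (by positivity)
    (fun σ hσ => re_vertexPotential_le hρs.le hσ) (by positivity)
    (fun σ hσ => norm_grad_vertexPotential_le hρs.le hσ) hq (conjSymm_vertexPotential hρs.le) ?_
  rw [hZ, heat]
  simp
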